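/- Let $n\ge 3$; indices $i$ are taken modulo $n$, with representatives $1,\dots,n$. **The group.** Let $\hat B$ be the extended affine type $A$ braid group: generators $\sigma_1,\dots,\sigma_n,\rho$ and relations $\sigma_i\sigma_j=\sigma_j\sigma_i$ for $j\not\equiv i\pm1$, $\sigma_i\sigma_{i+1}\sigma_i=\sigma_{i+1}\sigma_i\sigma_{i+1}$, and $\rho\sigma_i\rho^{-1}=\sigma_{i+1}$. **The category.** Let $R_n$ be the path ring over $\mathbb Z$ of the cyclic quiver with vertices $1,\dots,n$ and arrows $(i|i+1)$, $(i|i-1)$, modulo the relations $(i|i+1|i)=(i|i-1|i)$ and $(i-1|i|i+1)=(i+1|i|i-1)=0$; write $(i)$ for the path of length $0$ at $i$. It is graded by $\mathbb Z\times\mathbb Z/2\times\mathbb Z$: the first degree is $1$ on $(i|i+1)$ and $0$ on $(i|i-1)$; the second is the path length modulo $2$; the third is $1$ on $(n|1)$, $-1$ on $(1|n)$ and $0$ on the other arrows. Write $\{\cdot\},(\cdot),\langle\cdot\rangle$ for the three shifts, the degree $i$ part of a module shifted by $k$ being the degree $i-k$ part of the module. Put $P_i=R_n(i)$ and ${}_iP=(i)R_n$.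 Let $\mathcal C_n$ be the homotopy category of bounded cochain complexes of finitely generated projective trigraded left $R_n$-modules, with morphisms of tridegree $0$. Its Grothendieck group $K(\mathcal C_n)$ has the relation $[Y]=[X]+[Z]$ for each distinguished triangle $X\to Y\to Z\to X[1]$ and, since the $\mathbb Z/2$-grading is decategorified as a sign, $[X(1)]=-[X]$; it is a $\mathbb Z[t^{\pm1},s^{\pm1}]$-module with $t[X]=[X\{1\}]$ and $s[X]=[X\langle1\rangle]$. **The complexes.** Let $t_\rho$ be the automorphism of the ring $R_n$ that adds $1$ to all vertices of a path. Let $T_n^\rho$ be $R_n$ with left multiplication, with right action of $r$ by multiplication by $t_\rho(r)$, with the first two gradings of $R_n$, and with third degree $-1$ on $(1),(2|1),(1|n),(1|2|1)$ and $0$ on all other paths. Let ${}^\rho T_n$ be $R_n$ with right multiplication, with left action of $r$ by multiplication by $t_\rho(r)$, with the first two gradings of $R_n$, and with third degree $1$ on $(1),(n|1),(1|2),(1|2|1)$ and $0$ on all other paths. Both are trigraded $R_n$-bimodules. Consider the complexes of trigraded bimodules $$F_i:\ 0\to P_i\otimes_{\mathbb Z}{}_iP\xrightarrow{d_i}R_n\to0,\qquad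 F'_i:\ 0\to R_n\xrightarrow{d'_i}P_i\otimes_{\mathbb Z}{}_iP\{-1\}\to0,$$ with $R_n$ in cohomological degree $0$, $d_i((i)\otimes(i))=(i)$ and $$d'_i(1)=(i-1|i)\otimes(i|i-1)+(i+1|i)\otimes(i|i+1)+(i)\otimes(i|i-1|i)+(i|i-1|i)\otimes(i),$$ and $F_\rho=T_n^\rho$, $F'_\rho={}^\rho T_n$ in degree $0$. **The homological representation.** Let $F$ be the free group on $x_0,\dots,x_n$ (the fundamental group of the disk with $n+1$ punctures; words are read from right to left) and $D=x_0x_1\cdots x_n$. The group $\hat B$ acts on $F$ as follows: for $1\le i\le n-1$, $\sigma_i$ sends $x_i\mapsto x_{i+1}$, $x_{i+1}\mapsto x_{i+1}^{-1}x_ix_{i+1}$ and fixes the other generators; $\rho$ sends $x_0\mapsto x_1^{-1}x_0x_1$, $x_n\mapsto D^{-1}x_1D$, and $x_j\mapsto x_{j+1}$ for $1\le j\le n-1$; $\sigma_n$ acts as $\rho\sigma_{n-1}\rho^{-1}$. This action preserves the homomorphism from $F$ to $G=\langle t\rangle\times\langle q\rangle\cong\mathbb Z^2$ with $x_0\mapsto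 q$ and $x_j\mapsto t$ for $j\ne0$. Let $\tilde{\mathbb D}_G$ be the corresponding cover of the punctured disk. It retracts onto the graph with vertices $G\tilde p$ and edges $g\tilde x_j$ ($g\in G$, $0\le j\le n$), where $\tilde x_0$ is the lift of $x_0$ from $\tilde p$ to $q\tilde p$ and $\tilde x_j$ the lift of $x_j$ from $\tilde p$ to $t\tilde p$ for $j\neq0$. So $H_1(\tilde{\mathbb D}_G;\mathbb Z)$ is the kernel of $\partial:\bigoplus_{j=0}^n\mathbb Z[t^{\pm1},q^{\pm1}][\tilde x_j]\to\mathbb Z[t^{\pm1},q^{\pm1}]$, $[\tilde x_0]\mapsto q-1$, $[\tilde x_j]\mapsto t-1$ for $j\ne 0$. Each braid $\sigma$ acts on the cover by the unique lift that fixes $\tilde p$ and commutes with $G$; it sends the path $\tilde x_j$ to the lift at $\tilde p$ of $\sigma(x_j)$. The induced action on $H_1(\tilde{\mathbb D}_G;\mathbb Z)$ is $\rho_{RH}$. **Statement.** (i) There is a weak action of $\hat B$ on $\mathcal C_n$, that is, a family of endofunctors $\mathcal F_g$ $(g\in\hat B)$ with $\mathcal F_1\cong\mathrm{Id}$ and $\mathcal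 F_{gh}\cong\mathcal F_g\circ\mathcal F_h$, such that $\sigma_i,\sigma_i^{-1},\rho,\rho^{-1}$ act by $F_i\otimes_{R_n}-$, $F'_i\otimes_{R_n}-$, $F_\rho\otimes_{R_n}-$, $F'_\rho\otimes_{R_n}-$ respectively, and such that the braid represented by any word in the generators and their inverses acts by tensoring on the left with the tensor product of the complexes attached to its letters. (ii) The classes $[P_1],\dots,[P_n]$ form a basis of the $\mathbb Z[t^{\pm1},s^{\pm1}]$-module $K(\mathcal C_n)$, and the action induces a $\mathbb Z[t^{\pm1},s^{\pm1}]$-linear representation $\rho_{AKS}$ of $\hat B$ on $K(\mathcal C_n)$ whose matrices in this basis (the columns being the images of the basis vectors) are $$\rho_{AKS}(\sigma_i)=\begin{pmatrix}I_{i-2}&0&0&0&0\\0&1&0&0&0\\0&1&-t&t&0\\0&0&0&1&0\\0&0&0&0&I_{n-i-1}\end{pmatrix}\quad(2\le i\le n-1),$$ $$\rho_{AKS}(\sigma_1)=\begin{pmatrix}-t&t&0&s^{-1}\\0&1&0&0\\0&0&I_{n-3}&0\\0&0&0&1\end{pmatrix},\qquad\rho_{AKS}(\sigma_n)=\begin{pmatrix}1&0&0&0\\0&I_{n-3}&0&0\\0&0&1&0\\ts&0&1&-t\end{pmatrix},$$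 $$\rho_{AKS}(\rho)=\begin{pmatrix}0&s^{-1}\\I_{n-1}&0\end{pmatrix},\qquad\rho_{AKS}(\rho^{-1})=\begin{pmatrix}0&I_{n-1}\\s&0\end{pmatrix}.$$ (iii) The $\mathbb Z[t^{\pm1},q^{\pm1}]$-module $H_1(\tilde{\mathbb D}_G;\mathbb Z)$ has the basis $[\tilde\gamma_i]=[\tilde x_{i+1}]-[\tilde x_i]$ for $1\le i\le n-1$ and $$[\tilde\gamma_n]=\sum_{k=0}^{n-1}t^k(1-t)[\tilde x_{n-k}]+t^n(1-t)[\tilde x_0]+qt^n[\tilde x_1]-[\tilde x_n],$$ and for every $g\in\hat B$ the matrix of $\rho_{AKS}(g)$ in the basis $([P_i])$ becomes, after the substitution $s=q^{-1}t^{-n}$, the matrix of $\rho_{RH}(g)$ in the basis $([\tilde\gamma_i])$. -/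

import Mathlib

open CategoryTheory CategoryTheory.Limits

namespace AffineBraid

/-! ## Trigraded rings and bimodules -/

/-- Tridegrees: the second grading is a grading by `ℤ / 2`. -/
abbrev TriDeg : Type := ℤ × ZMod 2 × ℤ

/-- The homogeneous decomposition attached to an internal grading. -/
noncomputable def decompose {M : Type} [AddCommGroup M] {gr : TriDeg → AddSubgroup M}
    (h : DirectSum.IsInternal gr) : M →+ (TriDeg →₀ M) :=
  (DirectSum.toAddMonoid fun γ => (Finsupp.singleAddHom γ).comp (gr γ).subtype).comp
    (AddEquiv.ofBijective (DirectSum.coeAddMonoidHom gr) h).symm.toAddMonoidHom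

theorem decompose_of_mem {M : Type} [AddCommGroup M] {gr : TriDeg → AddSubgroup M}
    (h : DirectSum.IsInternal gr) {γ : TriDeg} {m : M} (hm : m ∈ gr γ) :
    decompose h m = Finsupp.single γ m := by
  have : (AddEquiv.ofBijective (DirectSum.coeAddMonoidHom gr) h).symm m
      = DirectSum.of (fun γ => gr γ) γ ⟨m, hm⟩ := by
    rw [AddEquiv.symm_apply_eq]
    exact (DirectSum.coeAddMonoidHom_of gr γ ⟨m, hm⟩).symm
  simp only [decompose, AddMonoidHom.comp_apply]
  change DirectSum.toAddMonoid _
    ((AddEquiv.ofBijective (DirectSum.coeAddMonoidHom gr) h).symm m) = _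
  rw [this, DirectSum.toAddMonoid_of]
  rfl

/-- A criterion for a family of subgroups to be a grading. -/
theorem isInternal_of_decompose {M : Type} [AddCommGroup M] (gr : TriDeg → AddSubgroup M)
    (dec : M →+ (TriDeg →₀ M)) (h₁ : ∀ γ, ∀ m ∈ gr γ, dec m = Finsupp.single γ m)
    (h₂ : ∀ m, m ∈ ⨆ γ, gr γ) : DirectSum.IsInternal gr := by
  have key : ∀ x : DirectSum TriDeg (fun γ => gr γ), ∀ γ,
      dec (DirectSum.coeAddMonoidHom gr x) γ = (x γ : M) := by
    intro x γ
    induction x using DirectSum.induction_on with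
    | zero => simp
    | of δ y =>
      rw [DirectSum.coeAddMonoidHom_of, h₁ δ _ y.2]
      by_cases h : δ = γ
      · subst h; simp
      · rw [Finsupp.single_eq_of_ne (Ne.symm h), DirectSum.of_eq_of_ne _ _ _ (Ne.symm h)]; rfl
    | add x y hx hy => simp [hx, hy]
  constructor
  · rw [injective_iff_map_eq_zero]
    intro x hx
    refine DFinsupp.ext fun γ => Subtype.ext ?_
    have h := key x γ
    rw [hx] at h
    simpa using h.symm
  · intro m
    have : (⨆ γ, gr γ) ≤ (DirectSum.coeAddMonoidHom gr).range := by
      refine iSup_le fun γ m hm => ⟨DirectSum.of (fun γ => gr γ) γ ⟨m, hm⟩, by simp⟩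
    exact this (h₂ m)

theorem iSup_eq_top_of_isInternal {M : Type} [AddCommGroup M] {gr : TriDeg → AddSubgroup M}
    (h : DirectSum.IsInternal gr) (m : M) : m ∈ ⨆ γ, gr γ := by
  obtain ⟨x, rfl⟩ := h.2 m
  induction x using DirectSum.induction_on with
  | zero => simp
  | of δ y =>
    rw [DirectSum.coeAddMonoidHom_of]
    exact (le_iSup gr δ) y.2
  | add x y hx hy => rw [map_add]; exact add_mem hx hy

/-- Induction on homogeneous elements. -/
theorem homogeneous_induction {M : Type} [AddCommGroup M] {gr : TriDeg → AddSubgroup M}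
    (h : DirectSum.IsInternal gr) {p : M → Prop} (h₀ : p 0)
    (h₁ : ∀ γ, ∀ m ∈ gr γ, p m) (h₂ : ∀ m m', p m → p m' → p (m + m')) (m : M) : p m :=
  AddSubgroup.iSup_induction gr (C := p) (iSup_eq_top_of_isInternal h m) h₁ h₀ h₂

/-- A retract of a graded group is graded. -/
theorem isInternal_of_retract {M N : Type} [AddCommGroup M] [AddCommGroup N]
    {gr : TriDeg → AddSubgroup M} (h : DirectSum.IsInternal gr) (s : N →+ M) (f : M →+ N)
    (hfs : ∀ x, f (s x) = x) (hf : ∀ γ, ∀ m ∈ gr γ, s (f m) ∈ gr γ) :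
    DirectSum.IsInternal (fun γ => (gr γ).comap s) := by
  refine isInternal_of_decompose _
    ((Finsupp.mapRange.addMonoidHom f).comp ((decompose h).comp s)) ?_ ?_
  · intro γ m hm
    simp [decompose_of_mem h hm, hfs]
  · intro x
    rw [← hfs x]
    induction s x using homogeneous_induction h with
    | h₀ => simp
    | h₁ γ m hm => exact (le_iSup (fun γ => (gr γ).comap s) γ) (hf γ m hm)
    | h₂ m m' hm hm' => rw [map_add]; exact add_mem hm hm'

/-- A trigraded ring. -/
structure TriRing where
  /-- the underlying ring -/
  carrier : Type
  [ring : Ring carrier]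
  /-- the homogeneous components -/
  gr : TriDeg → AddSubgroup carrier
  internal : DirectSum.IsInternal gr
  one_mem : (1 : carrier) ∈ gr 0
  mul_mem : ∀ {γ δ : TriDeg} {a b : carrier}, a ∈ gr γ → b ∈ gr δ → a * b ∈ gr (γ + δ)

instance : CoeSort TriRing Type := ⟨TriRing.carrier⟩

instance (A : TriRing) : Ring A := A.ring

/-- A trigraded `(A, B)`-bimodule. The right action of `B` is a left action of `Bᵐᵒᵖ`. -/
structure TriBimod (A B : TriRing) where
  /-- the underlying abelian group -/
  carrier : Type
  [addCommGroup : AddCommGroup carrier]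
  [leftModule : Module A carrier]
  [rightModule : Module (B : Type)ᵐᵒᵖ carrier]
  [smulComm : SMulCommClass A (B : Type)ᵐᵒᵖ carrier]
  /-- the homogeneous components -/
  gr : TriDeg → AddSubgroup carrier
  internal : DirectSum.IsInternal gr
  smul_mem : ∀ {γ δ : TriDeg} {a : A} {m : carrier}, a ∈ A.gr γ → m ∈ gr δ → a • m ∈ gr (γ + δ)
  op_smul_mem : ∀ {γ δ : TriDeg} {b : B} {m : carrier}, m ∈ gr γ → b ∈ B.gr δ →
    MulOpposite.op b • m ∈ gr (γ + δ)

namespace TriBimod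

variable {A B C : TriRing}

instance : CoeSort (TriBimod A B) Type := ⟨TriBimod.carrier⟩

instance (M : TriBimod A B) : AddCommGroup M := M.addCommGroup
instance (M : TriBimod A B) : Module A M := M.leftModule
instance (M : TriBimod A B) : Module (B : Type)ᵐᵒᵖ M := M.rightModule
instance (M : TriBimod A B) : SMulCommClass A (B : Type)ᵐᵒᵖ M := M.smulComm

/-- Morphisms of trigraded bimodules: bimodule maps which preserve the three gradings. -/
@[ext]
structure Hom (M N : TriBimod A B) where
  /-- the underlying additive map -/
  toFun : M →+ N
  map_smul : ∀ (a : A) (m : M), toFun (a • m) = a • toFun m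
  map_op_smul : ∀ (b : B) (m : M), toFun (MulOpposite.op b • m) = MulOpposite.op b • toFun m
  map_gr : ∀ {γ : TriDeg} {m : M}, m ∈ M.gr γ → toFun m ∈ N.gr γ

instance : Category (TriBimod A B) where
  Hom M N := Hom M N
  id M := ⟨AddMonoidHom.id M, fun _ _ => rfl, fun _ _ => rfl, fun h => h⟩
  comp f g := ⟨g.toFun.comp f.toFun,
    fun a m => by simp [f.map_smul, g.map_smul],
    fun b m => by simp [f.map_op_smul, g.map_op_smul],
    fun h => g.map_gr (f.map_gr h)⟩

@[ext]
theorem hom_ext {M N : TriBimod A B} {f g : M ⟶ N} (h : ∀ m, Hom.toFun f m = Hom.toFun g m) :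
    f = g :=
  Hom.ext (AddMonoidHom.ext h)

@[simp] theorem id_toFun (M : TriBimod A B) (m : M) : Hom.toFun (𝟙 M) m = m := rfl

@[simp] theorem comp_toFun {M N P : TriBimod A B} (f : M ⟶ N) (g : N ⟶ P) (m : M) :
    Hom.toFun (f ≫ g) m = Hom.toFun g (Hom.toFun f m) := rfl

section Preadditive

variable {M N : TriBimod A B}

instance : Zero (M ⟶ N) :=
  ⟨⟨0, fun _ _ => by simp, fun _ _ => by simp, fun _ => zero_mem _⟩⟩

instance : Add (M ⟶ N) :=
  ⟨fun f g => ⟨f.toFun + g.toFun, fun _ _ => by simp [f.map_smul, g.map_smul],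
    fun _ _ => by simp [f.map_op_smul, g.map_op_smul],
    fun h => add_mem (f.map_gr h) (g.map_gr h)⟩⟩

instance : Neg (M ⟶ N) :=
  ⟨fun f => ⟨-f.toFun, fun _ _ => by simp [f.map_smul], fun _ _ => by simp [f.map_op_smul],
    fun h => neg_mem (f.map_gr h)⟩⟩

@[simp] theorem zero_toFun (m : M) : Hom.toFun (0 : M ⟶ N) m = 0 := rfl
@[simp] theorem add_toFun (f g : M ⟶ N) (m : M) :
    Hom.toFun (f + g) m = Hom.toFun f m + Hom.toFun g m := rfl
@[simp] theorem neg_toFun (f : M ⟶ N) (m : M) : Hom.toFun (-f) m = -Hom.toFun f m := rfl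

instance : AddCommGroup (M ⟶ N) where
  add_assoc f g h := by ext; simp [add_assoc]
  zero_add f := by ext; simp
  add_zero f := by ext; simp
  neg_add_cancel f := by ext; simp
  add_comm f g := by ext; simp [add_comm]
  nsmul := nsmulRec
  zsmul := zsmulRec

end Preadditive

instance : Preadditive (TriBimod A B) where
  add_comp _ _ _ f g h := by ext; simp
  comp_add _ _ _ f g h := by ext; simp

/-! ### Coproducts -/

section Coproducts

variable {J : Type} (M : J → TriBimod A B)

open Classical in
theorem directSum_isInternal :
    DirectSum.IsInternal fun γ : TriDeg =>
      ({ carrier := {x : DirectSum J fun j => (M j : Type) | ∀ j, x j ∈ (M j).gr γ}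
         add_mem' := fun hx hy j => add_mem (hx j) (hy j)
         zero_mem' := fun _ => zero_mem _
         neg_mem' := fun hx j => neg_mem (hx j) } : AddSubgroup _) := by
  refine isInternal_of_decompose _
    (DirectSum.toAddMonoid fun j => (Finsupp.mapRange.addMonoidHom
      (DirectSum.of (fun j => (M j : Type)) j)).comp (decompose (M j).internal)) ?_ ?_
  · intro γ x hx
    conv_rhs => rw [← DirectSum.sum_support_of x]
    conv_lhs => rw [← DirectSum.sum_support_of x]
    rw [map_sum, Finsupp.single_finsetSum]
    refine Finset.sum_congr rfl fun j _ => ?_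
    rw [DirectSum.toAddMonoid_of]
    simp [decompose_of_mem (M j).internal (hx j)]
  · intro x
    induction x using DirectSum.induction_on with
    | zero => exact zero_mem _
    | of j y =>
      induction y using homogeneous_induction (M j).internal with
      | h₀ => rw [map_zero]; exact zero_mem _
      | h₁ γ m hm =>
        refine AddSubgroup.mem_iSup_of_mem γ fun k => ?_
        by_cases h : k = j
        · subst h; simpa using hm
        · rw [DirectSum.of_eq_of_ne _ _ _ h]; exact zero_mem _
      | h₂ m m' hm hm' => rw [map_add]; exact add_mem hm hm'
    | add x y hx hy => exact add_mem hx hy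

/-- The direct sum of a family of trigraded bimodules. -/
noncomputable abbrev directSum : TriBimod A B where
  carrier := DirectSum J fun j => M j
  smulComm := ⟨fun a b x => DFinsupp.ext fun j => smul_comm a b (x j)⟩
  gr γ :=
    { carrier := {x | ∀ j, x j ∈ (M j).gr γ}
      add_mem' := fun hx hy j => add_mem (hx j) (hy j)
      zero_mem' := fun _ => zero_mem _
      neg_mem' := fun hx j => neg_mem (hx j) }
  internal := directSum_isInternal M
  smul_mem ha hm j := (M j).smul_mem ha (hm j)
  op_smul_mem hm hb j := (M j).op_smul_mem (hm j) hb

open Classical in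
/-- The inclusion of a summand. -/
noncomputable def directSumι (j : J) : M j ⟶ directSum M where
  toFun := DirectSum.of (fun j => (M j : Type)) j
  map_smul a m := DirectSum.of_smul (M := fun j => (M j : Type)) A j a m
  map_op_smul b m := DirectSum.of_smul (M := fun j => (M j : Type)) (B : Type)ᵐᵒᵖ j (MulOpposite.op b) m
  map_gr := fun {γ m} hm k => by
    by_cases h : k = j
    · subst h; simpa using hm
    · rw [DirectSum.of_eq_of_ne _ _ _ h]; exact zero_mem _

open Classical in
/-- The map out of a direct sum. -/
noncomputable def directSumDesc {N : TriBimod A B} (f : ∀ j, M j ⟶ N) : directSum M ⟶ N where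
  toFun := DirectSum.toAddMonoid fun j => (f j).toFun
  map_smul a m := by
    induction m using DirectSum.induction_on with
    | zero => simp
    | of j y =>
      rw [← DirectSum.of_smul, DirectSum.toAddMonoid_of, DirectSum.toAddMonoid_of, (f j).map_smul]
    | add x y hx hy => rw [smul_add, map_add, map_add, hx, hy, smul_add]
  map_op_smul b m := by
    induction m using DirectSum.induction_on with
    | zero => simp
    | of j y =>
      rw [← DirectSum.of_smul, DirectSum.toAddMonoid_of, DirectSum.toAddMonoid_of,
        (f j).map_op_smul]
    | add x y hx hy => rw [smul_add, map_add, map_add, hx, hy, smul_add]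
  map_gr := fun {γ m} hm => by
    have h : m = _ := (DirectSum.sum_support_of m).symm
    rw [h, map_sum]
    refine sum_mem fun j _ => ?_
    rw [DirectSum.toAddMonoid_of]
    exact (f j).map_gr (hm j)

instance : HasCoproduct M := by
  classical
  refine ⟨⟨⟨Cofan.mk (directSum M) (directSumι M), ?_⟩⟩⟩
  refine Cofan.IsColimit.mk _ (fun s => directSumDesc M s.inj) ?_ ?_
  · intro s j
    ext m
    exact DirectSum.toAddMonoid_of (fun j => (s.inj j).toFun) j m
  · intro s f hf
    refine Hom.ext ?_
    refine DirectSum.addHom_ext (γ := s.pt) fun j y => ?_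
    have := congrArg (fun g => Hom.toFun g y) (hf j)
    refine this.trans ?_
    exact (DirectSum.toAddMonoid_of (fun j => (s.inj j).toFun) j y).symm

end Coproducts

instance : HasCoproducts.{0} (TriBimod A B) := fun _ =>
  ⟨fun F => hasColimit_of_iso (Discrete.natIsoFunctor (F := F))⟩

instance : HasFiniteCoproducts (TriBimod A B) := hasFiniteCoproducts_of_hasCoproducts _

instance : HasFiniteBiproducts (TriBimod A B) := HasFiniteBiproducts.of_hasFiniteCoproducts

instance : HasBinaryBiproducts (TriBimod A B) := hasBinaryBiproducts_of_finite_biproducts _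

instance : HasZeroObject (TriBimod A B) := hasZeroObject_of_hasFiniteBiproducts _

/-- The shift: the degree `δ` part of the shifted bimodule is the degree `δ - γ` part of the
original one. -/
def shift (γ : TriDeg) : TriBimod A B ⥤ TriBimod A B where
  obj M :=
    { carrier := M
      gr := fun δ => M.gr (δ - γ)
      internal := by
        refine isInternal_of_decompose _ ((Finsupp.mapDomain.addMonoidHom (· + γ)).comp
          (decompose M.internal)) ?_ ?_
        · intro δ m hm
          simp [decompose_of_mem M.internal hm, Finsupp.mapDomain_single]
        · intro m
          induction m using homogeneous_induction M.internal with
          | h₀ => exact zero_mem _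
          | h₁ δ m hm => exact AddSubgroup.mem_iSup_of_mem (δ + γ) (by simpa using hm)
          | h₂ m m' hm hm' => exact add_mem hm hm'
      smul_mem := fun {α β a m} ha hm => by
        rw [add_sub_assoc]; exact M.smul_mem ha hm
      op_smul_mem := fun {α β b m} hm hb => by
        rw [add_sub_right_comm]; exact M.op_smul_mem hm hb }
  map f := ⟨f.toFun, f.map_smul, f.map_op_smul, fun h => f.map_gr h⟩

instance (γ : TriDeg) : (shift γ : TriBimod A B ⥤ TriBimod A B).Additive where

/-! ### Tensor products -/

section Tensor

open TensorProduct

variable (M : TriBimod A B) (N : TriBimod B C)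

/-- The relations `m b ⊗ n = m ⊗ b n` defining the tensor product over `B`. -/
def tensorRel : Submodule A (M ⊗[ℤ] N) where
  __ := AddSubgroup.closure {x : M ⊗[ℤ] N | ∃ (m : M) (b : B) (n : N),
    x = (MulOpposite.op b • m) ⊗ₜ[ℤ] n - m ⊗ₜ[ℤ] (b • n)}
  smul_mem' := by
    intro a x hx
    change x ∈ AddSubgroup.closure _ at hx
    change a • x ∈ AddSubgroup.closure _
    induction hx using AddSubgroup.closure_induction with
    | mem x h =>
      obtain ⟨m, b, n, rfl⟩ := h
      refine AddSubgroup.subset_closure ⟨a • m, b, n, ?_⟩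
      rw [smul_sub, TensorProduct.smul_tmul', TensorProduct.smul_tmul',
        smul_comm a (MulOpposite.op b) m]
    | zero => rw [smul_zero]; exact zero_mem _
    | add x y _ _ hx hy => rw [smul_add]; exact add_mem hx hy
    | neg x _ hx => rw [smul_neg]; exact neg_mem hx

/-- The abelian group `M ⊗_B N`. -/
abbrev Tensor : Type := (M ⊗[ℤ] N) ⧸ tensorRel M N

variable {M N}

/-- The class of a pure tensor in `M ⊗_B N`. -/
def tmul (m : M) (n : N) : Tensor M N := (tensorRel M N).mkQ (m ⊗ₜ[ℤ] n)

theorem tmul_add (m : M) (n n' : N) : tmul m (n + n') = tmul m n + tmul m n' := by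
  simp only [tmul, TensorProduct.tmul_add, map_add]

theorem add_tmul (m m' : M) (n : N) : tmul (m + m') n = tmul m n + tmul m' n := by
  simp only [tmul, TensorProduct.add_tmul, map_add]

@[simp] theorem tmul_zero (m : M) : tmul m (0 : N) = 0 := by
  simp only [tmul, TensorProduct.tmul_zero, map_zero]

@[simp] theorem zero_tmul (n : N) : tmul (0 : M) n = 0 := by
  simp only [tmul, TensorProduct.zero_tmul, map_zero]

theorem smul_tmul' (a : A) (m : M) (n : N) : a • tmul m n = tmul (a • m) n := by
  simp only [tmul, ← map_smul, TensorProduct.smul_tmul']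

theorem tmul_balanced (m : M) (b : B) (n : N) :
    tmul (MulOpposite.op b • m) n = tmul m (b • n) := by
  rw [← sub_eq_zero]
  simp only [tmul, ← map_sub]
  rw [Submodule.mkQ_apply, Submodule.Quotient.mk_eq_zero]
  exact AddSubgroup.subset_closure ⟨m, b, n, rfl⟩

theorem tensor_induction {p : Tensor M N → Prop} (h₀ : p 0) (h₁ : ∀ m n, p (tmul m n))
    (h₂ : ∀ x y, p x → p y → p (x + y)) (x : Tensor M N) : p x := by
  obtain ⟨x, rfl⟩ := Submodule.mkQ_surjective _ x
  induction x using TensorProduct.induction_on with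
  | zero => simpa using h₀
  | tmul m n => exact h₁ m n
  | add x y hx hy => rw [map_add]; exact h₂ _ _ hx hy

/-- A balanced biadditive map induces a map on the tensor product. -/
def tensorLift {P : Type} [AddCommGroup P] (f : M →+ N →+ P)
    (hf : ∀ (m : M) (b : B) (n : N), f (MulOpposite.op b • m) n = f m (b • n)) :
    Tensor M N →+ P :=
  QuotientAddGroup.lift (tensorRel M N).toAddSubgroup
    (TensorProduct.liftAddHom f (fun r m n => by simp)) (by
      intro x hx
      change x ∈ AddSubgroup.closure _ at hx
      induction hx using AddSubgroup.closure_induction with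
      | mem x h =>
        obtain ⟨m, b, n, rfl⟩ := h
        simp [hf]
      | zero => exact zero_mem _
      | add x y _ _ hx hy => exact add_mem hx hy
      | neg x _ hx => exact neg_mem hx)

@[simp] theorem tensorLift_tmul {P : Type} [AddCommGroup P] (f : M →+ N →+ P)
    (hf : ∀ (m : M) (b : B) (n : N), f (MulOpposite.op b • m) n = f m (b • n)) (m : M) (n : N) :
    tensorLift f hf (tmul m n) = f m n := rfl

/-- The tensor product of two additive maps as a biadditive map. -/
def tmulHom : M →+ N →+ Tensor M N :=
  AddMonoidHom.mk' (fun m => AddMonoidHom.mk' (fun n => tmul m n) (tmul_add m))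
    (fun m m' => by ext n; exact add_tmul m m' n)

@[simp] theorem tmulHom_apply (m : M) (n : N) : tmulHom m n = tmul m n := rfl

variable (M N) in
/-- The homogeneous components of a tensor product. -/
def tensorGr (γ : TriDeg) : AddSubgroup (Tensor M N) :=
  AddSubgroup.closure {x | ∃ (α β : TriDeg) (m : M) (n : N),
    m ∈ M.gr α ∧ n ∈ N.gr β ∧ α + β = γ ∧ x = tmul m n}

theorem tmul_mem {α β : TriDeg} {m : M} {n : N} (hm : m ∈ M.gr α) (hn : n ∈ N.gr β) :
    tmul m n ∈ tensorGr M N (α + β) :=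
  AddSubgroup.subset_closure ⟨α, β, m, n, hm, hn, rfl, rfl⟩

theorem tensor_isInternal : DirectSum.IsInternal (tensorGr M N) := by
  let f : M →+ N →+ (TriDeg →₀ Tensor M N) :=
    AddMonoidHom.mk' (fun m => AddMonoidHom.mk' (fun n =>
      (decompose M.internal m).sum fun α a => (decompose N.internal n).sum fun β b =>
        Finsupp.single (α + β) (tmulHom a b))
      (by
        intro n n'
        rw [← Finsupp.sum_add]
        refine Finsupp.sum_congr fun α _ => ?_
        rw [map_add]
        refine Finsupp.sum_add_index' (fun β => ?_) (fun β b b' => ?_)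
        · rw [map_zero, Finsupp.single_zero]
        · rw [map_add, Finsupp.single_add]))
      (by
        intro m m'
        ext1 n
        simp only [AddMonoidHom.mk'_apply, AddMonoidHom.add_apply]
        rw [map_add]
        refine Finsupp.sum_add_index' (fun α => ?_) (fun α a a' => ?_)
        · simp
        · simp only [map_add, AddMonoidHom.add_apply, Finsupp.single_add, Finsupp.sum_add])
  have hfh : ∀ {α β : TriDeg} {m : M} {n : N}, m ∈ M.gr α → n ∈ N.gr β →
      f m n = Finsupp.single (α + β) (tmul m n) := by
    intro α β m n hm hn
    simp only [f, AddMonoidHom.mk'_apply, decompose_of_mem M.internal hm,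
      decompose_of_mem N.internal hn]
    rw [Finsupp.sum_single_index, Finsupp.sum_single_index] <;> simp
  have hf : ∀ (m : M) (b : B) (n : N), f (MulOpposite.op b • m) n = f m (b • n) := by
    intro m b n
    induction m using homogeneous_induction M.internal with
    | h₀ => simp
    | h₂ m m' hm hm' => simp [hm, hm']
    | h₁ α m hm =>
    induction n using homogeneous_induction N.internal with
    | h₀ => simp
    | h₂ n n' hn hn' => simp [hn, hn']
    | h₁ β n hn =>
    induction b using homogeneous_induction B.internal with
    | h₀ => simp
    | h₂ b b' hb hb' => simp [add_smul, hb, hb']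
    | h₁ γ b hb =>
    rw [hfh (M.op_smul_mem hm hb) hn, hfh hm (N.smul_mem hb hn), tmul_balanced, add_assoc]
  refine isInternal_of_decompose _ (tensorLift f hf) ?_ ?_
  · intro γ x hx
    induction hx using AddSubgroup.closure_induction with
    | mem x h =>
      obtain ⟨α, β, m, n, hm, hn, rfl, rfl⟩ := h
      rw [tensorLift_tmul, hfh hm hn]
    | zero => simp
    | add x y _ _ hx hy => rw [map_add, hx, hy, Finsupp.single_add]
    | neg x _ hx => rw [map_neg, hx, Finsupp.single_neg]
  · intro x
    induction x using tensor_induction with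
    | h₀ => exact zero_mem _
    | h₂ x y hx hy => exact add_mem hx hy
    | h₁ m n =>
    induction m using homogeneous_induction M.internal with
    | h₀ => rw [← tmulHom_apply, map_zero]; exact zero_mem _
    | h₂ m m' hm hm' => rw [add_tmul]; exact add_mem hm hm'
    | h₁ α m hm =>
    induction n using homogeneous_induction N.internal with
    | h₀ => rw [← tmulHom_apply, map_zero]; exact zero_mem _
    | h₂ n n' hn hn' => rw [tmul_add]; exact add_mem hn hn'
    | h₁ β n hn => exact AddSubgroup.mem_iSup_of_mem (α + β) (tmul_mem hm hn)

/-- Right multiplication by `c` on a tensor product. -/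
def tensorRight (c : (C : Type)ᵐᵒᵖ) : Tensor M N →+ Tensor M N :=
  tensorLift (tmulHom.compr₂ (AddMonoidHom.id _) |>.compl₂ (DistribSMul.toAddMonoidHom N c))
    (fun m b n => by
      simp only [AddMonoidHom.compl₂_apply]
      change tmul _ (c • n) = tmul m (c • b • n)
      rw [tmul_balanced, smul_comm b c n])

@[simp] theorem tensorRight_tmul (c : (C : Type)ᵐᵒᵖ) (m : M) (n : N) :
    tensorRight c (tmul m n) = tmul m (c • n) := rfl

theorem tensor_hom_ext {P : Type} [AddCommGroup P] {f g : Tensor M N →+ P}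
    (h : ∀ m n, f (tmul m n) = g (tmul m n)) : f = g := by
  ext x
  induction x using tensor_induction with
  | h₀ => simp
  | h₁ m n => exact h m n
  | h₂ x y hx hy => simp [hx, hy]

/-- The ring homomorphism giving the right action on a tensor product. -/
def tensorRightHom : (C : Type)ᵐᵒᵖ →+* AddMonoid.End (Tensor M N) where
  toFun c := tensorRight c
  map_one' := tensor_hom_ext fun m n => by
    rw [tensorRight_tmul, one_smul]; rfl
  map_zero' := tensor_hom_ext fun m n => by
    rw [tensorRight_tmul, zero_smul, ← tmulHom_apply, map_zero]; rfl
  map_mul' c d := tensor_hom_ext fun m n => by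
    rw [tensorRight_tmul, mul_smul]; rfl
  map_add' c d := tensor_hom_ext fun m n => by
    rw [tensorRight_tmul, add_smul, tmul_add]; rfl

instance tensorRightModule : Module (C : Type)ᵐᵒᵖ (Tensor M N) :=
  Module.compHom _ (tensorRightHom (M := M) (N := N))

variable (M N) in
/-- The tensor product over `B` of a trigraded `(A, B)`-bimodule and a trigraded
`(B, C)`-bimodule, with `deg (m ⊗ n) = deg m + deg n`. -/
abbrev tensorObj : TriBimod A C where
  carrier := Tensor M N
  smulComm := ⟨fun a c x => by
    change a • tensorRight c x = tensorRight c (a • x)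
    induction x using tensor_induction with
    | h₀ => simp
    | h₁ m n => rw [tensorRight_tmul, smul_tmul', smul_tmul', tensorRight_tmul]
    | h₂ x y hx hy => simp only [map_add, smul_add, hx, hy]⟩
  gr := tensorGr M N
  internal := tensor_isInternal
  smul_mem := fun {γ δ a x} ha hx => by
    induction hx using AddSubgroup.closure_induction with
    | mem x h =>
      obtain ⟨α, β, m, n, hm, hn, rfl, rfl⟩ := h
      rw [smul_tmul', ← add_assoc]
      exact tmul_mem (M.smul_mem ha hm) hn
    | zero => rw [smul_zero]; exact zero_mem _
    | add x y _ _ hx hy => rw [smul_add]; exact add_mem hx hy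
    | neg x _ hx => rw [smul_neg]; exact neg_mem hx
  op_smul_mem := fun {γ δ c x} hx hc => by
    change tensorRight (MulOpposite.op c) x ∈ _
    induction hx using AddSubgroup.closure_induction with
    | mem x h =>
      obtain ⟨α, β, m, n, hm, hn, rfl, rfl⟩ := h
      rw [tensorRight_tmul, add_assoc]
      exact tmul_mem hm (N.op_smul_mem hn hc)
    | zero => rw [map_zero]; exact zero_mem _
    | add x y _ _ hx hy => rw [map_add]; exact add_mem hx hy
    | neg x _ hx => rw [map_neg]; exact neg_mem hx

theorem op_smul_tmul (c : C) (m : M) (n : N) :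
    (MulOpposite.op c • (tmul m n : tensorObj M N) : tensorObj M N)
      = tmul m (MulOpposite.op c • n) := rfl

/-- Morphisms out of a tensor product. -/
def tensorDesc {P : TriBimod A C} (f : M →+ N →+ P)
    (hf : ∀ (m : M) (b : B) (n : N), f (MulOpposite.op b • m) n = f m (b • n))
    (hl : ∀ (a : A) (m : M) (n : N), f (a • m) n = a • f m n)
    (hr : ∀ (c : C) (m : M) (n : N), f m (MulOpposite.op c • n) = MulOpposite.op c • f m n)
    (hg : ∀ {α β : TriDeg} {m : M} {n : N}, m ∈ M.gr α → n ∈ N.gr β → f m n ∈ P.gr (α + β)) :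
    tensorObj M N ⟶ P where
  toFun := tensorLift f hf
  map_smul a x := by
    induction x using tensor_induction with
    | h₀ => simp
    | h₁ m n => rw [smul_tmul', tensorLift_tmul, tensorLift_tmul, hl]
    | h₂ x y hx hy => rw [smul_add, map_add, map_add, hx, hy, smul_add]
  map_op_smul c x := by
    induction x using tensor_induction with
    | h₀ => simp
    | h₁ m n => rw [op_smul_tmul, tensorLift_tmul, tensorLift_tmul, hr]
    | h₂ x y hx hy => rw [smul_add, map_add, map_add, hx, hy, smul_add]
  map_gr := fun {γ x} hx => by
    induction hx using AddSubgroup.closure_induction with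
    | mem x h =>
      obtain ⟨α, β, m, n, hm, hn, rfl, rfl⟩ := h
      exact hg hm hn
    | zero => rw [map_zero]; exact zero_mem _
    | add x y _ _ hx hy => rw [map_add]; exact add_mem hx hy
    | neg x _ hx => rw [map_neg]; exact neg_mem hx

/-- The tensor product of two morphisms. -/
def tensorMap {M M' : TriBimod A B} {N N' : TriBimod B C} (f : M ⟶ M') (g : N ⟶ N') :
    tensorObj M N ⟶ tensorObj M' N' :=
  tensorDesc (P := tensorObj M' N') ((tmulHom.comp f.toFun).compl₂ g.toFun)
    (fun m b n => by
      simp only [AddMonoidHom.compl₂_apply, AddMonoidHom.comp_apply, tmulHom_apply]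
      rw [f.map_op_smul, g.map_smul, tmul_balanced])
    (fun a m n => by simp [f.map_smul, smul_tmul'])
    (fun c m n => by simp [g.map_op_smul, op_smul_tmul])
    (fun hm hn => tmul_mem (f.map_gr hm) (g.map_gr hn))

@[simp] theorem tensorMap_tmul {M M' : TriBimod A B} {N N' : TriBimod B C} (f : M ⟶ M')
    (g : N ⟶ N') (m : M) (n : N) :
    Hom.toFun (tensorMap f g) (tmul m n) = tmul (Hom.toFun f m) (Hom.toFun g n) := rfl

theorem tensorObj_hom_ext {P : TriBimod A C} {f g : tensorObj M N ⟶ P}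
    (h : ∀ m n, Hom.toFun f (tmul m n) = Hom.toFun g (tmul m n)) : f = g :=
  Hom.ext (tensor_hom_ext h)

variable (A B C) in
/-- The tensor product over `B`, as a bifunctor. -/
def tensorFunctor : TriBimod A B ⥤ TriBimod B C ⥤ TriBimod A C where
  obj M :=
    { obj := fun N => tensorObj M N
      map := fun g => tensorMap (𝟙 M) g
      map_id := fun _ => tensorObj_hom_ext fun _ _ => rfl
      map_comp := fun _ _ => tensorObj_hom_ext fun _ _ => rfl }
  map f :=
    { app := fun N => tensorMap f (𝟙 N)
      naturality := fun _ _ _ => tensorObj_hom_ext fun _ _ => rfl }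
  map_id _ := by ext1; ext1; exact tensorObj_hom_ext fun _ _ => rfl
  map_comp _ _ := by ext1; ext1; exact tensorObj_hom_ext fun _ _ => rfl

instance : (tensorFunctor A B C).Additive where
  map_add {_ _ _ _} := by
    ext1; ext1
    exact tensorObj_hom_ext fun _ _ => add_tmul _ _ _

instance (M : TriBimod A B) : ((tensorFunctor A B C).obj M).Additive where
  map_add {_ _ _ _} := tensorObj_hom_ext fun _ _ => tmul_add _ _ _

end Tensor

end TriBimod
end AffineBraid
namespace AffineBraid

/-! ## The quiver algebra -/

instance neZeroOfFact (n : ℕ) [h : Fact (3 ≤ n)] : NeZero n := ⟨by have := h.out; omega⟩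

/-- Coefficients of an element of the quiver algebra in its basis of `4n` paths; vertices are
integers modulo `n`, so that the vertex `n` is `0`. -/
@[ext]
structure QuiverAlg (n : ℕ) where
  /-- the coefficient of the path `(i)` of length zero -/
  e : ZMod n → ℤ
  /-- the coefficient of the path `(i|i+1)` -/
  u : ZMod n → ℤ
  /-- the coefficient of the path `(i|i-1)` -/
  d : ZMod n → ℤ
  /-- the coefficient of the path `(i|i+1|i) = (i|i-1|i)` -/
  x : ZMod n → ℤ

namespace QuiverAlg

variable {n : ℕ}

instance : Zero (QuiverAlg n) := ⟨⟨0, 0, 0, 0⟩⟩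
instance : One (QuiverAlg n) := ⟨⟨1, 0, 0, 0⟩⟩
instance : Add (QuiverAlg n) := ⟨fun r s => ⟨r.e + s.e, r.u + s.u, r.d + s.d, r.x + s.x⟩⟩
instance : Neg (QuiverAlg n) := ⟨fun r => ⟨-r.e, -r.u, -r.d, -r.x⟩⟩

/-- Multiplication is concatenation of paths, `(i|j)(j|k) = (i|j|k)`, subject to
`(i|i+1|i) = (i|i-1|i)` and `(i-1|i|i+1) = (i+1|i|i-1) = 0`. -/
instance : Mul (QuiverAlg n) := ⟨fun r s =>
  { e := fun i => r.e i * s.e i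
    u := fun i => r.e i * s.u i + r.u i * s.e (i + 1)
    d := fun i => r.e i * s.d i + r.d i * s.e (i - 1)
    x := fun i => r.e i * s.x i + r.x i * s.e i + r.u i * s.d (i + 1) + r.d i * s.u (i - 1) }⟩

section simps

variable (r s : QuiverAlg n) (i : ZMod n)

@[simp] theorem zero_e : (0 : QuiverAlg n).e i = 0 := rfl
@[simp] theorem zero_u : (0 : QuiverAlg n).u i = 0 := rfl
@[simp] theorem zero_d : (0 : QuiverAlg n).d i = 0 := rfl
@[simp] theorem zero_x : (0 : QuiverAlg n).x i = 0 := rfl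
@[simp] theorem one_e : (1 : QuiverAlg n).e i = 1 := rfl
@[simp] theorem one_u : (1 : QuiverAlg n).u i = 0 := rfl
@[simp] theorem one_d : (1 : QuiverAlg n).d i = 0 := rfl
@[simp] theorem one_x : (1 : QuiverAlg n).x i = 0 := rfl
@[simp] theorem add_e : (r + s).e i = r.e i + s.e i := rfl
@[simp] theorem add_u : (r + s).u i = r.u i + s.u i := rfl
@[simp] theorem add_d : (r + s).d i = r.d i + s.d i := rfl
@[simp] theorem add_x : (r + s).x i = r.x i + s.x i := rfl
@[simp] theorem neg_e : (-r).e i = -r.e i := rfl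
@[simp] theorem neg_u : (-r).u i = -r.u i := rfl
@[simp] theorem neg_d : (-r).d i = -r.d i := rfl
@[simp] theorem neg_x : (-r).x i = -r.x i := rfl
@[simp] theorem mul_e : (r * s).e i = r.e i * s.e i := rfl
@[simp] theorem mul_u : (r * s).u i = r.e i * s.u i + r.u i * s.e (i + 1) := rfl
@[simp] theorem mul_d : (r * s).d i = r.e i * s.d i + r.d i * s.e (i - 1) := rfl
@[simp] theorem mul_x : (r * s).x i =
    r.e i * s.x i + r.x i * s.e i + r.u i * s.d (i + 1) + r.d i * s.u (i - 1) := rfl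

end simps

instance : AddCommGroup (QuiverAlg n) where
  add_assoc r s t := by ext i <;> simp [add_assoc]
  zero_add r := by ext i <;> simp
  add_zero r := by ext i <;> simp
  neg_add_cancel r := by ext i <;> simp
  add_comm r s := by ext i <;> simp [add_comm]
  nsmul := nsmulRec
  zsmul := zsmulRec

instance : Ring (QuiverAlg n) where
  __ := (inferInstance : AddCommGroup (QuiverAlg n))
  mul_assoc r s t := by ext i <;> simp <;> ring
  one_mul r := by ext i <;> simp
  mul_one r := by ext i <;> simp
  left_distrib r s t := by ext i <;> simp <;> ring
  right_distrib r s t := by ext i <;> simp <;> ring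
  zero_mul r := by ext i <;> simp
  mul_zero r := by ext i <;> simp

/-- The path `(i)`. -/
def pathE (i : ZMod n) : QuiverAlg n := ⟨Pi.single i 1, 0, 0, 0⟩
/-- The path `(i|i+1)`. -/
def pathU (i : ZMod n) : QuiverAlg n := ⟨0, Pi.single i 1, 0, 0⟩
/-- The path `(i|i-1)`. -/
def pathD (i : ZMod n) : QuiverAlg n := ⟨0, 0, Pi.single i 1, 0⟩
/-- The path `(i|i+1|i) = (i|i-1|i)`. -/
def pathX (i : ZMod n) : QuiverAlg n := ⟨0, 0, 0, Pi.single i 1⟩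

/-- Evaluation of coefficients as additive maps. -/
def eHom (i : ZMod n) : QuiverAlg n →+ ℤ := ⟨⟨fun r => r.e i, rfl⟩, fun _ _ => rfl⟩
/-- Evaluation of coefficients as additive maps. -/
def uHom (i : ZMod n) : QuiverAlg n →+ ℤ := ⟨⟨fun r => r.u i, rfl⟩, fun _ _ => rfl⟩
/-- Evaluation of coefficients as additive maps. -/
def dHom (i : ZMod n) : QuiverAlg n →+ ℤ := ⟨⟨fun r => r.d i, rfl⟩, fun _ _ => rfl⟩
/-- Evaluation of coefficients as additive maps. -/
def xHom (i : ZMod n) : QuiverAlg n →+ ℤ := ⟨⟨fun r => r.x i, rfl⟩, fun _ _ => rfl⟩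

theorem zsmul_e (k : ℤ) (r : QuiverAlg n) (i : ZMod n) : (k • r).e i = k * r.e i := by
  exact (map_zsmul (eHom i) k r).trans (smul_eq_mul _ _)
theorem zsmul_u (k : ℤ) (r : QuiverAlg n) (i : ZMod n) : (k • r).u i = k * r.u i := by
  exact (map_zsmul (uHom i) k r).trans (smul_eq_mul _ _)
theorem zsmul_d (k : ℤ) (r : QuiverAlg n) (i : ZMod n) : (k • r).d i = k * r.d i := by
  exact (map_zsmul (dHom i) k r).trans (smul_eq_mul _ _)
theorem zsmul_x (k : ℤ) (r : QuiverAlg n) (i : ZMod n) : (k • r).x i = k * r.x i := by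
  exact (map_zsmul (xHom i) k r).trans (smul_eq_mul _ _)

@[simp] theorem sum_e {ι : Type} (S : Finset ι) (f : ι → QuiverAlg n) (i : ZMod n) :
    (∑ j ∈ S, f j).e i = ∑ j ∈ S, (f j).e i := map_sum (eHom i) f S
@[simp] theorem sum_u {ι : Type} (S : Finset ι) (f : ι → QuiverAlg n) (i : ZMod n) :
    (∑ j ∈ S, f j).u i = ∑ j ∈ S, (f j).u i := map_sum (uHom i) f S
@[simp] theorem sum_d {ι : Type} (S : Finset ι) (f : ι → QuiverAlg n) (i : ZMod n) :
    (∑ j ∈ S, f j).d i = ∑ j ∈ S, (f j).d i := map_sum (dHom i) f S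
@[simp] theorem sum_x {ι : Type} (S : Finset ι) (f : ι → QuiverAlg n) (i : ZMod n) :
    (∑ j ∈ S, f j).x i = ∑ j ∈ S, (f j).x i := map_sum (xHom i) f S

theorem eq_sum_paths [NeZero n] (r : QuiverAlg n) :
    r = ∑ i, (r.e i • pathE i + r.u i • pathU i + r.d i • pathD i + r.x i • pathX i) := by
  ext i <;>
    simp only [sum_e, sum_u, sum_d, sum_x, add_e, add_u, add_d, add_x, zsmul_e, zsmul_u, zsmul_d,
      zsmul_x] <;>
    simp [pathE, pathU, pathD, pathX, Pi.single_apply]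

/-- Elements `(i)`, `(i|i+1)`, `(i|i-1)` of a ring subject to the defining relations of the path ring
of the cyclic quiver and to `(i|i+1|i) = (i|i-1|i)` and `(i|i+1|i+2) = (i|i-1|i-2) = 0`. -/
structure QuiverRel [NeZero n] {S : Type*} [Ring S] (e u d : ZMod n → S) : Prop where
  ee : ∀ i j, e i * e j = if j = i then e i else 0
  one : ∑ i, e i = 1
  eu : ∀ i, e i * u i = u i
  ue : ∀ i, u i * e (i + 1) = u i
  ed : ∀ i, e i * d i = d i
  de : ∀ i, d i * e (i - 1) = d i
  loops : ∀ i, u i * d (i + 1) = d i * u (i - 1)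
  uu : ∀ i, u i * u (i + 1) = 0
  dd : ∀ i, d i * d (i - 1) = 0

theorem quiverRel_paths [NeZero n] :
    QuiverRel (pathE : ZMod n → QuiverAlg n) pathU pathD where
  ee i j := by
    by_cases h : j = i
    · subst h
      ext k <;> by_cases hk : k = j <;> simp [pathE, hk]
    · ext k <;> by_cases hk : k = j <;> simp [pathE, hk, h]
  one := by ext k <;> simp [pathE, Pi.single_apply]
  eu i := by ext k <;> by_cases hk : k = i <;> simp [pathE, pathU, hk]
  ue i := by ext k <;> by_cases hk : k = i <;> simp [pathE, pathU, hk]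
  ed i := by ext k <;> by_cases hk : k = i <;> simp [pathE, pathD, hk]
  de i := by ext k <;> by_cases hk : k = i <;> simp [pathE, pathD, hk]
  loops i := by ext k <;> by_cases hk : k = i <;> simp [pathU, pathD, hk]
  uu i := by ext k <;> simp [pathU]
  dd i := by ext k <;> simp [pathD]

/-- The ring `QuiverAlg n` is the quotient of the path ring by the stated relations: it has the
universal property of the ring generated by the paths of length at most one, subject to them. -/
theorem existsUnique_hom [NeZero n] {S : Type*} [Ring S] {e u d : ZMod n → S}
    (h : QuiverRel e u d) : ∃! f : QuiverAlg n →+* S,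
      (∀ i, f (pathE i) = e i) ∧ (∀ i, f (pathU i) = u i) ∧ ∀ i, f (pathD i) = d i := by
  have ue : ∀ i j, u i * e j = if j = i + 1 then u i else 0 := fun i j => by
    rw [← h.ue i, mul_assoc, h.ee]
    split_ifs <;> simp [h.ue]
  have de : ∀ i j, d i * e j = if j = i - 1 then d i else 0 := fun i j => by
    rw [← h.de i, mul_assoc, h.ee]
    split_ifs <;> simp [h.de]
  have eu : ∀ i j, e i * u j = if j = i then u i else 0 := fun i j => by
    rw [← h.eu j, ← mul_assoc, h.ee]
    split_ifs with hij
    · rw [hij, h.eu]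
    · simp
  have ed : ∀ i j, e i * d j = if j = i then d i else 0 := fun i j => by
    rw [← h.ed j, ← mul_assoc, h.ee]
    split_ifs with hij
    · rw [hij, h.ed]
    · simp
  have uu : ∀ i j, u i * u j = 0 := fun i j => by
    rw [← h.eu j, ← mul_assoc, ue]
    split_ifs with hij
    · rw [hij, h.uu]
    · simp
  have dd : ∀ i j, d i * d j = 0 := fun i j => by
    rw [← h.ed j, ← mul_assoc, de]
    split_ifs with hij
    · rw [hij, h.dd]
    · simp
  obtain ⟨x, hx⟩ : ∃ x : ZMod n → S, ∀ i, x i = u i * d (i + 1) := ⟨_, fun _ => rfl⟩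
  have hx' : ∀ i, x i = d i * u (i - 1) := fun i => (hx i).trans (h.loops i)
  have ud : ∀ i j, u i * d j = if j = i + 1 then x i else 0 := fun i j => by
    rw [← h.ed j, ← mul_assoc, ue]
    split_ifs with hij
    · rw [hij, hx]
    · simp
  have du : ∀ i j, d i * u j = if j = i - 1 then x i else 0 := fun i j => by
    rw [← h.eu j, ← mul_assoc, de]
    split_ifs with hij
    · rw [hij, hx']
    · simp
  have ex : ∀ i j, e i * x j = if j = i then x i else 0 := fun i j => by
    rw [hx, ← mul_assoc, eu]
    split_ifs with hij
    · rw [hij, hx]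
    · simp
  have xe : ∀ i j, x i * e j = if j = i then x i else 0 := fun i j => by
    rw [hx, mul_assoc, de, add_sub_cancel_right]
    split_ifs with hij <;> simp
  have ux : ∀ i j, u i * x j = 0 := fun i j => by rw [hx, ← mul_assoc, uu, zero_mul]
  have dx : ∀ i j, d i * x j = 0 := fun i j => by rw [hx', ← mul_assoc, dd, zero_mul]
  have xu : ∀ i j, x i * u j = 0 := fun i j => by rw [hx', mul_assoc, uu, mul_zero]
  have xd : ∀ i j, x i * d j = 0 := fun i j => by rw [hx, mul_assoc, dd, mul_zero]
  have xx : ∀ i j, x i * x j = 0 := fun i j => by rw [hx j, ← mul_assoc, xu, zero_mul]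
  let f : QuiverAlg n →+* S :=
    { toFun := fun r => ∑ i, (r.e i • e i + r.u i • u i + r.d i • d i + r.x i • x i)
      map_zero' := by simp
      map_one' := by simp [h.one]
      map_add' := fun r s => by
        rw [← Finset.sum_add_distrib]
        refine Finset.sum_congr rfl fun i _ => ?_
        simp only [add_e, add_u, add_d, add_x, add_smul]
        abel
      map_mul' := fun r s => by
        rw [Finset.sum_mul_sum]
        refine Finset.sum_congr rfl fun i _ => ?_
        simp only [add_mul, mul_add, smul_mul_smul_comm, h.ee, ue, de, eu, ed, uu, dd, ud, du, ex,
          xe, ux, dx, xu, xd, xx, smul_zero, smul_ite, Finset.sum_add_distrib, Finset.sum_ite_eq',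
          Finset.mem_univ, if_true, Finset.sum_const_zero, mul_e, mul_u, mul_d, mul_x, add_smul]
        abel }
  refine ⟨f, ⟨fun i => ?_, fun i => ?_, fun i => ?_⟩, fun g hg => RingHom.ext fun r => ?_⟩
  · change ∑ j, _ = _
    simp [pathE, Pi.single_apply, ite_smul]
  · change ∑ j, _ = _
    simp [pathU, Pi.single_apply, ite_smul]
  · change ∑ j, _ = _
    simp [pathD, Pi.single_apply, ite_smul]
  · have hpx : ∀ i : ZMod n, (pathX i : QuiverAlg n) = pathU i * pathD (i + 1) := fun i => by
      ext k <;> by_cases hk : k = i <;> simp [pathU, pathD, pathX, hk]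
    have gx : ∀ i, g (pathX i) = x i := fun i => by rw [hpx, map_mul, hg.2.1, hg.2.2, hx]
    conv_lhs => rw [eq_sum_paths r]
    change _ = ∑ i, _
    simp only [map_sum, map_add, map_zsmul, hg.1, hg.2.1, hg.2.2, gx]

/-! ### Gradings -/

/-- An assignment of tridegrees to the `4n` paths. -/
@[ext]
structure PathDeg (n : ℕ) where
  /-- the degree of `(i)` -/
  e : ZMod n → TriDeg
  /-- the degree of `(i|i+1)` -/
  u : ZMod n → TriDeg
  /-- the degree of `(i|i-1)` -/
  d : ZMod n → TriDeg
  /-- the degree of `(i|i+1|i)` -/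
  x : ZMod n → TriDeg

/-- The span of the paths of degree `γ`. -/
def pathGr (P : PathDeg n) (γ : TriDeg) : AddSubgroup (QuiverAlg n) where
  carrier := {r | (∀ i, r.e i ≠ 0 → P.e i = γ) ∧ (∀ i, r.u i ≠ 0 → P.u i = γ) ∧
    (∀ i, r.d i ≠ 0 → P.d i = γ) ∧ ∀ i, r.x i ≠ 0 → P.x i = γ}
  add_mem' := by
    rintro r s ⟨h₁, h₂, h₃, h₄⟩ ⟨k₁, k₂, k₃, k₄⟩
    have key : ∀ (a b : ℤ) (Q : Prop), (a ≠ 0 → Q) → (b ≠ 0 → Q) → a + b ≠ 0 → Q := by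
      intro a b Q ha hb hab
      by_cases h : a = 0
      · exact hb fun hb => hab (by rw [h, hb, add_zero])
      · exact ha h
    exact ⟨fun i => key _ _ _ (h₁ i) (k₁ i), fun i => key _ _ _ (h₂ i) (k₂ i),
      fun i => key _ _ _ (h₃ i) (k₃ i), fun i => key _ _ _ (h₄ i) (k₄ i)⟩
  zero_mem' := ⟨fun i h => absurd rfl h, fun i h => absurd rfl h, fun i h => absurd rfl h,
    fun i h => absurd rfl h⟩
  neg_mem' := by
    rintro r ⟨h₁, h₂, h₃, h₄⟩
    exact ⟨fun i h => h₁ i (by simpa using h), fun i h => h₂ i (by simpa using h),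
      fun i h => h₃ i (by simpa using h), fun i h => h₄ i (by simpa using h)⟩

theorem pathGr_isInternal [NeZero n] (P : PathDeg n) : DirectSum.IsInternal (pathGr P) := by
  let dec : QuiverAlg n →+ (TriDeg →₀ QuiverAlg n) :=
    AddMonoidHom.mk' (fun r => ∑ i,
      (Finsupp.single (P.e i) (r.e i • pathE i) + Finsupp.single (P.u i) (r.u i • pathU i)
        + Finsupp.single (P.d i) (r.d i • pathD i) + Finsupp.single (P.x i) (r.x i • pathX i)))
      (fun r s => by
        rw [← Finset.sum_add_distrib]
        refine Finset.sum_congr rfl fun i _ => ?_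
        simp only [add_e, add_u, add_d, add_x, add_smul, Finsupp.single_add]
        abel)
  refine isInternal_of_decompose _ dec ?_ ?_
  · rintro γ r ⟨h₁, h₂, h₃, h₄⟩
    have key : ∀ (a : ℤ) (δ : TriDeg) (p : QuiverAlg n), (a ≠ 0 → δ = γ) →
        Finsupp.single δ (a • p) = Finsupp.single γ (a • p) := by
      intro a δ p h
      by_cases ha : a = 0
      · simp [ha]
      · rw [h ha]
    conv_rhs => rw [eq_sum_paths r, Finsupp.single_finsetSum]
    simp only [dec, AddMonoidHom.mk'_apply]
    refine Finset.sum_congr rfl fun i _ => ?_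
    rw [key _ _ _ (h₁ i), key _ _ _ (h₂ i), key _ _ _ (h₃ i), key _ _ _ (h₄ i)]
    simp only [Finsupp.single_add]
  · intro r
    rw [eq_sum_paths r]
    refine sum_mem fun i _ => add_mem (add_mem (add_mem ?_ ?_) ?_) ?_
    · refine AddSubgroup.mem_iSup_of_mem (P.e i) (zsmul_mem ?_ _)
      refine ⟨fun j h => ?_, fun j h => absurd rfl h, fun j h => absurd rfl h,
        fun j h => absurd rfl h⟩
      by_cases hj : j = i
      · rw [hj]
      · exact absurd (Pi.single_eq_of_ne hj _) h
    · refine AddSubgroup.mem_iSup_of_mem (P.u i) (zsmul_mem ?_ _)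
      refine ⟨fun j h => absurd rfl h, fun j h => ?_, fun j h => absurd rfl h,
        fun j h => absurd rfl h⟩
      by_cases hj : j = i
      · rw [hj]
      · exact absurd (Pi.single_eq_of_ne hj _) h
    · refine AddSubgroup.mem_iSup_of_mem (P.d i) (zsmul_mem ?_ _)
      refine ⟨fun j h => absurd rfl h, fun j h => absurd rfl h, fun j h => ?_,
        fun j h => absurd rfl h⟩
      by_cases hj : j = i
      · rw [hj]
      · exact absurd (Pi.single_eq_of_ne hj _) h
    · refine AddSubgroup.mem_iSup_of_mem (P.x i) (zsmul_mem ?_ _)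
      refine ⟨fun j h => absurd rfl h, fun j h => absurd rfl h, fun j h => absurd rfl h,
        fun j h => ?_⟩
      by_cases hj : j = i
      · rw [hj]
      · exact absurd (Pi.single_eq_of_ne hj _) h

/-- Compatibility of degrees with the concatenation of paths. -/
structure PathDeg.Compat (P Q S : PathDeg n) : Prop where
  ee : ∀ i, P.e i + Q.e i = S.e i
  eu : ∀ i, P.e i + Q.u i = S.u i
  ue : ∀ i, P.u i + Q.e (i + 1) = S.u i
  ed : ∀ i, P.e i + Q.d i = S.d i
  de : ∀ i, P.d i + Q.e (i - 1) = S.d i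
  ex : ∀ i, P.e i + Q.x i = S.x i
  xe : ∀ i, P.x i + Q.e i = S.x i
  ud : ∀ i, P.u i + Q.d (i + 1) = S.x i
  du : ∀ i, P.d i + Q.u (i - 1) = S.x i

theorem mul_mem_pathGr {P Q S : PathDeg n} (h : PathDeg.Compat P Q S) {γ δ : TriDeg}
    {r s : QuiverAlg n} (hr : r ∈ pathGr P γ) (hs : s ∈ pathGr Q δ) :
    r * s ∈ pathGr S (γ + δ) := by
  obtain ⟨h₁, h₂, h₃, h₄⟩ := hr
  obtain ⟨k₁, k₂, k₃, k₄⟩ := hs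
  have key : ∀ (a b : ℤ) (α β ζ : TriDeg), α + β = ζ → (a ≠ 0 → α = γ) → (b ≠ 0 → β = δ) →
      a * b ≠ 0 → ζ = γ + δ := by
    intro a b α β ζ hζ ha hb hab
    rw [← hζ, ha (left_ne_zero_of_mul hab), hb (right_ne_zero_of_mul hab)]
  have add : ∀ (a b : ℤ) (R : Prop), (a ≠ 0 → R) → (b ≠ 0 → R) → a + b ≠ 0 → R := by
    intro a b R ha hb hab
    by_cases h : a = 0
    · exact hb fun hb => hab (by rw [h, hb, add_zero])
    · exact ha h
  refine ⟨fun i => key _ _ _ _ _ (h.ee i) (h₁ i) (k₁ i), fun i => add _ _ _ ?_ ?_,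
    fun i => add _ _ _ ?_ ?_, fun i => add _ _ _ (add _ _ _ (add _ _ _ ?_ ?_) ?_) ?_⟩
  · exact key _ _ _ _ _ (h.eu i) (h₁ i) (k₂ i)
  · exact key _ _ _ _ _ (h.ue i) (h₂ i) (k₁ _)
  · exact key _ _ _ _ _ (h.ed i) (h₁ i) (k₃ i)
  · exact key _ _ _ _ _ (h.de i) (h₃ i) (k₁ _)
  · exact key _ _ _ _ _ (h.ex i) (h₁ i) (k₄ i)
  · exact key _ _ _ _ _ (h.xe i) (h₄ i) (k₁ i)
  · exact key _ _ _ _ _ (h.ud i) (h₂ i) (k₃ _)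
  · exact key _ _ _ _ _ (h.du i) (h₃ i) (k₂ _)

/-- The trigrading of the quiver algebra: the first degree counts the arrows `(i|i+1)`, the second
one is the length modulo two, the third one counts `(n|1)` positively and `(1|n)` negatively. -/
def stdDeg (n : ℕ) : PathDeg n where
  e _ := 0
  u i := (1, 1, if i = 0 then 1 else 0)
  d i := (0, 1, if i = 1 then -1 else 0)
  x _ := (1, 0, 0)

/-- The degrees on the twisted bimodule `T_n^ρ`: the third degree is `-1` on `(1)`, `(2|1)`,
`(1|n)`, `(1|2|1)` and zero on all other paths. -/
def twistDeg (n : ℕ) : PathDeg n where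
  e i := (0, 0, if i = 1 then -1 else 0)
  u _ := (1, 1, 0)
  d i := (0, 1, if i = 2 ∨ i = 1 then -1 else 0)
  x i := (1, 0, if i = 1 then -1 else 0)

/-- The degrees on the twisted bimodule `^ρT_n`: the third degree is `1` on `(1)`, `(n|1)`,
`(1|2)`, `(1|2|1)` and zero on all other paths. -/
def cotwistDeg (n : ℕ) : PathDeg n where
  e i := (0, 0, if i = 1 then 1 else 0)
  u i := (1, 1, if i = 0 ∨ i = 1 then 1 else 0)
  d _ := (0, 1, 0)
  x i := (1, 0, if i = 1 then 1 else 0)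

/-- The degrees `path ↦ deg (t_ρ⁻¹ path)`. -/
def rotDeg (n : ℕ) : PathDeg n where
  e i := (stdDeg n).e (i - 1)
  u i := (stdDeg n).u (i - 1)
  d i := (stdDeg n).d (i - 1)
  x i := (stdDeg n).x (i - 1)

theorem stdDeg_compat (n : ℕ) : PathDeg.Compat (stdDeg n) (stdDeg n) (stdDeg n) := by
  constructor <;> intro i <;> simp [stdDeg, Prod.ext_iff] <;>
    (try constructor) <;> (try decide)
  · by_cases h : i = 0 <;> simp [h]
  · by_cases h : i = 1 <;> simp [h, sub_eq_zero]

theorem two_ne_one_zmod [h : Fact (3 ≤ n)] : (2 : ZMod n) ≠ 1 := by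
  have h3 := h.out
  intro h
  have h' : ((1 : ℕ) : ZMod n) = ((0 : ℕ) : ZMod n) := by
    push_cast; linear_combination h
  rw [ZMod.natCast_eq_natCast_iff'] at h'
  rw [Nat.mod_eq_of_lt (by omega), Nat.mod_eq_of_lt (by omega)] at h'
  omega

theorem one_ne_zero_zmod [h : Fact (3 ≤ n)] : (1 : ZMod n) ≠ 0 := by
  intro h
  exact two_ne_one_zmod (n := n) (by linear_combination h)

theorem twistDeg_compat_left [Fact (3 ≤ n)] :
    PathDeg.Compat (stdDeg n) (twistDeg n) (twistDeg n) := by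
  have h21 := two_ne_one_zmod (n := n)
  have h10 := one_ne_zero_zmod (n := n)
  have h2 : ∀ i : ZMod n, i + 1 = 2 ↔ i = 1 := fun i =>
    ⟨fun h => by linear_combination h, fun h => by linear_combination h⟩
  constructor <;> intro i <;> simp [stdDeg, twistDeg, Prod.ext_iff, sub_eq_iff_eq_add, h2] <;>
    (try constructor) <;> (try decide) <;> (try norm_num) <;>
    (try (split_ifs <;> simp_all))

theorem twistDeg_compat_right [Fact (3 ≤ n)] :
    PathDeg.Compat (twistDeg n) (rotDeg n) (twistDeg n) := by
  have h21 := two_ne_one_zmod (n := n)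
  have h10 := one_ne_zero_zmod (n := n)
  constructor <;> intro i <;> simp [stdDeg, twistDeg, rotDeg, Prod.ext_iff, sub_eq_iff_eq_add] <;>
    (try constructor) <;> (try decide) <;> (try norm_num) <;>
    (try (split_ifs <;> simp_all))

theorem cotwistDeg_compat_left [Fact (3 ≤ n)] :
    PathDeg.Compat (rotDeg n) (cotwistDeg n) (cotwistDeg n) := by
  have h21 := two_ne_one_zmod (n := n)
  have h10 := one_ne_zero_zmod (n := n)
  constructor <;> intro i <;>
    simp [stdDeg, cotwistDeg, rotDeg, Prod.ext_iff, sub_eq_iff_eq_add] <;>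
    (try constructor) <;> (try decide) <;> (try norm_num) <;>
    (try (split_ifs <;> simp_all))

theorem cotwistDeg_compat_right [Fact (3 ≤ n)] :
    PathDeg.Compat (cotwistDeg n) (stdDeg n) (cotwistDeg n) := by
  have h21 := two_ne_one_zmod (n := n)
  have h10 := one_ne_zero_zmod (n := n)
  constructor <;> intro i <;>
    simp [stdDeg, cotwistDeg, Prod.ext_iff, sub_eq_iff_eq_add] <;>
    (try constructor) <;> (try decide) <;> (try norm_num) <;>
    (try (split_ifs <;> simp_all))

/-- The automorphism `t_ρ` sending each path `(i₁|…|i_k)` to `(i₁+1|…|i_k+1)`. -/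
def tRho (n : ℕ) : QuiverAlg n ≃+* QuiverAlg n where
  toFun r := ⟨fun i => r.e (i - 1), fun i => r.u (i - 1), fun i => r.d (i - 1),
    fun i => r.x (i - 1)⟩
  invFun r := ⟨fun i => r.e (i + 1), fun i => r.u (i + 1), fun i => r.d (i + 1),
    fun i => r.x (i + 1)⟩
  left_inv r := by ext i <;> simp
  right_inv r := by ext i <;> simp
  map_add' r s := by ext i <;> simp
  map_mul' r s := by ext i <;> simp

theorem tRho_mem {r : QuiverAlg n} {γ : TriDeg} (h : r ∈ pathGr (stdDeg n) γ) :
    tRho n r ∈ pathGr (rotDeg n) γ :=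
  ⟨fun i => h.1 (i - 1), fun i => h.2.1 (i - 1), fun i => h.2.2.1 (i - 1),
    fun i => h.2.2.2 (i - 1)⟩

end QuiverAlg

open QuiverAlg

/-- The trigraded ring `R_n`. -/
abbrev quiverRing (n : ℕ) [Fact (3 ≤ n)] : TriRing where
  carrier := QuiverAlg n
  gr := pathGr (stdDeg n)
  internal := pathGr_isInternal _
  one_mem := ⟨fun _ _ => rfl, fun _ h => absurd rfl h, fun _ h => absurd rfl h,
    fun _ h => absurd rfl h⟩
  mul_mem := mul_mem_pathGr (stdDeg_compat n)

/-- The ring of integers, concentrated in tridegree zero. -/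
abbrev intRing : TriRing where
  carrier := ℤ
  gr γ :=
    { carrier := {k | k ≠ 0 → γ = 0}
      add_mem' := fun {a b} ha hb h => by
        by_cases h' : a = 0
        · exact hb fun hb => h (by rw [h', hb, add_zero])
        · exact ha h'
      zero_mem' := fun h => absurd rfl h
      neg_mem' := fun ha h => ha (neg_ne_zero.mp h) }
  internal := by
    refine isInternal_of_decompose _ (Finsupp.singleAddHom 0) ?_ ?_
    · intro γ k hk
      by_cases h : k = 0
      · simp [h]
      · rw [hk h]; rfl
    · exact fun k => AddSubgroup.mem_iSup_of_mem 0 fun _ => rfl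
  one_mem := fun _ => rfl
  mul_mem := fun {γ δ a b} ha hb h => by
    rw [ha (left_ne_zero_of_mul h), hb (right_ne_zero_of_mul h), add_zero]

section

variable {n : ℕ} [Fact (3 ≤ n)] {A B : TriRing}

instance (M : TriBimod (quiverRing n) B) : Module (QuiverAlg n) M := M.leftModule

instance (M : TriBimod A (quiverRing n)) : Module (QuiverAlg n)ᵐᵒᵖ M := M.rightModule

instance (M : TriBimod (quiverRing n) B) : SMulCommClass (QuiverAlg n) (B : Type)ᵐᵒᵖ M :=
  M.smulComm

instance (M : TriBimod (quiverRing n) (quiverRing n)) :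
    SMulCommClass (QuiverAlg n) (QuiverAlg n)ᵐᵒᵖ M :=
  M.smulComm

end

/-- Trigraded `R_n`-bimodules. -/
abbrev RBimod (n : ℕ) [Fact (3 ≤ n)] : Type 1 := TriBimod (quiverRing n) (quiverRing n)

/-- Trigraded left `R_n`-modules, that is, trigraded `(R_n, ℤ)`-bimodules. -/
abbrev RMod (n : ℕ) [Fact (3 ≤ n)] : Type 1 := TriBimod (quiverRing n) intRing

/-- The regular bimodule `R_n`. -/
abbrev regBimod (n : ℕ) [Fact (3 ≤ n)] : RBimod n where
  carrier := QuiverAlg n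
  gr := pathGr (stdDeg n)
  internal := pathGr_isInternal _
  smul_mem := mul_mem_pathGr (stdDeg_compat n)
  op_smul_mem := mul_mem_pathGr (stdDeg_compat n)

/-- The abelian group underlying `T_n^ρ`. -/
def Twist (n : ℕ) : Type := QuiverAlg n

/-- The abelian group underlying `^ρT_n`. -/
def Cotwist (n : ℕ) : Type := QuiverAlg n

instance (n : ℕ) : AddCommGroup (Twist n) := inferInstanceAs (AddCommGroup (QuiverAlg n))
instance (n : ℕ) : AddCommGroup (Cotwist n) := inferInstanceAs (AddCommGroup (QuiverAlg n))

/-- The left action on `T_n^ρ` is multiplication. -/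
instance (n : ℕ) : Module (QuiverAlg n) (Twist n) :=
  inferInstanceAs (Module (QuiverAlg n) (QuiverAlg n))

/-- The element `r` acts on the right on `T_n^ρ` as multiplication by `t_ρ(r)`. -/
instance (n : ℕ) : Module (QuiverAlg n)ᵐᵒᵖ (Twist n) :=
  Module.compHom (QuiverAlg n) (tRho n).toRingHom.op

/-- The element `r` acts on the left on `^ρT_n` as multiplication by `t_ρ(r)`. -/
instance (n : ℕ) : Module (QuiverAlg n) (Cotwist n) :=
  Module.compHom (QuiverAlg n) (tRho n).toRingHom

/-- The right action on `^ρT_n` is multiplication. -/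
instance (n : ℕ) : Module (QuiverAlg n)ᵐᵒᵖ (Cotwist n) :=
  inferInstanceAs (Module (QuiverAlg n)ᵐᵒᵖ (QuiverAlg n))

/-- The trigraded bimodule `T_n^ρ`. -/
abbrev twistBimod (n : ℕ) [Fact (3 ≤ n)] : RBimod n where
  carrier := Twist n
  smulComm := ⟨fun a b m => (mul_assoc (G := QuiverAlg n) a m (tRho n b.unop)).symm⟩
  gr := pathGr (twistDeg n)
  internal := pathGr_isInternal (twistDeg n)
  smul_mem := mul_mem_pathGr twistDeg_compat_left
  op_smul_mem := fun hm hb => mul_mem_pathGr twistDeg_compat_right hm (tRho_mem hb)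

/-- The trigraded bimodule `^ρT_n`. -/
abbrev cotwistBimod (n : ℕ) [Fact (3 ≤ n)] : RBimod n where
  carrier := Cotwist n
  smulComm := ⟨fun a b m => (mul_assoc (G := QuiverAlg n) (tRho n a) m b.unop).symm⟩
  gr := pathGr (cotwistDeg n)
  internal := pathGr_isInternal (cotwistDeg n)
  smul_mem := fun ha hm => mul_mem_pathGr cotwistDeg_compat_left (tRho_mem ha) hm
  op_smul_mem := mul_mem_pathGr cotwistDeg_compat_right

/-- The left ideal `P_i = R_n (i)`. -/
abbrev leftIdeal (n : ℕ) (i : ZMod n) : Submodule (QuiverAlg n) (QuiverAlg n) :=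
  Submodule.span (QuiverAlg n) {pathE i}

/-- The right ideal `_iP = (i) R_n`. -/
abbrev rightIdeal (n : ℕ) (i : ZMod n) : Submodule (QuiverAlg n)ᵐᵒᵖ (QuiverAlg n) :=
  Submodule.span (QuiverAlg n)ᵐᵒᵖ {pathE i}

theorem pathE_mul_pathE {n : ℕ} (i : ZMod n) : (pathE i * pathE i : QuiverAlg n) = pathE i := by
  ext j <;> simp [pathE, Pi.single_apply]

theorem mul_pathE_of_mem {n : ℕ} {i : ZMod n} {p : QuiverAlg n} (h : p ∈ leftIdeal n i) :
    p * pathE i = p := by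
  obtain ⟨r, rfl⟩ := Submodule.mem_span_singleton.mp h
  rw [smul_eq_mul, mul_assoc, pathE_mul_pathE]

theorem pathE_mul_of_mem {n : ℕ} {i : ZMod n} {p : QuiverAlg n} (h : p ∈ rightIdeal n i) :
    pathE i * p = p := by
  obtain ⟨r, rfl⟩ := Submodule.mem_span_singleton.mp h
  rw [MulOpposite.smul_eq_mul_unop, ← mul_assoc, pathE_mul_pathE]

theorem mem_leftIdeal {n : ℕ} {i : ZMod n} {p : QuiverAlg n} (h : p * pathE i = p) : p ∈ leftIdeal n i :=
  Submodule.mem_span_singleton.mpr ⟨p, h⟩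

theorem mem_rightIdeal {n : ℕ} {i : ZMod n} {p : QuiverAlg n} (h : pathE i * p = p) :
    p ∈ rightIdeal n i :=
  Submodule.mem_span_singleton.mpr ⟨MulOpposite.op p, h⟩

theorem pathE_mem {n : ℕ} (i : ZMod n) : (pathE i : QuiverAlg n) ∈ pathGr (stdDeg n) 0 :=
  ⟨fun _ _ => rfl, fun _ h => absurd rfl h, fun _ h => absurd rfl h, fun _ h => absurd rfl h⟩

/-- Every abelian group is a right `ℤ`-module in a unique way. -/
instance (n : ℕ) (i : ZMod n) : Module ℤᵐᵒᵖ (leftIdeal n i) :=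
  Module.compHom _ (RingEquiv.toOpposite ℤ).symm.toRingHom

/-- The trigraded left module `P_i = R_n (i)`. -/
abbrev projLeft (n : ℕ) [Fact (3 ≤ n)] (i : ZMod n) : RMod n where
  carrier := leftIdeal n i
  smulComm := ⟨fun a b m => smul_comm a b.unop m⟩
  gr γ := (pathGr (stdDeg n) γ).comap (leftIdeal n i).subtype.toAddMonoidHom
  internal := isInternal_of_retract (pathGr_isInternal (stdDeg n)) _
    (AddMonoidHom.mk' (fun r => (⟨r * pathE i, Submodule.mem_span_singleton.mpr ⟨r, rfl⟩⟩ :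
      leftIdeal n i)) (fun r s => Subtype.ext (add_mul r s _)))
    (fun p => Subtype.ext (mul_pathE_of_mem p.2))
    (fun γ m hm => by
      have := mul_mem_pathGr (stdDeg_compat n) hm (pathE_mem i)
      rwa [add_zero] at this)
  smul_mem := fun {γ δ a m} ha hm => mul_mem_pathGr (stdDeg_compat n) ha hm
  op_smul_mem := fun {γ δ b m} hm hb => by
    by_cases h : b = 0
    · subst h
      have : (MulOpposite.op (0 : ℤ) • m : leftIdeal n i) = 0 := zero_smul _ m
      rw [this]
      exact zero_mem _
    · rw [hb h, add_zero]
      exact zsmul_mem hm b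

/-- The trigraded right module `_iP = (i) R_n`. -/
abbrev projRight (n : ℕ) [Fact (3 ≤ n)] (i : ZMod n) : TriBimod intRing (quiverRing n) where
  carrier := rightIdeal n i
  smulComm := ⟨fun a b m => (smul_comm b a m).symm⟩
  gr γ := (pathGr (stdDeg n) γ).comap (rightIdeal n i).subtype.toAddMonoidHom
  internal := isInternal_of_retract (pathGr_isInternal (stdDeg n)) _
    (AddMonoidHom.mk' (fun r => (⟨pathE i * r,
      Submodule.mem_span_singleton.mpr ⟨MulOpposite.op r, rfl⟩⟩ :
      rightIdeal n i)) (fun r s => Subtype.ext (mul_add _ r s)))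
    (fun p => Subtype.ext (pathE_mul_of_mem p.2))
    (fun γ m hm => by
      have := mul_mem_pathGr (stdDeg_compat n) (pathE_mem i) hm
      rwa [zero_add] at this)
  smul_mem := fun {γ δ a m} ha hm => by
    by_cases h : a = 0
    · subst h
      have : ((0 : ℤ) • m : rightIdeal n i) = 0 := zero_smul _ m
      rw [this]
      exact zero_mem _
    · rw [ha h, zero_add]
      exact zsmul_mem hm a
  op_smul_mem := fun {γ δ b m} hm hb => mul_mem_pathGr (stdDeg_compat n) hm hb

/-- The bimodule `P_i ⊗_ℤ _iP`. -/
noncomputable def projTensor (n : ℕ) [Fact (3 ≤ n)] (i : ZMod n) : RBimod n :=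
  TriBimod.tensorObj (projLeft n i) (projRight n i)

end AffineBraid
namespace AffineBraid
open QuiverAlg TriBimod

/-! ## The complexes of bimodules -/

theorem pathU_mul {n : ℕ} (i : ZMod n) : (pathU (i - 1) * pathE i : QuiverAlg n) = pathU (i - 1) := by
  ext j <;> simp [pathE, pathU, Pi.single_apply]
  rintro h1 rfl
  simp at h1

theorem pathD_mul {n : ℕ} (i : ZMod n) : (pathD (i + 1) * pathE i : QuiverAlg n) = pathD (i + 1) := by
  ext j <;> simp [pathE, pathD, Pi.single_apply]
  rintro h1 rfl
  simp at h1

theorem pathX_mul {n : ℕ} (i : ZMod n) : (pathX i * pathE i : QuiverAlg n) = pathX i := by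
  ext j <;> simp [pathE, pathX, Pi.single_apply]

theorem mul_pathU {n : ℕ} (i : ZMod n) : (pathE i * pathU i : QuiverAlg n) = pathU i := by
  ext j <;> simp [pathE, pathU, Pi.single_apply]

theorem mul_pathD {n : ℕ} (i : ZMod n) : (pathE i * pathD i : QuiverAlg n) = pathD i := by
  ext j <;> simp [pathE, pathD, Pi.single_apply]

theorem mul_pathX {n : ℕ} (i : ZMod n) : (pathE i * pathX i : QuiverAlg n) = pathX i := by
  ext j <;> simp [pathE, pathX, Pi.single_apply]

variable {n : ℕ} [Fact (3 ≤ n)]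

/-- An element of `R_n (i)` as an element of `P_i`. -/
def inLeft {i : ZMod n} (p : QuiverAlg n) (h : p * pathE i = p) : leftIdeal n i :=
  ⟨p, mem_leftIdeal h⟩

/-- An element of `(i) R_n` as an element of `_iP`. -/
def inRight {i : ZMod n} (p : QuiverAlg n) (h : pathE i * p = p) : rightIdeal n i :=
  ⟨p, mem_rightIdeal h⟩

/-- The multiplication `(p, q) ↦ p q` on `P_i × _iP`. -/
def mulPure (i : ZMod n) : leftIdeal n i →+ rightIdeal n i →+ QuiverAlg n :=
  AddMonoidHom.mk' (fun p => AddMonoidHom.mk' (fun q => (p.1 * q.1 : QuiverAlg n))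
    (fun q q' => mul_add p.1 q.1 q'.1))
    (fun p p' => by ext1 q; exact add_mul p.1 p'.1 q.1)

variable (n) in
/-- The differential `P_i ⊗ _iP ⟶ R_n`, which sends `p ⊗ q` to `p q` and in particular
`(i) ⊗ (i)` to `(i)`. -/
def dBraid (i : ZMod n) : projTensor n i ⟶ regBimod n :=
  tensorDesc (M := projLeft n i) (N := projRight n i) (P := regBimod n) (mulPure i)
    (fun p k q => by
      change (k • p.1) * q.1 = p.1 * (k • q.1)
      rw [smul_mul_assoc, mul_smul_comm])
    (fun a p q => mul_assoc a p.1 q.1)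
    (fun b p q => (mul_assoc p.1 q.1 b).symm)
    (fun hp hq => mul_mem_pathGr (stdDeg_compat n) hp hq)

/-- Pure tensors in `P_i ⊗ _iP`, as a biadditive map. -/
noncomputable def pureTensor (i : ZMod n) : leftIdeal n i →+ rightIdeal n i →+ projTensor n i :=
  tmulHom (M := projLeft n i) (N := projRight n i)

variable (n) in
/-- The element `(i-1|i) ⊗ (i|i-1) + (i+1|i) ⊗ (i|i+1) + (i) ⊗ (i|i-1|i) + (i|i-1|i) ⊗ (i)` of
`P_i ⊗ _iP`. -/
noncomputable def casimir (i : ZMod n) : projTensor n i :=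
  pureTensor i (inLeft (pathU (i - 1)) (pathU_mul i)) (inRight (pathD i) (mul_pathD i))
    + pureTensor i (inLeft (pathD (i + 1)) (pathD_mul i)) (inRight (pathU i) (mul_pathU i))
    + pureTensor i (inLeft (pathE i) (pathE_mul_pathE i)) (inRight (pathX i) (mul_pathX i))
    + pureTensor i (inLeft (pathX i) (pathX_mul i)) (inRight (pathE i) (pathE_mul_pathE i))

theorem smul_casimir (i : ZMod n) (r : QuiverAlg n) :
    r • casimir n i = MulOpposite.op r • casimir n i := by
  let U : leftIdeal n i := inLeft (pathU (i - 1)) (pathU_mul i)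
  let D : leftIdeal n i := inLeft (pathD (i + 1)) (pathD_mul i)
  let E : leftIdeal n i := inLeft (pathE i) (pathE_mul_pathE i)
  let X : leftIdeal n i := inLeft (pathX i) (pathX_mul i)
  let D' : rightIdeal n i := inRight (pathD i) (mul_pathD i)
  let U' : rightIdeal n i := inRight (pathU i) (mul_pathU i)
  let X' : rightIdeal n i := inRight (pathX i) (mul_pathX i)
  let E' : rightIdeal n i := inRight (pathE i) (pathE_mul_pathE i)
  have hu : (r • U : leftIdeal n i) = r.e (i - 1) • U + r.d i • X := by
    refine Subtype.ext ?_
    change r * pathU (i - 1) = r.e (i - 1) • pathU (i - 1) + r.d i • pathX i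
    ext j <;> simp only [add_e, add_u, add_d, add_x, zsmul_e, zsmul_u, zsmul_d, zsmul_x] <;>
      simp [pathU, pathX, Pi.single_apply]
    · split_ifs with h
      · rw [h]
      · rfl
    · by_cases h : j = i <;> simp [h]
  have hd : (r • D : leftIdeal n i) = r.e (i + 1) • D + r.u i • X := by
    refine Subtype.ext ?_
    change r * pathD (i + 1) = r.e (i + 1) • pathD (i + 1) + r.u i • pathX i
    ext j <;> simp only [add_e, add_u, add_d, add_x, zsmul_e, zsmul_u, zsmul_d, zsmul_x] <;>
      simp [pathD, pathX, Pi.single_apply]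
    · split_ifs with h
      · rw [h]
      · rfl
    · by_cases h : j = i <;> simp [h]
  have he : (r • E : leftIdeal n i)
      = r.e i • E + r.u (i - 1) • U + r.d (i + 1) • D + r.x i • X := by
    refine Subtype.ext ?_
    change r * pathE i = r.e i • pathE i + r.u (i - 1) • pathU (i - 1)
      + r.d (i + 1) • pathD (i + 1) + r.x i • pathX i
    ext j <;> simp only [add_e, add_u, add_d, add_x, zsmul_e, zsmul_u, zsmul_d, zsmul_x] <;>
      simp [pathU, pathD, pathE, pathX, Pi.single_apply]
    · split_ifs with h
      · rw [h]
      · rfl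
    · by_cases h : j = i - 1 <;> simp [h, eq_sub_iff_add_eq.symm]
    · by_cases h : j = i + 1 <;> simp [h, sub_eq_iff_eq_add]
    · split_ifs with h
      · rw [h]
      · rfl
  have hx : (r • X : leftIdeal n i) = r.e i • X := by
    refine Subtype.ext ?_
    change r * pathX i = r.e i • pathX i
    ext j <;> simp only [zsmul_e, zsmul_u, zsmul_d, zsmul_x] <;>
      simp [pathX, Pi.single_apply]
    · split_ifs with h
      · rw [h]
      · rfl
  have hd' : (MulOpposite.op r • D' : rightIdeal n i) = r.e (i - 1) • D' + r.u (i - 1) • X' := by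
    refine Subtype.ext ?_
    change pathD i * r = r.e (i - 1) • pathD i + r.u (i - 1) • pathX i
    ext j <;> simp only [add_e, add_u, add_d, add_x, zsmul_e, zsmul_u, zsmul_d, zsmul_x] <;>
      simp [pathD, pathX, Pi.single_apply]
    · by_cases h : j = i <;> simp [h]
    · by_cases h : j = i <;> simp [h]
  have hu' : (MulOpposite.op r • U' : rightIdeal n i) = r.e (i + 1) • U' + r.d (i + 1) • X' := by
    refine Subtype.ext ?_
    change pathU i * r = r.e (i + 1) • pathU i + r.d (i + 1) • pathX i
    ext j <;> simp only [add_e, add_u, add_d, add_x, zsmul_e, zsmul_u, zsmul_d, zsmul_x] <;>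
      simp [pathU, pathX, Pi.single_apply]
    · by_cases h : j = i <;> simp [h]
    · by_cases h : j = i <;> simp [h]
  have hx' : (MulOpposite.op r • X' : rightIdeal n i) = r.e i • X' := by
    refine Subtype.ext ?_
    change pathX i * r = r.e i • pathX i
    ext j <;> simp only [zsmul_e, zsmul_u, zsmul_d, zsmul_x] <;>
      simp [pathX, Pi.single_apply]
    · by_cases h : j = i <;> simp [h]
  have he' : (MulOpposite.op r • E' : rightIdeal n i)
      = r.e i • E' + r.u i • U' + r.d i • D' + r.x i • X' := by
    refine Subtype.ext ?_
    change pathE i * r = r.e i • pathE i + r.u i • pathU i + r.d i • pathD i + r.x i • pathX i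
    ext j <;> simp only [add_e, add_u, add_d, add_x, zsmul_e, zsmul_u, zsmul_d, zsmul_x] <;>
      simp [pathU, pathD, pathE, pathX, Pi.single_apply]
    all_goals (by_cases h : j = i <;> simp [h])
  have hc : casimir n i = pureTensor i U D' + pureTensor i D U' + pureTensor i E X'
      + pureTensor i X E' := rfl
  have hl : ∀ (p : leftIdeal n i) (q : rightIdeal n i),
      r • pureTensor i p q = pureTensor i (r • p) q := fun p q => rfl
  have hr : ∀ (p : leftIdeal n i) (q : rightIdeal n i),
      MulOpposite.op r • pureTensor i p q = pureTensor i p (MulOpposite.op r • q) :=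
    fun p q => rfl
  rw [hc]
  simp only [smul_add]
  rw [hl, hl, hl, hl, hr, hr, hr, hr, hu, hd, he, hx, hd', hu', hx', he']
  simp only [map_add, AddMonoidHom.add_apply, map_zsmul, AddMonoidHom.coe_smul, Pi.smul_apply]
  abel

variable (n) in
/-- The differential `R_n ⟶ P_i ⊗ _iP {-1}`, the bimodule map with `1 ↦ casimir n i`. -/
noncomputable def dBraidInv (i : ZMod n) : regBimod n ⟶ (shift (-1, 0, 0)).obj (projTensor n i) where
  toFun := AddMonoidHom.mk' (fun r : quiverRing n => r • casimir n i)
    (fun r s => add_smul r s (casimir n i))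
  map_smul a r := mul_smul (α := quiverRing n) a r (casimir n i)
  map_op_smul b r := by
    change ((r * b : QuiverAlg n) : quiverRing n) • casimir n i
      = (MulOpposite.op b • (r : quiverRing n) • casimir n i : projTensor n i)
    have h : ((r * b : QuiverAlg n) : quiverRing n) • casimir n i
      = (r : quiverRing n) • (b : quiverRing n) • casimir n i :=
      mul_smul (α := quiverRing n) r b (casimir n i)
    rw [h, smul_casimir i b]
    exact smul_comm (M := quiverRing n) (N := (quiverRing n : Type)ᵐᵒᵖ) r (MulOpposite.op b)
      (casimir n i)
  map_gr := fun {γ r} hr => by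
    have hc : casimir n i ∈ (projTensor n i).gr (1, 0, 0) := by
      have hU : ∀ j : ZMod n, pathU j ∈ pathGr (stdDeg n) ((stdDeg n).u j) := fun j =>
        ⟨fun k h => absurd rfl h, fun k h => by
          by_cases hk : k = j
          · rw [hk]
          · exact absurd (Pi.single_eq_of_ne hk _) h, fun k h => absurd rfl h,
          fun k h => absurd rfl h⟩
      have hD : ∀ j : ZMod n, pathD j ∈ pathGr (stdDeg n) ((stdDeg n).d j) := fun j =>
        ⟨fun k h => absurd rfl h, fun k h => absurd rfl h, fun k h => by
          by_cases hk : k = j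
          · rw [hk]
          · exact absurd (Pi.single_eq_of_ne hk _) h,
          fun k h => absurd rfl h⟩
      have hX : pathX i ∈ pathGr (stdDeg n) (1, 0, 0) :=
        ⟨fun k h => absurd rfl h, fun k h => absurd rfl h, fun k h => absurd rfl h,
          fun _ _ => rfl⟩
      have key : ∀ (p : leftIdeal n i) (q : rightIdeal n i) (α β : TriDeg),
          p.1 ∈ pathGr (stdDeg n) α → q.1 ∈ pathGr (stdDeg n) β → α + β = (1, 0, 0) →
          pureTensor i p q ∈ (projTensor n i).gr (1, 0, 0) := by
        intro p q α β hp hq h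
        rw [← h]
        exact tmul_mem (M := projLeft n i) (N := projRight n i) hp hq
      refine add_mem (add_mem (add_mem (key _ _ _ _ (hU _) (hD _) ?_)
        (key _ _ _ _ (hD _) (hU _) ?_)) (key _ _ _ _ (pathE_mem i) hX ?_))
        (key _ _ _ _ hX (pathE_mem i) ?_)
      · have := (stdDeg_compat n).ud (i - 1)
        rwa [sub_add_cancel] at this
      · have := (stdDeg_compat n).du (i + 1)
        rwa [add_sub_cancel_right] at this
      · exact zero_add _
      · exact add_zero _
    have := (projTensor n i).smul_mem hr hc
    have h2 : γ + (1, 0, 0) = γ - (-1, 0, 0) := by ext <;> simp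
    rw [h2] at this
    exact this

end AffineBraid
namespace AffineBraid
open QuiverAlg TriBimod

/-! ## The extended affine braid group -/

/-- The generators `σ_i` (`i` modulo `n`) and `ρ`. -/
inductive BraidGen (n : ℕ) : Type
  | sigma (i : ZMod n)
  | rho

open BraidGen

/-- The defining relators of the extended affine braid group. -/
inductive BraidRel (n : ℕ) : FreeGroup (BraidGen n) → Prop
  | comm (i j : ZMod n) (h₁ : j ≠ i + 1) (h₂ : j ≠ i - 1) :
      BraidRel n (FreeGroup.of (sigma i) * FreeGroup.of (sigma j) *
        (FreeGroup.of (sigma j) * FreeGroup.of (sigma i))⁻¹)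
  | braid (i : ZMod n) :
      BraidRel n (FreeGroup.of (sigma i) * FreeGroup.of (sigma (i + 1)) * FreeGroup.of (sigma i) *
        (FreeGroup.of (sigma (i + 1)) * FreeGroup.of (sigma i) *
          FreeGroup.of (sigma (i + 1)))⁻¹)
  | conj (i : ZMod n) :
      BraidRel n (FreeGroup.of rho * FreeGroup.of (sigma i) * (FreeGroup.of rho)⁻¹ *
        (FreeGroup.of (sigma (i + 1)))⁻¹)

/-- The extended affine type `A` braid group. -/
abbrev BraidGroup (n : ℕ) : Type := PresentedGroup {w | BraidRel n w}

/-- The generators of the braid group. -/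
def gen {n : ℕ} (g : BraidGen n) : BraidGroup n := PresentedGroup.of g

/-- A braid word: a list of generators and inverses (`true` stands for the generator itself and
`false` for its inverse). -/
abbrev BraidWord (n : ℕ) : Type := List (BraidGen n × Bool)

/-- The braid represented by a word. -/
def BraidWord.eval {n : ℕ} (w : BraidWord n) : BraidGroup n :=
  PresentedGroup.mk {w | BraidRel n w} (FreeGroup.mk w)

/-! ## Complexes of bimodules and the functors they define -/

section Functors

variable {n : ℕ} [Fact (3 ≤ n)]

variable (n) in
/-- The complex of bimodules attached to a generator or the inverse of a generator: `F_i`, `F'_i`,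
`F_ρ` and `F'_ρ`. The bimodules `R_n`, `T_n^ρ` and `^ρT_n` sit in degree zero. -/
noncomputable def letterComplex : BraidGen n × Bool → CochainComplex (RBimod n) ℤ
  | (sigma i, true) => HomologicalComplex.double (c := ComplexShape.up ℤ) (dBraid n i)
      (show (-1 : ℤ) + 1 = 0 by norm_num)
  | (sigma i, false) => HomologicalComplex.double (c := ComplexShape.up ℤ) (dBraidInv n i)
      (show (0 : ℤ) + 1 = 1 by norm_num)
  | (rho, true) => (HomologicalComplex.single (RBimod n) (ComplexShape.up ℤ) 0).obj (twistBimod n)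
  | (rho, false) =>
      (HomologicalComplex.single (RBimod n) (ComplexShape.up ℤ) 0).obj (cotwistBimod n)

/-- The tensor product over `R_n` of a complex of bimodules and a complex of bimodules or left
modules: the total complex of the double complex `B^p ⊗ K^q`. -/
noncomputable abbrev tensorComplex {C : TriRing} (B : CochainComplex (RBimod n) ℤ)
    (K : CochainComplex (TriBimod (quiverRing n) C) ℤ) :
    CochainComplex (TriBimod (quiverRing n) C) ℤ :=
  HomologicalComplex.mapBifunctor B K (tensorFunctor (quiverRing n) (quiverRing n) C)
    (ComplexShape.up ℤ)

/-- The tensor product of the complexes attached to the letters of a word. -/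
noncomputable def wordComplex : BraidWord n → CochainComplex (RBimod n) ℤ
  | [] => (HomologicalComplex.single (RBimod n) (ComplexShape.up ℤ) 0).obj (regBimod n)
  | l :: w => tensorComplex (letterComplex n l) (wordComplex w)

variable (n) in
/-- The homotopy category of cochain complexes of trigraded left `R_n`-modules. -/
abbrev RHot : Type 1 := HomotopyCategory (RMod n) (ComplexShape.up ℤ)

/-- The functor `B ⊗ -` on complexes of trigraded left modules. -/
noncomputable def tensorLeft (B : CochainComplex (RBimod n) ℤ) :
    CochainComplex (RMod n) ℤ ⥤ CochainComplex (RMod n) ℤ :=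
  (tensorFunctor (quiverRing n) (quiverRing n) intRing).map₂CochainComplex.obj B

/-- The functor `B ⊗ -` on the homotopy category. -/
noncomputable def tensorHot (B : CochainComplex (RBimod n) ℤ) : RHot n ⥤ RHot n :=
  CategoryTheory.Quotient.lift _ (tensorLeft B ⋙ HomotopyCategory.quotient _ _)
    (fun _ _ _ _ ⟨h⟩ => HomotopyCategory.eq_of_homotopy _ _
      (HomologicalComplex.mapBifunctorMapHomotopy₂ (𝟙 B) h _ _))

variable (n) in
/-- Bounded complexes of finitely generated projective modules. -/
def IsPerfect : ObjectProperty (RHot n) := fun K =>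
  (∀ k : ℤ, Module.Finite (QuiverAlg n) (K.as.X k) ∧ Module.Projective (QuiverAlg n) (K.as.X k)) ∧
    ∃ a b : ℤ, ∀ k : ℤ, k < a ∨ b < k → IsZero (K.as.X k)

variable (n) in
/-- The category `C_n`: the homotopy category of bounded complexes of finitely generated projective
trigraded left `R_n`-modules. -/
abbrev Cn : Type 1 := (IsPerfect n).FullSubcategory

/-- A trigraded left module as an object of the homotopy category, placed in degree zero. -/
noncomputable abbrev inDegreeZero (M : RMod n) : RHot n :=
  (HomotopyCategory.quotient _ _).obj
    ((HomologicalComplex.single (RMod n) (ComplexShape.up ℤ) 0).obj M)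

theorem perfect_of_isZero {M : RMod n} (h : IsZero M) :
    Module.Finite (QuiverAlg n) M ∧ Module.Projective (QuiverAlg n) M := by
  have h0 : ∀ m : M, m = 0 := fun m => by
    have := congrArg (fun f => Hom.toFun f m) (h.eq_of_src (𝟙 M) 0)
    simpa using this
  have : Subsingleton M := ⟨fun a b => by rw [h0 a, h0 b]⟩
  exact ⟨inferInstance, inferInstance⟩

theorem isPerfect_inDegreeZero (M : RMod n) [Module.Finite (QuiverAlg n) M]
    [Module.Projective (QuiverAlg n) M] : IsPerfect n (inDegreeZero M) := by
  have hz : ∀ k : ℤ, k ≠ 0 → IsZero ((inDegreeZero M).as.X k) := fun k hk =>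
    HomologicalComplex.isZero_single_obj_X (ComplexShape.up ℤ) 0 M k hk
  refine ⟨fun k => ?_, 0, 0, fun k hk => hz k (by omega)⟩
  by_cases hk : k = 0
  · subst hk
    have e := HomologicalComplex.singleObjXSelf (ComplexShape.up ℤ) (0 : ℤ) M
    let f : M ≃ₗ[QuiverAlg n] ((inDegreeZero M).as.X 0) :=
      { toFun := Hom.toFun e.inv
        invFun := Hom.toFun e.hom
        map_add' := map_add _
        map_smul' := fun a m => e.inv.map_smul a m
        left_inv := fun m => congrArg (fun f => Hom.toFun f m) e.inv_hom_id
        right_inv := fun m => congrArg (fun f => Hom.toFun f m) e.hom_inv_id }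
    exact ⟨Module.Finite.equiv f, Module.Projective.of_equiv f⟩
  · exact perfect_of_isZero (hz k hk)

theorem finite_projLeft (i : ZMod n) : Module.Finite (QuiverAlg n) (projLeft n i) :=
  Module.Finite.iff_fg.mpr (Submodule.fg_span_singleton _)

theorem projective_projLeft (i : ZMod n) : Module.Projective (QuiverAlg n) (projLeft n i) :=
  Module.Projective.of_split (leftIdeal n i).subtype
    ((LinearMap.toSpanSingleton (QuiverAlg n) (leftIdeal n i)
      ⟨pathE i, Submodule.mem_span_singleton_self _⟩))
    (LinearMap.ext fun p => Subtype.ext (mul_pathE_of_mem p.2))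

variable (n) in
/-- The module `P_i` as an object of `C_n`. -/
noncomputable def projObj (i : ZMod n) : Cn n :=
  haveI := finite_projLeft (n := n) i
  haveI := projective_projLeft (n := n) i
  ⟨inDegreeZero (projLeft n i), isPerfect_inDegreeZero _⟩

/-- The shift of tridegrees on the homotopy category. -/
noncomputable abbrev shiftHot (γ : TriDeg) : RHot n ⥤ RHot n :=
  (shift γ : RMod n ⥤ RMod n).mapHomotopyCategory (ComplexShape.up ℤ)

/-- The shift of tridegrees on `C_n`. -/
noncomputable def shiftCn (γ : TriDeg) : Cn n ⥤ Cn n :=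
  (IsPerfect n).lift ((IsPerfect n).ι ⋙ shiftHot γ) (fun K => by
    obtain ⟨h, a, b, hab⟩ := K.property
    exact ⟨h, a, b, fun k hk => (shift γ : RMod n ⥤ RMod n).map_isZero (hab k hk)⟩)

/-! ## The Grothendieck group -/

open Pretriangulated in
variable (n) in
/-- The relations `[Y] = [X] + [Z]` for distinguished triangles `X ⟶ Y ⟶ Z ⟶ X[1]`, and
`[X (1)] = -[X]` for the shift of the `ℤ/2`-grading. -/
inductive KRel : FreeAbelianGroup (Cn n) → Prop
  | triangle (X Y Z : Cn n) (f : X.obj ⟶ Y.obj) (g : Y.obj ⟶ Z.obj)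
      (h : Z.obj ⟶ (shiftFunctor (RHot n) (1 : ℤ)).obj X.obj)
      (H : Triangle.mk f g h ∈ distTriang (RHot n)) :
      KRel (FreeAbelianGroup.of Y - (FreeAbelianGroup.of X + FreeAbelianGroup.of Z))
  | sign (X : Cn n) :
      KRel (FreeAbelianGroup.of ((shiftCn (0, 1, 0)).obj X) + FreeAbelianGroup.of X)

variable (n) in
/-- The Grothendieck group of `C_n`. -/
def KGroup : Type 1 := FreeAbelianGroup (Cn n) ⧸ AddSubgroup.closure {x | KRel n x}

noncomputable instance : AddCommGroup (KGroup n) :=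
  inferInstanceAs (AddCommGroup (FreeAbelianGroup (Cn n) ⧸ AddSubgroup.closure {x | KRel n x}))

/-- The class of an object in the Grothendieck group. -/
def KGroup.mk (X : Cn n) : KGroup n := QuotientAddGroup.mk (FreeAbelianGroup.of X)

open Pretriangulated ZeroObject

theorem KGroup.mk_triangle {X Y Z : Cn n} {f : X.obj ⟶ Y.obj} {g : Y.obj ⟶ Z.obj}
    {h : Z.obj ⟶ (shiftFunctor (RHot n) (1 : ℤ)).obj X.obj}
    (H : Triangle.mk f g h ∈ distTriang (RHot n)) :
    KGroup.mk Y = KGroup.mk X + KGroup.mk Z := by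
  rw [← sub_eq_zero]
  exact (QuotientAddGroup.eq_zero_iff _).mpr
    (AddSubgroup.subset_closure (KRel.triangle X Y Z f g h H))

theorem KGroup.mk_sign (X : Cn n) : KGroup.mk ((shiftCn (0, 1, 0)).obj X) = -KGroup.mk X := by
  rw [← add_eq_zero_iff_eq_neg]
  exact (QuotientAddGroup.eq_zero_iff _).mpr (AddSubgroup.subset_closure (KRel.sign X))

theorem KGroup.mk_eq_of_iso {X Y : Cn n} (e : X.obj ≅ Y.obj) : KGroup.mk X = KGroup.mk Y := by
  have hZ : IsZero ((HomotopyCategory.quotient (RMod n) (ComplexShape.up ℤ)).obj 0) :=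
    Functor.map_isZero _ (isZero_zero _)
  have hz : ∀ k : ℤ, IsZero ((0 : CochainComplex (RMod n) ℤ).X k) := fun k =>
    (HomologicalComplex.eval (RMod n) (ComplexShape.up ℤ) k).map_isZero (isZero_zero _)
  let Z : Cn n := ⟨(HomotopyCategory.quotient (RMod n) (ComplexShape.up ℤ)).obj 0,
    fun k => perfect_of_isZero (hz k), 0, 0, fun k _ => hz k⟩
  have key : ∀ {X Y : Cn n} (e : X.obj ≅ Y.obj), KGroup.mk Y = KGroup.mk X + KGroup.mk Z := by
    intro X Y e
    refine KGroup.mk_triangle (f := e.hom) (g := (0 : Y.obj ⟶ Z.obj)) (h := 0) ?_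
    refine isomorphic_distinguished _ (contractible_distinguished X.obj) _ ?_
    exact Triangle.isoMk _ _ (Iso.refl _) e.symm (hZ.iso (isZero_zero _))
      (e.hom_inv_id.trans (Category.comp_id _).symm)
      ((isZero_zero _).eq_of_tgt _ _) (hZ.eq_of_src _ _)
  have hZ0 : KGroup.mk Z = 0 := by
    have h := key (Iso.refl X.obj)
    rwa [left_eq_add] at h
  rw [key e, hZ0, add_zero]

/-- Shifting by `γ` and then by `δ` amounts to shifting by `γ + δ`. -/
def shiftAddIso (γ δ ε : TriDeg) (h : γ + δ = ε) (M : RMod n) :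
    (shift δ).obj ((shift γ).obj M) ≅ (shift ε).obj M where
  hom := ⟨AddMonoidHom.id M, fun _ _ => rfl, fun _ _ => rfl, fun {α m} hm => by
    change m ∈ M.gr (α - ε)
    rw [← h, add_comm, ← sub_sub]
    exact hm⟩
  inv := ⟨AddMonoidHom.id M, fun _ _ => rfl, fun _ _ => rfl, fun {α m} hm => by
    change m ∈ M.gr (α - δ - γ)
    rw [sub_sub, add_comm, h]
    exact hm⟩

theorem KGroup.mk_shift_shift (γ δ ε : TriDeg) (h : γ + δ = ε) (X : Cn n) :
    KGroup.mk ((shiftCn δ).obj ((shiftCn γ).obj X)) = KGroup.mk ((shiftCn ε).obj X) :=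
  KGroup.mk_eq_of_iso ((HomotopyCategory.quotient (RMod n) (ComplexShape.up ℤ)).mapIso
    (HomologicalComplex.Hom.isoOfComponents (fun k => shiftAddIso γ δ ε h (X.obj.as.X k))
      (fun _ _ _ => rfl)))

theorem KGroup.mk_shift_zero (X : Cn n) : KGroup.mk ((shiftCn 0).obj X) = KGroup.mk X := by
  refine KGroup.mk_eq_of_iso ((HomotopyCategory.quotient (RMod n) (ComplexShape.up ℤ)).mapIso
    (HomologicalComplex.Hom.isoOfComponents (fun k =>
      { hom := ⟨AddMonoidHom.id _, fun _ _ => rfl, fun _ _ => rfl, fun {α m} hm => ?_⟩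
        inv := ⟨AddMonoidHom.id _, fun _ _ => rfl, fun _ _ => rfl, fun {α m} hm => ?_⟩ })
      (fun _ _ _ => rfl)))
  · change m ∈ (X.obj.as.X k).gr (α - 0) at hm
    rwa [sub_zero] at hm
  · change m ∈ (X.obj.as.X k).gr (α - 0)
    rwa [sub_zero]

/-- The endomorphism of the Grothendieck group given by a shift of tridegrees. -/
noncomputable def shiftK (γ : TriDeg) : KGroup n →+ KGroup n :=
  QuotientAddGroup.lift _ (FreeAbelianGroup.lift fun X => KGroup.mk ((shiftCn γ).obj X)) (by
    rw [AddSubgroup.closure_le]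
    rintro x hx
    change FreeAbelianGroup.lift _ x = 0
    cases hx with
    | triangle X Y Z f g h H =>
      have := KGroup.mk_triangle (X := (shiftCn γ).obj X) (Y := (shiftCn γ).obj Y)
        (Z := (shiftCn γ).obj Z) ((shiftHot γ).map_distinguished _ H)
      simp [this]
    | sign X =>
      have e := KGroup.mk_sign ((shiftCn γ).obj X)
      rw [KGroup.mk_shift_shift _ _ _ rfl, add_comm γ, ← KGroup.mk_shift_shift _ _ _ rfl] at e
      simp [e])

@[simp] theorem shiftK_mk (γ : TriDeg) (X : Cn n) :
    shiftK γ (KGroup.mk X) = KGroup.mk ((shiftCn γ).obj X) :=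
  FreeAbelianGroup.lift_apply_of _ _

theorem KGroup.hom_ext {f g : KGroup n →+ KGroup n}
    (h : ∀ X, f (KGroup.mk X) = g (KGroup.mk X)) : f = g := by
  refine QuotientAddGroup.addMonoidHom_ext _ (FreeAbelianGroup.lift_ext _ _ fun X => h X)

/-- Laurent polynomials in two variables over `ℤ`; the exponents are pairs of integers. -/
abbrev Laurent : Type := AddMonoidAlgebra ℤ (ℤ × ℤ)

/-- The monomial with exponents `a` and `b`. -/
noncomputable def Laurent.mono (a b : ℤ) : Laurent := AddMonoidAlgebra.single (a, b) 1

/-- The action of monomials on the Grothendieck group: `t` acts by `{1}` and `s` by `⟨1⟩`. -/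
noncomputable def monoK : Multiplicative (ℤ × ℤ) →* AddMonoid.End (KGroup n) where
  toFun a := shiftK (a.toAdd.1, 0, a.toAdd.2)
  map_one' := KGroup.hom_ext fun X => by
    rw [shiftK_mk]
    exact KGroup.mk_shift_zero X
  map_mul' a b := KGroup.hom_ext fun X => by
    change _ = shiftK _ (shiftK _ (KGroup.mk X))
    rw [shiftK_mk, shiftK_mk, shiftK_mk, KGroup.mk_shift_shift _ _ _ rfl]
    congr 3
    ext <;> simp [add_comm]

/-- The `ℤ[t^±1, s^±1]`-module structure of the Grothendieck group. -/
noncomputable instance : Module Laurent (KGroup n) :=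
  Module.compHom _
    (AddMonoidAlgebra.lift ℤ (AddMonoid.End (KGroup n)) (ℤ × ℤ) monoK).toRingHom

theorem mono_smul_mk (a b : ℤ) (X : Cn n) :
    Laurent.mono a b • KGroup.mk X = KGroup.mk ((shiftCn (a, 0, b)).obj X) := by
  change (AddMonoidAlgebra.lift ℤ (AddMonoid.End (KGroup n)) (ℤ × ℤ) monoK)
    (AddMonoidAlgebra.single (a, b) 1) (KGroup.mk X) = _
  rw [AddMonoidAlgebra.lift_single, one_smul]
  exact shiftK_mk _ _

end Functors

/-- A weak action of a group on a category. -/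
structure WeakAction (G : Type) [Group G] (C : Type 1) [Category.{0} C] where
  /-- the functor by which a group element acts -/
  functor : G → C ⥤ C
  one : Nonempty (functor 1 ≅ 𝟭 C)
  mul : ∀ g h, Nonempty (functor (g * h) ≅ functor h ⋙ functor g)

section Acts

variable {n : ℕ} [Fact (3 ≤ n)]

/-- In the weak action `A` on `C_n`, the braid `g` acts by the tensor product with the complex of
bimodules `B`. -/
def ActsBy (A : WeakAction (BraidGroup n) (Cn n)) (g : BraidGroup n)
    (B : CochainComplex (RBimod n) ℤ) : Prop :=
  Nonempty (A.functor g ⋙ (IsPerfect n).ι ≅ (IsPerfect n).ι ⋙ tensorHot B)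

end Acts

end AffineBraid
namespace AffineBraid
open QuiverAlg

/-! ## The Artin representation -/

/-- The fundamental group of the disk with `n + 1` punctures: the free group on the loops `x_0`
(the index `none`) and `x_1, …, x_n` (the integers modulo `n`, so that `x_n` is `some 0`). -/
abbrev LoopGroup (n : ℕ) : Type := FreeGroup (Option (ZMod n))

section Artin

variable {n : ℕ}

/-- The loop `x_0`. -/
def loopZero : LoopGroup n := FreeGroup.of none

/-- The loop `x_i`, for `i` in `1, …, n` taken modulo `n`. -/
def loop (i : ZMod n) : LoopGroup n := FreeGroup.of (some i)

variable (n) in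
/-- The boundary loop `x_0 x_1 … x_n`. -/
def boundaryLoop : LoopGroup n :=
  loopZero * ((List.range n).map fun k : ℕ => loop ((k : ZMod n) + 1)).prod

theorem hom_ext_loop {G : Type} [Group G] {f g : LoopGroup n →* G}
    (h₀ : f loopZero = g loopZero) (h : ∀ i, f (loop i) = g (loop i)) : f = g :=
  FreeGroup.ext_hom _ _ fun a => by
    cases a with
    | none => exact h₀
    | some i => exact h i

/-- Homomorphisms are determined by the images of `x_1, …, x_n` and of the boundary loop. -/
theorem hom_ext_boundary {G : Type} [Group G] {f g : LoopGroup n →* G}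
    (h₀ : f (boundaryLoop n) = g (boundaryLoop n)) (h : ∀ i, f (loop i) = g (loop i)) : f = g := by
  refine hom_ext_loop ?_ h
  have e : ∀ f : LoopGroup n →* G, f (boundaryLoop n) =
      f loopZero * ((List.range n).map fun k : ℕ => f (loop ((k : ZMod n) + 1))).prod := fun f => by
    rw [boundaryLoop, map_mul, map_list_prod, List.map_map]
    rfl
  rw [e, e] at h₀
  simp only [h] at h₀
  exact mul_right_cancel h₀

/-- `x_i ↦ x_{i+1}`, `x_{i+1} ↦ x_{i+1}⁻¹ x_i x_{i+1}`, and the other loops are fixed. -/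
def sigmaHom (i : ZMod n) : LoopGroup n →* LoopGroup n :=
  FreeGroup.lift fun a => match a with
    | none => loopZero
    | some j => if j = i then loop (i + 1) else
        if j = i + 1 then (loop (i + 1))⁻¹ * loop i * loop (i + 1) else loop j

/-- `x_i ↦ x_i x_{i+1} x_i⁻¹`, `x_{i+1} ↦ x_i`, and the other loops are fixed. -/
def sigmaInvHom (i : ZMod n) : LoopGroup n →* LoopGroup n :=
  FreeGroup.lift fun a => match a with
    | none => loopZero
    | some j => if j = i then loop i * loop (i + 1) * (loop i)⁻¹ else
        if j = i + 1 then loop i else loop j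

/-- `x_0 ↦ x_1⁻¹ x_0 x_1`, `x_n ↦ (x_0 … x_n)⁻¹ x_1 (x_0 … x_n)`, and `x_j ↦ x_{j+1}` for the other
loops. -/
def rhoHom : LoopGroup n →* LoopGroup n :=
  FreeGroup.lift fun a => match a with
    | none => (loop 1)⁻¹ * loopZero * loop 1
    | some j => if j = 0 then (boundaryLoop n)⁻¹ * loop 1 * boundaryLoop n else loop (j + 1)

/-- The inverse of `rhoHom`. -/
def rhoInvHom : LoopGroup n →* LoopGroup n :=
  FreeGroup.lift fun a => match a with
    | none => (boundaryLoop n * loop 0 * (boundaryLoop n)⁻¹) * loopZero *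
        (boundaryLoop n * loop 0 * (boundaryLoop n)⁻¹)⁻¹
    | some j => if j = 1 then boundaryLoop n * loop 0 * (boundaryLoop n)⁻¹ else loop (j - 1)

@[simp] theorem sigmaHom_zero (i : ZMod n) : sigmaHom i loopZero = loopZero :=
  FreeGroup.lift_apply_of
@[simp] theorem sigmaHom_loop (i j : ZMod n) : sigmaHom i (loop j) =
    if j = i then loop (i + 1) else
      if j = i + 1 then (loop (i + 1))⁻¹ * loop i * loop (i + 1) else loop j :=
  FreeGroup.lift_apply_of
@[simp] theorem sigmaInvHom_zero (i : ZMod n) : sigmaInvHom i loopZero = loopZero :=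
  FreeGroup.lift_apply_of
@[simp] theorem sigmaInvHom_loop (i j : ZMod n) : sigmaInvHom i (loop j) =
    if j = i then loop i * loop (i + 1) * (loop i)⁻¹ else
      if j = i + 1 then loop i else loop j :=
  FreeGroup.lift_apply_of
@[simp] theorem rhoHom_zero : rhoHom (loopZero : LoopGroup n) = (loop 1)⁻¹ * loopZero * loop 1 :=
  FreeGroup.lift_apply_of
@[simp] theorem rhoHom_loop (j : ZMod n) : rhoHom (loop j) =
    if j = 0 then (boundaryLoop n)⁻¹ * loop 1 * boundaryLoop n else loop (j + 1) :=
  FreeGroup.lift_apply_of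
@[simp] theorem rhoInvHom_zero : rhoInvHom (loopZero : LoopGroup n) =
    (boundaryLoop n * loop 0 * (boundaryLoop n)⁻¹) * loopZero *
      (boundaryLoop n * loop 0 * (boundaryLoop n)⁻¹)⁻¹ :=
  FreeGroup.lift_apply_of
@[simp] theorem rhoInvHom_loop (j : ZMod n) : rhoInvHom (loop j) =
    if j = 1 then boundaryLoop n * loop 0 * (boundaryLoop n)⁻¹ else loop (j - 1) :=
  FreeGroup.lift_apply_of

theorem natCast_inj_of_lt {a b : ℕ} (ha : a < n) (hb : b < n) (h : (a : ZMod n) = b) : a = b := by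
  rw [ZMod.natCast_eq_natCast_iff', Nat.mod_eq_of_lt ha, Nat.mod_eq_of_lt hb] at h
  exact h

variable [hn : Fact (3 ≤ n)]

theorem succ_ne_self (i : ZMod n) : i + 1 ≠ i := fun h =>
  one_ne_zero_zmod (n := n) (by linear_combination h)

theorem rhoHom_boundary : rhoHom (boundaryLoop n) = boundaryLoop n := by
  obtain ⟨m, hm⟩ : ∃ m, n = m + 1 := ⟨n - 1, by have := hn.out; omega⟩
  have e : boundaryLoop n = loopZero * (loop 1 *
      ((List.range m).map fun k : ℕ => loop (((k : ZMod n) + 1) + 1)).prod) := by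
    rw [boundaryLoop, hm, List.range_succ_eq_map, List.map_cons, List.prod_cons, List.map_map]
    simp [Function.comp_def]
  have e' : boundaryLoop n = loopZero *
      (((List.range m).map fun k : ℕ => loop ((k : ZMod n) + 1)).prod * loop 0) := by
    rw [boundaryLoop, hm, List.range_succ, List.map_append, List.prod_append]
    have : ((m : ZMod (m + 1)) + 1) = 0 := by exact_mod_cast ZMod.natCast_self (m + 1)
    simp [this]
  have e2 : rhoHom (((List.range m).map fun k : ℕ => loop ((k : ZMod n) + 1)).prod) =
      ((List.range m).map fun k : ℕ => loop (((k : ZMod n) + 1) + 1)).prod := by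
    rw [map_list_prod, List.map_map]
    congr 1
    refine List.map_congr_left fun k hk => ?_
    have hk := List.mem_range.mp hk
    have h0 : (k : ZMod n) + 1 ≠ 0 := fun h => by
      have : ((k + 1 : ℕ) : ZMod n) = ((0 : ℕ) : ZMod n) := by push_cast; exact h
      have := natCast_inj_of_lt (by omega) (by omega) this
      omega
    simp [h0]
  conv_lhs => rw [e']
  rw [map_mul, map_mul, e2, rhoHom_zero, rhoHom_loop, if_pos rfl]
  have e3 : ((List.range m).map fun k : ℕ => loop (((k : ZMod n) + 1) + 1)).prod =
    (loop 1)⁻¹ * (loopZero⁻¹ * boundaryLoop n) := by rw [e]; group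
  rw [e3]
  group

theorem rhoHom_rhoInvHom (w : LoopGroup n) : rhoHom (rhoInvHom w) = w := by
  refine DFunLike.congr_fun (f := rhoHom.comp rhoInvHom) (g := MonoidHom.id _)
    (hom_ext_loop ?_ fun j => ?_) w
  · simp [rhoHom_boundary]
    group
  · by_cases h : j = 1
    · simp [rhoHom_boundary, h]
      group
    · simp [h, sub_eq_zero]

theorem rhoInvHom_boundary : rhoInvHom (boundaryLoop n) = boundaryLoop n := by
  obtain ⟨m, hm⟩ : ∃ m, n = m + 1 := ⟨n - 1, by have := hn.out; omega⟩
  have e : boundaryLoop n = loopZero * (loop 1 *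
      ((List.range m).map fun k : ℕ => loop (((k : ZMod n) + 1) + 1)).prod) := by
    rw [boundaryLoop, hm, List.range_succ_eq_map, List.map_cons, List.prod_cons, List.map_map]
    simp [Function.comp_def]
  have e' : boundaryLoop n = loopZero *
      (((List.range m).map fun k : ℕ => loop ((k : ZMod n) + 1)).prod * loop 0) := by
    rw [boundaryLoop, hm, List.range_succ, List.map_append, List.prod_append]
    have : ((m : ZMod (m + 1)) + 1) = 0 := by exact_mod_cast ZMod.natCast_self (m + 1)
    simp [this]
  have e2 : rhoInvHom (((List.range m).map fun k : ℕ => loop (((k : ZMod n) + 1) + 1)).prod) =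
      ((List.range m).map fun k : ℕ => loop ((k : ZMod n) + 1)).prod := by
    rw [map_list_prod, List.map_map]
    congr 1
    refine List.map_congr_left fun k hk => ?_
    have hk := List.mem_range.mp hk
    have h0 : (k : ZMod n) + 1 ≠ 0 := fun h => by
      have : ((k + 1 : ℕ) : ZMod n) = ((0 : ℕ) : ZMod n) := by push_cast; exact h
      have := natCast_inj_of_lt (by omega) (by omega) this
      omega
    simp [h0]
  conv_lhs => rw [e]
  rw [map_mul, map_mul, e2, rhoInvHom_zero, rhoInvHom_loop, if_pos rfl]
  have e3 : ((List.range m).map fun k : ℕ => loop ((k : ZMod n) + 1)).prod =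
    loopZero⁻¹ * boundaryLoop n * (loop 0)⁻¹ := by rw [e']; group
  rw [e3]
  group

theorem rhoInvHom_rhoHom (w : LoopGroup n) : rhoInvHom (rhoHom w) = w := by
  refine DFunLike.congr_fun (f := rhoInvHom.comp rhoHom) (g := MonoidHom.id _)
    (hom_ext_loop ?_ fun j => ?_) w
  · simp
    group
  · by_cases h : j = 0
    · simp [rhoInvHom_boundary, h]
      group
    · simp [h]

theorem sigmaHom_sigmaInvHom (i : ZMod n) (w : LoopGroup n) : sigmaHom i (sigmaInvHom i w) = w := by
  refine DFunLike.congr_fun (f := (sigmaHom i).comp (sigmaInvHom i)) (g := MonoidHom.id _)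
    (hom_ext_loop ?_ fun j => ?_) w
  · simp
  · have h10 := one_ne_zero_zmod (n := n)
    by_cases h : j = i
    · simp [h, h10]
      group
    · by_cases h' : j = i + 1
      · simp [h', h10]
      · simp [h, h']

theorem sigmaInvHom_sigmaHom (i : ZMod n) (w : LoopGroup n) : sigmaInvHom i (sigmaHom i w) = w := by
  refine DFunLike.congr_fun (f := (sigmaInvHom i).comp (sigmaHom i)) (g := MonoidHom.id _)
    (hom_ext_loop ?_ fun j => ?_) w
  · simp
  · have h10 := one_ne_zero_zmod (n := n)
    by_cases h : j = i
    · simp [h, h10]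
    · by_cases h' : j = i + 1
      · simp [h', h10]
        group
      · simp [h, h']

theorem sigmaHom_boundary {i : ZMod n} (hi : i ≠ 0) :
    sigmaHom i (boundaryLoop n) = boundaryLoop n := by
  have hv : i.val ≠ 0 := fun h => hi ((ZMod.val_eq_zero i).mp h)
  have hlt : i.val < n := ZMod.val_lt i
  have hc : ((i.val : ℕ) : ZMod n) = i := ZMod.natCast_zmod_val i
  let Q : ℕ → LoopGroup n := fun m => ((List.range m).map fun k : ℕ => loop ((k : ZMod n) + 1)).prod
  have Qs : ∀ m, Q (m + 1) = Q m * loop ((m : ZMod n) + 1) := fun m => by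
    simp [Q, List.range_succ]
  have key : ∀ m, m ≤ n → (m ≠ i.val → sigmaHom i (Q m) = Q m) ∧
      (m = i.val → sigmaHom i (Q m) = Q (m - 1) * loop (i + 1)) := by
    intro m
    induction m with
    | zero => exact fun _ => ⟨fun _ => by simp [Q], fun h => absurd h.symm hv⟩
    | succ m ih =>
      intro hm
      obtain ⟨ih₁, ih₂⟩ := ih (by omega)
      refine ⟨fun h => ?_, fun h => ?_⟩
      · by_cases h' : m = i.val
        · have hmi : (m : ZMod n) = i := by rw [h', hc]
          obtain ⟨k, hk⟩ : ∃ k, m = k + 1 := ⟨m - 1, by omega⟩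
          have hki : (k : ZMod n) + 1 = i := by rw [← hmi, hk]; push_cast; rfl
          rw [Qs, map_mul, ih₂ h', hmi, sigmaHom_loop, if_neg (succ_ne_self i), if_pos rfl, hk,
            Nat.add_sub_cancel, Qs, hki]
          group
        · have h1 : (m : ZMod n) + 1 ≠ i := fun e => by
            by_cases hmn : m + 1 = n
            · apply hi
              rw [← e]
              have : ((m + 1 : ℕ) : ZMod n) = 0 := by rw [hmn]; exact ZMod.natCast_self n
              exact_mod_cast this
            · have : ((m + 1 : ℕ) : ZMod n) = (i.val : ℕ) := by rw [hc]; push_cast; exact e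
              exact h (natCast_inj_of_lt (by omega) hlt this)
          have h2 : (m : ZMod n) + 1 ≠ i + 1 := fun e => by
            have : (m : ZMod n) = (i.val : ℕ) := by rw [hc]; exact add_right_cancel e
            exact h' (natCast_inj_of_lt (by omega) hlt this)
          rw [Qs, map_mul, ih₁ h', sigmaHom_loop, if_neg h1, if_neg h2]
      · have hmi : (m : ZMod n) + 1 = i := by rw [← hc, ← h]; push_cast; rfl
        rw [Qs, map_mul, ih₁ (by omega), hmi, sigmaHom_loop, if_pos rfl, Nat.add_sub_cancel]
  change sigmaHom i (loopZero * Q n) = loopZero * Q n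
  rw [map_mul, sigmaHom_zero, (key n le_rfl).1 (by omega)]

/-- The action of `σ_i` on the free group, for `i ≠ n`. -/
def sigmaAut (i : ZMod n) : MulAut (LoopGroup n) where
  toFun := sigmaHom i
  invFun := sigmaInvHom i
  left_inv := sigmaInvHom_sigmaHom i
  right_inv := sigmaHom_sigmaInvHom i
  map_mul' := map_mul _

variable (n) in
/-- The action of `ρ` on the free group. -/
def rhoAut : MulAut (LoopGroup n) where
  toFun := rhoHom
  invFun := rhoInvHom
  left_inv := rhoInvHom_rhoHom
  right_inv := rhoHom_rhoInvHom
  map_mul' := map_mul _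

/-- The action of the generators on the free group; `σ_n` acts as `ρ σ_{n-1} ρ⁻¹`. -/
def artinGen : BraidGen n → MulAut (LoopGroup n)
  | .sigma i => if i = 0 then rhoAut n * sigmaAut (-1) * (rhoAut n)⁻¹ else sigmaAut i
  | .rho => rhoAut n

theorem artinGen_conj (i : ZMod n) :
    rhoAut n * artinGen (.sigma i) * (rhoAut n)⁻¹ = artinGen (.sigma (i + 1)) := by
  have h10 := one_ne_zero_zmod (n := n)
  have h21 := two_ne_one_zmod (n := n)
  by_cases h1 : i + 1 = 0
  · have h0 : i ≠ 0 := fun h => h10 (by rw [← h1, h, zero_add])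
    rw [artinGen, artinGen, if_pos h1, if_neg h0, eq_neg_of_add_eq_zero_left h1]
  rw [mul_inv_eq_iff_eq_mul]
  by_cases h0 : i = 0
  · subst h0
    simp only [artinGen, if_true, zero_add, if_neg h10]
    rw [← mul_assoc, mul_inv_eq_iff_eq_mul, mul_assoc]
    have hm : (-1 : ZMod n) ≠ 0 := neg_ne_zero.mpr h10
    have key : rhoHom.comp (rhoHom.comp (sigmaHom (-1))) =
        (sigmaHom (1 : ZMod n)).comp (rhoHom.comp rhoHom) := by
      refine hom_ext_boundary ?_ fun j => ?_
      · simp [rhoHom_boundary, sigmaHom_boundary hm, sigmaHom_boundary h10]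
      · have h211 : (1 + 1 : ZMod n) ≠ 1 := succ_ne_self 1
        by_cases hj : j = -1
        · subst hj
          simp [rhoHom_boundary, sigmaHom_boundary h10, h10, hm]
        · by_cases hj' : j = 0
          · subst hj'
            simp [rhoHom_boundary, sigmaHom_boundary h10, h10, Ne.symm hm, hm]
            group
          · have e1 : j + 1 ≠ 0 := fun h => hj (eq_neg_of_add_eq_zero_left h)
            have e2 : j + 1 + 1 ≠ 1 := fun h => e1 (by linear_combination h)
            have e3 : j + 1 ≠ 1 := fun h => hj' (by linear_combination h)
            simp [hj, hj', e1, e2, e3]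
    exact MulEquiv.ext fun w => DFunLike.congr_fun key w
  · simp only [artinGen, if_neg h1, if_neg h0]
    have key : rhoHom.comp (sigmaHom i) = (sigmaHom (i + 1)).comp rhoHom := by
      have hii := succ_ne_self i
      refine hom_ext_loop ?_ fun j => ?_
      · have e1 : 1 ≠ i + 1 := fun h => h0 (by linear_combination -h)
        have e2 : 1 ≠ i + 1 + 1 := fun h => h1 (by linear_combination -h)
        simp [e1, e2]
      · by_cases hj : j = i
        · subst hj
          simp [h0, h1]
        · by_cases hj' : j = i + 1
          · subst hj'
            simp [h0, h1, h10]
          · by_cases hj0 : j = 0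
            · subst hj0
              have e1 : 1 ≠ i + 1 := fun h => h0 (by linear_combination -h)
              have e2 : 1 ≠ i + 1 + 1 := fun h => h1 (by linear_combination -h)
              simp [hj, hj', e1, e2, sigmaHom_boundary h1]
            · have e1 : j + 1 ≠ i + 1 + 1 := fun h => hj' (add_right_cancel h)
              simp [hj, hj', hj0]
    exact MulEquiv.ext fun w => DFunLike.congr_fun key w

theorem artinGen_comm {i j : ZMod n} (h₁ : j ≠ i + 1) (h₂ : j ≠ i - 1) :
    artinGen (.sigma i) * artinGen (.sigma j) = artinGen (.sigma j) * artinGen (.sigma i) := by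
  have h10 := one_ne_zero_zmod (n := n)
  have h21 := two_ne_one_zmod (n := n)
  have step : ∀ i j : ZMod n,
      artinGen (.sigma i) * artinGen (.sigma j) = artinGen (.sigma j) * artinGen (.sigma i) →
      artinGen (.sigma (i + 1)) * artinGen (.sigma (j + 1)) =
        artinGen (.sigma (j + 1)) * artinGen (.sigma (i + 1)) := by
    intro i j h
    rw [← artinGen_conj, ← artinGen_conj, ← MulAut.conj_apply, ← MulAut.conj_apply, ← map_mul,
      ← map_mul, h]
  have steps : ∀ (k : ℕ) (i j : ZMod n),
      artinGen (.sigma i) * artinGen (.sigma j) = artinGen (.sigma j) * artinGen (.sigma i) →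
      artinGen (.sigma (i + (k : ZMod n))) * artinGen (.sigma (j + (k : ZMod n))) =
        artinGen (.sigma (j + (k : ZMod n))) * artinGen (.sigma (i + (k : ZMod n))) := by
    intro k i j h
    induction k with
    | zero => simpa using h
    | succ k ih => simpa [add_assoc] using step _ _ ih
  obtain ⟨k, hk⟩ := ZMod.natCast_zmod_surjective (i - 1)
  have base : ∀ j : ZMod n, j ≠ 1 + 1 → j ≠ 0 →
      artinGen (.sigma 1) * artinGen (.sigma j) = artinGen (.sigma j) * artinGen (.sigma 1) := by
    intro j h2 h0
    by_cases hj1 : j = 1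
    · rw [hj1]
    simp only [artinGen, if_neg h10, if_neg h0]
    have key : (sigmaHom 1).comp (sigmaHom j) = (sigmaHom j).comp (sigmaHom 1) := by
      refine hom_ext_loop (by simp) fun k => ?_
      have a1 : j + 1 ≠ 1 := fun h => h0 (by linear_combination h)
      have a2 : j + 1 ≠ 1 + 1 := fun h => hj1 (add_right_cancel h)
      have b1 : (1 : ZMod n) + 1 ≠ j := fun h => h2 h.symm
      have b2 : (1 : ZMod n) + 1 ≠ j + 1 := fun h => a2 h.symm
      by_cases c1 : k = 1
      · subst c1
        simp [Ne.symm hj1, Ne.symm a1, b1, b2]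
      by_cases c2 : k = 1 + 1
      · subst c2
        simp [Ne.symm hj1, Ne.symm a1, b1, b2, h10]
      by_cases c3 : k = j
      · subst c3
        simp [c1, c2, a1, a2]
      by_cases c4 : k = j + 1
      · subst c4
        simp [a1, a2, hj1, h2, c3]
      simp [c1, c2, c3, c4]
    exact MulEquiv.ext fun w => DFunLike.congr_fun key w
  have h := steps k 1 (j - k) (base _ (fun h => h₁ (by rw [hk] at h; linear_combination h))
    (fun h => h₂ (by rw [hk] at h; linear_combination h)))
  rw [hk] at h
  simpa using h

theorem artinGen_braid (i : ZMod n) :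
    artinGen (.sigma i) * artinGen (.sigma (i + 1)) * artinGen (.sigma i) =
      artinGen (.sigma (i + 1)) * artinGen (.sigma i) * artinGen (.sigma (i + 1)) := by
  have h10 := one_ne_zero_zmod (n := n)
  have h21 := two_ne_one_zmod (n := n)
  have steps : ∀ k : ℕ, artinGen (.sigma (1 + (k : ZMod n))) *
      artinGen (.sigma (1 + (k : ZMod n) + 1)) * artinGen (.sigma (1 + (k : ZMod n))) =
      artinGen (.sigma (1 + (k : ZMod n) + 1)) * artinGen (.sigma (1 + (k : ZMod n))) *
        artinGen (.sigma (1 + (k : ZMod n) + 1)) := by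
    intro k
    induction k with
    | zero =>
      have h110 : (1 + 1 : ZMod n) ≠ 0 := fun h => by
        have : ((2 : ℕ) : ZMod n) = ((0 : ℕ) : ZMod n) := by push_cast; linear_combination h
        have := natCast_inj_of_lt (by have := hn.out; omega) (by have := hn.out; omega) this
        omega
      simp only [Nat.cast_zero, add_zero, artinGen, if_neg h10, if_neg h110]
      have key : ((sigmaHom 1).comp (sigmaHom (1 + 1))).comp (sigmaHom (1 : ZMod n)) =
          ((sigmaHom (1 + 1)).comp (sigmaHom 1)).comp (sigmaHom (1 + 1)) := by
        refine hom_ext_loop (by simp) fun k => ?_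
        have b1 : (1 : ZMod n) + 1 + 1 ≠ 1 := fun h => h110 (by linear_combination h)
        by_cases c1 : k = 1
        · subst c1
          simp [h10, h110]
        by_cases c2 : k = 1 + 1
        · subst c2
          simp [h10, b1, h110]
        by_cases c3 : k = 1 + 1 + 1
        · subst c3
          simp [h10, b1, h110, mul_assoc]
        simp [c1, c2, c3]
      exact MulEquiv.ext fun w => DFunLike.congr_fun key w
    | succ k ih =>
      push_cast
      rw [show (1 + ((k : ZMod n) + 1)) = (1 + (k : ZMod n)) + 1 by ring, ← artinGen_conj,
        ← artinGen_conj, ← MulAut.conj_apply, ← MulAut.conj_apply]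
      simp only [← map_mul, ih]
  obtain ⟨k, hk⟩ := ZMod.natCast_zmod_surjective (i - 1)
  have h := steps k
  rw [hk] at h
  simpa using h

variable (n) in
/-- The Artin representation of the braid group on the free group. -/
def artin : BraidGroup n →* MulAut (LoopGroup n) :=
  PresentedGroup.toGroup (f := artinGen) (by
    rintro r (⟨i, j, h₁, h₂⟩ | ⟨i⟩ | ⟨i⟩)
    · simp only [map_mul, map_inv, FreeGroup.lift_apply_of]
      rw [artinGen_comm h₁ h₂, mul_inv_cancel]
    · simp only [map_mul, map_inv, FreeGroup.lift_apply_of]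
      rw [artinGen_braid, mul_inv_cancel]
    · simp only [map_mul, map_inv, FreeGroup.lift_apply_of]
      rw [show artinGen (.rho : BraidGen n) = rhoAut n from rfl, artinGen_conj, mul_inv_cancel])

end Artin

end AffineBraid
namespace AffineBraid
open QuiverAlg

/-! ## The homological representation

The `n + 1`-punctured disk retracts onto a bouquet of circles `x_0, …, x_n`, and its cover with deck
group `G = ⟨t⟩ × ⟨q⟩` onto a graph with vertices `G p̃` and edges `g x̃_j`, where `x̃_0` runs from
`p̃` to `q p̃` and the other `x̃_j` run from `p̃` to `t p̃`. Here `Laurent.mono a b = t^a q^b`. -/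

theorem Laurent.mono_mul (a b c d : ℤ) :
    Laurent.mono a b * Laurent.mono c d = Laurent.mono (a + c) (b + d) := by
  simp [Laurent.mono, AddMonoidAlgebra.single_mul_single]

theorem Laurent.mono_zero : Laurent.mono 0 0 = 1 := rfl

/-- The deck transformation attached to a loop: `t` for `x_1, …, x_n` and `q` for `x_0`. -/
def deckDeg {n : ℕ} : Option (ZMod n) → ℤ × ℤ
  | none => (0, 1)
  | some _ => (1, 0)

/-- The homomorphism from the fundamental group of the punctured disk to the deck group. -/
def deckHom (n : ℕ) : LoopGroup n →* Multiplicative (ℤ × ℤ) :=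
  FreeGroup.lift fun j => Multiplicative.ofAdd (deckDeg j)

/-- The cellular `1`-chains of the graph: the free module on the edges `x̃_0, …, x̃_n`. -/
abbrev CoverChains (n : ℕ) : Type := Option (ZMod n) → Laurent

/-- The edge `x̃_j`. -/
noncomputable def coverEdge {n : ℕ} (j : Option (ZMod n)) : CoverChains n := Pi.single j 1

/-- One step of a path in the cover: having traversed the chain `c` and being at the vertex
`t^a q^b p̃`, traverse the edge `t^a q^b x̃_j`. -/
noncomputable def coverStep {n : ℕ} (j : Option (ZMod n)) :
    Equiv.Perm (CoverChains n × (ℤ × ℤ)) where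
  toFun c := (c.1 + Laurent.mono c.2.1 c.2.2 • coverEdge j, c.2 + deckDeg j)
  invFun c := (c.1 - Laurent.mono (c.2.1 - (deckDeg j).1) (c.2.2 - (deckDeg j).2) • coverEdge j,
    c.2 - deckDeg j)
  left_inv c := by ext1 <;> simp
  right_inv c := by ext1 <;> simp

/-- The lift of a loop, read from right to left, to a path in the cover. -/
noncomputable def liftPath {n : ℕ} : LoopGroup n →* Equiv.Perm (CoverChains n × (ℤ × ℤ)) :=
  FreeGroup.lift coverStep

/-- The `1`-chain of the lift of a loop to the cover that starts at `p̃`. -/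
noncomputable def liftChain {n : ℕ} (w : LoopGroup n) : CoverChains n :=
  (liftPath w (0, 0)).1

section Cover

variable {n : ℕ}

theorem liftPath_apply (w : LoopGroup n) (c : CoverChains n × (ℤ × ℤ)) :
    liftPath w c = (c.1 + Laurent.mono c.2.1 c.2.2 • liftChain w,
      c.2 + (deckHom n w).toAdd) := by
  have hof : ∀ j, (liftPath (FreeGroup.of j) : Equiv.Perm (CoverChains n × (ℤ × ℤ))) =
      coverStep j := fun j => FreeGroup.lift_apply_of
  have dof : ∀ j : Option (ZMod n), (deckHom n (FreeGroup.of j)).toAdd = deckDeg j := fun j =>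
    congrArg Multiplicative.toAdd FreeGroup.lift_apply_of
  have hp : ∀ (j : Option (ZMod n)) c, liftPath (FreeGroup.of j) c =
      (c.1 + Laurent.mono c.2.1 c.2.2 • liftChain (FreeGroup.of j),
        c.2 + (deckHom n (FreeGroup.of j)).toAdd) := fun j c => by
    simp only [liftChain, hof, dof]
    simp [coverStep, Prod.mk_zero_zero, Laurent.mono_zero]
  have mulc : ∀ v w : LoopGroup n,
      (∀ c, liftPath v c = (c.1 + Laurent.mono c.2.1 c.2.2 • liftChain v,
        c.2 + (deckHom n v).toAdd)) →
      (∀ c, liftPath w c = (c.1 + Laurent.mono c.2.1 c.2.2 • liftChain w,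
        c.2 + (deckHom n w).toAdd)) →
      ∀ c, liftPath (v * w) c = (c.1 + Laurent.mono c.2.1 c.2.2 • liftChain (v * w),
        c.2 + (deckHom n (v * w)).toAdd) := by
    intro v w hv hw c
    have e : liftChain (v * w) = liftChain w +
        Laurent.mono (deckHom n w).toAdd.1 (deckHom n w).toAdd.2 • liftChain v := by
      rw [liftChain, map_mul, Equiv.Perm.mul_apply, hw, hv]
      simp [Laurent.mono_zero]
    rw [map_mul, Equiv.Perm.mul_apply, hw, hv, e]
    ext1
    · simp only [smul_add, smul_smul, Laurent.mono_mul, Prod.fst_add, Prod.snd_add, add_assoc]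
    · simp only [map_mul, toAdd_mul]
      abel
  have invc : ∀ v : LoopGroup n,
      (∀ c, liftPath v c = (c.1 + Laurent.mono c.2.1 c.2.2 • liftChain v,
        c.2 + (deckHom n v).toAdd)) →
      ∀ c, liftPath v⁻¹ c = (c.1 + Laurent.mono c.2.1 c.2.2 • liftChain v⁻¹,
        c.2 + (deckHom n v⁻¹).toAdd) := by
    intro v hv
    have e : ∀ c, liftPath v⁻¹ c = (c.1 - Laurent.mono (c.2.1 - (deckHom n v).toAdd.1)
        (c.2.2 - (deckHom n v).toAdd.2) • liftChain v, c.2 - (deckHom n v).toAdd) := by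
      intro c
      rw [map_inv, Equiv.Perm.inv_eq_iff_eq, hv]
      ext1 <;> simp
    intro c
    rw [liftChain, e, e]
    ext1
    · simp only [smul_smul, Laurent.mono_mul, smul_neg, Prod.fst_zero, Prod.snd_zero,
        sub_eq_add_neg, zero_add]
    · simp [sub_eq_add_neg]
  induction w using FreeGroup.induction_on generalizing c with
  | C1 => simp [liftChain]
  | of j => exact hp j c
  | inv_of j _ => exact invc _ (hp j) c
  | mul v w hv hw => exact mulc v w hv hw c

theorem liftChain_mul (v w : LoopGroup n) : liftChain (v * w) = liftChain w +
    Laurent.mono (deckHom n w).toAdd.1 (deckHom n w).toAdd.2 • liftChain v := by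
  rw [liftChain, map_mul, Equiv.Perm.mul_apply, liftPath_apply w, liftPath_apply v]
  simp [Laurent.mono_zero]

theorem liftChain_one : liftChain (1 : LoopGroup n) = 0 := by simp [liftChain]

theorem liftChain_of (j : Option (ZMod n)) : liftChain (FreeGroup.of j) = coverEdge j := by
  have : (liftPath (FreeGroup.of j) : Equiv.Perm (CoverChains n × (ℤ × ℤ))) = coverStep j :=
    FreeGroup.lift_apply_of
  rw [liftChain, this]
  simp [coverStep, Laurent.mono_zero]

/-- Two crossed homomorphisms on the free group agree when they agree on the generators. -/
theorem crossed_ext {M : Type} [AddCommGroup M] [Module Laurent M] {f g : LoopGroup n → M}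
    (hf : ∀ v w, f (v * w) = f w +
      Laurent.mono (deckHom n w).toAdd.1 (deckHom n w).toAdd.2 • f v)
    (hg : ∀ v w, g (v * w) = g w +
      Laurent.mono (deckHom n w).toAdd.1 (deckHom n w).toAdd.2 • g v)
    (h : ∀ j, f (FreeGroup.of j) = g (FreeGroup.of j)) (w : LoopGroup n) : f w = g w := by
  have one : ∀ f : LoopGroup n → M, (∀ v w, f (v * w) = f w +
      Laurent.mono (deckHom n w).toAdd.1 (deckHom n w).toAdd.2 • f v) → f 1 = 0 := by
    intro f hf
    have := hf 1 1
    simpa [Laurent.mono_zero] using this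
  induction w using FreeGroup.induction_on with
  | C1 => rw [one f hf, one g hg]
  | of j => exact h j
  | inv_of j ih =>
    have hf' := hf (FreeGroup.of j) (FreeGroup.of j)⁻¹
    have hg' := hg (FreeGroup.of j) (FreeGroup.of j)⁻¹
    rw [mul_inv_cancel, one f hf] at hf'
    rw [mul_inv_cancel, one g hg] at hg'
    rw [eq_neg_of_add_eq_zero_left hf'.symm, eq_neg_of_add_eq_zero_left hg'.symm, h]
  | mul v w hv hw => rw [hf, hg, hv, hw]

variable [Fact (3 ≤ n)]

variable (n) in
/-- The boundary map from `1`-chains to `0`-chains: `x̃_0 ↦ q - 1` and `x̃_j ↦ t - 1`. -/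
noncomputable def coverBoundary : CoverChains n →ₗ[Laurent] Laurent :=
  Fintype.linearCombination Laurent fun j => Laurent.mono (deckDeg j).1 (deckDeg j).2 - 1

variable (n) in
/-- The first homology of the cover. -/
noncomputable abbrev CoverH1 : Submodule Laurent (CoverChains n) := LinearMap.ker (coverBoundary n)

theorem coverBoundary_liftChain (w : LoopGroup n) : coverBoundary n (liftChain w) =
    Laurent.mono (deckHom n w).toAdd.1 (deckHom n w).toAdd.2 - 1 := by
  refine crossed_ext (f := fun w => coverBoundary n (liftChain w)) (g := fun w =>
    Laurent.mono (deckHom n w).toAdd.1 (deckHom n w).toAdd.2 - 1) ?_ ?_ ?_ w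
  · intro v w
    simp [liftChain_mul]
  · intro v w
    have h : Laurent.mono (deckHom n (v * w)).toAdd.1 (deckHom n (v * w)).toAdd.2 =
        Laurent.mono (deckHom n w).toAdd.1 (deckHom n w).toAdd.2 *
          Laurent.mono (deckHom n v).toAdd.1 (deckHom n v).toAdd.2 := by
      rw [Laurent.mono_mul]
      simp [add_comm]
    simp only [h, smul_eq_mul]
    ring
  · intro j
    have dof : (deckHom n (FreeGroup.of j)).toAdd = deckDeg j :=
      congrArg Multiplicative.toAdd FreeGroup.lift_apply_of
    simp [liftChain_of, coverBoundary, coverEdge, dof, Fintype.linearCombination_apply_single]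

/-- The map on `1`-chains induced by the lift to the cover of a homeomorphism of the punctured disk
that acts as `α` on the fundamental group: `x̃_j` is sent to the lift of `α x_j`. -/
noncomputable def chainMap (α : MulAut (LoopGroup n)) : CoverChains n →ₗ[Laurent] CoverChains n :=
  Fintype.linearCombination Laurent fun j => liftChain (α (FreeGroup.of j))

theorem chainMap_edge (α : MulAut (LoopGroup n)) (j : Option (ZMod n)) :
    chainMap α (coverEdge j) = liftChain (α (FreeGroup.of j)) := by
  simp [chainMap, coverEdge, Fintype.linearCombination_apply_single]

theorem chain_hom_ext {M : Type} [AddCommGroup M] [Module Laurent M]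
    {f g : CoverChains n →ₗ[Laurent] M} (h : ∀ j, f (coverEdge j) = g (coverEdge j)) : f = g :=
  LinearMap.pi_ext' fun j => LinearMap.ext_ring (h j)

theorem deckHom_artin (g : BraidGroup n) (w : LoopGroup n) :
    deckHom n (artin n g w) = deckHom n w := by
  let S : Subgroup (MulAut (LoopGroup n)) :=
    { carrier := {α | (deckHom n).comp α.toMonoidHom = deckHom n}
      one_mem' := MonoidHom.ext fun _ => rfl
      mul_mem' := fun {α β} ha hb => by
        refine MonoidHom.ext fun w => ?_
        exact (DFunLike.congr_fun ha (β w)).trans (DFunLike.congr_fun hb w)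
      inv_mem' := fun {α} ha => by
        refine MonoidHom.ext fun w => ?_
        have := DFunLike.congr_fun ha (α⁻¹ w)
        change deckHom n (α (α⁻¹ w)) = deckHom n (α⁻¹ w) at this
        rw [MulAut.apply_inv_self] at this
        exact this.symm }
  have h0 : deckHom n loopZero = Multiplicative.ofAdd (0, 1) := FreeGroup.lift_apply_of
  have h1 : ∀ j, deckHom n (loop j) = Multiplicative.ofAdd (1, 0) := fun j =>
    FreeGroup.lift_apply_of
  have hr : rhoAut n ∈ S := by
    refine hom_ext_loop ?_ fun j => ?_
    · change deckHom n (rhoHom loopZero) = _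
      simp [mul_assoc, mul_comm (deckHom n loopZero)]
    · change deckHom n (rhoHom (loop j)) = _
      by_cases hj : j = 0
      · simp [hj, mul_assoc, h1]
      · simp [hj, h1]
  have hs : ∀ i : ZMod n, sigmaAut i ∈ S := fun i => by
    refine hom_ext_loop ?_ fun j => ?_
    · change deckHom n (sigmaHom i loopZero) = _
      simp
    · change deckHom n (sigmaHom i (loop j)) = _
      rw [sigmaHom_loop]
      split_ifs <;> simp [h1]
  have key : artin n g ∈ S := by
    have : (artin n).range ≤ S := by
      rw [MonoidHom.range_eq_map, ← PresentedGroup.closure_range_of, MonoidHom.map_closure,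
        Subgroup.closure_le]
      rintro _ ⟨_, ⟨a, rfl⟩, rfl⟩
      have e : artin n (PresentedGroup.of a) = artinGen a := PresentedGroup.toGroup.of _
      rw [e]
      cases a with
      | rho => exact hr
      | sigma i =>
        rw [artinGen]
        split_ifs
        · exact S.mul_mem (S.mul_mem hr (hs _)) (S.inv_mem hr)
        · exact hs i
    exact this ⟨g, rfl⟩
  exact DFunLike.congr_fun key w

theorem chainMap_liftChain (g : BraidGroup n) (w : LoopGroup n) :
    chainMap (artin n g) (liftChain w) = liftChain (artin n g w) := by
  refine crossed_ext (f := fun w => chainMap (artin n g) (liftChain w))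
    (g := fun w => liftChain (artin n g w)) ?_ ?_ ?_ w
  · intro v w
    simp [liftChain_mul]
  · intro v w
    simp [liftChain_mul, deckHom_artin]
  · intro j
    rw [liftChain_of, chainMap_edge]

theorem coverBoundary_chainMap (g : BraidGroup n) (c : CoverChains n) :
    coverBoundary n (chainMap (artin n g) c) = coverBoundary n c := by
  refine DFunLike.congr_fun (f := (coverBoundary n).comp (chainMap (artin n g)))
    (chain_hom_ext fun j => ?_) c
  rw [LinearMap.comp_apply, ← liftChain_of, chainMap_liftChain, coverBoundary_liftChain,
    coverBoundary_liftChain, deckHom_artin]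

variable (n) in
/-- The homological representation: the action of the braid group on the first homology of the
cover by the lifts that fix `p̃`. -/
noncomputable def rhoRH : Representation Laurent (BraidGroup n) (CoverH1 n) where
  toFun g := (chainMap (artin n g)).restrict fun c hc => by
    rw [LinearMap.mem_ker] at hc ⊢
    rw [coverBoundary_chainMap, hc]
  map_one' := by
    refine LinearMap.ext fun c => Subtype.ext ?_
    change chainMap (artin n 1) c.1 = c.1
    refine DFunLike.congr_fun (f := chainMap (artin n 1)) (g := LinearMap.id)
      (chain_hom_ext fun j => ?_) c.1
    rw [chainMap_edge, map_one]
    exact liftChain_of j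
  map_mul' g h := by
    refine LinearMap.ext fun c => Subtype.ext ?_
    change chainMap (artin n (g * h)) c.1 = chainMap (artin n g) (chainMap (artin n h) c.1)
    refine DFunLike.congr_fun (f := chainMap (artin n (g * h)))
      (g := (chainMap (artin n g)).comp (chainMap (artin n h))) (chain_hom_ext fun j => ?_) c.1
    rw [LinearMap.comp_apply, chainMap_edge, chainMap_edge, chainMap_liftChain, map_mul,
      MulAut.mul_apply]

/-- The cycles `γ̃_1, …, γ̃_n` (the last one has the index `0`): `γ̃_i = x̃_{i+1} - x̃_i` for `i < n`,
and `γ̃_n` is the sum of `t^k (1 - t) x̃_{n-k}` over `0 ≤ k < n` and of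
`t^n (1 - t) x̃_0 + q t^n x̃_1 - x̃_n`. -/
noncomputable def gammaCycle (i : ZMod n) : CoverChains n :=
  if i = 0 then
    ∑ k ∈ Finset.range n, (Laurent.mono k 0 * (1 - Laurent.mono 1 0)) • coverEdge (some (-(k : ZMod n))) +
      (Laurent.mono n 0 * (1 - Laurent.mono 1 0)) • coverEdge none +
      Laurent.mono n 1 • coverEdge (some 1) - coverEdge (some 0)
  else coverEdge (some (i + 1)) - coverEdge (some i)

end Cover

/-! ## The matrices -/

section Matrices

variable {n : ℕ}

/-- The matrix of `σ_i`: the identity except in the row `i`, which has the entries `-t` in the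
column `i`, `t` in the column `i + 1` (but `t s` if `i = n`), `1` in the column `i - 1` (but `s⁻¹` if
`i = 1`) and zeros elsewhere. Here `Laurent.mono a b = t^a s^b`, and the index `n` is `0`. -/
noncomputable def matSigma (i : ZMod n) : Matrix (ZMod n) (ZMod n) Laurent :=
  Matrix.of fun a b =>
    if a = i then
      if b = i then -Laurent.mono 1 0
      else if b = i + 1 then (if i = 0 then Laurent.mono 1 1 else Laurent.mono 1 0)
      else if b = i - 1 then (if i = 1 then Laurent.mono 0 (-1) else 1)
      else 0
    else if a = b then 1 else 0

/-- The matrix of `ρ`: `P_i ↦ P_{i+1}` for `i < n`, and `P_n ↦ s⁻¹ P_1`. -/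
noncomputable def matRho : Matrix (ZMod n) (ZMod n) Laurent :=
  Matrix.of fun a b => if a = b + 1 then (if b = 0 then Laurent.mono 0 (-1) else 1) else 0

/-- The matrix of `ρ⁻¹`: `P_{i+1} ↦ P_i` for `i < n`, and `P_1 ↦ s P_n`. -/
noncomputable def matRhoInv : Matrix (ZMod n) (ZMod n) Laurent :=
  Matrix.of fun a b => if b = a + 1 then (if a = 0 then Laurent.mono 0 1 else 1) else 0

/-- The specialization `t ↦ t`, `s ↦ q⁻¹ t⁻ⁿ`. -/
noncomputable def specialize (n : ℕ) : Laurent →+* Laurent :=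
  AddMonoidAlgebra.mapDomainRingHom ℤ
    (AddMonoidHom.mk' (fun a : ℤ × ℤ => (a.1 - n * a.2, -a.2)) (fun a b => by
      ext <;> simp <;> ring))

theorem specialize_mono (a b : ℤ) :
    specialize n (Laurent.mono a b) = Laurent.mono (a - n * b) (-b) := by
  simp [specialize, Laurent.mono]

end Matrices

end AffineBraid

open AffineBraid

/-!
# Categorical and homological representations of the extended affine braid group

**The weak action.** Tensoring complexes of bimodules is exact in each variable on homotopy
categories, because the total complex preserves degreewise split sequences. A weak action requires
isomorphisms, but no coherence between them; so it is given by a homomorphism from the braid group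
to the group of isomorphism classes of invertible complexes of bimodules (`braidClass`), and only
the relations have to be verified. The complex `F_i` is the cone of `d_i : U_i ⟶ R_n`, where
`U_i = P_i ⊗ _iP`. The main tool is `TensorTriang.cone_tensor`: if `U_i ⊗ X ⟶ U_i ⊗ X'` is a split
monomorphism with a complement that `d_i` maps isomorphically to `X'`, then `F_i` times the cone
of `X ⟶ X'` is the shift of `X`. Applied to the Casimir element `d'_i` (`cancels_casimir`), this
shows that `F'_i` is inverse to `F_i`. Applied to the multiplication `U_j ⊗ U_i ⟶ U_i` for
adjacent `i` and `j` (`cancels_edge`) and to its mirror image, it gives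
`F_i ⊗ F_j ⊗ U_i ≅ (U_j ⊗ U_i)[1] ≅ U_j ⊗ F_i ⊗ F_j`. As `d_i` generates the group of morphisms from `U_i` to `R_n` freely,
an invertible object that intertwines `U_i` and `U_j` also intertwines their cones
(`TensorTriang.Inv.conj`), which is the braid relation. The other relations follow in the same
way, from `U_i ⊗ U_j = 0` for distant `i` and `j`, and from `T_n^ρ ⊗ U_i ≅ U_{i+1} ⊗ T_n^ρ`
(`twistSwapIso`).

**The Grothendieck group.** The graded rank of the multiplicity space of the `i`-th simple module
in the socle extends to an Euler characteristic of perfect complexes, invariant under homotopy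
since it is an alternating sum of traces, and it separates the classes of the `P_i`
(`linearIndependent_projObj`). That they span is reduced to modules by brutal truncation. A
nonzero finitely generated projective module `M` has a summand `P_i {γ}`
(`LeftPerfect.exists_split`): some path `x_i = (i|i+1|i)` does not annihilate `M`, the subgroup
`x_i M_γ` is pure, so that there is a functional with the value `1` at some `x_i a`, and the
Casimir element turns the functional into a morphism `M ⟶ P_i {γ}` that splits `P_i {γ} ⟶ M`,
`(i) ↦ (i) a` (`frobeniusHom`). The matrices follow from `[F_i ⊗ P_j] = [P_j] - [P_i ⊗ _iP ⊗ P_j]` and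
a basis of `(i) R_n (j)`.

**The homology of the cover.** Modulo `t - 1`, the boundary of a cycle is `q - 1` times its
coefficient at `x̃_0`; so this coefficient is a multiple of that of `γ̃_n`, and the remaining
cycles are combinations of differences of the `x̃_j` (`span_gammaCycle`). The braids fix the
boundary loop `D`, and `γ̃_n` is a combination of the lift of `D`, `x̃_1` and `x̃_n`; this gives
the action of `ρ` and of `σ_i` for `i ≠ n` on the cycles. These braids generate the group, so the
comparison of their matrices is enough (`toMatrix_repK_specialize`).
-/

/-! ### Bifunctors on homotopy categories of complexes -/

namespace AffineBraid

section Bifunctor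

open HomologicalComplex

universe v₁ v₂ v₃ u₁ u₂ u₃
variable {C₁ : Type u₁} {C₂ : Type u₂} {D : Type u₃} [Category.{v₁} C₁] [Category.{v₂} C₂]
  [Category.{v₃} D] [Preadditive C₁] [Preadditive C₂] [Preadditive D]
  (F : C₁ ⥤ C₂ ⥤ D) [F.Additive] [∀ X, (F.obj X).Additive]
  [∀ (K₁ : CochainComplex C₁ ℤ) (K₂ : CochainComplex C₂ ℤ),
    HasMapBifunctor K₁ K₂ F (ComplexShape.up ℤ)]

/-- The functor on homotopy categories given by a bifunctor and a complex in its first variable. -/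
noncomputable def map₂HotObj (K : CochainComplex C₁ ℤ) :
    HomotopyCategory C₂ (ComplexShape.up ℤ) ⥤ HomotopyCategory D (ComplexShape.up ℤ) :=
  CategoryTheory.Quotient.lift _ (F.map₂CochainComplex.obj K ⋙ HomotopyCategory.quotient _ _)
    (fun _ _ _ _ ⟨h⟩ => HomotopyCategory.eq_of_homotopy _ _
      (HomologicalComplex.mapBifunctorMapHomotopy₂ (𝟙 K) h _ _))

/-- The bifunctor on homotopy categories induced by a bifunctor. -/
noncomputable def map₂Hot : HomotopyCategory C₁ (ComplexShape.up ℤ) ⥤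
    HomotopyCategory C₂ (ComplexShape.up ℤ) ⥤ HomotopyCategory D (ComplexShape.up ℤ) :=
  CategoryTheory.Quotient.lift _
    { obj := map₂HotObj F
      map := fun {K L} f => CategoryTheory.Quotient.natTransLift _
        (Functor.whiskerRight (F.map₂CochainComplex.map f) (HomotopyCategory.quotient _ _))
      map_id := fun K => by
        refine CategoryTheory.Quotient.natTrans_ext _ _ ?_
        ext X
        change (HomotopyCategory.quotient _ _).map ((F.map₂CochainComplex.map (𝟙 K)).app X) = 𝟙 _
        rw [CategoryTheory.Functor.map_id]
        exact (HomotopyCategory.quotient _ _).map_id _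
      map_comp := fun f g => by
        refine CategoryTheory.Quotient.natTrans_ext _ _ ?_
        ext X
        change (HomotopyCategory.quotient _ _).map ((F.map₂CochainComplex.map (f ≫ g)).app X) =
          (HomotopyCategory.quotient _ _).map _ ≫ (HomotopyCategory.quotient _ _).map _
        rw [CategoryTheory.Functor.map_comp, NatTrans.comp_app, CategoryTheory.Functor.map_comp] }
    (fun K L f g ⟨h⟩ => by
      refine CategoryTheory.Quotient.natTrans_ext _ _ ?_
      ext X
      exact HomotopyCategory.eq_of_homotopy _ _
        (HomologicalComplex.mapBifunctorMapHomotopy₁ h (𝟙 X) _ _))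

end Bifunctor
section Exact
open HomologicalComplex Pretriangulated

universe v₁ v₂ v₃ u₁ u₂ u₃
variable {C : Type u₁} {D : Type u₂} [Category.{v₁} C] [Category.{v₂} D]
  [Preadditive C] [Preadditive D]

theorem degreewise_split_iff (S : ShortComplex (CochainComplex C ℤ)) (n : ℤ) :
    Nonempty (S.map (eval C _ n)).Splitting ↔
      ∃ (r : S.X₂.X n ⟶ S.X₁.X n) (s : S.X₃.X n ⟶ S.X₂.X n), S.f.f n ≫ r = 𝟙 _ ∧
        s ≫ S.g.f n = 𝟙 _ ∧ r ≫ S.f.f n + S.g.f n ≫ s = 𝟙 _ :=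
  ⟨fun ⟨σ⟩ => ⟨σ.r, σ.s, σ.f_r, σ.s_g, σ.id⟩,
    fun ⟨r, s, h₁, h₂, h₃⟩ => ⟨{ r := r, s := s, f_r := h₁, s_g := h₂, id := h₃ }⟩⟩

/-- A functor between homotopy categories which is induced by a functor of complexes that
preserves degreewise split short exact sequences maps a distinguished triangle to a pair of
morphisms which is part of a distinguished triangle. -/
theorem exists_distinguished_map [HasZeroObject C] [HasZeroObject D]
    [HasBinaryBiproducts C] [HasBinaryBiproducts D]
    (Φ : CochainComplex C ℤ ⥤ CochainComplex D ℤ) [Φ.PreservesZeroMorphisms]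
    (G : HomotopyCategory C (ComplexShape.up ℤ) ⥤ HomotopyCategory D (ComplexShape.up ℤ))
    (e : HomotopyCategory.quotient _ _ ⋙ G ≅ Φ ⋙ HomotopyCategory.quotient _ _)
    (hΦ : ∀ S : ShortComplex (CochainComplex C ℤ),
      (∀ n, Nonempty (S.map (eval C _ n)).Splitting) →
      ∀ n, Nonempty ((S.map Φ).map (eval D _ n)).Splitting)
    {X Y Z : HomotopyCategory C (ComplexShape.up ℤ)} (f : X ⟶ Y) (g : Y ⟶ Z) (h : Z ⟶ X⟦(1 : ℤ)⟧)
    (hT : Triangle.mk f g h ∈ distTriang _) :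
    ∃ h' : G.obj Z ⟶ (G.obj X)⟦(1 : ℤ)⟧, Triangle.mk (G.map f) (G.map g) h' ∈ distTriang _ := by
  obtain ⟨S, σ, ⟨i⟩⟩ := (HomotopyCategory.distinguished_iff_iso_trianglehOfDegreewiseSplit _).1 hT
  have τ := hΦ S (fun n => ⟨σ n⟩)
  let Q := HomotopyCategory.quotient C (ComplexShape.up ℤ)
  let Q' := HomotopyCategory.quotient D (ComplexShape.up ℤ)
  let a₁ : X ≅ Q.obj S.X₁ := Triangle.π₁.mapIso i
  let a₂ : Y ≅ Q.obj S.X₂ := Triangle.π₂.mapIso i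
  let a₃ : Z ≅ Q.obj S.X₃ := Triangle.π₃.mapIso i
  have h1 : f ≫ a₂.hom = a₁.hom ≫ Q.map S.f := i.hom.comm₁
  have h2 : g ≫ a₃.hom = a₂.hom ≫ Q.map S.g := i.hom.comm₂
  let b₁ : G.obj (Q.obj S.X₁) ≅ Q'.obj (Φ.obj S.X₁) := e.app S.X₁
  let b₂ : G.obj (Q.obj S.X₂) ≅ Q'.obj (Φ.obj S.X₂) := e.app S.X₂
  let b₃ : G.obj (Q.obj S.X₃) ≅ Q'.obj (Φ.obj S.X₃) := e.app S.X₃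
  have h3 : G.map (Q.map S.f) ≫ b₂.hom = b₁.hom ≫ Q'.map (Φ.map S.f) := e.hom.naturality S.f
  have h4 : G.map (Q.map S.g) ≫ b₃.hom = b₂.hom ≫ Q'.map (Φ.map S.g) := e.hom.naturality S.g
  let j₁ := G.mapIso a₁ ≪≫ b₁
  let j₂ := G.mapIso a₂ ≪≫ b₂
  let j₃ := G.mapIso a₃ ≪≫ b₃
  have c₁ : G.map f ≫ j₂.hom = j₁.hom ≫ Q'.map (Φ.map S.f) := by
    simp only [j₁, j₂, Iso.trans_hom, Functor.mapIso_hom]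
    rw [← G.map_comp_assoc, h1, G.map_comp, Category.assoc, h3, Category.assoc]
  have c₂ : G.map g ≫ j₃.hom = j₂.hom ≫ Q'.map (Φ.map S.g) := by
    simp only [j₂, j₃, Iso.trans_hom, Functor.mapIso_hom]
    rw [← G.map_comp_assoc, h2, G.map_comp, Category.assoc, h4, Category.assoc]
  let T' := CochainComplex.trianglehOfDegreewiseSplit (S.map Φ) (fun n => (τ n).some)
  have hT' : T' ∈ distTriang _ :=
    (HomotopyCategory.distinguished_iff_iso_trianglehOfDegreewiseSplit _).2 ⟨_, _, ⟨Iso.refl _⟩⟩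
  let m : Q'.obj (Φ.obj S.X₃) ⟶ (Q'.obj (Φ.obj S.X₁))⟦(1 : ℤ)⟧ := T'.mor₃
  refine ⟨j₃.hom ≫ m ≫ (shiftFunctor _ (1 : ℤ)).map j₁.inv, isomorphic_distinguished
    (Triangle.mk (Q'.map (Φ.map S.f)) (Q'.map (Φ.map S.g)) m) hT' _
    (Triangle.isoMk _ _ j₁ j₂ j₃ c₁ c₂ ?_)⟩
  change (j₃.hom ≫ m ≫ (shiftFunctor _ (1 : ℤ)).map j₁.inv) ≫
    (shiftFunctor _ (1 : ℤ)).map j₁.hom = j₃.hom ≫ m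
  rw [Category.assoc, Category.assoc, ← Functor.map_comp, j₁.inv_hom_id,
    CategoryTheory.Functor.map_id, Category.comp_id]

end Exact

section Bifunctor

open HomologicalComplex Pretriangulated

universe v₁ v₂ v₃ u₁ u₂ u₃
variable {C₁ : Type u₁} {C₂ : Type u₂} {D : Type u₃} [Category.{v₁} C₁] [Category.{v₂} C₂]
  [Category.{v₃} D] [Preadditive C₁] [Preadditive C₂] [Preadditive D]
  (F : C₁ ⥤ C₂ ⥤ D) [F.Additive] [∀ X, (F.obj X).Additive]
  [∀ (K₁ : CochainComplex C₁ ℤ) (K₂ : CochainComplex C₂ ℤ),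
    HasMapBifunctor K₁ K₂ F (ComplexShape.up ℤ)]

/-- The map between total objects induced by morphisms of graded objects which need not commute with
the differentials. -/
noncomputable def gradedMap {K₁ L₁ : CochainComplex C₁ ℤ} {K₂ L₂ : CochainComplex C₂ ℤ}
    (f : ∀ p, K₁.X p ⟶ L₁.X p) (g : ∀ p, K₂.X p ⟶ L₂.X p) (n : ℤ) :
    (mapBifunctor K₁ K₂ F (.up ℤ)).X n ⟶ (mapBifunctor L₁ L₂ F (.up ℤ)).X n :=
  mapBifunctorDesc (fun p q h => (F.map (f p)).app (K₂.X q) ≫ (F.obj (L₁.X p)).map (g q) ≫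
    ιMapBifunctor L₁ L₂ F (.up ℤ) p q n h)

theorem gradedMap_comp {K₁ L₁ M₁ : CochainComplex C₁ ℤ} {K₂ L₂ M₂ : CochainComplex C₂ ℤ}
    (f : ∀ p, K₁.X p ⟶ L₁.X p) (g : ∀ p, K₂.X p ⟶ L₂.X p)
    (f' : ∀ p, L₁.X p ⟶ M₁.X p) (g' : ∀ p, L₂.X p ⟶ M₂.X p) (n : ℤ) :
    gradedMap F f g n ≫ gradedMap F f' g' n =
      gradedMap F (fun p => f p ≫ f' p) (fun p => g p ≫ g' p) n := by
  refine mapBifunctor.hom_ext fun p q h => ?_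
  rw [gradedMap, ι_mapBifunctorDesc_assoc, gradedMap, gradedMap, ι_mapBifunctorDesc,
    Category.assoc, Category.assoc, ι_mapBifunctorDesc]
  simp

theorem gradedMap_id (K₁ : CochainComplex C₁ ℤ) (K₂ : CochainComplex C₂ ℤ) (n : ℤ) :
    gradedMap F (fun p => 𝟙 (K₁.X p)) (fun p => 𝟙 (K₂.X p)) n = 𝟙 _ := by
  refine mapBifunctor.hom_ext fun p q h => ?_
  rw [gradedMap, ι_mapBifunctorDesc]
  simp

theorem mapBifunctorMap_f {K₁ L₁ : CochainComplex C₁ ℤ} {K₂ L₂ : CochainComplex C₂ ℤ}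
    (f : K₁ ⟶ L₁) (g : K₂ ⟶ L₂) (n : ℤ) :
    (mapBifunctorMap f g F (.up ℤ)).f n = gradedMap F f.f g.f n := by
  refine mapBifunctor.hom_ext fun p q h => ?_
  rw [gradedMap, ι_mapBifunctorDesc, ι_mapBifunctorMap]

theorem gradedMap_add_left {K₁ L₁ : CochainComplex C₁ ℤ} {K₂ L₂ : CochainComplex C₂ ℤ}
    (f f' : ∀ p, K₁.X p ⟶ L₁.X p) (g : ∀ p, K₂.X p ⟶ L₂.X p) (n : ℤ) :
    gradedMap F (fun p => f p + f' p) g n = gradedMap F f g n + gradedMap F f' g n := by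
  refine mapBifunctor.hom_ext fun p q h => ?_
  rw [Preadditive.comp_add]
  simp only [gradedMap, ι_mapBifunctorDesc]
  simp [F.map_add]

theorem gradedMap_add_right {K₁ L₁ : CochainComplex C₁ ℤ} {K₂ L₂ : CochainComplex C₂ ℤ}
    (f : ∀ p, K₁.X p ⟶ L₁.X p) (g g' : ∀ p, K₂.X p ⟶ L₂.X p) (n : ℤ) :
    gradedMap F f (fun p => g p + g' p) n = gradedMap F f g n + gradedMap F f g' n := by
  refine mapBifunctor.hom_ext fun p q h => ?_
  rw [Preadditive.comp_add]
  simp only [gradedMap, ι_mapBifunctorDesc]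
  simp [Functor.map_add]

instance (K : CochainComplex C₁ ℤ) : (F.map₂CochainComplex.obj K).Additive where
  map_add {X Y f g} := by
    ext n : 1
    change (mapBifunctorMap (𝟙 K) (f + g) F _).f n = (mapBifunctorMap (𝟙 K) f F _).f n +
      (mapBifunctorMap (𝟙 K) g F _).f n
    simp only [mapBifunctorMap_f]
    exact gradedMap_add_right F _ _ _ _

instance (K : CochainComplex C₂ ℤ) : (F.map₂CochainComplex.flip.obj K).Additive where
  map_add {X Y f g} := by
    ext n : 1
    change (mapBifunctorMap (f + g) (𝟙 K) F _).f n = (mapBifunctorMap f (𝟙 K) F _).f n +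
      (mapBifunctorMap g (𝟙 K) F _).f n
    simp only [mapBifunctorMap_f]
    exact gradedMap_add_left F _ _ _ _

/-- The total complex of a bifunctor preserves degreewise splittings in the second variable. -/
theorem nonempty_splitting_right (K : CochainComplex C₁ ℤ) (S : ShortComplex (CochainComplex C₂ ℤ))
    (h : ∀ n, Nonempty (S.map (eval C₂ _ n)).Splitting) (n : ℤ) :
    Nonempty ((S.map (F.map₂CochainComplex.obj K)).map (eval D _ n)).Splitting := by
  choose r s h₁ h₂ h₃ using fun n => (degreewise_split_iff S n).1 (h n)
  have e (p : ℤ) : (𝟙 K : K ⟶ K).f p = 𝟙 (K.X p) := rfl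
  refine (degreewise_split_iff _ _).2 ⟨gradedMap F (fun p => 𝟙 (K.X p)) r n,
    gradedMap F (fun p => 𝟙 (K.X p)) s n, ?_, ?_, ?_⟩
  · change (mapBifunctorMap (𝟙 K) S.f F _).f n ≫ _ = 𝟙 _
    rw [mapBifunctorMap_f, gradedMap_comp, ← gradedMap_id]
    simp only [e, h₁, Category.comp_id]
  · change _ ≫ (mapBifunctorMap (𝟙 K) S.g F _).f n = 𝟙 _
    rw [mapBifunctorMap_f, gradedMap_comp, ← gradedMap_id]
    simp only [e, h₂, Category.comp_id]
  · change gradedMap F (fun p => 𝟙 (K.X p)) r n ≫ (mapBifunctorMap (𝟙 K) S.f F _).f n +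
      (mapBifunctorMap (𝟙 K) S.g F _).f n ≫ gradedMap F (fun p => 𝟙 (K.X p)) s n =
        𝟙 ((mapBifunctor K S.X₂ F (.up ℤ)).X n)
    rw [mapBifunctorMap_f, mapBifunctorMap_f, gradedMap_comp, gradedMap_comp, ← gradedMap_id]
    simp only [e, Category.comp_id]
    rw [← gradedMap_add_right]
    simp only [h₃]

/-- The total complex of a bifunctor preserves degreewise splittings in the first variable. -/
theorem nonempty_splitting_left (K : CochainComplex C₂ ℤ) (S : ShortComplex (CochainComplex C₁ ℤ))
    (h : ∀ n, Nonempty (S.map (eval C₁ _ n)).Splitting) (n : ℤ) :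
    Nonempty ((S.map (F.map₂CochainComplex.flip.obj K)).map (eval D _ n)).Splitting := by
  choose r s h₁ h₂ h₃ using fun n => (degreewise_split_iff S n).1 (h n)
  have e (p : ℤ) : (𝟙 K : K ⟶ K).f p = 𝟙 (K.X p) := rfl
  refine (degreewise_split_iff _ _).2 ⟨gradedMap F r (fun p => 𝟙 (K.X p)) n,
    gradedMap F s (fun p => 𝟙 (K.X p)) n, ?_, ?_, ?_⟩
  · change (mapBifunctorMap S.f (𝟙 K) F _).f n ≫ _ = 𝟙 _
    rw [mapBifunctorMap_f, gradedMap_comp, ← gradedMap_id]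
    simp only [e, h₁, Category.comp_id]
  · change _ ≫ (mapBifunctorMap S.g (𝟙 K) F _).f n = 𝟙 _
    rw [mapBifunctorMap_f, gradedMap_comp, ← gradedMap_id]
    simp only [e, h₂, Category.comp_id]
  · change gradedMap F r (fun p => 𝟙 (K.X p)) n ≫ (mapBifunctorMap S.f (𝟙 K) F _).f n +
      (mapBifunctorMap S.g (𝟙 K) F _).f n ≫ gradedMap F s (fun p => 𝟙 (K.X p)) n =
        𝟙 ((mapBifunctor S.X₂ K F (.up ℤ)).X n)
    rw [mapBifunctorMap_f, mapBifunctorMap_f, gradedMap_comp, gradedMap_comp, ← gradedMap_id]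
    simp only [e, Category.comp_id]
    rw [← gradedMap_add_left]
    simp only [h₃]

variable [HasZeroObject D] [HasBinaryBiproducts D]

/-- The bifunctor is exact in its second variable. Nothing is said about the connecting morphism. -/
theorem map₂Hot_obj_exact [HasZeroObject C₂] [HasBinaryBiproducts C₂]
    (K : HomotopyCategory C₁ (ComplexShape.up ℤ))
    {X Y Z : HomotopyCategory C₂ (ComplexShape.up ℤ)} (f : X ⟶ Y) (g : Y ⟶ Z) (h : Z ⟶ X⟦(1 : ℤ)⟧)
    (hT : Triangle.mk f g h ∈ distTriang _) :
    ∃ h', Triangle.mk (((map₂Hot F).obj K).map f) (((map₂Hot F).obj K).map g) h' ∈ distTriang _ :=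
  exists_distinguished_map (F.map₂CochainComplex.obj K.as) ((map₂Hot F).obj K) (Iso.refl _)
    (nonempty_splitting_right F K.as) f g h hT

/-- The bifunctor is exact in its first variable. -/
theorem map₂Hot_flip_obj_exact [HasZeroObject C₁] [HasBinaryBiproducts C₁]
    (K : HomotopyCategory C₂ (ComplexShape.up ℤ))
    {X Y Z : HomotopyCategory C₁ (ComplexShape.up ℤ)} (f : X ⟶ Y) (g : Y ⟶ Z) (h : Z ⟶ X⟦(1 : ℤ)⟧)
    (hT : Triangle.mk f g h ∈ distTriang _) :
    ∃ h', Triangle.mk (((map₂Hot F).flip.obj K).map f) (((map₂Hot F).flip.obj K).map g) h' ∈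
      distTriang _ :=
  exists_distinguished_map (F.map₂CochainComplex.flip.obj K.as) ((map₂Hot F).flip.obj K)
    (Iso.refl _) (nonempty_splitting_left F K.as) f g h hT

end Bifunctor
end AffineBraid

/-! ### Associativity of total complexes -/

namespace AffineBraid
section Assoc
open HomologicalComplex
universe v₁ v₂ v₃ v₁₂ v₂₃ v₄ u₁ u₂ u₃ u₁₂ u₂₃ u₄
variable {C₁ : Type u₁} {C₂ : Type u₂} {C₃ : Type u₃} {C₁₂ : Type u₁₂} {C₂₃ : Type u₂₃}
  {C₄ : Type u₄} [Category.{v₁} C₁] [Category.{v₂} C₂] [Category.{v₃} C₃] [Category.{v₁₂} C₁₂]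
  [Category.{v₂₃} C₂₃] [Category.{v₄} C₄] [Preadditive C₁] [Preadditive C₂] [Preadditive C₃]
  [Preadditive C₁₂] [Preadditive C₂₃] [Preadditive C₄]
  {F₁₂ : C₁ ⥤ C₂ ⥤ C₁₂} {G : C₁₂ ⥤ C₃ ⥤ C₄} {F : C₁ ⥤ C₂₃ ⥤ C₄} {G₂₃ : C₂ ⥤ C₃ ⥤ C₂₃}
  [F₁₂.Additive] [∀ X, (F₁₂.obj X).Additive] [G.Additive] [∀ X, (G.obj X).Additive]
  [F.Additive] [∀ X, (F.obj X).Additive] [G₂₃.Additive] [∀ X, (G₂₃.obj X).Additive]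
  [∀ (K₁ : CochainComplex C₁ ℤ) (K₂ : CochainComplex C₂ ℤ), HasMapBifunctor K₁ K₂ F₁₂ (.up ℤ)]
  [∀ (K₁ : CochainComplex C₁₂ ℤ) (K₂ : CochainComplex C₃ ℤ), HasMapBifunctor K₁ K₂ G (.up ℤ)]
  [∀ (K₁ : CochainComplex C₁ ℤ) (K₂ : CochainComplex C₂₃ ℤ), HasMapBifunctor K₁ K₂ F (.up ℤ)]
  [∀ (K₁ : CochainComplex C₂ ℤ) (K₂ : CochainComplex C₃ ℤ), HasMapBifunctor K₁ K₂ G₂₃ (.up ℤ)]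

theorem ι₁₂_map (K₁ L₁ : CochainComplex C₁ ℤ) (K₂ L₂ : CochainComplex C₂ ℤ) (K₃ L₃ :
    CochainComplex C₃ ℤ)
    (f₁ : K₁ ⟶ L₁) (f₂ : K₂ ⟶ L₂) (f₃ : K₃ ⟶ L₃) (i₁ i₂ i₃ j : ℤ)
    (h : ComplexShape.r (.up ℤ) (.up ℤ) (.up ℤ) (.up ℤ) (.up ℤ) (i₁, i₂, i₃) = j) :
    mapBifunctor₁₂.ι F₁₂ G K₁ K₂ K₃ (.up ℤ) (.up ℤ) i₁ i₂ i₃ j h ≫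
      (mapBifunctorMap (mapBifunctorMap f₁ f₂ F₁₂ (.up ℤ)) f₃ G (.up ℤ)).f j =
    (G.map ((F₁₂.map (f₁.f i₁)).app _ ≫ (F₁₂.obj _).map (f₂.f i₂))).app _ ≫
      (G.obj _).map (f₃.f i₃) ≫
        mapBifunctor₁₂.ι F₁₂ G L₁ L₂ L₃ (.up ℤ) (.up ℤ) i₁ i₂ i₃ j h := by
  obtain ⟨k, hk⟩ : ∃ k, ComplexShape.π (.up ℤ) (.up ℤ) (.up ℤ) (i₁, i₂) = k := ⟨_, rfl⟩
  have h' : ComplexShape.π (.up ℤ) (.up ℤ) (.up ℤ) (k, i₃) = j := by rw [← hk]; exact h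
  rw [mapBifunctor₁₂.ι_eq _ _ _ _ _ _ _ _ _ _ k _ hk h',
    mapBifunctor₁₂.ι_eq _ _ _ _ _ _ _ _ _ _ k _ hk h', Category.assoc, ι_mapBifunctorMap,
    ← NatTrans.comp_app_assoc, ← G.map_comp, ι_mapBifunctorMap]
  simp only [G.map_comp, NatTrans.comp_app, Category.assoc]
  rw [NatTrans.naturality_assoc]

theorem ι₂₃_map (K₁ L₁ : CochainComplex C₁ ℤ) (K₂ L₂ : CochainComplex C₂ ℤ) (K₃ L₃ :
    CochainComplex C₃ ℤ)
    (f₁ : K₁ ⟶ L₁) (f₂ : K₂ ⟶ L₂) (f₃ : K₃ ⟶ L₃) (i₁ i₂ i₃ j : ℤ)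
    (h : ComplexShape.r (.up ℤ) (.up ℤ) (.up ℤ) (.up ℤ) (.up ℤ) (i₁, i₂, i₃) = j) :
    mapBifunctor₂₃.ι F G₂₃ K₁ K₂ K₃ (.up ℤ) (.up ℤ) (.up ℤ) i₁ i₂ i₃ j h ≫
      (mapBifunctorMap f₁ (mapBifunctorMap f₂ f₃ G₂₃ (.up ℤ)) F (.up ℤ)).f j =
    (F.map (f₁.f i₁)).app _ ≫
      (F.obj _).map ((G₂₃.map (f₂.f i₂)).app _ ≫ (G₂₃.obj _).map (f₃.f i₃)) ≫
        mapBifunctor₂₃.ι F G₂₃ L₁ L₂ L₃ (.up ℤ) (.up ℤ) (.up ℤ) i₁ i₂ i₃ j h := by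
  obtain ⟨k, hk⟩ : ∃ k, ComplexShape.π (.up ℤ) (.up ℤ) (.up ℤ) (i₂, i₃) = k := ⟨_, rfl⟩
  have h' : ComplexShape.π (.up ℤ) (.up ℤ) (.up ℤ) (i₁, k) = j := by
    rw [← hk, ← ComplexShape.assoc (.up ℤ) (.up ℤ) (.up ℤ) (.up ℤ) (.up ℤ) (.up ℤ)]; exact h
  rw [mapBifunctor₂₃.ι_eq _ _ _ _ _ _ _ _ _ _ _ k _ hk h',
    mapBifunctor₂₃.ι_eq _ _ _ _ _ _ _ _ _ _ _ k _ hk h', Category.assoc, ι_mapBifunctorMap,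
    NatTrans.naturality_assoc, ← Functor.map_comp_assoc, ← Functor.map_comp_assoc,
    ι_mapBifunctorMap, Category.assoc]

end Assoc

section Assoc
open HomologicalComplex
universe v₁ v₂ v₃ v₁₂ v₂₃ v₄ u₁ u₂ u₃ u₁₂ u₂₃ u₄
variable {C₁ : Type u₁} {C₂ : Type u₂} {C₃ : Type u₃} {C₁₂ : Type u₁₂} {C₂₃ : Type u₂₃}
  {C₄ : Type u₄} [Category.{v₁} C₁] [Category.{v₂} C₂] [Category.{v₃} C₃] [Category.{v₁₂} C₁₂]
  [Category.{v₂₃} C₂₃] [Category.{v₄} C₄]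
  {F₁₂ : C₁ ⥤ C₂ ⥤ C₁₂} {G : C₁₂ ⥤ C₃ ⥤ C₄} {F : C₁ ⥤ C₂₃ ⥤ C₄} {G₂₃ : C₂ ⥤ C₃ ⥤ C₂₃}
  (α : bifunctorComp₁₂ F₁₂ G ≅ bifunctorComp₂₃ F G₂₃)

/-- The component of an associator of bifunctors. -/
def associatorApp (X₁ : C₁) (X₂ : C₂) (X₃ : C₃) :
    (G.obj ((F₁₂.obj X₁).obj X₂)).obj X₃ ⟶ (F.obj X₁).obj ((G₂₃.obj X₂).obj X₃) :=
  ((α.hom.app X₁).app X₂).app X₃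

theorem associatorApp_naturality {X₁ Y₁ : C₁} {X₂ Y₂ : C₂} {X₃ Y₃ : C₃} (f₁ : X₁ ⟶ Y₁)
    (f₂ : X₂ ⟶ Y₂) (f₃ : X₃ ⟶ Y₃) :
    (G.map ((F₁₂.map f₁).app X₂ ≫ (F₁₂.obj Y₁).map f₂)).app X₃ ≫
      (G.obj ((F₁₂.obj Y₁).obj Y₂)).map f₃ ≫ associatorApp α Y₁ Y₂ Y₃ =
    associatorApp α X₁ X₂ X₃ ≫ (F.map f₁).app _ ≫
      (F.obj Y₁).map ((G₂₃.map f₂).app X₃ ≫ (G₂₃.obj Y₂).map f₃) := by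
  have n₁ : (G.map ((F₁₂.map f₁).app X₂)).app X₃ ≫ associatorApp α Y₁ X₂ X₃ =
      associatorApp α X₁ X₂ X₃ ≫ (F.map f₁).app ((G₂₃.obj X₂).obj X₃) :=
    congr_app (congr_app (α.hom.naturality f₁) X₂) X₃
  have n₂ : (G.map ((F₁₂.obj Y₁).map f₂)).app X₃ ≫ associatorApp α Y₁ Y₂ X₃ =
      associatorApp α Y₁ X₂ X₃ ≫ (F.obj Y₁).map ((G₂₃.map f₂).app X₃) :=
    congr_app ((α.hom.app Y₁).naturality f₂) X₃
  have n₃ : (G.obj ((F₁₂.obj Y₁).obj Y₂)).map f₃ ≫ associatorApp α Y₁ Y₂ Y₃ =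
      associatorApp α Y₁ Y₂ X₃ ≫ (F.obj Y₁).map ((G₂₃.obj Y₂).map f₃) :=
    ((α.hom.app Y₁).app Y₂).naturality f₃
  rw [n₃, G.map_comp, NatTrans.comp_app, Category.assoc, reassoc_of% n₂,
    reassoc_of% n₁, Functor.map_comp]

variable [Preadditive C₁] [Preadditive C₂] [Preadditive C₃]
  [Preadditive C₁₂] [Preadditive C₂₃] [Preadditive C₄]
  [F₁₂.Additive] [∀ X, (F₁₂.obj X).Additive] [G.Additive] [∀ X, (G.obj X).Additive]
  [F.Additive] [∀ X, (F.obj X).Additive] [G₂₃.Additive] [∀ X, (G₂₃.obj X).Additive]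
  [∀ (K₁ : CochainComplex C₁ ℤ) (K₂ : CochainComplex C₂ ℤ), HasMapBifunctor K₁ K₂ F₁₂ (.up ℤ)]
  [∀ (K₁ : CochainComplex C₁₂ ℤ) (K₂ : CochainComplex C₃ ℤ), HasMapBifunctor K₁ K₂ G (.up ℤ)]
  [∀ (K₁ : CochainComplex C₁ ℤ) (K₂ : CochainComplex C₂₃ ℤ), HasMapBifunctor K₁ K₂ F (.up ℤ)]
  [∀ (K₁ : CochainComplex C₂ ℤ) (K₂ : CochainComplex C₃ ℤ), HasMapBifunctor K₁ K₂ G₂₃ (.up ℤ)]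

variable (K₁ L₁ : CochainComplex C₁ ℤ) (K₂ L₂ : CochainComplex C₂ ℤ) (K₃ L₃ : CochainComplex C₃ ℤ)
  [HasGoodTrifunctor₁₂Obj F₁₂ G K₁ K₂ K₃ (.up ℤ) (.up ℤ)]
  [HasGoodTrifunctor₂₃Obj F G₂₃ K₁ K₂ K₃ (.up ℤ) (.up ℤ) (.up ℤ)]
  [HasGoodTrifunctor₁₂Obj F₁₂ G L₁ L₂ L₃ (.up ℤ) (.up ℤ)]
  [HasGoodTrifunctor₂₃Obj F G₂₃ L₁ L₂ L₃ (.up ℤ) (.up ℤ) (.up ℤ)]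

theorem ι₁₂_mapBifunctorAssociator (i₁ i₂ i₃ j : ℤ)
    (h : ComplexShape.r (.up ℤ) (.up ℤ) (.up ℤ) (.up ℤ) (.up ℤ) (i₁, i₂, i₃) = j) :
    mapBifunctor₁₂.ι F₁₂ G K₁ K₂ K₃ (.up ℤ) (.up ℤ) i₁ i₂ i₃ j h ≫
      (mapBifunctorAssociator α K₁ K₂ K₃ (.up ℤ) (.up ℤ) (.up ℤ)).hom.f j =
    associatorApp α (K₁.X i₁) (K₂.X i₂) (K₃.X i₃) ≫
      mapBifunctor₂₃.ι F G₂₃ K₁ K₂ K₃ (.up ℤ) (.up ℤ) (.up ℤ) i₁ i₂ i₃ j h :=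
  ι_mapBifunctorAssociatorX_hom α K₁ K₂ K₃ (.up ℤ) (.up ℤ) (.up ℤ) i₁ i₂ i₃ j h

/-- Naturality of the associator of bifunctors on cochain complexes. -/
theorem mapBifunctorAssociator_naturality (f₁ : K₁ ⟶ L₁) (f₂ : K₂ ⟶ L₂) (f₃ : K₃ ⟶ L₃) :
    mapBifunctorMap (mapBifunctorMap f₁ f₂ F₁₂ (.up ℤ)) f₃ G (.up ℤ) ≫
      (mapBifunctorAssociator α L₁ L₂ L₃ (.up ℤ) (.up ℤ) (.up ℤ)).hom =
    (mapBifunctorAssociator α K₁ K₂ K₃ (.up ℤ) (.up ℤ) (.up ℤ)).hom ≫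
      mapBifunctorMap f₁ (mapBifunctorMap f₂ f₃ G₂₃ (.up ℤ)) F (.up ℤ) := by
  ext j : 1
  refine mapBifunctor₁₂.hom_ext fun i₁ i₂ i₃ h => ?_
  rw [comp_f, comp_f, reassoc_of% (ι₁₂_mapBifunctorAssociator α K₁ K₂ K₃ i₁ i₂ i₃ j h),
    reassoc_of% (ι₁₂_map K₁ L₁ K₂ L₂ K₃ L₃ f₁ f₂ f₃ i₁ i₂ i₃ j h),
    ι₁₂_mapBifunctorAssociator, ι₂₃_map]
  have n := associatorApp_naturality α (f₁.f i₁) (f₂.f i₂) (f₃.f i₃)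
  rw [reassoc_of% n]

end Assoc

/-! ### Total complexes with a factor in degree zero -/

section Single
open HomologicalComplex
universe v₁ v₂ v₃ u₁ u₂ u₃
variable {C₁ : Type u₁} {C₂ : Type u₂} {D : Type u₃} [Category.{v₁} C₁] [Category.{v₂} C₂]
  [Category.{v₃} D] [Preadditive C₁] [Preadditive C₂] [Preadditive D]
  [HasZeroObject C₁]
  (F : C₁ ⥤ C₂ ⥤ D) [F.Additive] [∀ X, (F.obj X).Additive]
  [∀ (K₁ : CochainComplex C₁ ℤ) (K₂ : CochainComplex C₂ ℤ),
    HasMapBifunctor K₁ K₂ F (ComplexShape.up ℤ)]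

/-- The inclusion of the summands which involve the only nonzero term of a complex concentrated in
degree zero, in the first variable. -/
noncomputable def singleLeftι (X : C₁) (K : CochainComplex C₂ ℤ) (q : ℤ) :
    (F.obj X).obj (K.X q) ⟶ (mapBifunctor ((single C₁ (.up ℤ) 0).obj X) K F (.up ℤ)).X q :=
  (F.map (singleObjXSelf (.up ℤ) 0 X).inv).app (K.X q) ≫
      ιMapBifunctor ((single C₁ (.up ℤ) 0).obj X) K F (.up ℤ) 0 q q (zero_add q)

theorem singleLeftι_d (X : C₁) (K : CochainComplex C₂ ℤ) {p q : ℤ} (h : (ComplexShape.up ℤ).Rel p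
    q) :
    singleLeftι F X K p ≫ (mapBifunctor ((single C₁ (.up ℤ) 0).obj X) K F (.up ℤ)).d p q =
      (F.obj X).map (K.d p q) ≫ singleLeftι F X K q := by
  rw [singleLeftι, Category.assoc, mapBifunctor.d_eq, Preadditive.comp_add, mapBifunctor.ι_D₁,
      mapBifunctor.ι_D₂, mapBifunctor.d₁_eq _ _ _ _ (show (ComplexShape.up ℤ).Rel 0 1 by simp) p q
      (by obtain rfl := h; exact add_comm _ _), mapBifunctor.d₂_eq _ _ _ _ _ h q (zero_add q)]
  simp [singleLeftι]

theorem singleLeftι_map {X Y : C₁} {K L : CochainComplex C₂ ℤ} (f : X ⟶ Y) (g : K ⟶ L) (q : ℤ) :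
    singleLeftι F X K q ≫ (mapBifunctorMap ((single C₁ (.up ℤ) 0).map f) g F (.up ℤ)).f q =
      (F.map f).app _ ≫ (F.obj Y).map (g.f q) ≫ singleLeftι F Y L q := by
  rw [singleLeftι, Category.assoc, ι_mapBifunctorMap, singleLeftι, NatTrans.naturality_assoc,
    ← NatTrans.comp_app_assoc, ← F.map_comp, ← NatTrans.comp_app_assoc, ← F.map_comp,
    single_map_f_self]
  simp

/-- The projection onto the summands which involve the only nonzero term of a complex concentrated
in degree zero, in the first variable. -/
noncomputable def singleLeftπ (X : C₁) (K : CochainComplex C₂ ℤ) (q : ℤ) :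
    (mapBifunctor ((single C₁ (.up ℤ) 0).obj X) K F (.up ℤ)).X q ⟶ (F.obj X).obj (K.X q) :=
  mapBifunctorDesc fun p r h => if hp : p = 0 then
    (F.map (singleObjXIsoOfEq (.up ℤ) 0 X p hp).hom).app _ ≫
      (F.obj X).map (K.XIsoOfEq (show r = q by subst hp; exact (zero_add r).symm.trans h)).hom
          else 0

theorem singleLeftι_π (X : C₁) (K : CochainComplex C₂ ℤ) (q : ℤ) :
    singleLeftι F X K q ≫ singleLeftπ F X K q = 𝟙 _ := by
  rw [singleLeftι, singleLeftπ, Category.assoc, ι_mapBifunctorDesc, dif_pos rfl,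
    ← NatTrans.comp_app_assoc, ← F.map_comp]
  erw [Iso.inv_hom_id]
  simp

theorem singleLeftπ_ι (X : C₁) (K : CochainComplex C₂ ℤ) (q : ℤ) :
    singleLeftπ F X K q ≫ singleLeftι F X K q = 𝟙 _ := by
  refine mapBifunctor.hom_ext fun p r h => ?_
  by_cases hp : p = 0
  · subst hp
    obtain rfl : r = q := (zero_add r).symm.trans h
    rw [singleLeftπ, ι_mapBifunctorDesc_assoc, dif_pos rfl, XIsoOfEq_rfl, Iso.refl_hom,
      CategoryTheory.Functor.map_id, Category.comp_id, singleLeftι,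
      ← NatTrans.comp_app_assoc, ← F.map_comp]
    erw [Iso.hom_inv_id]
    simp
  · refine (IsZero.eq_of_src ?_ _ _)
    have hz : IsZero (((single C₁ (.up ℤ) 0).obj X).X p) := isZero_single_obj_X _ _ _ _ hp
    rw [IsZero.iff_id_eq_zero] at hz ⊢
    rw [← NatTrans.id_app, ← F.map_id, hz, F.map_zero, NatTrans.app_zero]

/-- The total complex of a bifunctor at a complex concentrated in degree zero in the first
variable. -/
noncomputable def mapBifunctorSingleLeft (X : C₁) (K : CochainComplex C₂ ℤ) :
    ((F.obj X).mapHomologicalComplex (.up ℤ)).obj K ≅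
      mapBifunctor ((single C₁ (.up ℤ) 0).obj X) K F (.up ℤ) :=
  HomologicalComplex.Hom.isoOfComponents
    (fun q => ⟨singleLeftι F X K q, singleLeftπ F X K q, singleLeftι_π F X K q,
      singleLeftπ_ι F X K q⟩) (fun _ _ h => singleLeftι_d F X K h)

theorem mapBifunctorSingleLeft_naturality {X Y : C₁} {K L : CochainComplex C₂ ℤ} (f : X ⟶ Y)
    (g : K ⟶ L) :
    (mapBifunctorSingleLeft F X K).hom ≫ mapBifunctorMap ((single C₁ (.up ℤ) 0).map f) g F (.up ℤ) =
      (NatTrans.mapHomologicalComplex (F.map f) (.up ℤ)).app K ≫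
        ((F.obj Y).mapHomologicalComplex (.up ℤ)).map g ≫ (mapBifunctorSingleLeft F Y L).hom := by
  ext q
  exact singleLeftι_map F f g q

end Single

section SingleRight
open HomologicalComplex
universe v₁ v₂ v₃ u₁ u₂ u₃
variable {C₁ : Type u₁} {C₂ : Type u₂} {D : Type u₃} [Category.{v₁} C₁] [Category.{v₂} C₂]
  [Category.{v₃} D] [Preadditive C₁] [Preadditive C₂] [Preadditive D]
  [HasZeroObject C₂]
  (F : C₁ ⥤ C₂ ⥤ D) [F.Additive] [∀ X, (F.obj X).Additive]
  [∀ (K₁ : CochainComplex C₁ ℤ) (K₂ : CochainComplex C₂ ℤ),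
    HasMapBifunctor K₁ K₂ F (ComplexShape.up ℤ)]

/-- The inclusion of the summands which involve the only nonzero term of a complex concentrated in
degree zero, in the second variable. -/
noncomputable def singleRightι (K : CochainComplex C₁ ℤ) (Y : C₂) (q : ℤ) :
    (F.obj (K.X q)).obj Y ⟶ (mapBifunctor K ((single C₂ (.up ℤ) 0).obj Y) F (.up ℤ)).X q :=
  (F.obj (K.X q)).map (singleObjXSelf (.up ℤ) 0 Y).inv ≫
      ιMapBifunctor K ((single C₂ (.up ℤ) 0).obj Y) F (.up ℤ) q 0 q (add_zero q)

theorem singleRightι_d (K : CochainComplex C₁ ℤ) (Y : C₂) {p q : ℤ}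
    (h : (ComplexShape.up ℤ).Rel p q) :
    singleRightι F K Y p ≫ (mapBifunctor K ((single C₂ (.up ℤ) 0).obj Y) F (.up ℤ)).d p q =
      (F.map (K.d p q)).app Y ≫ singleRightι F K Y q := by
  rw [singleRightι, Category.assoc, mapBifunctor.d_eq, Preadditive.comp_add, mapBifunctor.ι_D₁,
      mapBifunctor.ι_D₂, mapBifunctor.d₂_eq _ _ _ _ _ (show (ComplexShape.up ℤ).Rel 0 1 by simp) q
      (by obtain rfl := h; rfl), mapBifunctor.d₁_eq _ _ _ _ h 0 q (add_zero q)]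
  simp [singleRightι]

theorem singleRightι_map {X Y : C₂} {K L : CochainComplex C₁ ℤ} (g : K ⟶ L) (f : X ⟶ Y) (q : ℤ) :
    singleRightι F K X q ≫ (mapBifunctorMap g ((single C₂ (.up ℤ) 0).map f) F (.up ℤ)).f q =
      (F.map (g.f q)).app _ ≫ (F.obj _).map f ≫ singleRightι F L Y q := by
  rw [singleRightι, Category.assoc, ι_mapBifunctorMap, singleRightι, NatTrans.naturality_assoc,
    ← Functor.map_comp_assoc, ← Functor.map_comp_assoc,
    single_map_f_self]
  simp

/-- The projection onto the summands which involve the only nonzero term of a complex concentrated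
in degree zero, in the second variable. -/
noncomputable def singleRightπ (K : CochainComplex C₁ ℤ) (Y : C₂) (q : ℤ) :
    (mapBifunctor K ((single C₂ (.up ℤ) 0).obj Y) F (.up ℤ)).X q ⟶ (F.obj (K.X q)).obj Y :=
  mapBifunctorDesc fun p r h => if hr : r = 0 then
    (F.obj (K.X p)).map (singleObjXIsoOfEq (.up ℤ) 0 Y r hr).hom ≫
      (F.map (K.XIsoOfEq (show p = q by subst hr; exact (add_zero p).symm.trans h)).hom).app Y
          else 0

theorem singleRightι_π (K : CochainComplex C₁ ℤ) (Y : C₂) (q : ℤ) :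
    singleRightι F K Y q ≫ singleRightπ F K Y q = 𝟙 _ := by
  rw [singleRightι, singleRightπ, Category.assoc, ι_mapBifunctorDesc, dif_pos rfl,
    ← Functor.map_comp_assoc]
  erw [Iso.inv_hom_id]
  simp

theorem singleRightπ_ι (K : CochainComplex C₁ ℤ) (Y : C₂) (q : ℤ) :
    singleRightπ F K Y q ≫ singleRightι F K Y q = 𝟙 _ := by
  refine mapBifunctor.hom_ext fun p r h => ?_
  by_cases hr : r = 0
  · subst hr
    obtain rfl : p = q := (add_zero p).symm.trans h
    rw [singleRightπ, ι_mapBifunctorDesc_assoc, dif_pos rfl, XIsoOfEq_rfl, Iso.refl_hom,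
      F.map_id, NatTrans.id_app, Category.comp_id, singleRightι, ← Functor.map_comp_assoc]
    erw [Iso.hom_inv_id]
    simp
  · refine (IsZero.eq_of_src ?_ _ _)
    have hz : IsZero (((single C₂ (.up ℤ) 0).obj Y).X r) := isZero_single_obj_X _ _ _ _ hr
    rw [IsZero.iff_id_eq_zero] at hz ⊢
    rw [← CategoryTheory.Functor.map_id, hz, Functor.map_zero]

/-- The total complex of a bifunctor at a complex concentrated in degree zero in the second
variable. -/
noncomputable def mapBifunctorSingleRight (K : CochainComplex C₁ ℤ) (Y : C₂) :
    ((F.flip.obj Y).mapHomologicalComplex (.up ℤ)).obj K ≅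
      mapBifunctor K ((single C₂ (.up ℤ) 0).obj Y) F (.up ℤ) :=
  HomologicalComplex.Hom.isoOfComponents
    (fun q => ⟨singleRightι F K Y q, singleRightπ F K Y q, singleRightι_π F K Y q,
      singleRightπ_ι F K Y q⟩) (fun _ _ h => singleRightι_d F K Y h)

theorem mapBifunctorSingleRight_naturality {X Y : C₂} {K L : CochainComplex C₁ ℤ} (g : K ⟶ L)
    (f : X ⟶ Y) :
    (mapBifunctorSingleRight F K X).hom ≫
        mapBifunctorMap g ((single C₂ (.up ℤ) 0).map f) F (.up ℤ) =
      ((F.flip.obj X).mapHomologicalComplex (.up ℤ)).map g ≫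
        (NatTrans.mapHomologicalComplex (F.flip.map f) (.up ℤ)).app L ≫
          (mapBifunctorSingleRight F L Y).hom := by
  ext q
  exact singleRightι_map F g f q

end SingleRight
end AffineBraid

/-! ### Invertible objects and cones in tensor triangulated categories -/

namespace AffineBraid
section Tensor
open Pretriangulated
universe v u
variable (𝓗 : Type u) [Category.{v} 𝓗] [Preadditive 𝓗] [HasZeroObject 𝓗] [HasShift 𝓗 ℤ]
  [∀ n : ℤ, (shiftFunctor 𝓗 n).Additive] [Pretriangulated 𝓗]

/-- A tensor product on a pretriangulated category which is exact in each variable. No coherence of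
the associativity and unit isomorphisms is required, and nothing about the connecting morphisms. -/
structure TensorTriang where
  /-- the tensor product -/
  T : 𝓗 ⥤ 𝓗 ⥤ 𝓗
  /-- the unit -/
  unit : 𝓗
  add_right : ∀ K, (T.obj K).Additive
  add_left : ∀ K, (T.flip.obj K).Additive
  exact_right : ∀ (K : 𝓗) {X Y Z : 𝓗} (f : X ⟶ Y) (g : Y ⟶ Z) (h : Z ⟶ X⟦(1 : ℤ)⟧),
    Triangle.mk f g h ∈ distTriang 𝓗 →
      ∃ h', Triangle.mk ((T.obj K).map f) ((T.obj K).map g) h' ∈ distTriang 𝓗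
  exact_left : ∀ (K : 𝓗) {X Y Z : 𝓗} (f : X ⟶ Y) (g : Y ⟶ Z) (h : Z ⟶ X⟦(1 : ℤ)⟧),
    Triangle.mk f g h ∈ distTriang 𝓗 →
      ∃ h', Triangle.mk ((T.flip.obj K).map f) ((T.flip.obj K).map g) h' ∈ distTriang 𝓗
  /-- associativity -/
  assoc : ∀ X Y Z, (T.obj ((T.obj X).obj Y)).obj Z ≅ (T.obj X).obj ((T.obj Y).obj Z)
  assoc_naturality₁ : ∀ {X X' : 𝓗} (f : X ⟶ X') (Y Z : 𝓗),
    (T.map ((T.map f).app Y)).app Z ≫ (assoc X' Y Z).hom = (assoc X Y Z).hom ≫ (T.map f).app _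
  assoc_naturality₂ : ∀ (X : 𝓗) {Y Y' : 𝓗} (f : Y ⟶ Y') (Z : 𝓗),
    (T.map ((T.obj X).map f)).app Z ≫ (assoc X Y' Z).hom =
      (assoc X Y Z).hom ≫ (T.obj X).map ((T.map f).app Z)
  assoc_naturality₃ : ∀ (X Y : 𝓗) {Z Z' : 𝓗} (f : Z ⟶ Z'),
    (T.obj _).map f ≫ (assoc X Y Z').hom =
      (assoc X Y Z).hom ≫ (T.obj X).map ((T.obj Y).map f)
  /-- the left unit isomorphism -/
  lam : ∀ X, (T.obj unit).obj X ≅ X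
  lam_naturality : ∀ {X X' : 𝓗} (f : X ⟶ X'), (T.obj unit).map f ≫ (lam X').hom = (lam X).hom ≫ f
  /-- the right unit isomorphism -/
  rho : ∀ X, (T.obj X).obj unit ≅ X
  rho_naturality : ∀ {X X' : 𝓗} (f : X ⟶ X'), (T.map f).app unit ≫ (rho X').hom = (rho X).hom ≫ f

variable {𝓗}

/-- If the first morphism `f` of a distinguished triangle `A ⟶ B ⟶ C` has a complement
`s : D ⟶ B`, then `D` is isomorphic to `C`. -/
theorem isIso_of_complement {A B C D : 𝓗} {f : A ⟶ B} {g : B ⟶ C} {h : C ⟶ A⟦(1 : ℤ)⟧}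
    (hT : Triangle.mk f g h ∈ distTriang 𝓗) (s : D ⟶ B) (r : B ⟶ A) (p : B ⟶ D)
    (h₁ : f ≫ r = 𝟙 _) (h₂ : s ≫ p = 𝟙 _) (h₃ : f ≫ p = 0) (h₄ : s ≫ r = 0)
    (h₅ : r ≫ f + p ≫ s = 𝟙 _) : IsIso (s ≫ g) := by
  let e : B ≅ A ⊞ D :=
    { hom := biprod.lift r p
      inv := biprod.desc f s
      hom_inv_id := by rw [biprod.lift_desc, h₅]
      inv_hom_id := by
        ext <;> simp [h₁, h₂, h₃, h₄] }
  have hc : f ≫ e.hom = biprod.inl := by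
    ext <;> simp [e, h₁, h₃]
  let i := isoTriangleOfIso₁₂ (Triangle.mk f g h) (binaryBiproductTriangle A D) hT
    (binaryBiproductTriangle_distinguished A D) (Iso.refl A) e (by
      change f ≫ e.hom = 𝟙 A ≫ biprod.inl
      rw [hc, Category.id_comp])
  let j : C ≅ D := Triangle.π₃.mapIso i
  have hj : g ≫ j.hom = p := by
    have : g ≫ j.hom = e.hom ≫ biprod.snd := by
      have := i.hom.comm₂
      have h' : i.hom.hom₂ = e.hom := isoTriangleOfIso₁₂_hom_hom₂ _ _ _ _ _ _ _
      rw [h'] at this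
      exact this
    rw [this]; simp [e]
  have : s ≫ g = j.inv := by
    rw [← cancel_mono j.hom, Category.assoc, hj, h₂, j.inv_hom_id]
  rw [this]
  infer_instance

theorem comp_inv_eq_of_comp_hom_eq {C : Type u} [Category.{v} C] {A B A' B' : C} {e : A ≅ B} {e'
    : A' ≅ B'} {a : A ⟶ A'}
    {b : B ⟶ B'} (h : a ≫ e'.hom = e.hom ≫ b) : b ≫ e'.inv = e.inv ≫ a := by
  rw [Iso.comp_inv_eq, Category.assoc, h, Iso.inv_hom_id_assoc]

theorem nonempty_iso_of_triangle {A B C A' B' C' : 𝓗} {f : A ⟶ B} {g : B ⟶ C}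
    {h : C ⟶ A⟦(1 : ℤ)⟧} (hT : Triangle.mk f g h ∈ distTriang 𝓗) {f' : A' ⟶ B'} {g' : B' ⟶ C'}
    {h' : C' ⟶ A'⟦(1 : ℤ)⟧} (hT' : Triangle.mk f' g' h' ∈ distTriang 𝓗) (a : A ≅ A') (b : B ≅ B')
    (hab : f ≫ b.hom = a.hom ≫ f') : Nonempty (C ≅ C') :=
  ⟨Triangle.π₃.mapIso (isoTriangleOfIso₁₂ (Triangle.mk f g h) (Triangle.mk f' g' h') hT hT' a b
      hab)⟩

theorem nonempty_iso_of_isZero {A B C : 𝓗} {f : A ⟶ B} {g : B ⟶ C}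
    {h : C ⟶ A⟦(1 : ℤ)⟧} (hT : Triangle.mk f g h ∈ distTriang 𝓗) (hA : IsZero A) :
    Nonempty (B ≅ C) := by
  have := (Triangle.isZero₁_iff_isIso₂ _ hT).1 hA
  exact ⟨@asIso _ _ _ _ g this⟩

namespace TensorTriang

variable (W : TensorTriang 𝓗)

/-- The tensor product with the order of the factors exchanged. -/
def op : TensorTriang 𝓗 where
  T := W.T.flip
  unit := W.unit
  add_right := W.add_left
  add_left := W.add_right
  exact_right := W.exact_left
  exact_left := W.exact_right
  assoc X Y Z := (W.assoc Z Y X).symm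
  assoc_naturality₁ f Y Z := comp_inv_eq_of_comp_hom_eq (W.assoc_naturality₃ Z Y f)
  assoc_naturality₂ X _ _ f Z := comp_inv_eq_of_comp_hom_eq (W.assoc_naturality₂ Z f X)
  assoc_naturality₃ X Y _ _ f := comp_inv_eq_of_comp_hom_eq (W.assoc_naturality₁ f Y X)
  lam := W.rho
  lam_naturality := W.rho_naturality
  rho := W.lam
  rho_naturality := W.lam_naturality

/-- The tensor product of two isomorphisms. -/
def isoTensor {X X' Y Y' : 𝓗} (e : X ≅ X') (f : Y ≅ Y') :
    (W.T.obj X).obj Y ≅ (W.T.obj X').obj Y' :=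
  (W.T.mapIso e).app Y ≪≫ (W.T.obj X').mapIso f

theorem isZero_right (K : 𝓗) {Z : 𝓗} (h : IsZero Z) : IsZero ((W.T.obj K).obj Z) := by
  have := W.add_right K
  rw [IsZero.iff_id_eq_zero] at h ⊢
  rw [← CategoryTheory.Functor.map_id, h, Functor.map_zero]

theorem shift_right (X Y : 𝓗) :
    Nonempty (((W.T.obj X).obj Y)⟦(1 : ℤ)⟧ ≅ (W.T.obj X).obj (Y⟦(1 : ℤ)⟧)) := by
  obtain ⟨h, hT⟩ := W.exact_right X _ _ _ (contractible_distinguished₂ Y)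
  exact nonempty_iso_of_triangle (contractible_distinguished₂ _) hT (Iso.refl _)
    ((isZero_zero _).iso (W.isZero_right X (isZero_zero _)))
    ((W.isZero_right X (isZero_zero _)).eq_of_tgt _ _)

/-- The morphism `U ⊗ X ⟶ U ⊗ X'` induced by `x` has a complement, which `U ⊗ X' ⟶ 𝟙 ⊗ X'` maps
isomorphically. -/
def Cancels {U X X' : 𝓗} (m : U ⟶ W.unit) (x : X ⟶ X') : Prop :=
  ∃ (D : 𝓗) (s : D ⟶ (W.T.obj U).obj X') (r : (W.T.obj U).obj X' ⟶ (W.T.obj U).obj X)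
    (p : (W.T.obj U).obj X' ⟶ D), (W.T.obj U).map x ≫ r = 𝟙 _ ∧ s ≫ p = 𝟙 _ ∧
      (W.T.obj U).map x ≫ p = 0 ∧ s ≫ r = 0 ∧ r ≫ (W.T.obj U).map x + p ≫ s = 𝟙 _ ∧
        IsIso (s ≫ (W.T.map m).app X')

variable {W} in
/-- The property `Cancels` depends only on the isomorphism class of the arrow. -/
theorem Cancels.of_arrow_iso {U X X' Y Y' : 𝓗} {m : U ⟶ W.unit} {x : X ⟶ X'} {y : Y ⟶ Y'}
    (h : W.Cancels m x) (e : X ≅ Y) (e' : X' ≅ Y') (he : x ≫ e'.hom = e.hom ≫ y) :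
    W.Cancels m y := by
  obtain ⟨D, s, r, p, h₁, h₂, h₃, h₄, h₅, h₆⟩ := h
  have hy : y = e.inv ≫ x ≫ e'.hom := by rw [he, Iso.inv_hom_id_assoc]
  refine ⟨D, s ≫ (W.T.obj U).map e'.hom, (W.T.obj U).map e'.inv ≫ r ≫ (W.T.obj U).map e.hom,
    (W.T.obj U).map e'.inv ≫ p, ?_, ?_, ?_, ?_, ?_, ?_⟩
  · simp only [hy, Functor.map_comp, Category.assoc]
    rw [← Functor.map_comp_assoc _ e'.hom, e'.hom_inv_id, CategoryTheory.Functor.map_id,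
      Category.id_comp, reassoc_of% h₁, ← Functor.map_comp, e.inv_hom_id,
      CategoryTheory.Functor.map_id]
  · rw [Category.assoc, ← Functor.map_comp_assoc, e'.hom_inv_id, CategoryTheory.Functor.map_id,
      Category.id_comp, h₂]
  · simp only [hy, Functor.map_comp, Category.assoc]
    rw [← Functor.map_comp_assoc _ e'.hom, e'.hom_inv_id, CategoryTheory.Functor.map_id,
      Category.id_comp, h₃, comp_zero]
  · rw [Category.assoc, ← Functor.map_comp_assoc, e'.hom_inv_id, CategoryTheory.Functor.map_id,
      Category.id_comp, reassoc_of% h₄, zero_comp]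
  · have : (W.T.obj U).map e'.inv ≫ (r ≫ (W.T.obj U).map x + p ≫ s) ≫ (W.T.obj U).map e'.hom =
        𝟙 _ := by
      rw [h₅, Category.id_comp, ← Functor.map_comp, e'.inv_hom_id, CategoryTheory.Functor.map_id]
    rw [← this]
    simp only [hy, Functor.map_comp, Category.assoc, Preadditive.add_comp, Preadditive.comp_add]
    rw [← Functor.map_comp_assoc _ e.hom, e.hom_inv_id, CategoryTheory.Functor.map_id,
      Category.id_comp]
  · rw [Category.assoc, (W.T.map m).naturality, ← Category.assoc]
    infer_instance

/-- Let `U ⟶ 𝟙 ⟶ F` and `X ⟶ X' ⟶ Y` be distinguished. If a complement of `U ⊗ X ⟶ U ⊗ X'` cancels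
against `X'`, then `F ⊗ Y` is the shift of `X`. -/
theorem cone_tensor {U F X X' Y : 𝓗} {m : U ⟶ W.unit} {f : W.unit ⟶ F} {k : F ⟶ U⟦(1 : ℤ)⟧}
    (hF : Triangle.mk m f k ∈ distTriang 𝓗) {x : X ⟶ X'} {g : X' ⟶ Y} {l : Y ⟶ X⟦(1 : ℤ)⟧}
    (hY : Triangle.mk x g l ∈ distTriang 𝓗) (hc : W.Cancels m x) :
    Nonempty ((W.T.obj F).obj Y ≅ X⟦(1 : ℤ)⟧) := by
  obtain ⟨D, s, r, p, h₁, h₂, h₃, h₄, h₅, hs⟩ := hc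
  obtain ⟨k₁, hk₁⟩ := W.exact_right U _ _ _ hY
  have := isIso_of_complement hk₁ s r p h₁ h₂ h₃ h₄ h₅
  obtain ⟨k₂, hk₂⟩ := W.exact_left Y _ _ _ hF
  obtain ⟨k₃, hk₃⟩ := W.exact_right W.unit _ _ _ hY
  have hk₄ := rot_of_distTriang _ hk₃
  -- `U ⊗ Y ≅ D ≅ 𝟙 ⊗ X'`, compatibly with the morphisms to `𝟙 ⊗ Y`, whose cones are `F ⊗ Y` and the
  -- shift of `𝟙 ⊗ X`
  have hc : (W.T.flip.obj Y).map m ≫ (Iso.refl _).hom =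
      ((asIso (s ≫ (W.T.obj U).map g)).symm ≪≫ asIso (s ≫ (W.T.map m).app X')).hom ≫
        (W.T.obj W.unit).map g := by
    change (W.T.map m).app Y ≫ 𝟙 _ = (inv (s ≫ (W.T.obj U).map g) ≫ (s ≫ (W.T.map m).app X')) ≫ _
    rw [Category.comp_id, Category.assoc, IsIso.eq_inv_comp, Category.assoc, Category.assoc,
      NatTrans.naturality]
  obtain ⟨e⟩ := nonempty_iso_of_triangle hk₂ hk₄ _ (Iso.refl _) hc
  exact ⟨e ≪≫ (shiftFunctor 𝓗 (1 : ℤ)).mapIso (W.lam X)⟩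

/-- Mutually inverse objects. -/
def Inv (B B' : 𝓗) : Prop :=
  Nonempty ((W.T.obj B).obj B' ≅ W.unit) ∧ Nonempty ((W.T.obj B').obj B ≅ W.unit)

variable {W}

theorem Inv.op {B B' : 𝓗} (h : W.Inv B B') : W.op.Inv B B' := ⟨h.2, h.1⟩

theorem Inv.symm {B B' : 𝓗} (h : W.Inv B B') : W.Inv B' B := ⟨h.2, h.1⟩

/-- Tensoring with an invertible object is an equivalence. -/
theorem Inv.isEquivalence {B B' : 𝓗} (h : W.Inv B B') : (W.T.obj B).IsEquivalence := by
  have key : ∀ {C C' : 𝓗}, W.Inv C C' → Nonempty (W.T.obj C' ⋙ W.T.obj C ≅ 𝟭 𝓗) := by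
    rintro C C' ⟨⟨e⟩, -⟩
    refine ⟨NatIso.ofComponents (fun X => (W.assoc C C' X).symm ≪≫ (W.T.mapIso e).app X ≪≫ W.lam X)
      fun {X Y} f => ?_⟩
    have h₃ := W.assoc_naturality₃ C C' f
    simp only [Functor.comp_map, Iso.trans_hom, Iso.symm_hom, Functor.id_map, Category.assoc]
    rw [← cancel_epi (W.assoc C C' X).hom, ← reassoc_of% h₃, Iso.hom_inv_id_assoc,
      Iso.hom_inv_id_assoc, ← W.lam_naturality f]
    exact (W.T.map e.hom).naturality_assoc f _
  exact (CategoryTheory.Equivalence.mk (W.T.obj B) (W.T.obj B') (key h.symm).some.symm (key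
      h).some).isEquivalence_functor

/-- If the shift of `F'` is inverse to `F` up to a shift, then `F'` is inverse to `F`. -/
theorem Inv.of_shift {F G F' : 𝓗} (h₁ : Nonempty ((W.T.obj F).obj G ≅ W.unit⟦(1 : ℤ)⟧))
    (h₂ : Nonempty ((W.T.obj G).obj F ≅ W.unit⟦(1 : ℤ)⟧)) (e : F'⟦(1 : ℤ)⟧ ≅ G) : W.Inv F F' := by
  obtain ⟨e₁⟩ := h₁
  obtain ⟨e₂⟩ := h₂
  obtain ⟨a₁⟩ := W.shift_right F F'
  obtain ⟨a₂⟩ := W.op.shift_right F F'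
  exact ⟨⟨(shiftFunctor 𝓗 (1 : ℤ)).preimageIso (a₁ ≪≫ (W.T.obj F).mapIso e ≪≫ e₁)⟩,
    ⟨(shiftFunctor 𝓗 (1 : ℤ)).preimageIso (a₂ ≪≫ (W.T.mapIso e).app F ≪≫ e₂)⟩⟩

/-- Conjugation by an invertible object. If `U ⟶ 𝟙` and `V ⟶ 𝟙` generate the abelian groups of
morphisms to the unit freely, then an isomorphism `B ⊗ U ≅ V ⊗ B` identifies them up to a sign, and
hence also their cones. -/
theorem Inv.conj {B B' : 𝓗} (hB : W.Inv B B') {U V F G : 𝓗} {m : U ⟶ W.unit} {f : W.unit ⟶ F}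
    {k : F ⟶ U⟦(1 : ℤ)⟧} (hF : Triangle.mk m f k ∈ distTriang 𝓗) {m' : V ⟶ W.unit}
    {g : W.unit ⟶ G} {l : G ⟶ V⟦(1 : ℤ)⟧} (hG : Triangle.mk m' g l ∈ distTriang 𝓗)
    (hm : ∀ φ : U ⟶ W.unit, ∃ n : ℤ, φ = n • m) (hm' : ∀ φ : V ⟶ W.unit, ∃ n : ℤ, φ = n • m')
    (hm₀ : ∀ n : ℤ, n • m = 0 → n = 0)
    (h : Nonempty ((W.T.obj B).obj U ≅ (W.T.obj V).obj B)) :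
    Nonempty ((W.T.obj B).obj F ≅ (W.T.obj G).obj B) := by
  obtain ⟨φ⟩ := h
  have := W.add_right B
  have := W.add_left B
  have := hB.isEquivalence
  have : (W.T.flip.obj B).IsEquivalence := hB.op.isEquivalence
  let τ : (W.T.obj B).obj W.unit ≅ (W.T.obj W.unit).obj B := W.rho B ≪≫ (W.lam B).symm
  obtain ⟨a, ha⟩ := hm ((W.T.obj B).preimage (φ.hom ≫ (W.T.map m').app B ≫ τ.inv))
  obtain ⟨b, hb⟩ := hm' ((W.T.flip.obj B).preimage (φ.inv ≫ (W.T.obj B).map m ≫ τ.hom))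
  have ha' : φ.hom ≫ (W.T.map m').app B ≫ τ.inv = a • (W.T.obj B).map m := by
    rw [← Functor.map_zsmul, ← ha, Functor.map_preimage]
  have hb' : φ.inv ≫ (W.T.obj B).map m ≫ τ.hom = b • (W.T.map m').app B := by
    change _ = b • (W.T.flip.obj B).map m'
    rw [← Functor.map_zsmul, ← hb, Functor.map_preimage]
  have hab : (W.T.obj B).map m = (b * a) • (W.T.obj B).map m := by
    rw [mul_smul, ← ha', ← Preadditive.comp_zsmul, ← Preadditive.zsmul_comp, ← hb']
    simp
  have hab' : (1 - b * a) • m = 0 := by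
    apply (W.T.obj B).map_injective
    rw [Functor.map_zsmul, Functor.map_zero, sub_smul, one_smul, ← hab, sub_self]
  -- `a` and `b` are inverse to each other, hence signs
  have hu : b * a = 1 := by have := hm₀ _ hab'; omega
  obtain ⟨k₁, hk₁⟩ := W.exact_right B _ _ _ hF
  obtain ⟨k₂, hk₂⟩ := W.exact_left B _ _ _ hG
  have ha'' : φ.hom ≫ (W.T.map m').app B = (a • (W.T.obj B).map m) ≫ τ.hom := by
    rw [← ha']; simp
  rcases Int.eq_one_or_neg_one_of_mul_eq_one' hu with ⟨-, rfl⟩ | ⟨-, rfl⟩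
  · refine nonempty_iso_of_triangle hk₁ hk₂ φ τ ?_
    change _ = φ.hom ≫ (W.T.map m').app B
    rw [ha'', one_smul]
  · refine nonempty_iso_of_triangle hk₁ hk₂ φ ⟨-τ.hom, -τ.inv, by simp, by simp⟩ ?_
    change _ = φ.hom ≫ (W.T.map m').app B
    rw [ha'']; simp

/-- The braid relation. The cancellations identify both `F ⊗ G ⊗ U` and `V ⊗ F ⊗ G` with the shift
of `V ⊗ U`; hence `F ⊗ G` intertwines `U` and `V`, and so it intertwines their cones. -/
theorem braid_of_cancels {U V F G F' G' : 𝓗} {m : U ⟶ W.unit} {f : W.unit ⟶ F}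
    {k : F ⟶ U⟦(1 : ℤ)⟧} (hF : Triangle.mk m f k ∈ distTriang 𝓗) {m' : V ⟶ W.unit}
    {g : W.unit ⟶ G} {l : G ⟶ V⟦(1 : ℤ)⟧} (hG : Triangle.mk m' g l ∈ distTriang 𝓗)
    (hm : ∀ φ : U ⟶ W.unit, ∃ n : ℤ, φ = n • m) (hm' : ∀ φ : V ⟶ W.unit, ∃ n : ℤ, φ = n • m')
    (hm₀ : ∀ n : ℤ, n • m = 0 → n = 0) (iF : W.Inv F F') (iG : W.Inv G G')
    (h₁ : W.Cancels m ((W.T.map m').app U)) (h₂ : W.op.Cancels m' ((W.T.obj V).map m)) :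
    Nonempty ((W.T.obj ((W.T.obj F).obj G)).obj F ≅ (W.T.obj G).obj ((W.T.obj F).obj G)) := by
  obtain ⟨k₁, hk₁⟩ := W.exact_left U _ _ _ hG
  obtain ⟨k₂, hk₂⟩ := W.exact_right V _ _ _ hF
  obtain ⟨e₁⟩ := W.cone_tensor hF hk₁ h₁
  obtain ⟨e₂⟩ := W.op.cone_tensor hG hk₂ h₂
  have hi : W.Inv ((W.T.obj F).obj G) ((W.T.obj G').obj F') := by
    refine ⟨⟨?_⟩, ⟨?_⟩⟩
    · exact W.assoc _ _ _ ≪≫ (W.T.obj F).mapIso ((W.assoc _ _ _).symm ≪≫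
        (W.T.mapIso iG.1.some).app F' ≪≫ W.lam F') ≪≫ iF.1.some
    · exact W.assoc _ _ _ ≪≫ (W.T.obj G').mapIso ((W.assoc _ _ _).symm ≪≫
        (W.T.mapIso iF.2.some).app G ≪≫ W.lam G) ≪≫ iG.2.some
  exact hi.conj hF hG hm hm' hm₀ ⟨W.assoc _ _ _ ≪≫ e₁ ≪≫ e₂.symm ≪≫ W.assoc V F G⟩

/-- The commutation relation. If `U ⊗ V` and `V ⊗ U` vanish, then `F ⊗ V ≅ V ≅ V ⊗ F`, so that
conjugation by `F` fixes `V` and hence the cone of `V ⟶ 𝟙`. -/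
theorem comm_of_isZero {U V F G F' : 𝓗} {m : U ⟶ W.unit} {f : W.unit ⟶ F}
    {k : F ⟶ U⟦(1 : ℤ)⟧} (hF : Triangle.mk m f k ∈ distTriang 𝓗) {m' : V ⟶ W.unit}
    {g : W.unit ⟶ G} {l : G ⟶ V⟦(1 : ℤ)⟧} (hG : Triangle.mk m' g l ∈ distTriang 𝓗)
    (hm' : ∀ φ : V ⟶ W.unit, ∃ n : ℤ, φ = n • m')
    (hm₀ : ∀ n : ℤ, n • m' = 0 → n = 0) (iF : W.Inv F F')
    (h₁ : IsZero ((W.T.obj U).obj V)) (h₂ : IsZero ((W.T.obj V).obj U)) :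
    Nonempty ((W.T.obj F).obj G ≅ (W.T.obj G).obj F) := by
  obtain ⟨k₁, hk₁⟩ := W.exact_left V _ _ _ hF
  obtain ⟨k₂, hk₂⟩ := W.exact_right V _ _ _ hF
  obtain ⟨e₁⟩ := nonempty_iso_of_isZero hk₁ h₁
  obtain ⟨e₂⟩ := nonempty_iso_of_isZero hk₂ h₂
  exact iF.conj hG hG hm' hm' hm₀ ⟨e₁.symm ≪≫ W.lam V ≪≫ (W.rho V).symm ≪≫ e₂⟩

variable (W)

/-- The set of isomorphism classes of objects. -/
def IsoClass (_ : TensorTriang 𝓗) : Type u := Quotient (isIsomorphicSetoid 𝓗)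

/-- The isomorphism class of an object. -/
def cls (X : 𝓗) : W.IsoClass := Quotient.mk (isIsomorphicSetoid 𝓗) X

variable {W} in
theorem cls_eq_iff {X Y : 𝓗} : W.cls X = W.cls Y ↔ Nonempty (X ≅ Y) := Quotient.eq

/-- The tensor product of isomorphism classes is a monoid; no coherence is required for this. -/
instance : Monoid W.IsoClass where
  mul := Quotient.map₂ (fun X Y => (W.T.obj X).obj Y)
    (fun _ _ ⟨e⟩ _ _ ⟨e'⟩ => ⟨W.isoTensor e e'⟩)
  one := W.cls W.unit
  mul_assoc := by
    rintro ⟨X⟩ ⟨Y⟩ ⟨Z⟩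
    exact Quotient.sound ⟨W.assoc X Y Z⟩
  one_mul := by
    rintro ⟨X⟩
    exact Quotient.sound ⟨W.lam X⟩
  mul_one := by
    rintro ⟨X⟩
    exact Quotient.sound ⟨W.rho X⟩

variable {W} in
/-- The unit of the monoid of isomorphism classes given by an invertible object. -/
def Inv.unit {B B' : 𝓗} (h : W.Inv B B') : W.IsoClassˣ where
  val := W.cls B
  inv := W.cls B'
  val_inv := cls_eq_iff.2 h.1
  inv_val := cls_eq_iff.2 h.2

end TensorTriang
end Tensor
end AffineBraid

/-! ### Associativity, coproducts and units for bimodules -/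

namespace AffineBraid
namespace TriBimod
section Assoc
variable {A B C D : TriRing}

/-- The balanced map defining the associativity isomorphism. -/
def assocAux (M : TriBimod A B) (N : TriBimod B C) (P : TriBimod C D) :
    Tensor M N →+ P →+ Tensor M (tensorObj N P) :=
  tensorLift
    (AddMonoidHom.mk' (fun m => AddMonoidHom.mk'
      (fun n => (tmulHom m).comp (tmulHom (M := N) (N := P) n))
      (fun n n' => by ext p; simp))
      (fun m m' => by ext n p; simp))
    (fun m b n => by
      ext p
      change tmul (MulOpposite.op b • m) (tmul n p : tensorObj N P) =
        tmul (N := tensorObj N P) m (tmul (b • n) p)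
      rw [tmul_balanced, smul_tmul'])

@[simp] theorem assocAux_tmul (M : TriBimod A B) (N : TriBimod B C) (P : TriBimod C D) (m : M)
    (n : N) (p : P) : assocAux M N P (tmul m n) p = tmul m (tmul n p : tensorObj N P) := rfl

/-- The map `(m ⊗ n) ⊗ p ↦ m ⊗ (n ⊗ p)`. -/
def assocHom (M : TriBimod A B) (N : TriBimod B C) (P : TriBimod C D) :
    tensorObj (tensorObj M N) P ⟶ tensorObj M (tensorObj N P) :=
  tensorDesc (P := tensorObj M (tensorObj N P)) (assocAux M N P)
    (fun x c p => by
      induction x using tensor_induction with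
      | h₀ => simp
      | h₁ m n => rw [op_smul_tmul, assocAux_tmul, assocAux_tmul, tmul_balanced]
      | h₂ x y hx hy => simp only [smul_add, map_add, AddMonoidHom.add_apply, hx, hy])
    (fun a x p => by
      induction x using tensor_induction with
      | h₀ => simp
      | h₁ m n => rw [smul_tmul', assocAux_tmul, assocAux_tmul, smul_tmul']
      | h₂ x y hx hy => simp only [smul_add, map_add, AddMonoidHom.add_apply, hx, hy])
    (fun d x p => by
      induction x using tensor_induction with
      | h₀ => simp
      | h₁ m n => rw [assocAux_tmul, assocAux_tmul, op_smul_tmul, op_smul_tmul]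
      | h₂ x y hx hy => simp only [smul_add, map_add, AddMonoidHom.add_apply, hx, hy])
    (fun {α β x p} hx hp => by
      induction hx using AddSubgroup.closure_induction with
      | mem x h =>
        obtain ⟨γ, δ, m, n, hm, hn, rfl, rfl⟩ := h
        rw [assocAux_tmul, add_assoc]
        exact tmul_mem hm (tmul_mem hn hp)
      | zero => rw [map_zero]; exact zero_mem _
      | add x y _ _ hx hy => rw [map_add]; exact add_mem hx hy
      | neg x _ hx => rw [map_neg]; exact neg_mem hx)

/-- The balanced map defining the inverse of the associativity isomorphism. -/
def assocInvAux (M : TriBimod A B) (N : TriBimod B C) (P : TriBimod C D) :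
    M →+ Tensor N P →+ Tensor (tensorObj M N) P :=
  AddMonoidHom.mk' (fun m => tensorLift
      (AddMonoidHom.mk' (fun n => tmulHom (tmul m n : tensorObj M N))
        (fun n n' => by ext p; simp [tmul_add]))
      (fun n c p => by
        change tmul (M := tensorObj M N) (tmul m (MulOpposite.op c • n)) p =
          tmul (M := tensorObj M N) (tmul m n) (c • p)
        rw [← tmul_balanced, op_smul_tmul]))
    (fun m m' => tensor_hom_ext fun n p => by
      simp [add_tmul])

@[simp] theorem assocInvAux_tmul (M : TriBimod A B) (N : TriBimod B C) (P : TriBimod C D) (m : M)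
    (n : N) (p : P) : assocInvAux M N P m (tmul n p) = tmul (tmul m n : tensorObj M N) p := rfl

/-- The map `m ⊗ (n ⊗ p) ↦ (m ⊗ n) ⊗ p`. -/
def assocInv (M : TriBimod A B) (N : TriBimod B C) (P : TriBimod C D) :
    tensorObj M (tensorObj N P) ⟶ tensorObj (tensorObj M N) P :=
  tensorDesc (P := tensorObj (tensorObj M N) P) (assocInvAux M N P)
    (fun m b x => by
      induction x using tensor_induction with
      | h₀ => simp
      | h₁ n p => rw [smul_tmul', assocInvAux_tmul, assocInvAux_tmul, tmul_balanced]
      | h₂ x y hx hy => simp only [smul_add, map_add, hx, hy])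
    (fun a m x => by
      induction x using tensor_induction with
      | h₀ => simp
      | h₁ n p => rw [assocInvAux_tmul, assocInvAux_tmul, smul_tmul', smul_tmul']
      | h₂ x y hx hy => simp only [smul_add, map_add, hx, hy])
    (fun d m x => by
      induction x using tensor_induction with
      | h₀ => simp
      | h₁ n p => rw [op_smul_tmul, assocInvAux_tmul, assocInvAux_tmul, op_smul_tmul]
      | h₂ x y hx hy => simp only [smul_add, map_add, hx, hy])
    (fun {α β m x} hm hx => by
      induction hx using AddSubgroup.closure_induction with
      | mem x h =>
        obtain ⟨γ, δ, n, p, hn, hp, rfl, rfl⟩ := h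
        rw [assocInvAux_tmul, ← add_assoc]
        exact tmul_mem (tmul_mem hm hn) hp
      | zero => rw [map_zero]; exact zero_mem _
      | add x y _ _ hx hy => rw [map_add]; exact add_mem hx hy
      | neg x _ hx => rw [map_neg]; exact neg_mem hx)

theorem tensor₁₂_hom_ext {M : TriBimod A B} {N : TriBimod B C} {P : TriBimod C D}
    {X : TriBimod A D} {f g : tensorObj (tensorObj M N) P ⟶ X}
    (h : ∀ m n p, Hom.toFun f (tmul (tmul m n : tensorObj M N) p) =
      Hom.toFun g (tmul (tmul m n : tensorObj M N) p)) : f = g :=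
  tensorObj_hom_ext fun x p => by
    induction x using tensor_induction with
    | h₀ => rw [zero_tmul, map_zero, map_zero]
    | h₁ m n => exact h m n p
    | h₂ x y hx hy => rw [add_tmul, map_add, map_add, hx, hy]

theorem tensor₂₃_hom_ext {M : TriBimod A B} {N : TriBimod B C} {P : TriBimod C D}
    {X : TriBimod A D} {f g : tensorObj M (tensorObj N P) ⟶ X}
    (h : ∀ m n p, Hom.toFun f (tmul m (tmul n p : tensorObj N P)) =
      Hom.toFun g (tmul m (tmul n p : tensorObj N P))) : f = g :=
  tensorObj_hom_ext fun m x => by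
    induction x using tensor_induction with
    | h₀ => rw [tmul_zero, map_zero, map_zero]
    | h₁ n p => exact h m n p
    | h₂ x y hx hy => rw [tmul_add, map_add, map_add, hx, hy]

/-- Associativity of the tensor product. -/
def tensorAssoc (M : TriBimod A B) (N : TriBimod B C) (P : TriBimod C D) :
    tensorObj (tensorObj M N) P ≅ tensorObj M (tensorObj N P) where
  hom := assocHom M N P
  inv := assocInv M N P
  hom_inv_id := tensor₁₂_hom_ext fun _ _ _ => rfl
  inv_hom_id := tensor₂₃_hom_ext fun _ _ _ => rfl

variable (A B C D) in
/-- Associativity of the tensor product, as an isomorphism of trifunctors. -/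
def tensorFunctorAssoc :
    bifunctorComp₁₂ (tensorFunctor A B C) (tensorFunctor A C D) ≅
      bifunctorComp₂₃ (tensorFunctor A B D) (tensorFunctor B C D) :=
  NatIso.ofComponents (fun M => NatIso.ofComponents (fun N => NatIso.ofComponents
      (fun P => tensorAssoc M N P)
      (fun _ => tensor₁₂_hom_ext fun _ _ _ => rfl))
    (fun _ => by ext1; ext1; exact tensor₁₂_hom_ext fun _ _ _ => rfl))
  (fun _ => by ext1; ext1; ext1; ext1; exact tensor₁₂_hom_ext fun _ _ _ => rfl)

end Assoc

section Coproducts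
variable {A B C : TriRing} {J : Type}

open Classical in
/-- The universal property of the cofan of inclusions into a direct sum. -/
noncomputable def directSumIsColimit (M : J → TriBimod A B) :
    IsColimit (Cofan.mk (directSum M) (directSumι M)) := by
  refine Cofan.IsColimit.mk _ (fun s => directSumDesc M s.inj) ?_ ?_
  · intro s j
    ext m
    exact DirectSum.toAddMonoid_of (fun j => (s.inj j).toFun) j m
  · intro s f hf
    refine Hom.ext ?_
    refine DirectSum.addHom_ext (γ := s.pt) fun j y => ?_
    have := congrArg (fun g => Hom.toFun g y) (hf j)
    refine this.trans ?_
    exact (DirectSum.toAddMonoid_of (fun j => (s.inj j).toFun) j y).symm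

theorem directSum_induction {M : J → TriBimod A B} {p : directSum M → Prop} (h₀ : p 0)
    (h₁ : ∀ j m, p (Hom.toFun (directSumι M j) m)) (h₂ : ∀ x y, p x → p y → p (x + y))
    (x : directSum M) : p x := by
  classical
  induction x using DirectSum.induction_on with
  | zero => exact h₀
  | of j y => exact h₁ j y
  | add x y hx hy => exact h₂ x y hx hy

theorem directSum_mem {M : J → TriBimod A B} {γ : TriDeg} {x : directSum M}
    (hx : x ∈ (directSum M).gr γ) {p : directSum M → Prop} (h₀ : p 0)
    (h₁ : ∀ j, ∀ m ∈ (M j).gr γ, p (Hom.toFun (directSumι M j) m))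
    (h₂ : ∀ x y, p x → p y → p (x + y)) : p x := by
  classical
  have h : x = _ := (DirectSum.sum_support_of x).symm
  rw [h]
  refine Finset.sum_induction _ p h₂ h₀ fun j _ => h₁ j (x j) (hx j)

/-- The map out of `M ⊗ ⨁ N_j` given by maps out of the `M ⊗ N_j`. -/
noncomputable def tensorDirectSumDesc (M : TriBimod A B) {N : J → TriBimod B C} {P : TriBimod A C}
    (f : ∀ j, tensorObj M (N j) ⟶ P) : tensorObj M (directSum N) ⟶ P := by
  classical
  refine tensorDesc (P := P) (AddMonoidHom.mk' (fun m => (DirectSum.toAddMonoid fun j =>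
      (f j).toFun.comp (tmulHom m) : DirectSum J (fun j => (N j : Type)) →+ P)) ?_) ?_ ?_ ?_ ?_
  · intro m m'
    refine DirectSum.addHom_ext (γ := P) fun j y => ?_
    simp
  · intro m b x
    induction x using directSum_induction with
    | h₀ => simp
    | h₁ j n =>
      rw [← (directSumι N j).map_smul]
      simp only [AddMonoidHom.mk'_apply]
      erw [DirectSum.toAddMonoid_of, DirectSum.toAddMonoid_of]
      simp only [AddMonoidHom.comp_apply, tmulHom_apply]
      rw [tmul_balanced]
    | h₂ x y hx hy => rw [smul_add, map_add, map_add, hx, hy]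
  · intro a m x
    induction x using directSum_induction with
    | h₀ => simp
    | h₁ j n =>
      simp only [AddMonoidHom.mk'_apply]
      erw [DirectSum.toAddMonoid_of, DirectSum.toAddMonoid_of]
      simp only [AddMonoidHom.comp_apply, tmulHom_apply]
      rw [← smul_tmul', (f j).map_smul]
    | h₂ x y hx hy => rw [map_add, map_add, smul_add, hx, hy]
  · intro c m x
    induction x using directSum_induction with
    | h₀ => simp
    | h₁ j n =>
      rw [← (directSumι N j).map_op_smul]
      simp only [AddMonoidHom.mk'_apply]
      erw [DirectSum.toAddMonoid_of, DirectSum.toAddMonoid_of]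
      simp only [AddMonoidHom.comp_apply, tmulHom_apply]
      rw [← op_smul_tmul, (f j).map_op_smul]
    | h₂ x y hx hy => rw [smul_add, map_add, map_add, smul_add, hx, hy]
  · intro α β m x hm hx
    refine directSum_mem (p := fun x => _ ∈ P.gr (α + β)) hx ?_ ?_ ?_
    · rw [map_zero]; exact zero_mem _
    · intro j n hn
      simp only [AddMonoidHom.mk'_apply]
      erw [DirectSum.toAddMonoid_of]
      exact (f j).map_gr (tmul_mem hm hn)
    · intro x y hx hy
      rw [map_add]; exact add_mem hx hy

/-- The map out of `(⨁ N_j) ⊗ P` given by maps out of the `N_j ⊗ P`. -/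
noncomputable def directSumTensorDesc {N : J → TriBimod A B} (P : TriBimod B C) {X : TriBimod A C}
    (f : ∀ j, tensorObj (N j) P ⟶ X) : tensorObj (directSum N) P ⟶ X := by
  classical
  let F : DirectSum J (fun j => (N j : Type)) →+ P →+ X := DirectSum.toAddMonoid fun j =>
    (AddMonoidHom.compHom (f j).toFun).comp tmulHom
  have hF : ∀ j n p, F (Hom.toFun (directSumι N j) n) p = Hom.toFun (f j) (tmul n p) :=
    fun j n p => DFunLike.congr_fun (DirectSum.toAddMonoid_of (fun j =>
      (AddMonoidHom.compHom (f j).toFun).comp tmulHom) j n) p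
  refine tensorDesc (P := X) F ?_ ?_ ?_ ?_
  · intro x b p
    induction x using directSum_induction with
    | h₀ => simp
    | h₁ j n =>
      rw [← (directSumι N j).map_op_smul]
      rw [hF, hF, tmul_balanced]
    | h₂ x y hx hy =>
      rw [smul_add, map_add, map_add, AddMonoidHom.add_apply, AddMonoidHom.add_apply, hx, hy]
  · intro a x p
    induction x using directSum_induction with
    | h₀ => simp
    | h₁ j n =>
      rw [← (directSumι N j).map_smul]
      rw [hF, hF, ← smul_tmul', (f j).map_smul]
    | h₂ x y hx hy =>
      rw [smul_add, map_add, map_add, AddMonoidHom.add_apply, AddMonoidHom.add_apply, smul_add,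
        hx, hy]
  · intro c x p
    induction x using directSum_induction with
    | h₀ => simp
    | h₁ j n =>
      rw [hF, hF, ← op_smul_tmul, (f j).map_op_smul]
    | h₂ x y hx hy =>
      rw [map_add, AddMonoidHom.add_apply, AddMonoidHom.add_apply, smul_add, hx, hy]
  · intro α β x p hx hp
    refine directSum_mem (p := fun x => F x p ∈ X.gr (α + β)) hx ?_ ?_ ?_
    · rw [map_zero]; exact zero_mem _
    · intro j n hn
      rw [hF]
      exact (f j).map_gr (tmul_mem hn hp)
    · intro x y hx hy
      rw [map_add]; exact add_mem hx hy

theorem tensorDirectSumDesc_tmul (M : TriBimod A B) {N : J → TriBimod B C} {P : TriBimod A C}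
    (f : ∀ j, tensorObj M (N j) ⟶ P) (m : M) (j : J) (n : N j) :
    Hom.toFun (tensorDirectSumDesc M f) (tmul m (Hom.toFun (directSumι N j) n)) =
      Hom.toFun (f j) (tmul m n) := by
  classical
  exact DirectSum.toAddMonoid_of (fun j => (f j).toFun.comp (tmulHom m)) j n

theorem directSumTensorDesc_tmul {N : J → TriBimod A B} (P : TriBimod B C) {X : TriBimod A C}
    (f : ∀ j, tensorObj (N j) P ⟶ X) (j : J) (n : N j) (p : P) :
    Hom.toFun (directSumTensorDesc P f) (tmul (Hom.toFun (directSumι N j) n) p) =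
      Hom.toFun (f j) (tmul n p) := by
  classical
  exact DFunLike.congr_fun (DirectSum.toAddMonoid_of (fun j =>
    (AddMonoidHom.compHom (f j).toFun).comp tmulHom) j n) p

instance (M : TriBimod A B) (N : J → TriBimod B C) :
    PreservesColimit (Discrete.functor N) ((tensorFunctor A B C).obj M) := by
  refine preservesColimit_of_preserves_colimit_cocone (directSumIsColimit N) ?_
  refine (isColimitMapCoconeCofanMkEquiv _ _ _).symm ?_
  refine Cofan.IsColimit.mk _ (fun s => tensorDirectSumDesc M s.inj) ?_ ?_
  · intro s j
    exact tensorObj_hom_ext fun m n => tensorDirectSumDesc_tmul M s.inj m j n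
  · intro s f hf
    refine tensorObj_hom_ext fun m x => ?_
    induction x using directSum_induction with
    | h₀ => rw [tmul_zero, map_zero, map_zero]
    | h₁ j n =>
      exact (congrArg (fun g => Hom.toFun g (tmul m n)) (hf j)).trans
        (tensorDirectSumDesc_tmul M s.inj m j n).symm
    | h₂ x y hx hy => rw [tmul_add, map_add, map_add, hx, hy]

instance (P : TriBimod B C) (N : J → TriBimod A B) :
    PreservesColimit (Discrete.functor N) ((tensorFunctor A B C).flip.obj P) := by
  refine preservesColimit_of_preserves_colimit_cocone (directSumIsColimit N) ?_
  refine (isColimitMapCoconeCofanMkEquiv _ _ _).symm ?_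
  refine Cofan.IsColimit.mk _ (fun s => directSumTensorDesc P s.inj) ?_ ?_
  · intro s j
    exact tensorObj_hom_ext fun n p => directSumTensorDesc_tmul P s.inj j n p
  · intro s f hf
    refine tensorObj_hom_ext fun x p => ?_
    induction x using directSum_induction with
    | h₀ => rw [zero_tmul, map_zero, map_zero]
    | h₁ j n =>
      exact (congrArg (fun g => Hom.toFun g (tmul n p)) (hf j)).trans
        (directSumTensorDesc_tmul P s.inj j n p).symm
    | h₂ x y hx hy => rw [add_tmul, map_add, map_add, hx, hy]

instance (N : TriBimod B C) : ((tensorFunctor A B C).flip.obj N).Additive where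
  map_add {_ _ _ _} := tensorObj_hom_ext fun _ _ => add_tmul _ _ _

end Coproducts

section Units
variable {n : ℕ} [Fact (3 ≤ n)] {C : TriRing}

/-- The left unit isomorphism. -/
def leftUnit (N : TriBimod (quiverRing n) C) : tensorObj (regBimod n) N ≅ N where
  hom := tensorDesc (P := N) (AddMonoidHom.mk' (fun r => DistribSMul.toAddMonoidHom N (r :
      quiverRing n))
      (fun r r' => by ext x; exact add_smul _ _ _))
    (fun r b x => mul_smul r b x)
    (fun a r x => mul_smul a r x)
    (fun c r x => smul_comm (r : quiverRing n) (MulOpposite.op c) x)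
    (fun hr hx => N.smul_mem hr hx)
  inv :=
    { toFun := tmulHom (1 : QuiverAlg n)
      map_smul := fun a x => by
        change tmul (M := regBimod n) _ _ = a • tmul (M := regBimod n) _ _
        rw [← tmul_balanced, smul_tmul']
        change tmul (M := regBimod n) (1 * a) x = tmul (M := regBimod n) (a * 1) x
        rw [one_mul, mul_one]
      map_op_smul := fun b x => rfl
      map_gr := fun {γ x} hx => by
        have := tmul_mem (M := regBimod n) (quiverRing n).one_mem hx
        rwa [zero_add] at this }
  hom_inv_id := tensorObj_hom_ext fun r x => by
    change tmul (M := regBimod n) (1 : QuiverAlg n) ((r : quiverRing n) • x) = tmul r x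
    rw [← tmul_balanced]
    change tmul (M := regBimod n) (1 * r) x = _
    rw [one_mul]
  inv_hom_id := by ext x; exact one_smul (QuiverAlg n) x

/-- The right unit isomorphism. -/
def rightUnit (N : TriBimod C (quiverRing n)) : tensorObj N (regBimod n) ≅ N where
  hom := tensorDesc (P := N) (AddMonoidHom.mk' (fun x => AddMonoidHom.mk' (fun r : QuiverAlg n =>
        (MulOpposite.op r : (quiverRing n : Type)ᵐᵒᵖ) • x) (fun r r' => add_smul (MulOpposite.op r)
          (MulOpposite.op r') x))
      (fun x x' => by ext r; exact smul_add (MulOpposite.op r) x x'))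
    (fun x b r => (mul_smul (MulOpposite.op r) (MulOpposite.op b) x).symm)
    (fun a x r => (N.smulComm.smul_comm a (MulOpposite.op r) x).symm)
    (fun c x r => mul_smul (MulOpposite.op c) (MulOpposite.op r) x)
    (fun hx hr => N.op_smul_mem hx hr)
  inv :=
    { toFun := (tmulHom (N := regBimod n)).flip (1 : QuiverAlg n)
      map_smul := fun a x => rfl
      map_op_smul := fun b x => by
        refine (tmul_balanced (N := regBimod n) x b (1 : QuiverAlg n)).trans ?_
        exact congrArg (tmul (N := regBimod n) x) ((mul_one b).trans (one_mul b).symm)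
      map_gr := fun {γ x} hx => by
        have := tmul_mem (N := regBimod n) hx (quiverRing n).one_mem
        rwa [add_zero] at this }
  hom_inv_id := tensorObj_hom_ext fun x r => by
    change tmul (N := regBimod n) ((MulOpposite.op r : (quiverRing n : Type)ᵐᵒᵖ) • x) (1 :
        QuiverAlg n)
      = tmul (N := regBimod n) x r
    rw [tmul_balanced]
    change tmul (N := regBimod n) x (r * 1) = _
    rw [mul_one]
  inv_hom_id := by ext x; exact one_smul (QuiverAlg n)ᵐᵒᵖ x

variable (n C) in
/-- The left unit isomorphism as an isomorphism of functors. -/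
def leftUnitIso : (tensorFunctor (quiverRing n) (quiverRing n) C).obj (regBimod n) ≅ 𝟭 _ :=
  NatIso.ofComponents leftUnit (fun f => tensorObj_hom_ext fun r x => (f.map_smul r x).symm)

variable (n C) in
/-- The right unit isomorphism as an isomorphism of functors. -/
def rightUnitIso :
    (tensorFunctor C (quiverRing n) (quiverRing n)).flip.obj (regBimod n) ≅ 𝟭 _ :=
  NatIso.ofComponents rightUnit (fun f => tensorObj_hom_ext fun x r => (f.map_op_smul r x).symm)

end Units
end TriBimod
end AffineBraid

/-! ### The tensor product of complexes of bimodules -/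

namespace AffineBraid
open TriBimod HomologicalComplex
section
variable (n : ℕ) [Fact (3 ≤ n)] (C : TriRing)

/-- The homotopy category of complexes of trigraded `(R_n, C)`-bimodules. -/
abbrev BHot : Type 1 := HomotopyCategory (TriBimod (quiverRing n) C) (ComplexShape.up ℤ)

/-- The tensor product over `R_n` on homotopy categories. -/
noncomputable abbrev hotTensor : BHot n (quiverRing n) ⥤ BHot n C ⥤ BHot n C :=
  map₂Hot (tensorFunctor (quiverRing n) (quiverRing n) C)

/-- The class of a complex. -/
abbrev hotQ : CochainComplex (TriBimod (quiverRing n) C) ℤ ⥤ BHot n C :=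
  HomotopyCategory.quotient _ _

variable {n C}

/-- Associativity of the tensor product of complexes. -/
noncomputable def complexAssoc (K L : CochainComplex (RBimod n) ℤ)
    (M : CochainComplex (TriBimod (quiverRing n) C) ℤ) :
    tensorComplex (tensorComplex K L) M ≅ tensorComplex K (tensorComplex L M) :=
  mapBifunctorAssociator (tensorFunctorAssoc (quiverRing n) (quiverRing n) (quiverRing n) C)
    K L M (.up ℤ) (.up ℤ) (.up ℤ)

theorem complexAssoc_naturality {K K' L L' : CochainComplex (RBimod n) ℤ}
    {M M' : CochainComplex (TriBimod (quiverRing n) C) ℤ} (f : K ⟶ K') (g : L ⟶ L') (h : M ⟶ M') :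
    mapBifunctorMap (mapBifunctorMap f g (tensorFunctor _ _ _) (.up ℤ)) h (tensorFunctor _ _ _)
      (.up ℤ) ≫ (complexAssoc K' L' M').hom = (complexAssoc K L M).hom ≫
        mapBifunctorMap f (mapBifunctorMap g h (tensorFunctor _ _ _) (.up ℤ)) (tensorFunctor _ _ _)
          (.up ℤ) :=
  mapBifunctorAssociator_naturality _ K K' L L' M M' f g h

/-- Associativity of the tensor product on homotopy categories. -/
noncomputable def hotAssoc (X Y : BHot n (quiverRing n)) (Z : BHot n C) :
    ((hotTensor n C).obj (((hotTensor n (quiverRing n)).obj X).obj Y)).obj Z ≅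
      ((hotTensor n C).obj X).obj (((hotTensor n C).obj Y).obj Z) :=
  (hotQ n C).mapIso (complexAssoc X.as Y.as Z.as)

theorem mapBifunctorMap_id' (K : CochainComplex (RBimod n) ℤ)
    (M : CochainComplex (TriBimod (quiverRing n) C) ℤ) :
    mapBifunctorMap (𝟙 K) (𝟙 M) (tensorFunctor (quiverRing n) (quiverRing n) C) (.up ℤ) = 𝟙 _ :=
  ((tensorFunctor (quiverRing n) (quiverRing n) C).map₂CochainComplex.obj K).map_id M

theorem hotAssoc_naturality₁ {X X' : BHot n (quiverRing n)} (f : X ⟶ X') (Y : BHot n (quiverRing n))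
    (Z : BHot n C) :
    ((hotTensor n C).map (((hotTensor n _).map f).app Y)).app Z ≫ (hotAssoc X' Y Z).hom =
      (hotAssoc X Y Z).hom ≫ ((hotTensor n C).map f).app _ := by
  obtain ⟨K⟩ := X
  obtain ⟨K'⟩ := X'
  obtain ⟨L⟩ := Y
  obtain ⟨M⟩ := Z
  obtain ⟨f, rfl⟩ := (hotQ n _).map_surjective f
  have := congrArg (hotQ n C).map (complexAssoc_naturality f (𝟙 L) (𝟙 M))
  rw [Functor.map_comp, Functor.map_comp, mapBifunctorMap_id'] at this
  exact this

theorem hotAssoc_naturality₂ (X : BHot n (quiverRing n)) {Y Y' : BHot n (quiverRing n)} (f : Y ⟶ Y')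
    (Z : BHot n C) :
    ((hotTensor n C).map (((hotTensor n _).obj X).map f)).app Z ≫ (hotAssoc X Y' Z).hom =
      (hotAssoc X Y Z).hom ≫ ((hotTensor n C).obj X).map (((hotTensor n C).map f).app Z) := by
  obtain ⟨K⟩ := X
  obtain ⟨L⟩ := Y
  obtain ⟨L'⟩ := Y'
  obtain ⟨M⟩ := Z
  obtain ⟨f, rfl⟩ := (hotQ n _).map_surjective f
  have := congrArg (hotQ n C).map (complexAssoc_naturality (𝟙 K) f (𝟙 M))
  rw [Functor.map_comp, Functor.map_comp] at this
  exact this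

theorem hotAssoc_naturality₃ (X Y : BHot n (quiverRing n)) {Z Z' : BHot n C} (f : Z ⟶ Z') :
    ((hotTensor n C).obj (((hotTensor n _).obj X).obj Y)).map f ≫ (hotAssoc X Y Z').hom =
      (hotAssoc X Y Z).hom ≫ ((hotTensor n C).obj X).map (((hotTensor n C).obj Y).map f) := by
  obtain ⟨K⟩ := X
  obtain ⟨L⟩ := Y
  obtain ⟨M⟩ := Z
  obtain ⟨M'⟩ := Z'
  obtain ⟨f, rfl⟩ := (hotQ n _).map_surjective f
  have := congrArg (hotQ n C).map (complexAssoc_naturality (𝟙 K) (𝟙 L) f)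
  rw [Functor.map_comp, Functor.map_comp, mapBifunctorMap_id'] at this
  exact this

variable (n C) in
/-- A bimodule as a complex in degree zero, up to homotopy. -/
noncomputable abbrev hotS : TriBimod (quiverRing n) C ⥤ BHot n C :=
  HomologicalComplex.single _ (.up ℤ) 0 ⋙ hotQ n C

end
end AffineBraid

/-! ### The tensor triangulated category of complexes of bimodules -/

namespace AffineBraid
open TriBimod HomologicalComplex
section
variable {n : ℕ} [Fact (3 ≤ n)] {C : TriRing}

/-- The left unit isomorphism for complexes. -/
noncomputable def complexLeftUnit (K : CochainComplex (TriBimod (quiverRing n) C) ℤ) :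
    tensorComplex ((single _ (.up ℤ) 0).obj (regBimod n)) K ≅ K :=
  (mapBifunctorSingleLeft _ _ _).symm ≪≫
    (NatIso.mapHomologicalComplex (leftUnitIso n C) (.up ℤ)).app K ≪≫
      (Functor.mapHomologicalComplexIdIso _ _).app K

theorem complexLeftUnit_naturality {K L : CochainComplex (TriBimod (quiverRing n) C) ℤ}
    (f : K ⟶ L) :
    mapBifunctorMap (𝟙 ((single _ (.up ℤ) 0).obj (regBimod n))) f (tensorFunctor _ _ C) (.up ℤ) ≫
      (complexLeftUnit L).hom = (complexLeftUnit K).hom ≫ f := by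
  have h := mapBifunctorSingleLeft_naturality (tensorFunctor (quiverRing n) (quiverRing n) C)
    (𝟙 (regBimod n)) f
  rw [CategoryTheory.Functor.map_id] at h
  rw [← cancel_epi (mapBifunctorSingleLeft (tensorFunctor (quiverRing n) (quiverRing n) C)
    (regBimod n) K).hom]
  refine (Category.assoc _ _ _).symm.trans ((congrArg (· ≫ _) h).trans ?_)
  ext q
  simp [complexLeftUnit]

/-- The right unit isomorphism for complexes. -/
noncomputable def complexRightUnit (K : CochainComplex (RBimod n) ℤ) :
    tensorComplex K ((single _ (.up ℤ) 0).obj (regBimod n)) ≅ K :=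
  (mapBifunctorSingleRight (tensorFunctor (quiverRing n) (quiverRing n) (quiverRing n)) _ _).symm ≪≫
    (NatIso.mapHomologicalComplex (rightUnitIso n (quiverRing n)) (.up ℤ)).app K ≪≫
      (Functor.mapHomologicalComplexIdIso _ _).app K

theorem complexRightUnit_naturality {K L : CochainComplex (RBimod n) ℤ} (f : K ⟶ L) :
    mapBifunctorMap f (𝟙 ((single _ (.up ℤ) 0).obj (regBimod n))) (tensorFunctor _ _ _) (.up ℤ) ≫
      (complexRightUnit L).hom = (complexRightUnit K).hom ≫ f := by
  have h := mapBifunctorSingleRight_naturality (tensorFunctor (quiverRing n) (quiverRing n) _)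
    f (𝟙 (regBimod n))
  rw [CategoryTheory.Functor.map_id] at h
  rw [← cancel_epi (mapBifunctorSingleRight (tensorFunctor (quiverRing n) (quiverRing n) _)
    K (regBimod n)).hom]
  refine (Category.assoc _ _ _).symm.trans ((congrArg (· ≫ _) h).trans ?_)
  ext q
  simp [complexRightUnit]

end
section
variable (n : ℕ) [Fact (3 ≤ n)]

instance (C : TriRing) (K : BHot n (quiverRing n)) : ((hotTensor n C).obj K).Additive where
  map_add {X Y f g} := by
    obtain ⟨f, rfl⟩ := (hotQ n _).map_surjective f
    obtain ⟨g, rfl⟩ := (hotQ n _).map_surjective g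
    exact (congrArg (hotQ n C).map (((tensorFunctor (quiverRing n) (quiverRing n)
      C).map₂CochainComplex.obj K.as).map_add (f := f) (g := g))).trans ((hotQ n C).map_add)

instance (K : BHot n (quiverRing n)) :
    ((hotTensor n (quiverRing n)).flip.obj K).Additive where
  map_add {X Y f g} := by
    obtain ⟨f, rfl⟩ := (hotQ n _).map_surjective f
    obtain ⟨g, rfl⟩ := (hotQ n _).map_surjective g
    exact (congrArg (hotQ n _).map (((tensorFunctor (quiverRing n) (quiverRing n)
      (quiverRing n)).map₂CochainComplex.flip.obj K.as).map_add (f := f) (g := g))).trans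
        ((hotQ n _).map_add)

/-- The homotopy category of complexes of bimodules, with the tensor product over `R_n`. -/
noncomputable def bimodTriang : TensorTriang (BHot n (quiverRing n)) where
  T := hotTensor n (quiverRing n)
  unit := (hotS n _).obj (regBimod n)
  add_right _ := inferInstance
  add_left _ := inferInstance
  exact_right K _ _ _ f g h hT := map₂Hot_obj_exact _ K f g h hT
  exact_left K _ _ _ f g h hT := map₂Hot_flip_obj_exact _ K f g h hT
  assoc := hotAssoc
  assoc_naturality₁ := hotAssoc_naturality₁
  assoc_naturality₂ := hotAssoc_naturality₂
  assoc_naturality₃ := hotAssoc_naturality₃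
  lam X := (hotQ n _).mapIso (complexLeftUnit X.as)
  lam_naturality {X X'} f := by
    obtain ⟨f, rfl⟩ := (hotQ n _).map_surjective f
    have := congrArg (hotQ n _).map (complexLeftUnit_naturality f)
    rw [Functor.map_comp, Functor.map_comp] at this
    exact this
  rho X := (hotQ n _).mapIso (complexRightUnit X.as)
  rho_naturality {X X'} f := by
    obtain ⟨f, rfl⟩ := (hotQ n _).map_surjective f
    have := congrArg (hotQ n _).map (complexRightUnit_naturality f)
    rw [Functor.map_comp, Functor.map_comp] at this
    exact this

end
end AffineBraid

/-! ### Two-term complexes as cones -/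

namespace AffineBraid
section Double
open HomologicalComplex CochainComplex Pretriangulated
universe v u
variable {𝓐 : Type u} [Category.{v} 𝓐] [Preadditive 𝓐]

theorem isIso_of_isZero {X Y : 𝓐} (g : X ⟶ Y) (hX : IsZero X) (hY : IsZero Y) : IsIso g :=
  ⟨0, hX.eq_of_src _ _, hY.eq_of_src _ _⟩

variable [HasZeroObject 𝓐] {A B : 𝓐} (f : A ⟶ B)

/-- The complex `A ⟶ B` in degrees `0` and `1`, shifted. -/
theorem nonempty_double_shift_iso (h : (ComplexShape.up ℤ).Rel 0 1) (h' : (ComplexShape.up ℤ).Rel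
    (-1) 0) :
    Nonempty ((double (c := .up ℤ) f h)⟦(1 : ℤ)⟧ ≅ double (c := .up ℤ) f h') := by
  let K := (double (c := .up ℤ) f h)⟦(1 : ℤ)⟧
  let e₀ : K.X (-1) ≅ A := doubleXIso₀ f h
  let e₁ : K.X 0 ≅ B := doubleXIso₁ f h (by omega)
  have hd : K.d (-1) 0 = -(e₀.hom ≫ f ≫ e₁.inv) := by
    have : K.d (-1) 0 = (1 : ℤ).negOnePow • (double (c := .up ℤ) f h).d 0 1 :=
      CochainComplex.shiftFunctor_obj_d' _ _ _ _
    rw [this, double_d f h (by omega), Int.negOnePow_one, Units.neg_smul, one_smul]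
    rfl
  have hzd : ∀ k, (ComplexShape.up ℤ).Rel 0 k → K.d 0 k = 0 := fun k hk => by
    obtain rfl : k = 1 := by simpa [eq_comm] using hk
    exact (isZero_double_X f h 2 (by omega) (by omega)).eq_of_tgt _ _
  let φ : double (c := .up ℤ) f h' ⟶ K := mkHomFromDouble h' (by omega) (-e₀.inv) e₁.inv
    (by rw [hd]; simp) (fun k hk => by rw [hzd k hk, comp_zero])
  have : ∀ k, IsIso (φ.f k) := fun k => by
    by_cases h₀ : k = -1
    · subst h₀
      rw [mkHomFromDouble_f₀]
      have : IsIso (-e₀.inv) := ⟨-e₀.hom, by simp, by simp⟩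
      infer_instance
    · by_cases h₁ : k = 0
      · subst h₁
        rw [mkHomFromDouble_f₁]
        infer_instance
      · exact isIso_of_isZero _ (isZero_double_X f _ k h₀ h₁)
          (isZero_double_X f h (k + 1) (by omega) (by omega))
  have := Hom.isIso_of_components φ
  exact ⟨(asIso φ).symm⟩

/-- A homotopy between morphisms of complexes concentrated in degree zero is trivial. -/
theorem eq_of_single_homotopic {g : A ⟶ B}
    (hg : (HomotopyCategory.quotient 𝓐 (.up ℤ)).map ((single 𝓐 (.up ℤ) 0).map f) =
      (HomotopyCategory.quotient 𝓐 (.up ℤ)).map ((single 𝓐 (.up ℤ) 0).map g)) : f = g := by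
  have h := HomotopyCategory.homotopyOfEq _ _ hg
  have := h.comm 0
  rw [dNext_eq _ (show (ComplexShape.up ℤ).Rel 0 1 by simp),
    prevD_eq _ (show (ComplexShape.up ℤ).Rel (-1) 0 by simp)] at this
  simp only [single_obj_d, zero_comp, comp_zero, zero_add, single_map_f_self] at this
  simpa using this

variable [HasBinaryBiproducts 𝓐]

theorem single_map_inl_comm :
    ((singleObjXSelf (.up ℤ) 0 A).inv ≫
        (mappingCone.inl ((single 𝓐 (.up ℤ) 0).map f)).v 0 (-1) (by omega)) ≫
      (mappingCone ((single 𝓐 (.up ℤ) 0).map f)).d (-1) 0 =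
    f ≫ (singleObjXSelf (.up ℤ) 0 B).inv ≫
      (mappingCone.inr ((single 𝓐 (.up ℤ) 0).map f)).f 0 := by
  rw [Category.assoc, mappingCone.inl_v_d _ 0 (-1) 1 (by omega) (by omega), single_obj_d, zero_comp,
    sub_zero, single_map_f_self]
  simp

/-- The comparison of the complex `A ⟶ B` with the mapping cone of `A[0] ⟶ B[0]`. -/
noncomputable def doubleToCone (h : (ComplexShape.up ℤ).Rel (-1) 0) :
    double (c := .up ℤ) f h ⟶ mappingCone ((single 𝓐 (.up ℤ) 0).map f) :=
  mkHomFromDouble h (by omega) _ _ (single_map_inl_comm f) (fun k hk => by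
    rw [Category.assoc, HomologicalComplex.Hom.comm, single_obj_d, zero_comp, comp_zero])

theorem isIso_doubleToCone (h : (ComplexShape.up ℤ).Rel (-1) 0) : IsIso (doubleToCone f h) := by
  have hz : ∀ (X : 𝓐) (k : ℤ), k ≠ 0 → IsZero (((single 𝓐 (.up ℤ) 0).obj X).X k) :=
    fun X k hk => isZero_single_obj_X _ _ _ _ hk
  have : ∀ k, IsIso ((doubleToCone f h).f k) := fun k => by
    by_cases h₀ : k = -1
    · subst h₀
      rw [doubleToCone, mkHomFromDouble_f₀]
      have : IsIso ((mappingCone.inl ((single 𝓐 (.up ℤ) 0).map f)).v 0 (-1) (by omega)) :=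
        ⟨(mappingCone.fst ((single 𝓐 (.up ℤ) 0).map f)).1.v (-1) 0 (by omega), by simp, by
          rw [mappingCone.ext_from_iff _ 0 (-1) (by omega)]
          exact ⟨by simp, (hz B (-1) (by omega)).eq_of_src _ _⟩⟩
      infer_instance
    · by_cases h₁ : k = 0
      · subst h₁
        rw [doubleToCone, mkHomFromDouble_f₁]
        have : IsIso ((mappingCone.inr ((single 𝓐 (.up ℤ) 0).map f)).f 0) :=
          ⟨(mappingCone.snd ((single 𝓐 (.up ℤ) 0).map f)).v 0 0 (by omega), by simp, by
            rw [mappingCone.ext_from_iff _ 1 0 (by omega)]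
            exact ⟨(hz A 1 (by omega)).eq_of_src _ _, by simp⟩⟩
        infer_instance
      · refine isIso_of_isZero _ (isZero_double_X f _ k h₀ h₁) ?_
        rw [mappingCone.isZero_X_iff]
        exact ⟨hz _ _ (by omega), hz _ _ h₁⟩
  exact Hom.isIso_of_components _

/-- A morphism `A ⟶ B` and the complex `A ⟶ B` in degrees `-1` and `0` form a triangle. -/
theorem exists_double_triangle (h : (ComplexShape.up ℤ).Rel (-1) 0) :
    ∃ (g : (HomotopyCategory.quotient 𝓐 (.up ℤ)).obj ((single 𝓐 (.up ℤ) 0).obj B) ⟶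
        (HomotopyCategory.quotient 𝓐 (.up ℤ)).obj (double (c := .up ℤ) f h)) (k : _ ⟶ _),
      Triangle.mk ((HomotopyCategory.quotient 𝓐 (.up ℤ)).map ((single 𝓐 (.up ℤ) 0).map f)) g k ∈
        distTriang (HomotopyCategory 𝓐 (.up ℤ)) := by
  have := isIso_doubleToCone f h
  let e := (HomotopyCategory.quotient 𝓐 (.up ℤ)).mapIso (asIso (doubleToCone f h))
  let T := mappingCone.triangleh ((single 𝓐 (.up ℤ) 0).map f)
  have hT : T ∈ distTriang _ := HomotopyCategory.mappingCone_triangleh_distinguished _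
  refine ⟨T.mor₂ ≫ e.inv, e.hom ≫ T.mor₃, ?_⟩
  refine isomorphic_distinguished _ hT _ (Triangle.isoMk _ _ (Iso.refl _) (Iso.refl _) e ?_ ?_ ?_)
  · exact (Category.comp_id _).trans (Category.id_comp _).symm
  · exact (Category.assoc _ _ _).trans ((congrArg (T.mor₂ ≫ ·) e.inv_hom_id).trans
      ((Category.comp_id _).trans (Category.id_comp _).symm))
  · exact (congrArg (_ ≫ ·) (CategoryTheory.Functor.map_id _ _)).trans (Category.comp_id _)

end Double
end AffineBraid

/-! ### Cancellation for bimodules -/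

namespace AffineBraid
section SingleSingle
open HomologicalComplex
universe v₁ v₂ v₃ u₁ u₂ u₃
variable {C₁ : Type u₁} {C₂ : Type u₂} {D : Type u₃} [Category.{v₁} C₁] [Category.{v₂} C₂]
  [Category.{v₃} D] [Preadditive C₁] [Preadditive C₂] [Preadditive D]
  [HasZeroObject C₁] [HasZeroObject C₂] [HasZeroObject D]
  (F : C₁ ⥤ C₂ ⥤ D) [F.Additive] [∀ X, (F.obj X).Additive]
  [∀ (K₁ : CochainComplex C₁ ℤ) (K₂ : CochainComplex C₂ ℤ),
    HasMapBifunctor K₁ K₂ F (ComplexShape.up ℤ)]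

/-- The total complex of a bifunctor at two complexes concentrated in degree zero. -/
noncomputable def mapBifunctorSingleSingle (X : C₁) (Y : C₂) :
    (single D (.up ℤ) 0).obj ((F.obj X).obj Y) ≅
      mapBifunctor ((single C₁ (.up ℤ) 0).obj X) ((single C₂ (.up ℤ) 0).obj Y) F (.up ℤ) :=
  ((singleMapHomologicalComplex (F.obj X) (.up ℤ) 0).app Y).symm ≪≫ mapBifunctorSingleLeft F X _

theorem mapBifunctorSingleSingle_naturality {X X' : C₁} {Y Y' : C₂} (f : X ⟶ X') (g : Y ⟶ Y') :
    (single D (.up ℤ) 0).map ((F.obj X).map g ≫ (F.map f).app Y') ≫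
        (mapBifunctorSingleSingle F X' Y').hom =
      (mapBifunctorSingleSingle F X Y).hom ≫
        mapBifunctorMap ((single C₁ (.up ℤ) 0).map f) ((single C₂ (.up ℤ) 0).map g) F (.up ℤ) := by
  simp only [mapBifunctorSingleSingle, Iso.trans_hom, Iso.symm_hom, Category.assoc,
    mapBifunctorSingleLeft_naturality]
  simp only [← Category.assoc]
  congr 1
  refine from_single_hom_ext ?_
  have key : ∀ {P Q : D} {Z Z' : C₂} (a : P ≅ (F.obj X).obj Y) (c : Q ≅ (F.obj X').obj Y')
      (b : Z ≅ Y) (b' : Z' ≅ Y'),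
      (a.hom ≫ ((F.obj X).map g ≫ (F.map f).app Y') ≫ c.inv) ≫ c.hom ≫ (F.obj X').map b'.inv =
        (a.hom ≫ (F.obj X).map b.inv) ≫ (F.map f).app Z ≫
          (F.obj X').map (b.hom ≫ g ≫ b'.inv) := by
    intros
    simp [← Functor.map_comp]
  simp only [comp_f, single_map_f_self, Iso.app_inv, singleMapHomologicalComplex_inv_app_self,
    NatTrans.mapHomologicalComplex_app_f, Functor.mapHomologicalComplex_map_f]
  exact (key _ _ _ _).trans (Category.assoc _ _ _).symm

end SingleSingle
section
open TriBimod HomologicalComplex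
variable {n : ℕ} [Fact (3 ≤ n)] {C : TriRing}

/-- The tensor product of bimodules in degree zero. -/
noncomputable def hotMu (M : RBimod n) (N : TriBimod (quiverRing n) C) :
    ((hotTensor n C).obj ((hotS n _).obj M)).obj ((hotS n C).obj N) ≅
      (hotS n C).obj (tensorObj M N) :=
  (hotQ n C).mapIso
    (mapBifunctorSingleSingle (tensorFunctor (quiverRing n) (quiverRing n) C) M N).symm

theorem hotMu_right (M : RBimod n) {N N' : TriBimod (quiverRing n) C} (g : N ⟶ N') :
    ((hotTensor n C).obj ((hotS n _).obj M)).map ((hotS n C).map g) ≫ (hotMu M N').hom =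
      (hotMu M N).hom ≫ (hotS n C).map (tensorMap (𝟙 M) g) := by
  have h := congrArg (hotQ n C).map (mapBifunctorSingleSingle_naturality
    (tensorFunctor (quiverRing n) (quiverRing n) C) (𝟙 M) g)
  rw [CategoryTheory.Functor.map_id, CategoryTheory.Functor.map_id, NatTrans.id_app,
    Category.comp_id, Functor.map_comp, Functor.map_comp] at h
  exact (Iso.eq_inv_comp ((hotQ n C).mapIso (mapBifunctorSingleSingle
    (tensorFunctor (quiverRing n) (quiverRing n) C) M N))).2
      ((Category.assoc _ _ _).symm.trans ((Iso.comp_inv_eq ((hotQ n C).mapIso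
        (mapBifunctorSingleSingle
          (tensorFunctor (quiverRing n) (quiverRing n) C) M N'))).2 h.symm))

theorem hotMu_left {M M' : RBimod n} (f : M ⟶ M') (N : TriBimod (quiverRing n) C) :
    ((hotTensor n C).map ((hotS n _).map f)).app ((hotS n C).obj N) ≫ (hotMu M' N).hom =
      (hotMu M N).hom ≫ (hotS n C).map (tensorMap f (𝟙 N)) := by
  have h := congrArg (hotQ n C).map (mapBifunctorSingleSingle_naturality
    (tensorFunctor (quiverRing n) (quiverRing n) C) f (𝟙 N))
  rw [CategoryTheory.Functor.map_id, CategoryTheory.Functor.map_id,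
    Category.id_comp, Functor.map_comp, Functor.map_comp] at h
  exact (Iso.eq_inv_comp ((hotQ n C).mapIso (mapBifunctorSingleSingle
    (tensorFunctor (quiverRing n) (quiverRing n) C) M N))).2
      ((Category.assoc _ _ _).symm.trans ((Iso.comp_inv_eq ((hotQ n C).mapIso
        (mapBifunctorSingleSingle
          (tensorFunctor (quiverRing n) (quiverRing n) C) M' N))).2 h.symm))

end
section
open Pretriangulated
universe v u
variable {𝓗 : Type u} [Category.{v} 𝓗] [Preadditive 𝓗] [HasZeroObject 𝓗] [HasShift 𝓗 ℤ]
  [∀ n : ℤ, (shiftFunctor 𝓗 n).Additive] [Pretriangulated 𝓗] {W : TensorTriang 𝓗}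

/-- The condition `Cancels` in terms of a morphism isomorphic to `U ⊗ X ⟶ U ⊗ X'`. -/
theorem TensorTriang.Cancels.of_splitting {U X X' A A' D : 𝓗} {m : U ⟶ W.unit} {x : X ⟶ X'}
    (μ : (W.T.obj U).obj X ≅ A) (μ' : (W.T.obj U).obj X' ≅ A') (a : A ⟶ A') (s : D ⟶ A')
    (r : A' ⟶ A) (p : A' ⟶ D) (hμ : (W.T.obj U).map x ≫ μ'.hom = μ.hom ≫ a)
    (h₁ : a ≫ r = 𝟙 _) (h₂ : s ≫ p = 𝟙 _) (h₃ : a ≫ p = 0) (h₄ : s ≫ r = 0)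
    (h₅ : r ≫ a + p ≫ s = 𝟙 _) (h₆ : IsIso (s ≫ μ'.inv ≫ (W.T.map m).app X')) :
    W.Cancels m x := by
  have hx : (W.T.obj U).map x = μ.hom ≫ a ≫ μ'.inv := by
    rw [← Category.assoc, Iso.eq_comp_inv, hμ]
  refine ⟨D, s ≫ μ'.inv, μ'.hom ≫ r ≫ μ.inv, μ'.hom ≫ p, ?_, ?_, ?_, ?_, ?_, ?_⟩
  · simp [hx, reassoc_of% h₁]
  · simp [h₂]
  · simp [hx, h₃]
  · simp [reassoc_of% h₄]
  · have := congrArg (fun φ => μ'.hom ≫ φ ≫ μ'.inv) h₅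
    simpa [hx] using this
  · rwa [Category.assoc]

end
section
open TriBimod HomologicalComplex
variable {n : ℕ} [Fact (3 ≤ n)]

/-- The condition `Cancels` for bimodules in degree zero. -/
theorem cancels_of_bimod {U X X' D : RBimod n} (m : U ⟶ regBimod n) (x : X ⟶ X')
    (s : D ⟶ tensorObj U X') (r : tensorObj U X' ⟶ tensorObj U X) (p : tensorObj U X' ⟶ D)
    (h₁ : tensorMap (𝟙 U) x ≫ r = 𝟙 _) (h₂ : s ≫ p = 𝟙 _) (h₃ : tensorMap (𝟙 U) x ≫ p = 0)
    (h₄ : s ≫ r = 0) (h₅ : r ≫ tensorMap (𝟙 U) x + p ≫ s = 𝟙 _)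
    (h₆ : IsIso (s ≫ tensorMap m (𝟙 X'))) :
    (bimodTriang n).Cancels ((hotS n _).map m) ((hotS n _).map x) := by
  refine .of_splitting (hotMu U X) (hotMu U X') ((hotS n _).map (tensorMap (𝟙 U) x))
    ((hotS n _).map s) ((hotS n _).map r) ((hotS n _).map p) (hotMu_right U x)
    (by rw [← Functor.map_comp, h₁, CategoryTheory.Functor.map_id])
    (by rw [← Functor.map_comp, h₂, CategoryTheory.Functor.map_id])
    (by rw [← Functor.map_comp, h₃, Functor.map_zero])
    (by rw [← Functor.map_comp, h₄, Functor.map_zero])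
    (by rw [← Functor.map_comp, ← Functor.map_comp, ← Functor.map_add, h₅,
      CategoryTheory.Functor.map_id]) ?_
  have h : (hotMu U X').inv ≫ ((hotTensor n _).map ((hotS n _).map m)).app ((hotS n _).obj X') =
      (hotS n _).map (tensorMap m (𝟙 X')) ≫ (hotMu (regBimod n) X').inv :=
    (Iso.inv_comp_eq _).2 ((Category.assoc _ _ _).symm.trans
      ((Iso.comp_inv_eq _).2 (hotMu_left m X').symm)).symm
  have h' : (hotS n _).map s ≫ (hotMu U X').inv ≫
      ((hotTensor n _).map ((hotS n _).map m)).app ((hotS n _).obj X') =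
      (hotS n _).map (s ≫ tensorMap m (𝟙 X')) ≫ (hotMu (regBimod n) X').inv := by
    rw [h, Functor.map_comp, Category.assoc]
  exact h'.symm ▸ (inferInstance : IsIso ((hotS n _).map (s ≫ tensorMap m (𝟙 X')) ≫
    (hotMu (regBimod n) X').inv))

/-- The mirror image of `cancels_of_bimod`. -/
theorem cancels_op_of_bimod {U X X' D : RBimod n} (m : U ⟶ regBimod n) (x : X ⟶ X')
    (s : D ⟶ tensorObj X' U) (r : tensorObj X' U ⟶ tensorObj X U) (p : tensorObj X' U ⟶ D)
    (h₁ : tensorMap x (𝟙 U) ≫ r = 𝟙 _) (h₂ : s ≫ p = 𝟙 _) (h₃ : tensorMap x (𝟙 U) ≫ p = 0)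
    (h₄ : s ≫ r = 0) (h₅ : r ≫ tensorMap x (𝟙 U) + p ≫ s = 𝟙 _)
    (h₆ : IsIso (s ≫ tensorMap (𝟙 X') m)) :
    (bimodTriang n).op.Cancels ((hotS n _).map m) ((hotS n _).map x) := by
  refine .of_splitting (hotMu X U) (hotMu X' U) ((hotS n _).map (tensorMap x (𝟙 U)))
    ((hotS n _).map s) ((hotS n _).map r) ((hotS n _).map p) (hotMu_left x U)
    (by rw [← Functor.map_comp, h₁, CategoryTheory.Functor.map_id])
    (by rw [← Functor.map_comp, h₂, CategoryTheory.Functor.map_id])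
    (by rw [← Functor.map_comp, h₃, Functor.map_zero])
    (by rw [← Functor.map_comp, h₄, Functor.map_zero])
    (by rw [← Functor.map_comp, ← Functor.map_comp, ← Functor.map_add, h₅,
      CategoryTheory.Functor.map_id]) ?_
  have h : (hotMu X' U).inv ≫ ((hotTensor n _).obj ((hotS n _).obj X')).map ((hotS n _).map m) =
      (hotS n _).map (tensorMap (𝟙 X') m) ≫ (hotMu X' (regBimod n)).inv :=
    (Iso.inv_comp_eq _).2 ((Category.assoc _ _ _).symm.trans
      ((Iso.comp_inv_eq _).2 (hotMu_right X' m).symm)).symm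
  have h' : (hotS n _).map s ≫ (hotMu X' U).inv ≫
      ((hotTensor n _).obj ((hotS n _).obj X')).map ((hotS n _).map m) =
      (hotS n _).map (s ≫ tensorMap (𝟙 X') m) ≫ (hotMu X' (regBimod n)).inv := by
    rw [h, Functor.map_comp, Category.assoc]
  exact h'.symm ▸ (inferInstance : IsIso ((hotS n _).map (s ≫ tensorMap (𝟙 X') m) ≫
    (hotMu X' (regBimod n)).inv))

end
end AffineBraid

/-! ### Morphisms from `P_i ⊗ _iP` -/

namespace AffineBraid
open TriBimod QuiverAlg MulOpposite
section
variable {n : ℕ} [Fact (3 ≤ n)] {C : TriRing}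

theorem smul_tensor (a : QuiverAlg n) {M : RBimod n} {N : TriBimod (quiverRing n) C} (m : M)
    (y : N) : a • (tmul m y : tensorObj M N) = tmul (a • m) y := smul_tmul' _ _ _

theorem tensor_balanced (b : QuiverAlg n) {M : RBimod n} {N : TriBimod (quiverRing n) C} (m : M)
    (y : N) : (tmul (op b • m) y : tensorObj M N) = tmul m (b • y) := tmul_balanced _ _ _

theorem hom_tmul_op_smul {M : RBimod n} {N Q : TriBimod (quiverRing n) C} (f : tensorObj M N ⟶ Q)
    (m : M) (c : C) (y : N) :
    Hom.toFun f (tmul m (op c • y)) = op c • Hom.toFun f (tmul m y) := f.map_op_smul c (tmul m y)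

theorem hom_smul_tmul {M : RBimod n} {N Q : TriBimod (quiverRing n) C} (f : tensorObj M N ⟶ Q)
    (a : QuiverAlg n) (m : M) (y : N) :
    Hom.toFun f (tmul (a • m) y) = a • Hom.toFun f (tmul m y) := f.map_smul a (tmul m y)

/-- The generator `(i) ⊗ (i)` of `P_i ⊗ _iP`. -/
noncomputable def projGen (i : ZMod n) : projTensor n i :=
  pureTensor i (inLeft (pathE i) (pathE_mul_pathE i)) (inRight (pathE i) (pathE_mul_pathE i))

theorem pureTensor_eq (i : ZMod n) (p : leftIdeal n i) (q : rightIdeal n i) :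
    pureTensor i p q = p.1 • op q.1 • projGen i := by
  have h₁ : p.1 • inLeft (i := i) (pathE i) (pathE_mul_pathE i) = p :=
    Subtype.ext (mul_pathE_of_mem p.2)
  have h₂ : op q.1 • inRight (i := i) (pathE i) (pathE_mul_pathE i) = q :=
    Subtype.ext (pathE_mul_of_mem q.2)
  conv_lhs => rw [← h₁, ← h₂]
  rfl

theorem pathE_smul_projGen (i : ZMod n) : pathE i • projGen i = projGen i := by
  have : pathE i • inLeft (i := i) (pathE i) (pathE_mul_pathE i) = inLeft (pathE i)
      (pathE_mul_pathE i) :=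
    Subtype.ext (pathE_mul_pathE i)
  exact congrArg (fun p => pureTensor i p (inRight (pathE i) (pathE_mul_pathE i))) this

theorem op_pathE_smul_projGen (i : ZMod n) : op (pathE i) • projGen i = projGen i := by
  have : op (pathE i) • inRight (i := i) (pathE i) (pathE_mul_pathE i) = inRight (pathE i)
      (pathE_mul_pathE i) :=
    Subtype.ext (pathE_mul_pathE i)
  exact congrArg (fun p => pureTensor i (inLeft (pathE i) (pathE_mul_pathE i)) p) this

theorem projTensor_induction {i : ZMod n} {P : projTensor n i → Prop} (h₀ : P 0)
    (h₁ : ∀ a b : QuiverAlg n, P (a • op b • projGen i)) (h₂ : ∀ x y, P x → P y → P (x + y))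
    (x : projTensor n i) : P x := by
  induction x using tensor_induction with
  | h₀ => exact h₀
  | h₁ p q =>
    have := h₁ p.1 q.1
    rwa [← pureTensor_eq] at this
  | h₂ x y hx hy => exact h₂ x y hx hy

theorem projTensor_induction' {i : ZMod n} {P : projTensor n i → Prop} (h₀ : P 0)
    (h₁ : ∀ p q, P (pureTensor i p q)) (h₂ : ∀ x y, P x → P y → P (x + y))
    (x : projTensor n i) : P x :=
  tensor_induction h₀ h₁ h₂ x

theorem projTensor_gr_induction {i : ZMod n} {γ : TriDeg} {P : projTensor n i → Prop} (h₀ : P 0)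
    (h₁ : ∀ (α β : TriDeg) (p : leftIdeal n i) (q : rightIdeal n i), p.1 ∈ pathGr (stdDeg n) α →
      q.1 ∈ pathGr (stdDeg n) β → α + β = γ → P (pureTensor i p q))
    (h₂ : ∀ x y, P x → P y → P (x + y)) (h₃ : ∀ x, P x → P (-x)) {x : projTensor n i}
    (hx : x ∈ (projTensor n i).gr γ) : P x := by
  induction hx using AddSubgroup.closure_induction with
  | mem u h =>
    obtain ⟨α, β, p, q, hp, hq, h, rfl⟩ := h
    exact h₁ α β p q hp hq h
  | zero => exact h₀
  | add u v _ _ hu hv => exact h₂ u v hu hv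
  | neg u _ hu => exact h₃ u hu

/-- The bimodule `P_i ⊗ _iP` is generated by `(i) ⊗ (i)`. -/
theorem projTensor_hom_ext {i : ZMod n} {Q : RBimod n} {f g : projTensor n i ⟶ Q}
    (h : Hom.toFun f (projGen i) = Hom.toFun g (projGen i)) : f = g := by
  refine Hom.ext (AddMonoidHom.ext fun x => ?_)
  induction x using projTensor_induction with
  | h₀ => rw [map_zero, map_zero]
  | h₁ a b =>
    refine (f.map_smul a _).trans (Eq.trans ?_ (g.map_smul a _).symm)
    refine congrArg (a • ·) ((f.map_op_smul b _).trans (Eq.trans ?_ (g.map_op_smul b _).symm))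
    rw [h]
  | h₂ x y hx hy => rw [map_add, map_add, hx, hy]

theorem projTensor_tensor_hom_ext {i : ZMod n} {N Q : TriBimod (quiverRing n) C}
    {f g : tensorObj (projTensor n i) N ⟶ Q}
    (h : ∀ y : N, Hom.toFun f (tmul (projGen i) y) = Hom.toFun g (tmul (projGen i) y)) : f = g := by
  refine tensorObj_hom_ext fun u y => ?_
  induction u using projTensor_induction with
  | h₀ => rw [zero_tmul, map_zero, map_zero]
  | h₁ a b =>
    rw [hom_smul_tmul, hom_smul_tmul, tensor_balanced, h]
  | h₂ x y hx hy => rw [add_tmul, map_add, map_add, hx, hy]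

theorem tensor_projTensor_hom_ext {i : ZMod n} {M Q : RBimod n}
    {f g : tensorObj M (projTensor n i) ⟶ Q}
    (h : ∀ m : M, Hom.toFun f (tmul m (projGen i)) = Hom.toFun g (tmul m (projGen i))) : f = g := by
  refine tensorObj_hom_ext fun m u => ?_
  induction u using projTensor_induction with
  | h₀ => rw [tmul_zero, map_zero, map_zero]
  | h₁ a b =>
    rw [smul_comm, hom_tmul_op_smul (C := quiverRing n), hom_tmul_op_smul (C := quiverRing n),
      ← tensor_balanced, h]
  | h₂ x y hx hy => rw [tmul_add, map_add, map_add, hx, hy]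

/-- The biadditive map `(p ⊗ q, y) ↦ p φ(q y)`. -/
noncomputable def projMulAux (i : ZMod n) {N Q : TriBimod (quiverRing n) C} (φ : N →+ Q) :
    projTensor n i →+ N →+ Q :=
  tensorLift (M := projLeft n i) (N := projRight n i)
    (AddMonoidHom.mk' (fun p => AddMonoidHom.mk' (fun q => AddMonoidHom.mk' (fun y =>
      p.1 • φ (q.1 • y)) (fun y y' => by rw [smul_add, map_add, smul_add]))
      (fun q q' => by
        ext y
        change p.1 • φ ((q.1 + q'.1) • y) = p.1 • φ (q.1 • y) + p.1 • φ (q'.1 • y)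
        rw [add_smul, map_add, smul_add]))
      (fun p p' => by ext q y; exact add_smul p.1 p'.1 _))
    (fun p k q => by
      ext y
      change (k • p.1) • φ (q.1 • y) = p.1 • φ ((k • q.1) • y)
      rw [smul_assoc k q.1 y, map_zsmul, smul_comm, smul_assoc])

/-- The bimodule map `(p ⊗ q) ⊗ y ↦ p φ(q y)`, for a map `φ` of right modules. -/
noncomputable def projMul (i : ZMod n) {N Q : TriBimod (quiverRing n) C} (φ : N →+ Q)
    (hr : ∀ (c : C) (y : N), φ (op c • y) = op c • φ y)
    (hg : ∀ {γ : TriDeg} {y : N}, y ∈ N.gr γ → φ y ∈ Q.gr γ) :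
    tensorObj (projTensor n i) N ⟶ Q :=
  tensorDesc (projMulAux i φ)
    (fun u b y => by
      induction u using projTensor_induction' with
      | h₀ => rw [smul_zero, map_zero]; rfl
      | h₁ p q =>
        change p.1 • φ ((q.1 * b) • y) = p.1 • φ (q.1 • (b : QuiverAlg n) • y)
        rw [mul_smul]
      | h₂ x y hx hy =>
        rw [smul_add, map_add, map_add, AddMonoidHom.add_apply, AddMonoidHom.add_apply, hx, hy])
    (fun a u y => by
      induction u using projTensor_induction' with
      | h₀ => rw [smul_zero, map_zero]; exact (smul_zero a).symm
      | h₁ p q => exact mul_smul (a : QuiverAlg n) p.1 (φ (q.1 • y))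
      | h₂ x y hx hy =>
        rw [smul_add, map_add, map_add, AddMonoidHom.add_apply, AddMonoidHom.add_apply, hx, hy]
        exact (smul_add _ _ _).symm)
    (fun c u y => by
      induction u using projTensor_induction' with
      | h₀ => rw [map_zero]; exact (smul_zero (op c)).symm
      | h₁ p q =>
        change p.1 • φ (q.1 • op c • y) = op c • p.1 • φ (q.1 • y)
        rw [smul_comm q.1 (op c) y, hr, smul_comm]
      | h₂ x y hx hy =>
        rw [map_add, AddMonoidHom.add_apply, AddMonoidHom.add_apply, hx, hy]
        exact (smul_add _ _ _).symm)
    (fun {α β u y} hu hy => by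
      refine projTensor_gr_induction (P := fun u => projMulAux i φ u y ∈ Q.gr (α + β)) ?_
        (fun α' β' p q hp hq h => ?_) (fun u v hu hv => ?_) (fun u hu => ?_) hu
      · rw [map_zero]; exact zero_mem _
      · rw [← h, add_assoc]
        exact Q.smul_mem hp (hg (N.smul_mem hq hy))
      · rw [map_add]; exact add_mem hu hv
      · rw [map_neg]; exact neg_mem hu)

theorem projMul_gen {i : ZMod n} {N Q : TriBimod (quiverRing n) C} (φ : N →+ Q)
    (hr : ∀ (c : C) (y : N), φ (op c • y) = op c • φ y)
    (hg : ∀ {γ : TriDeg} {y : N}, y ∈ N.gr γ → φ y ∈ Q.gr γ) (y : N) :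
    Hom.toFun (projMul i φ hr hg) (tmul (projGen i) y) = pathE i • φ (pathE i • y) := rfl

/-- The map `p ⊗ q ↦ ε(p) z q` of right modules. -/
noncomputable def coeffMap (i : ZMod n) {Q : RBimod n} (ε : QuiverAlg n →+ ℤ) (z : Q) :
    projTensor n i →+ Q :=
  tensorLift (M := projLeft n i) (N := projRight n i)
    (AddMonoidHom.mk' (fun p => AddMonoidHom.mk' (fun q => ε p.1 • op q.1 • z)
      (fun q q' => by
        change ε p.1 • op (q.1 + q'.1) • z = _
        exact (congrArg (ε p.1 • ·) (add_smul (op q.1) (op q'.1) z)).trans (smul_add _ _ _)))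
      (fun p p' => by
        ext q
        change ε (p.1 + p'.1) • op q.1 • z = _
        rw [map_add, add_smul]; rfl))
    (fun p k q => by
      change ε (k • p.1) • op q.1 • z = ε p.1 • op (k • q.1) • z
      rw [map_zsmul, op_smul, smul_assoc, smul_assoc, smul_comm])

theorem coeffMap_op_smul {i : ZMod n} {Q : RBimod n} (ε : QuiverAlg n →+ ℤ) (z : Q)
    (c : QuiverAlg n) (u : projTensor n i) :
    coeffMap i ε z (op c • u) = op c • coeffMap i ε z u := by
  induction u using projTensor_induction' with
  | h₀ => rw [smul_zero, map_zero, smul_zero]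
  | h₁ p q =>
    change ε p.1 • op (q.1 * c) • z = op c • ε p.1 • op q.1 • z
    rw [op_mul, mul_smul, smul_comm]
  | h₂ x y hx hy => rw [smul_add, map_add, map_add, hx, hy, smul_add]

theorem coeffMap_mem {i : ZMod n} {Q : RBimod n} {ε : QuiverAlg n →+ ℤ} {z : Q} {γ δ : TriDeg}
    (hε : ∀ {α : TriDeg} {a : QuiverAlg n}, a ∈ pathGr (stdDeg n) α → ε a ≠ 0 → α = γ)
    (hz : z ∈ Q.gr δ) {α : TriDeg} {u : projTensor n i} (hu : u ∈ (projTensor n i).gr (α + γ)) :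
    coeffMap i ε z u ∈ Q.gr (α + δ) := by
  generalize hα : α + γ = α' at hu
  refine projTensor_gr_induction (P := fun u => coeffMap i ε z u ∈ Q.gr (α + δ)) ?_
    (fun β β' p q hp hq h => ?_) (fun u v hu hv => ?_) (fun u hu => ?_) hu
  · rw [map_zero]; exact zero_mem _
  · change ε p.1 • op q.1 • z ∈ _
    by_cases h0 : ε p.1 = 0
    · rw [h0, zero_smul]; exact zero_mem _
    · obtain rfl := hε hp h0
      obtain rfl : β' = α := by
        rw [← h, add_comm] at hα
        exact (add_left_cancel hα).symm
      rw [add_comm]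
      exact zsmul_mem (Q.op_smul_mem hz hq) _
  · rw [map_add]; exact add_mem hu hv
  · rw [map_neg]; exact neg_mem hu

end
end AffineBraid

/-! ### Morphisms given by elements -/

namespace AffineBraid
open TriBimod QuiverAlg MulOpposite
section
variable {n : ℕ} [Fact (3 ≤ n)]

/-- The shift of tridegrees may be moved from one factor of a tensor product to the other. -/
def tensorShiftSwap {A B C : TriRing} (γ : TriDeg) (M : TriBimod A B) (N : TriBimod B C) :
    tensorObj ((shift γ).obj M) N ≅ tensorObj M ((shift γ).obj N) where
  hom := tensorDesc (P := tensorObj M ((shift γ).obj N)) (tmulHom (M := M) (N := N))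
    (fun m b x => tmul_balanced (M := M) (N := N) m b x) (fun a m x => (smul_tmul' _ _ _).symm)
    (fun c m x => rfl)
    (fun {α β m x} hm hx => by
      have := tmul_mem (M := M) (N := (shift γ).obj N) (α := α - γ) (β := β + γ) hm
        (show x ∈ N.gr _ by rwa [add_sub_cancel_right])
      rwa [show α - γ + (β + γ) = α + β by abel] at this)
  inv := tensorDesc (P := tensorObj ((shift γ).obj M) N) (tmulHom (M := M) (N := N))
    (fun m b x => tmul_balanced (M := M) (N := N) m b x) (fun a m x => (smul_tmul' _ _ _).symm)
    (fun c m x => rfl)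
    (fun {α β m x} hm hx => by
      have := tmul_mem (M := (shift γ).obj M) (N := N) (α := α + γ) (β := β - γ)
        (show m ∈ M.gr _ by rwa [add_sub_cancel_right]) hx
      rwa [show α + γ + (β - γ) = α + β by abel] at this)
  hom_inv_id := tensorObj_hom_ext fun m x => rfl
  inv_hom_id := tensorObj_hom_ext fun m x => rfl

/-- The map `p ⊗ q ↦ p z q`. -/
noncomputable def elemMap (i : ZMod n) {Q : RBimod n} (z : Q) : projTensor n i →+ Q :=
  tensorLift (M := projLeft n i) (N := projRight n i)
    (AddMonoidHom.mk' (fun p => AddMonoidHom.mk' (fun q => p.1 • op q.1 • z)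
      (fun q q' => (congrArg (p.1 • ·) (add_smul (op q.1) (op q'.1) z)).trans (smul_add _ _ _)))
      (fun p p' => by ext q; exact add_smul p.1 p'.1 _))
    (fun p k q => by
      change (k • p.1) • op q.1 • z = p.1 • op (k • q.1) • z
      rw [op_smul, smul_assoc, smul_assoc, smul_comm])

theorem elemMap_smul (i : ZMod n) {Q : RBimod n} (z : Q) (a : QuiverAlg n) (u : projTensor n i) :
    elemMap i z (a • u) = a • elemMap i z u := by
  induction u using projTensor_induction' with
  | h₀ => rw [smul_zero, map_zero, smul_zero]
  | h₁ p q => exact mul_smul a p.1 _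
  | h₂ x y hx hy => rw [smul_add, map_add, map_add, hx, hy, smul_add]

theorem elemMap_op_smul (i : ZMod n) {Q : RBimod n} (z : Q) (c : QuiverAlg n)
    (u : projTensor n i) : elemMap i z (op c • u) = op c • elemMap i z u := by
  induction u using projTensor_induction' with
  | h₀ => rw [smul_zero, map_zero, smul_zero]
  | h₁ p q =>
    change p.1 • op (q.1 * c) • z = op c • p.1 • op q.1 • z
    rw [op_mul, mul_smul, smul_comm]
  | h₂ x y hx hy => rw [smul_add, map_add, map_add, hx, hy, smul_add]

theorem elemMap_mem {i : ZMod n} {Q : RBimod n} {z : Q} {γ δ : TriDeg} (hz : z ∈ Q.gr δ)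
    {u : projTensor n i} (hu : u ∈ (projTensor n i).gr γ) : elemMap i z u ∈ Q.gr (γ + δ) := by
  refine projTensor_gr_induction (P := fun u => elemMap i z u ∈ Q.gr (γ + δ)) ?_
    (fun β β' p q hp hq h => ?_) (fun u v hu hv => ?_) (fun u hu => ?_) hu
  · rw [map_zero]; exact zero_mem _
  · have := Q.smul_mem hp (Q.op_smul_mem hz hq)
    rwa [show β + (δ + β') = γ + δ by rw [← h]; abel] at this
  · rw [map_add]; exact add_mem hu hv
  · rw [map_neg]; exact neg_mem hu

/-- The bimodule map `p ⊗ q ↦ p z q`, for an element `z` of degree zero. -/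
noncomputable def elemHom (i : ZMod n) {Q : RBimod n} (z : Q) (hz : z ∈ Q.gr 0) :
    projTensor n i ⟶ Q where
  toFun := elemMap i z
  map_smul a u := elemMap_smul i z a u
  map_op_smul c u := elemMap_op_smul i z c u
  map_gr := fun {γ u} hu => by
    have := elemMap_mem hz hu
    rwa [add_zero] at this

/-- The bimodule map `p ⊗ q ↦ p z q`, for a homogeneous element `z`. -/
noncomputable def elemHomShift (i : ZMod n) (γ : TriDeg) {Q : RBimod n} (z : Q) (hz : z ∈ Q.gr γ) :
    (shift γ).obj (projTensor n i) ⟶ Q where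
  toFun := elemMap i z
  map_smul a u := elemMap_smul i z a u
  map_op_smul c u := elemMap_op_smul i z c u
  map_gr := fun {δ u} hu => by
    have := elemMap_mem hz (γ := δ - γ) hu
    rwa [sub_add_cancel] at this

/-- The right module map `p ⊗ q ↦ p_e z q + p_x z' q`, where `p_e` and `p_x` are the coefficients of
`(i)` and of `(i|i+1|i)` in `p`. -/
noncomputable def loopMap (i : ZMod n) {Q : RBimod n} (z z' : Q) : projTensor n i →+ Q :=
  coeffMap i (eHom i) z + coeffMap i (xHom i) z'

theorem loopMap_smul_gen (i : ZMod n) {Q : RBimod n} (z z' : Q) (a : QuiverAlg n) :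
    loopMap i z z' (a • projGen i) = a.e i • op (pathE i) • z + a.x i • op (pathE i) • z' := by
  change (a * pathE i).e i • op (pathE i) • z + (a * pathE i).x i • op (pathE i) • z' = _
  simp [pathE]

theorem loopMap_op_smul (i : ZMod n) {Q : RBimod n} (z z' : Q) (c : QuiverAlg n)
    (u : projTensor n i) : loopMap i z z' (op c • u) = op c • loopMap i z z' u := by
  rw [loopMap, AddMonoidHom.add_apply, AddMonoidHom.add_apply, coeffMap_op_smul, coeffMap_op_smul,
    smul_add]

theorem loopMap_mem {i : ZMod n} {Q : RBimod n} {z z' : Q} {γ δ : TriDeg} (hz : z ∈ Q.gr γ)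
    (hz' : z' ∈ Q.gr (γ + (1, 0, 0))) {u : projTensor n i} (hu : u ∈ (projTensor n i).gr δ) :
    loopMap i z z' u ∈ Q.gr (δ + γ) := by
  refine add_mem (coeffMap_mem (γ := 0) (fun ha h => (ha.1 i h).symm) hz (by rwa [add_zero])) ?_
  have := coeffMap_mem (i := i) (ε := xHom i) (γ := (1, 0, 0)) (α := δ - (1, 0, 0)) (u := u)
    (fun ha h => (ha.2.2.2 i h).symm) hz' (by rwa [sub_add_cancel])
  rwa [show δ - (1, 0, 0) + (γ + (1, 0, 0)) = δ + γ by abel] at this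

/-- The bimodule map `P_i ⊗ _iP ⊗ P_i ⊗ _iP ⟶ Q` given by the images of `(i) ⊗ (i) ⊗ (i) ⊗ (i)` and
of `(i) ⊗ (i) ⊗ (i|i+1|i) ⊗ (i)`. -/
noncomputable def loopHom (i : ZMod n) {Q : RBimod n} (z z' : Q) (hz : z ∈ Q.gr 0)
    (hz' : z' ∈ Q.gr (1, 0, 0)) : tensorObj (projTensor n i) (projTensor n i) ⟶ Q :=
  projMul i (loopMap i z z') (loopMap_op_smul i z z') (fun {γ y} hy => by
    have := loopMap_mem hz (by rwa [zero_add]) hy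
    rwa [add_zero] at this)

/-- The shifted version of `loopHom`. -/
noncomputable def loopHomShift (i : ZMod n) (γ : TriDeg) {Q : RBimod n} (z z' : Q)
    (hz : z ∈ Q.gr γ) (hz' : z' ∈ Q.gr (γ + (1, 0, 0))) :
    tensorObj (projTensor n i) ((shift γ).obj (projTensor n i)) ⟶ Q :=
  projMul i (N := (shift γ).obj (projTensor n i)) (loopMap i z z') (loopMap_op_smul i z z')
    (fun {δ y} hy => by
      have := loopMap_mem hz hz' (δ := δ - γ) hy
      rwa [sub_add_cancel] at this)

end
end AffineBraid

/-! ### Adjacent vertices of the quiver -/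

namespace AffineBraid
open TriBimod QuiverAlg MulOpposite
section
variable {n : ℕ}

theorem pathE_e (i : ZMod n) : (pathE i : QuiverAlg n).e i = 1 := Pi.single_eq_same _ _

theorem pathE_mul_mul_pathE_eq_zero {i j : ZMod n} (h₀ : j ≠ i) (h₁ : j ≠ i + 1) (h₂ : j ≠ i - 1)
    (a : QuiverAlg n) : pathE i * a * pathE j = 0 := by
  ext k <;> by_cases h : k = i <;> simp [pathE, h, h₀.symm, h₁.symm, h₂.symm]

variable [Fact (3 ≤ n)] {C : TriRing}

theorem add_one_ne (i : ZMod n) : i + 1 ≠ i := fun h => one_ne_zero_zmod (n := n) (by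
  simpa using h)

theorem sub_one_ne (i : ZMod n) : i - 1 ≠ i := fun h => one_ne_zero_zmod (n := n) (by
  simpa using h)

theorem two_ne_zero_zmod : (2 : ZMod n) ≠ 0 := by
  intro h
  have h' : ((2 : ℕ) : ZMod n) = 0 := by exact_mod_cast h
  rw [ZMod.natCast_eq_zero_iff] at h'
  have := Nat.le_of_dvd (by norm_num) h'
  have := (Fact.out : 3 ≤ n)
  omega

theorem add_one_ne_sub_one (i : ZMod n) : i + 1 ≠ i - 1 := fun h =>
  two_ne_zero_zmod (n := n) (by linear_combination h)

theorem pathE_mul_mul_pathE (i : ZMod n) (a : QuiverAlg n) :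
    pathE i * a * pathE i = a.e i • pathE i + a.x i • pathX i := by
  have h₁ := add_one_ne i
  have h₂ := sub_one_ne i
  ext j <;> simp only [add_e, add_u, add_d, add_x, zsmul_e, zsmul_u, zsmul_d, zsmul_x] <;>
    by_cases h : j = i <;> simp [pathE, pathX, h, h₁, h₂]

/-- Elements `w` and `w'` spanning `(i)R_n(j)` and `(j)R_n(i)`, for adjacent vertices `i` and `j`.
-/
structure Edge (i j : ZMod n) where
  /-- the arrow from `i` to `j` -/
  w : QuiverAlg n
  /-- the arrow from `j` to `i` -/
  w' : QuiverAlg n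
  /-- the coefficient of the first arrow -/
  coeff : QuiverAlg n →+ ℤ
  /-- the coefficient of the second arrow -/
  coeff' : QuiverAlg n →+ ℤ
  /-- the tridegree of the first arrow -/
  deg : TriDeg
  /-- the tridegree of the second arrow -/
  deg' : TriDeg
  mul_mul : ∀ a, pathE i * a * pathE j = coeff a • w
  mul_mul' : ∀ a, pathE j * a * pathE i = coeff' a • w'
  coeff_mem : ∀ {γ a}, a ∈ pathGr (stdDeg n) γ → coeff a ≠ 0 → γ = deg
  coeff_mem' : ∀ {γ a}, a ∈ pathGr (stdDeg n) γ → coeff' a ≠ 0 → γ = deg'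
  mem : w ∈ pathGr (stdDeg n) deg
  mem' : w' ∈ pathGr (stdDeg n) deg'
  deg_add : deg + deg' = (1, 0, 0)
  coeff_w : coeff w = 1
  coeff_w' : coeff' w' = 1
  pathE_mul : pathE i * w = w
  pathE_mul' : pathE j * w' = w'
  mul_pathE : w * pathE j = w
  mul_pathE' : w' * pathE i = w'
  w_mul : w * w' = pathX i
  w'_mul : w' * w = pathX j

/-- The reversed edge. -/
def Edge.symm {i j : ZMod n} (E : Edge i j) : Edge j i where
  w := E.w'
  w' := E.w
  coeff := E.coeff'
  coeff' := E.coeff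
  deg := E.deg'
  deg' := E.deg
  mul_mul := E.mul_mul'
  mul_mul' := E.mul_mul
  coeff_mem := E.coeff_mem'
  coeff_mem' := E.coeff_mem
  mem := E.mem'
  mem' := E.mem
  deg_add := by rw [add_comm, E.deg_add]
  coeff_w := E.coeff_w'
  coeff_w' := E.coeff_w
  pathE_mul := E.pathE_mul'
  pathE_mul' := E.pathE_mul
  mul_pathE := E.mul_pathE'
  mul_pathE' := E.mul_pathE
  w_mul := E.w'_mul
  w'_mul := E.w_mul

/-- The edge between consecutive vertices. -/
def edgeSucc (i : ZMod n) : Edge i (i + 1) where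
  w := pathU i
  w' := pathD (i + 1)
  coeff := uHom i
  coeff' := dHom (i + 1)
  deg := (stdDeg n).u i
  deg' := (stdDeg n).d (i + 1)
  mul_mul a := by
    have h₁ := add_one_ne i
    have h₂ := add_one_ne_sub_one i
    ext j <;> simp only [zsmul_e, zsmul_u, zsmul_d, zsmul_x] <;> by_cases h : j = i <;>
      simp [pathE, pathU, h, h₁.symm, h₂.symm, uHom]
  mul_mul' a := by
    have h₁ := add_one_ne i
    have h₂ := add_one_ne_sub_one (i + 1)
    rw [add_sub_cancel_right] at h₂
    ext j <;> simp only [zsmul_e, zsmul_u, zsmul_d, zsmul_x] <;> by_cases h : j = i + 1 <;>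
      simp [pathE, pathD, h, h₁, h₂, dHom]
  coeff_mem h ha := (h.2.1 i ha).symm
  coeff_mem' h ha := (h.2.2.1 _ ha).symm
  mem := by
    refine ⟨fun k h => absurd rfl h, fun k h => ?_, fun k h => absurd rfl h,
          fun k h => absurd rfl h⟩
    by_cases hk : k = i
    · rw [hk]
    · exact absurd (Pi.single_eq_of_ne hk _) h
  mem' := by
    refine ⟨fun k h => absurd rfl h, fun k h => absurd rfl h, fun k h => ?_,
          fun k h => absurd rfl h⟩
    by_cases hk : k = i + 1
    · rw [hk]
    · exact absurd (Pi.single_eq_of_ne hk _) h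
  deg_add := (stdDeg_compat n).ud i
  coeff_w := Pi.single_eq_same _ _
  coeff_w' := Pi.single_eq_same _ _
  pathE_mul := mul_pathU i
  pathE_mul' := mul_pathD _
  mul_pathE := by have := pathU_mul (i + 1); rwa [add_sub_cancel_right] at this
  mul_pathE' := pathD_mul i
  w_mul := by
    ext j <;> by_cases h : j = i <;> simp [pathU, pathD, pathX, h]
  w'_mul := by
    ext j <;> by_cases h : j = i + 1 <;> simp [pathU, pathD, pathX, h]

end
end AffineBraid

/-! ### Tensor products of the bimodules `P_i ⊗ _iP` -/

namespace AffineBraid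
open TriBimod QuiverAlg MulOpposite
section
variable {n : ℕ} [Fact (3 ≤ n)] {C : TriRing}

theorem loopMap_gen {i : ZMod n} {Q : RBimod n} (z z' : Q) (a : QuiverAlg n) :
    pathE i • loopMap i z z' (pathE i • a • projGen i) =
      pathE i • op (pathE i) • (a.e i • z + a.x i • z') := by
  rw [smul_smul (pathE i) a, loopMap_smul_gen]
  simp [pathE, smul_comm (op _)]

theorem loopHom_gen {i : ZMod n} {Q : RBimod n} {z z' : Q} (hz : z ∈ Q.gr 0)
    (hz' : z' ∈ Q.gr (1, 0, 0)) (he : pathE i • op (pathE i) • z = z) :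
    Hom.toFun (loopHom i z z' hz hz') (tmul (projGen i) (projGen i)) = z := by
  have := loopMap_gen (i := i) z z' 1
  rw [one_smul] at this
  refine this.trans ?_
  simpa using he

theorem loopHom_loop {i : ZMod n} {Q : RBimod n} {z z' : Q} (hz : z ∈ Q.gr 0)
    (hz' : z' ∈ Q.gr (1, 0, 0)) (he : pathE i • op (pathE i) • z' = z') :
    Hom.toFun (loopHom i z z' hz hz') (tmul (projGen i) (pathX i • projGen i)) = z' := by
  refine (loopMap_gen z z' (pathX i)).trans ?_
  simpa [pathX] using he

theorem loopHomShift_gen {i : ZMod n} {γ : TriDeg} {Q : RBimod n} {z z' : Q} (hz : z ∈ Q.gr γ)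
    (hz' : z' ∈ Q.gr (γ + (1, 0, 0))) (he : pathE i • op (pathE i) • z = z) :
    Hom.toFun (loopHomShift i γ z z' hz hz')
      (tmul (N := (shift γ).obj (projTensor n i)) (projGen i) (projGen i)) = z := by
  have := loopMap_gen (i := i) z z' 1
  rw [one_smul] at this
  refine this.trans ?_
  simpa using he

theorem loopHomShift_loop {i : ZMod n} {γ : TriDeg} {Q : RBimod n} {z z' : Q} (hz : z ∈ Q.gr γ)
    (hz' : z' ∈ Q.gr (γ + (1, 0, 0))) (he : pathE i • op (pathE i) • z' = z') :
    Hom.toFun (loopHomShift i γ z z' hz hz')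
      (tmul (N := (shift γ).obj (projTensor n i)) (projGen i) (pathX i • projGen i)) = z' := by
  refine (loopMap_gen z z' (pathX i)).trans ?_
  simpa [pathX] using he

theorem zsmul_tmul {A B : TriRing} {M : TriBimod A B} {N : TriBimod B C} (k : ℤ) (m : M) (y : N) :
    tmul (k • m) y = k • tmul m y :=
  congrArg (fun f : N →+ Tensor M N => f y) (map_zsmul tmulHom k m)

theorem tmul_zsmul {A B : TriRing} {M : TriBimod A B} {N : TriBimod B C} (k : ℤ) (m : M) (y : N) :
    tmul m (k • y) = k • tmul m y := map_zsmul (tmulHom m) k y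

theorem smul_gen_mul (i : ZMod n) (a : QuiverAlg n) :
    a • projGen i = (a * pathE i) • projGen i := by
  rw [mul_smul, pathE_smul_projGen]

theorem smul_gen_tmul (i : ZMod n) {N : TriBimod (quiverRing n) C} (a : QuiverAlg n) (y : N) :
    tmul (a • projGen i) y = tmul (a • projGen i) (pathE i • y) := by
  rw [← tensor_balanced, ← smul_comm a, op_pathE_smul_projGen]

theorem gen_tmul (i : ZMod n) {N : TriBimod (quiverRing n) C} (y : N) :
    tmul (projGen i) y = tmul (projGen i) (pathE i • y) := by
  rw [← tensor_balanced, op_pathE_smul_projGen]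

theorem gen_tmul_smul (i : ZMod n) {N : TriBimod (quiverRing n) C} (a : QuiverAlg n) {v : N}
    (hv : pathE i • v = v) :
    tmul (projGen i) (a • v) = a.e i • tmul (projGen i) v +
      a.x i • tmul (projGen i) (pathX i • v) := by
  have h : pathE i • a • v = a.e i • v + a.x i • pathX i • v := by
    rw [← hv, smul_smul, smul_smul, pathE_mul_mul_pathE, add_smul, smul_assoc,
      smul_assoc, hv]
  rw [gen_tmul, h, tmul_add, tmul_zsmul, tmul_zsmul]

/-- The bimodule `P_i ⊗ _iP ⊗ P_i ⊗ _iP` is generated by two elements, as `(i) R_n (i)` is spanned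
by `(i)` and `(i|i+1|i)`. -/
theorem loop_hom_ext {i : ZMod n} {Q : RBimod n}
    {f g : tensorObj (projTensor n i) (projTensor n i) ⟶ Q}
    (h₁ : Hom.toFun f (tmul (projGen i) (projGen i)) =
      Hom.toFun g (tmul (projGen i) (projGen i)))
    (h₂ : Hom.toFun f (tmul (projGen i) (pathX i • projGen i)) =
      Hom.toFun g (tmul (projGen i) (pathX i • projGen i))) : f = g := by
  have key : ∀ a : QuiverAlg n, Hom.toFun f (tmul (projGen i) (a • projGen i)) =
      Hom.toFun g (tmul (projGen i) (a • projGen i)) := fun a => by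
    have h := gen_tmul_smul i a (pathE_smul_projGen i)
    refine (congrArg f.toFun h).trans (Eq.trans ?_ (congrArg g.toFun h).symm)
    rw [map_add, map_add, map_zsmul, map_zsmul, map_zsmul, map_zsmul]
    exact congrArg₂ (fun s t => a.e i • s + a.x i • t) h₁ h₂
  refine projTensor_tensor_hom_ext fun y => ?_
  refine projTensor_induction (P := fun y => Hom.toFun f (tmul (projGen i) y) =
    Hom.toFun g (tmul (projGen i) y)) ?_ (fun a b => ?_) (fun x y hx hy => ?_) y
  · have h := tmul_zero (N := projTensor n i) (projGen i)
    exact (congrArg f.toFun h).trans ((map_zero f.toFun).trans ((congrArg g.toFun h).trans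
      (map_zero g.toFun)).symm)
  · rw [smul_comm a]
    exact (f.map_op_smul b (tmul (projGen i) (a • projGen i))).trans ((congrArg (op b • ·)
      (key a)).trans (g.map_op_smul b (tmul (projGen i) (a • projGen i))).symm)
  · have h := tmul_add (projGen i) x y
    exact (congrArg f.toFun h).trans ((map_add f.toFun _ _).trans ((congrArg₂ (· + ·) hx hy).trans
      ((congrArg g.toFun h).trans (map_add g.toFun _ _)).symm))

theorem loop_hom_ext_shift {i : ZMod n} {γ : TriDeg} {Q : RBimod n}
    {f g : tensorObj (projTensor n i) ((shift γ).obj (projTensor n i)) ⟶ Q}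
    (h₁ : Hom.toFun f (tmul (N := (shift γ).obj (projTensor n i)) (projGen i) (projGen i)) =
      Hom.toFun g (tmul (N := (shift γ).obj (projTensor n i)) (projGen i) (projGen i)))
    (h₂ : Hom.toFun f (tmul (N := (shift γ).obj (projTensor n i)) (projGen i) (pathX i • projGen
        i)) =
      Hom.toFun g (tmul (N := (shift γ).obj (projTensor n i)) (projGen i) (pathX i • projGen i)))
          : f = g := by
  have key : ∀ a : QuiverAlg n, Hom.toFun f (tmul (N := (shift γ).obj (projTensor n i)) (projGen
      i) (a • projGen i)) =
      Hom.toFun g (tmul (N := (shift γ).obj (projTensor n i)) (projGen i) (a • projGen i)) := fun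
          a => by
    have h := gen_tmul_smul (N := (shift γ).obj (projTensor n i)) i a (pathE_smul_projGen i)
    refine (congrArg f.toFun h).trans (Eq.trans ?_ (congrArg g.toFun h).symm)
    rw [map_add, map_add, map_zsmul, map_zsmul, map_zsmul, map_zsmul]
    exact congrArg₂ (fun s t => a.e i • s + a.x i • t) h₁ h₂
  refine projTensor_tensor_hom_ext fun y => ?_
  refine projTensor_induction (P := fun y => Hom.toFun f (tmul (N := (shift γ).obj (projTensor n
      i)) (projGen i) y) =
    Hom.toFun g (tmul (N := (shift γ).obj (projTensor n i)) (projGen i) y)) ?_ (fun a b => ?_)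
        (fun x y hx hy => ?_) y
  · have h := tmul_zero (N := (shift γ).obj (projTensor n i)) (projGen i)
    exact (congrArg f.toFun h).trans ((map_zero f.toFun).trans ((congrArg g.toFun h).trans
      (map_zero g.toFun)).symm)
  · rw [smul_comm a]
    exact (f.map_op_smul b (tmul (N := (shift γ).obj (projTensor n i)) (projGen i) (a • projGen
        i))).trans ((congrArg (op b • ·)
      (key a)).trans (g.map_op_smul b (tmul (N := (shift γ).obj (projTensor n i)) (projGen i) (a
          • projGen i))).symm)
  · have h := tmul_add (N := (shift γ).obj (projTensor n i)) (projGen i) x y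
    exact (congrArg f.toFun h).trans ((map_add f.toFun _ _).trans ((congrArg₂ (· + ·) hx hy).trans
      ((congrArg g.toFun h).trans (map_add g.toFun _ _)).symm))

/-- The generator of `P_i ⊗ _iP ⊗ P_j ⊗ _jP ⊗ P_i ⊗ _iP` for adjacent `i` and `j`. -/
noncomputable def edgeGen {i j : ZMod n} (E : Edge i j) :
    tensorObj (projTensor n i) (tensorObj (projTensor n j) (projTensor n i)) :=
  tmul (N := tensorObj (projTensor n j) (projTensor n i)) (projGen i)
    (tmul (E.w • projGen j) (E.w' • projGen i))

theorem gen_tmul_tmul {i j : ZMod n} (E : Edge i j) (a b : QuiverAlg n) :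
    tmul (N := tensorObj (projTensor n j) (projTensor n i)) (projGen i)
      (tmul (a • projGen j) (b • projGen i)) = (E.coeff a * E.coeff' b) • edgeGen E := by
  rw [smul_gen_tmul j, smul_gen_mul i b, smul_smul, ← mul_assoc, E.mul_mul', smul_gen_mul j a]
  refine (gen_tmul i _).trans ?_
  rw [smul_tensor, smul_smul, ← mul_assoc, E.mul_mul, smul_assoc, smul_assoc, mul_smul, zsmul_tmul,
    tmul_zsmul]
  congr 1
  exact (congrArg (tmul (N := tensorObj (projTensor n j) (projTensor n i)) (projGen i))
    (tmul_zsmul (E.coeff' b) _ _)).trans (tmul_zsmul _ _ _)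

/-- The tensor product has one generator, as `(i) R_n (j)` and `(j) R_n (i)` have rank one. -/
theorem edge_hom_ext {i j : ZMod n} (E : Edge i j) {Q : RBimod n}
    {f g : tensorObj (projTensor n i) (tensorObj (projTensor n j) (projTensor n i)) ⟶ Q}
    (h : Hom.toFun f (edgeGen E) = Hom.toFun g (edgeGen E)) : f = g := by
  refine projTensor_tensor_hom_ext fun y => ?_
  induction y using tensor_induction with
  | h₀ => rw [tmul_zero, map_zero, map_zero]
  | h₂ x y hx hy => rw [tmul_add, map_add, map_add, hx, hy]
  | h₁ u v =>
  induction u using projTensor_induction with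
  | h₀ => rw [zero_tmul, tmul_zero, map_zero, map_zero]
  | h₂ x y hx hy => rw [add_tmul, tmul_add, map_add, map_add, hx, hy]
  | h₁ a b =>
  induction v using projTensor_induction with
  | h₀ => rw [tmul_zero, tmul_zero, map_zero, map_zero]
  | h₂ x y hx hy => rw [tmul_add, tmul_add, map_add, map_add, hx, hy]
  | h₁ c d =>
  rw [smul_comm a, tensor_balanced, smul_comm c, smul_comm b, smul_smul]
  refine (hom_tmul_op_smul (C := quiverRing n) f (projGen i) d (tmul _ _)).trans (Eq.trans ?_
    (hom_tmul_op_smul (C := quiverRing n) g (projGen i) d (tmul _ _)).symm)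
  rw [gen_tmul_tmul E, map_zsmul, map_zsmul, h]

end
end AffineBraid

/-! ### Cancellation at an edge -/

namespace AffineBraid
open TriBimod QuiverAlg MulOpposite
section
variable {n : ℕ}

theorem pathX_mem (i : ZMod n) : (pathX i : QuiverAlg n) ∈ pathGr (stdDeg n) (1, 0, 0) :=
  ⟨fun _ h => absurd rfl h, fun _ h => absurd rfl h, fun _ h => absurd rfl h, fun _ _ => rfl⟩

variable [Fact (3 ≤ n)]

/-- The element `z` lies in `(i) Q (i)`. -/
def Corner (i : ZMod n) {Q : RBimod n} (z : Q) : Prop := pathE i • op (pathE i) • z = z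

theorem projGen_mem (i : ZMod n) : projGen i ∈ (projTensor n i).gr 0 := by
  have := tmul_mem (M := projLeft n i) (N := projRight n i) (α := 0) (β := 0)
    (m := inLeft (pathE i) (pathE_mul_pathE i)) (n := inRight (pathE i) (pathE_mul_pathE i))
    (pathE_mem i) (pathE_mem i)
  rwa [add_zero] at this

theorem dBraid_smul_gen (i : ZMod n) (a : QuiverAlg n) :
    Hom.toFun (dBraid n i) (a • projGen i) = a * pathE i := by
  change (a * pathE i) * pathE i = _
  rw [mul_assoc, pathE_mul_pathE]

theorem dBraid_gen (i : ZMod n) : Hom.toFun (dBraid n i) (projGen i) = pathE i :=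
  pathE_mul_pathE i

theorem gen_gen_mem (i : ZMod n) :
    (tmul (projGen i) (projGen i)) ∈ (tensorObj (projTensor n i) (projTensor n i)).gr 0 := by
  have := tmul_mem (projGen_mem i) (projGen_mem i)
  rwa [add_zero] at this

theorem edgeGen_mem {i j : ZMod n} (E : Edge i j) :
    edgeGen E ∈ (tensorObj (projTensor n i)
      (tensorObj (projTensor n j) (projTensor n i))).gr (1, 0, 0) := by
  have h := tmul_mem (N := tensorObj (projTensor n j) (projTensor n i)) (projGen_mem i)
    (tmul_mem ((projTensor n j).smul_mem E.mem (projGen_mem j))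
      ((projTensor n i).smul_mem E.mem' (projGen_mem i)))
  rwa [zero_add, add_zero, add_zero, E.deg_add] at h

theorem corner_edgeGen {i j : ZMod n} (E : Edge i j) :
    Corner i (edgeGen E) := by
  have h : op (pathE i) • E.w' • projGen i = E.w' • projGen i := by
    rw [← smul_comm E.w', op_pathE_smul_projGen]
  have h' : tmul (N := tensorObj (projTensor n j) (projTensor n i)) (pathE i • projGen i)
    (tmul (E.w • projGen j) (op (pathE i) • E.w' • projGen i)) = edgeGen E := by
    rw [h, pathE_smul_projGen]
    rfl
  exact h'

theorem corner_gen_gen (i : ZMod n) :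
    Corner (Q := tensorObj (projTensor n i) (projTensor n i)) i
      (tmul (projGen i) (projGen i)) := by
  have h : tmul (pathE i • projGen i) (op (pathE i) • projGen i) =
      tmul (projGen i) (projGen i) := by
    rw [pathE_smul_projGen, op_pathE_smul_projGen]
  exact h

/-- The map `P_j ⊗ _jP ⊗ P_i ⊗ _iP ⟶ P_i ⊗ _iP` which multiplies the first three factors. -/
noncomputable def contractLeft (j i : ZMod n) :
    tensorObj (projTensor n j) (projTensor n i) ⟶ projTensor n i :=
  tensorMap (dBraid n j) (𝟙 _) ≫ (leftUnit _).hom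

theorem contractLeft_tmul (j i : ZMod n) (a : QuiverAlg n) (y : projTensor n i) :
    Hom.toFun (contractLeft j i) (tmul (a • projGen j) y) = (a * pathE j) • y := by
  change (Hom.toFun (dBraid n j) (a • projGen j) : QuiverAlg n) • y = _
  rw [dBraid_smul_gen]

theorem contractLeft_edge {i j : ZMod n} (E : Edge i j) :
    Hom.toFun (tensorMap (𝟙 (projTensor n i)) (contractLeft j i)) (edgeGen E) =
      tmul (projGen i) (pathX i • projGen i) := by
  change tmul (projGen i) (Hom.toFun (contractLeft j i) (tmul (E.w • projGen j)
    (E.w' • projGen i))) = _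
  rw [contractLeft_tmul, smul_smul, E.mul_pathE, E.w_mul]

theorem elemHom_gen {i : ZMod n} {Q : RBimod n} {z : Q} (hz : z ∈ Q.gr 0)
    (he : Corner i z) : Hom.toFun (elemHom i z hz) (projGen i) = z := he

theorem corner_gen (i : ZMod n) : Corner i (projGen i) := by
  rw [Corner, op_pathE_smul_projGen, pathE_smul_projGen]

theorem corner_zero (i : ZMod n) {Q : RBimod n} : Corner i (0 : Q) := by
  rw [Corner, smul_zero, smul_zero]

theorem comp_apply_of_eq {A B : TriRing} {M N P : TriBimod A B} {f : M ⟶ N} {g : N ⟶ P} {m : M}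
    {x : N} {y : P} (h : Hom.toFun f m = x) (h' : Hom.toFun g x = y) :
    Hom.toFun (f ≫ g) m = y :=
  (congrArg g.toFun h).trans h'

/-- The map `d_i ⊗ 1` is an isomorphism on the summand generated by `(i) ⊗ (i) ⊗ (i) ⊗ (i)`. -/
theorem isIso_gen_dBraid (i : ZMod n) :
    IsIso (elemHom i _ (gen_gen_mem i) ≫ tensorMap (dBraid n i) (𝟙 (projTensor n i))) := by
  have h : (elemHom i _ (gen_gen_mem i) ≫ tensorMap (dBraid n i) (𝟙 (projTensor n i))) ≫
      (leftUnit _).hom = 𝟙 _ := by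
    refine projTensor_hom_ext ?_
    refine (congrArg (fun t => Hom.toFun (leftUnit (projTensor n i)).hom (Hom.toFun
      (tensorMap (dBraid n i) (𝟙 (projTensor n i))) t))
      (elemHom_gen (gen_gen_mem i) (corner_gen_gen i))).trans ?_
    change (Hom.toFun (dBraid n i) (projGen i) : QuiverAlg n) • projGen i = projGen i
    rw [dBraid_gen, pathE_smul_projGen]
  rw [← Iso.eq_comp_inv] at h
  rw [h]
  infer_instance

/-- For adjacent `i` and `j`, multiplication identifies `P_i ⊗ _iP ⊗ P_j ⊗ _jP ⊗ P_i ⊗ _iP` with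
the summand of `P_i ⊗ _iP ⊗ P_i ⊗ _iP` generated by `(i) ⊗ (i) ⊗ (i|j|i) ⊗ (i)`. The summand
generated by `(i) ⊗ (i) ⊗ (i) ⊗ (i)` is a complement. -/
theorem cancels_edge {i j : ZMod n} (E : Edge i j) :
    (bimodTriang n).Cancels ((hotS n _).map (dBraid n i)) ((hotS n _).map (contractLeft j i)) := by
  refine cancels_of_bimod _ _ (elemHom i _ (gen_gen_mem i))
    (loopHom i 0 (edgeGen E) (zero_mem _) (edgeGen_mem E))
    (loopHom i (projGen i) 0 (projGen_mem i) (zero_mem _)) ?_ ?_ ?_ ?_ ?_ (isIso_gen_dBraid i)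
  · exact edge_hom_ext E (comp_apply_of_eq (contractLeft_edge E)
      (loopHom_loop _ _ (corner_edgeGen E)))
  · exact projTensor_hom_ext (comp_apply_of_eq (elemHom_gen _ (corner_gen_gen i))
      (loopHom_gen _ _ (corner_gen i)))
  · exact edge_hom_ext E (comp_apply_of_eq (contractLeft_edge E) (loopHom_loop _ _ (corner_zero i)))
  · exact projTensor_hom_ext (comp_apply_of_eq (elemHom_gen _ (corner_gen_gen i))
      (loopHom_gen _ _ (corner_zero i)))
  · refine loop_hom_ext ?_ ?_
    · exact (congrArg₂ (· + ·) (comp_apply_of_eq (loopHom_gen _ _ (corner_zero i)) (map_zero _))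
        (comp_apply_of_eq (loopHom_gen _ _ (corner_gen i))
          (elemHom_gen _ (corner_gen_gen i)))).trans (zero_add _)
    · exact (congrArg₂ (· + ·) (comp_apply_of_eq (loopHom_loop _ _ (corner_edgeGen E))
        (contractLeft_edge E)) (comp_apply_of_eq (loopHom_loop _ _ (corner_zero i))
          (map_zero _))).trans (add_zero _)

end
end AffineBraid

/-! ### The mirror image of the cancellation at an edge -/

namespace AffineBraid
open TriBimod QuiverAlg MulOpposite
section
variable {n : ℕ} [Fact (3 ≤ n)]

/-- The map `P_i ⊗ _iP ⊗ P_j ⊗ _jP ⟶ P_i ⊗ _iP` which multiplies the last three factors. -/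
noncomputable def contractRight (i j : ZMod n) :
    tensorObj (projTensor n i) (projTensor n j) ⟶ projTensor n i :=
  tensorMap (𝟙 _) (dBraid n j) ≫ (rightUnit _).hom

theorem contractRight_tmul (i j : ZMod n) (a : QuiverAlg n) (y : projTensor n i) :
    Hom.toFun (contractRight i j) (tmul y (a • projGen j)) = op (a * pathE j) • y := by
  change op (Hom.toFun (dBraid n j) (a • projGen j) : QuiverAlg n) • y = _
  rw [dBraid_smul_gen]

/-- The generator of `P_i ⊗ _iP ⊗ P_j ⊗ _jP ⊗ P_i ⊗ _iP` for adjacent `i` and `j`, bracketed to the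
left. -/
noncomputable def edgeGen' {i j : ZMod n} (E : Edge i j) :
    tensorObj (tensorObj (projTensor n i) (projTensor n j)) (projTensor n i) :=
  tmul (M := tensorObj (projTensor n i) (projTensor n j)) (tmul (projGen i) (E.w • projGen j))
    (E.w' • projGen i)

theorem edge_hom_ext' {i j : ZMod n} (E : Edge i j) {Q : RBimod n}
    {f g : tensorObj (tensorObj (projTensor n i) (projTensor n j)) (projTensor n i) ⟶ Q}
    (h : Hom.toFun f (edgeGen' E) = Hom.toFun g (edgeGen' E)) : f = g :=
  (cancel_epi (tensorAssoc (projTensor n i) (projTensor n j) (projTensor n i)).inv).1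
    (edge_hom_ext E h)

theorem edgeGen'_mem {i j : ZMod n} (E : Edge i j) :
    edgeGen' E ∈ (tensorObj (tensorObj (projTensor n i) (projTensor n j))
      (projTensor n i)).gr (1, 0, 0) :=
  (tensorAssoc (projTensor n i) (projTensor n j) (projTensor n i)).inv.map_gr (edgeGen_mem E)

theorem Corner.map {i : ZMod n} {Q Q' : RBimod n} (f : Q ⟶ Q') {z : Q} (hz : Corner i z) :
    Corner i (Hom.toFun f z) := by
  have h := (congrArg f.toFun hz).symm.trans ((f.map_smul (pathE i) _).trans
    (congrArg (pathE i • ·) (f.map_op_smul (pathE i) z)))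
  exact h.symm

theorem corner_edgeGen' {i j : ZMod n} (E : Edge i j) : Corner i (edgeGen' E) :=
  (corner_edgeGen E).map (tensorAssoc (projTensor n i) (projTensor n j) (projTensor n i)).inv

theorem contractRight_edge {i j : ZMod n} (E : Edge i j) :
    Hom.toFun (tensorMap (contractRight i j) (𝟙 (projTensor n i))) (edgeGen' E) =
      tmul (projGen i) (pathX i • projGen i) := by
  change tmul (Hom.toFun (contractRight i j) (tmul (projGen i) (E.w • projGen j)))
    (E.w' • projGen i) = _
  rw [contractRight_tmul, E.mul_pathE, tensor_balanced, smul_smul, E.w_mul]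

/-- The mirror image of `isIso_gen_dBraid`. -/
theorem isIso_gen_dBraid' (i : ZMod n) :
    IsIso (elemHom i _ (gen_gen_mem i) ≫ tensorMap (𝟙 (projTensor n i)) (dBraid n i)) := by
  have h : (elemHom i _ (gen_gen_mem i) ≫ tensorMap (𝟙 (projTensor n i)) (dBraid n i)) ≫
      (rightUnit _).hom = 𝟙 _ := by
    refine projTensor_hom_ext ?_
    refine (congrArg (fun t => Hom.toFun (rightUnit (projTensor n i)).hom (Hom.toFun
      (tensorMap (𝟙 (projTensor n i)) (dBraid n i)) t))
      (elemHom_gen (gen_gen_mem i) (corner_gen_gen i))).trans ?_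
    change op (Hom.toFun (dBraid n i) (projGen i) : QuiverAlg n) • projGen i = projGen i
    rw [dBraid_gen, op_pathE_smul_projGen]
  rw [← Iso.eq_comp_inv] at h
  rw [h]
  infer_instance

/-- The mirror image of `cancels_edge`. -/
theorem cancels_op_edge {i j : ZMod n} (E : Edge i j) :
    (bimodTriang n).op.Cancels ((hotS n _).map (dBraid n i))
      ((hotS n _).map (contractRight i j)) := by
  refine cancels_op_of_bimod _ _ (elemHom i _ (gen_gen_mem i))
    (loopHom i 0 (edgeGen' E) (zero_mem _) (edgeGen'_mem E))
    (loopHom i (projGen i) 0 (projGen_mem i) (zero_mem _)) ?_ ?_ ?_ ?_ ?_ (isIso_gen_dBraid' i)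
  · exact edge_hom_ext' E (comp_apply_of_eq (contractRight_edge E)
      (loopHom_loop _ _ (corner_edgeGen' E)))
  · exact projTensor_hom_ext (comp_apply_of_eq (elemHom_gen _ (corner_gen_gen i))
      (loopHom_gen _ _ (corner_gen i)))
  · exact edge_hom_ext' E (comp_apply_of_eq (contractRight_edge E)
      (loopHom_loop _ _ (corner_zero i)))
  · exact projTensor_hom_ext (comp_apply_of_eq (elemHom_gen _ (corner_gen_gen i))
      (loopHom_gen _ _ (corner_zero i)))
  · refine loop_hom_ext ?_ ?_
    · exact (congrArg₂ (· + ·) (comp_apply_of_eq (loopHom_gen _ _ (corner_zero i)) (map_zero _))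
        (comp_apply_of_eq (loopHom_gen _ _ (corner_gen i))
          (elemHom_gen _ (corner_gen_gen i)))).trans (zero_add _)
    · exact (congrArg₂ (· + ·) (comp_apply_of_eq (loopHom_loop _ _ (corner_edgeGen' E))
        (contractRight_edge E)) (comp_apply_of_eq (loopHom_loop _ _ (corner_zero i))
          (map_zero _))).trans (add_zero _)

end
end AffineBraid

/-! ### The Casimir element -/

namespace AffineBraid
open TriBimod QuiverAlg MulOpposite
section
variable {n : ℕ} [Fact (3 ≤ n)]

variable (n) in
/-- The bimodule `P_i ⊗ _iP {-1}`. -/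
noncomputable abbrev projTensorShift (i : ZMod n) : RBimod n :=
  (shift (-1, 0, 0)).obj (projTensor n i)

theorem deg_neg_one_add : ((-1, 0, 0) : TriDeg) + (1, 0, 0) = 0 := by decide

theorem casimir_eq (i : ZMod n) : casimir n i = pathU (i - 1) • op (pathD i) • projGen i +
    pathD (i + 1) • op (pathU i) • projGen i + op (pathX i) • projGen i + pathX i • projGen i := by
  have h₁ : pathE i • op (pathX i) • projGen i = op (pathX i) • projGen i := by
    rw [smul_comm, pathE_smul_projGen]
  rw [casimir, pureTensor_eq, pureTensor_eq, pureTensor_eq, pureTensor_eq]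
  change _ + _ + pathE i • op (pathX i) • projGen i + pathX i • op (pathE i) • projGen i = _
  rw [h₁, op_pathE_smul_projGen]
  rfl

theorem pathE_mul_pathU_pred (i : ZMod n) : (pathE i * pathU (i - 1) : QuiverAlg n) = 0 := by
  ext k <;> by_cases h : k = i <;> simp [pathE, pathU, h, (sub_one_ne i).symm]

theorem pathE_mul_pathD_succ (i : ZMod n) : (pathE i * pathD (i + 1) : QuiverAlg n) = 0 := by
  ext k <;> by_cases h : k = i <;> simp [pathE, pathD, h, (add_one_ne i).symm]

theorem pathE_smul_casimir (i : ZMod n) :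
    pathE i • casimir n i = op (pathX i) • projGen i + pathX i • projGen i := by
  rw [casimir_eq, smul_add, smul_add, smul_add, smul_smul, smul_smul, smul_smul,
    pathE_mul_pathU_pred, pathE_mul_pathD_succ, mul_pathX, zero_smul, zero_smul, zero_add, zero_add,
    smul_comm (pathE i), pathE_smul_projGen]

theorem op_pathE_smul_casimir (i : ZMod n) :
    op (pathE i) • casimir n i = op (pathX i) • projGen i + pathX i • projGen i := by
  rw [← smul_casimir, pathE_smul_casimir]

theorem tensor_regBimod_hom_ext {i : ZMod n} {Q : RBimod n}
    {f g : tensorObj (projTensor n i) (regBimod n) ⟶ Q}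
    (h : Hom.toFun f (tmul (N := regBimod n) (projGen i) (1 : QuiverAlg n)) =
      Hom.toFun g (tmul (N := regBimod n) (projGen i) (1 : QuiverAlg n))) : f = g :=
  (cancel_epi (rightUnit (projTensor n i)).inv).1 (projTensor_hom_ext h)

theorem regBimod_tensor_hom_ext {i : ZMod n} {Q : RBimod n}
    {f g : tensorObj (regBimod n) (projTensor n i) ⟶ Q}
    (h : Hom.toFun f (tmul (M := regBimod n) (1 : QuiverAlg n) (projGen i)) =
      Hom.toFun g (tmul (M := regBimod n) (1 : QuiverAlg n) (projGen i))) : f = g :=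
  (cancel_epi (leftUnit (projTensor n i)).inv).1 (projTensor_hom_ext h)

theorem projTensor_hom_ext_shift {i : ZMod n} {γ : TriDeg} {Q : RBimod n}
    {f g : (shift γ).obj (projTensor n i) ⟶ Q}
    (h : f.toFun (projGen i) = g.toFun (projGen i)) : f = g := by
  refine Hom.ext (AddMonoidHom.ext fun x => ?_)
  refine projTensor_induction (P := fun x => f.toFun x = g.toFun x) ?_ (fun a b => ?_)
    (fun x y hx hy => ?_) x
  · exact (map_zero f.toFun).trans (map_zero g.toFun).symm
  · refine (f.map_smul a _).trans (Eq.trans ?_ (g.map_smul a _).symm)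
    refine congrArg (a • ·) ((f.map_op_smul b _).trans (Eq.trans ?_ (g.map_op_smul b _).symm))
    exact congrArg (op b • ·) h
  · exact (map_add f.toFun x y).trans ((congrArg₂ (· + ·) hx hy).trans (map_add g.toFun x y).symm)

theorem elemHomShift_gen {i : ZMod n} {γ : TriDeg} {Q : RBimod n} {z : Q} (hz : z ∈ Q.gr γ)
    (he : Corner i z) : (elemHomShift i γ z hz).toFun (projGen i) = z := he

/-- The element `(i) ⊗ (i) ⊗ (i) ⊗ (i)` with the shifted grading. -/
noncomputable def genGenShift (i : ZMod n) : tensorObj (projTensor n i) (projTensorShift n i) :=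
  tmul (N := projTensorShift n i) (projGen i) (projGen i)

/-- The element `(i) ⊗ (i) ⊗ (i|i+1|i) ⊗ (i)` with the shifted grading. -/
noncomputable def genLoopShift (i : ZMod n) : tensorObj (projTensor n i) (projTensorShift n i) :=
  tmul (N := projTensorShift n i) (projGen i) (pathX i • projGen i)

theorem genGenShift_mem (i : ZMod n) : genGenShift i ∈
    (tensorObj (projTensor n i) (projTensorShift n i)).gr (-1, 0, 0) := by
  have := tmul_mem (N := projTensorShift n i) (projGen_mem i) (β := (-1, 0, 0))
    (n := projGen i) (by
      change projGen i ∈ (projTensor n i).gr _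
      rw [sub_self]; exact projGen_mem i)
  rwa [zero_add] at this

theorem corner_genGenShift (i : ZMod n) : Corner i (genGenShift i) := by
  have h : tmul (N := projTensorShift n i) (pathE i • projGen i)
      (op (pathE i) • projGen i : projTensor n i) = genGenShift i := by
    rw [pathE_smul_projGen, op_pathE_smul_projGen]
    rfl
  exact h

/-- The map `P_i ⊗ _iP {-1} ⟶ P_i ⊗ _iP ⊗ P_i ⊗ _iP {-1}`. -/
noncomputable def coprodShift (i : ZMod n) :
    projTensorShift n i ⟶ tensorObj (projTensor n i) (projTensorShift n i) :=
  elemHomShift i _ (genGenShift i) (genGenShift_mem i)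

theorem coprodShift_gen (i : ZMod n) : (coprodShift i).toFun (projGen i) = genGenShift i :=
  elemHomShift_gen _ (corner_genGenShift i)

theorem corner_neg_smul_gen (i : ZMod n) :
    Corner (Q := projTensorShift n i) i (-(pathX i • projGen i) : projTensor n i) := by
  have h : pathE i • op (pathE i) • (-(pathX i • projGen i)) = -(pathX i • projGen i) := by
    rw [smul_neg, smul_neg, ← smul_comm (pathX i), op_pathE_smul_projGen, smul_smul, mul_pathX]
  exact h

theorem corner_neg_op_smul_gen (i : ZMod n) :
    Corner (Q := projTensorShift n i) i (-(op (pathX i) • projGen i) : projTensor n i) := by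
  have h : pathE i • op (pathE i) • (-(op (pathX i) • projGen i)) = -(op (pathX i) • projGen i)
      := by
    rw [smul_neg, smul_neg, smul_smul, ← op_mul, pathX_mul, smul_comm (pathE i),
      pathE_smul_projGen]
  exact h

theorem projGen_mem_shift (i : ZMod n) :
    (show projTensorShift n i from projGen i) ∈ (projTensorShift n i).gr (-1, 0, 0) := by
  change projGen i ∈ (projTensor n i).gr _
  rw [sub_self]; exact projGen_mem i

theorem smul_gen_mem_shift (i : ZMod n) :
    (show projTensorShift n i from (-(pathX i • projGen i) : projTensor n i)) ∈
      (projTensorShift n i).gr ((-1, 0, 0) + (1, 0, 0)) := by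
  have := neg_mem ((projTensor n i).smul_mem (pathX_mem i) (projGen_mem i))
  rw [deg_neg_one_add]
  exact this

theorem op_smul_gen_mem_shift (i : ZMod n) :
    (show projTensorShift n i from (-(op (pathX i) • projGen i) : projTensor n i)) ∈
      (projTensorShift n i).gr ((-1, 0, 0) + (1, 0, 0)) := by
  have := neg_mem ((projTensor n i).op_smul_mem (projGen_mem i) (pathX_mem i))
  rw [deg_neg_one_add]
  exact this

/-- The image of the generator of `P_i ⊗ _iP ⊗ R_n` under the differential of `F'_i`. -/
theorem tensorMap_dBraidInv (i : ZMod n) :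
    Hom.toFun (tensorMap (𝟙 (projTensor n i)) (dBraidInv n i))
      (tmul (N := regBimod n) (projGen i) (1 : QuiverAlg n)) =
    tmul (N := projTensorShift n i) (projGen i) (op (pathX i) • projGen i : projTensor n i) +
      genLoopShift i := by
  have h : Hom.toFun (dBraidInv n i) (1 : QuiverAlg n) = casimir n i := one_smul (QuiverAlg n) _
  have h₂ := gen_tmul i (N := projTensorShift n i) (casimir n i)
  have h₃ := tmul_add (N := projTensorShift n i) (projGen i) (op (pathX i) • projGen i :
      projTensor n i)
    (pathX i • projGen i : projTensor n i)
  refine (congrArg (tmul (N := projTensorShift n i) (projGen i)) h).trans (h₂.trans (Eq.trans ?_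
      h₃))
  exact congrArg (tmul (N := projTensorShift n i) (projGen i)) (pathE_smul_casimir i)

theorem tensorMap_dBraidInv' (i : ZMod n) :
    Hom.toFun (tensorMap (dBraidInv n i) (𝟙 (projTensor n i)) ≫ (tensorShiftSwap _ _ _).hom)
      (tmul (M := regBimod n) (1 : QuiverAlg n) (projGen i)) =
    genLoopShift i + tmul (N := projTensorShift n i) (pathX i • projGen i) (projGen i) := by
  have h : Hom.toFun (dBraidInv n i) (1 : QuiverAlg n) = casimir n i := one_smul (QuiverAlg n) _
  have h₁ : Hom.toFun (tensorMap (dBraidInv n i) (𝟙 (projTensor n i)) ≫ (tensorShiftSwap _ _ _).hom)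
      (tmul (M := regBimod n) (1 : QuiverAlg n) (projGen i)) =
        tmul (N := projTensorShift n i) (casimir n i) (projGen i) :=
    congrArg (fun t => tmul (N := projTensorShift n i) t (projGen i)) h
  have h₂ : tmul (N := projTensorShift n i) (casimir n i) (projGen i) =
      tmul (N := projTensorShift n i) (op (pathE i) • casimir n i) (projGen i) :=
    (congrArg (tmul (N := projTensorShift n i) (casimir n i)) (pathE_smul_projGen i)).symm.trans
      (tensor_balanced (N := projTensorShift n i) (pathE i) (casimir n i) (projGen i)).symm
  rw [h₁, h₂, op_pathE_smul_casimir]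
  refine (add_tmul (N := projTensorShift n i) _ _ _).trans ?_
  exact congrArg (· + tmul (N := projTensorShift n i) (pathX i • projGen i) (projGen i))
    (tensor_balanced (N := projTensorShift n i) (pathX i) (projGen i) (projGen i))

end
end AffineBraid

/-! ### Cancellation of the Casimir element -/

namespace AffineBraid
open TriBimod QuiverAlg MulOpposite
section
variable {n : ℕ} [Fact (3 ≤ n)]

theorem gen_one_mem (i : ZMod n) : tmul (N := regBimod n) (projGen i) (1 : QuiverAlg n) ∈
    (tensorObj (projTensor n i) (regBimod n)).gr ((-1, 0, 0) + (1, 0, 0)) := by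
  have h := ((rightUnit (projTensor n i)).inv).map_gr (projGen_mem i)
  rw [deg_neg_one_add]
  exact h

theorem one_gen_mem (i : ZMod n) : tmul (M := regBimod n) (1 : QuiverAlg n) (projGen i) ∈
    (tensorObj (regBimod n) (projTensor n i)).gr ((-1, 0, 0) + (1, 0, 0)) := by
  have h := ((leftUnit (projTensor n i)).inv).map_gr (projGen_mem i)
  rw [deg_neg_one_add]
  exact h

theorem corner_gen_one (i : ZMod n) : Corner
    (Q := tensorObj (projTensor n i) (regBimod n)) i (tmul (N := regBimod n) (projGen i) (1 :
        QuiverAlg n)) := by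
  have h₁ := (((rightUnit (projTensor n i)).inv).map_smul (pathE i) (projGen i)).symm
  have h₂ := (((rightUnit (projTensor n i)).inv).map_op_smul (pathE i) (projGen i)).symm
  rw [pathE_smul_projGen] at h₁
  rw [op_pathE_smul_projGen] at h₂
  exact (congrArg (pathE i • ·) h₂).trans h₁

theorem corner_one_gen (i : ZMod n) : Corner
    (Q := tensorObj (regBimod n) (projTensor n i)) i (tmul (M := regBimod n) (1 : QuiverAlg n)
        (projGen i)) := by
  have h₁ := (((leftUnit (projTensor n i)).inv).map_smul (pathE i) (projGen i)).symm
  have h₂ := (((leftUnit (projTensor n i)).inv).map_op_smul (pathE i) (projGen i)).symm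
  rw [pathE_smul_projGen] at h₁
  rw [op_pathE_smul_projGen] at h₂
  exact (congrArg (pathE i • ·) h₂).trans h₁

theorem hom_gen_op_smul_gen {i : ZMod n} {Q : RBimod n}
    (f : tensorObj (projTensor n i) (projTensorShift n i) ⟶ Q) {z : Q}
    (h : f.toFun (genGenShift i) = z) :
    f.toFun (tmul (N := projTensorShift n i) (projGen i)
      (op (pathX i) • projGen i : projTensor n i)) = op (pathX i) • z :=
  (f.map_op_smul (pathX i) (genGenShift i)).trans (congrArg (op (pathX i) • ·) h)

theorem hom_smul_gen_gen {i : ZMod n} {Q : RBimod n}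
    (f : tensorObj (projTensor n i) (projTensorShift n i) ⟶ Q) {z : Q}
    (h : f.toFun (genGenShift i) = z) :
    f.toFun (tmul (N := projTensorShift n i) (pathX i • projGen i) (projGen i)) = pathX i • z :=
  (f.map_smul (pathX i) (genGenShift i)).trans (congrArg (pathX i • ·) h)

theorem hom_gen_op_smul_gen_zero {i : ZMod n} {Q : RBimod n}
    (f : tensorObj (projTensor n i) (projTensorShift n i) ⟶ Q) (h : f.toFun (genGenShift i) = 0) :
    f.toFun (tmul (N := projTensorShift n i) (projGen i)
      (op (pathX i) • projGen i : projTensor n i)) = 0 :=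
  (hom_gen_op_smul_gen f h).trans (smul_zero _)

theorem hom_smul_gen_gen_zero {i : ZMod n} {Q : RBimod n}
    (f : tensorObj (projTensor n i) (projTensorShift n i) ⟶ Q) (h : f.toFun (genGenShift i) = 0) :
    f.toFun (tmul (N := projTensorShift n i) (pathX i • projGen i) (projGen i)) = 0 :=
  (hom_smul_gen_gen f h).trans (smul_zero _)

theorem hom_op_smul_of_eq {P Q : RBimod n} (f : P ⟶ Q) {u : P} {z : Q} (c : QuiverAlg n)
    (h : f.toFun u = z) : f.toFun (op c • u) = op c • z :=
  (f.map_op_smul c u).trans (congrArg (op c • ·) h)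

theorem hom_smul_of_eq {P Q : RBimod n} (f : P ⟶ Q) {u : P} {z : Q} (c : QuiverAlg n)
    (h : f.toFun u = z) : f.toFun (c • u) = c • z :=
  (f.map_smul c u).trans (congrArg (c • ·) h)

theorem isIso_coprodShift_dBraid (i : ZMod n) :
    IsIso (coprodShift i ≫ tensorMap (dBraid n i) (𝟙 (projTensorShift n i))) := by
  have h : (coprodShift i ≫ tensorMap (dBraid n i) (𝟙 (projTensorShift n i))) ≫
      (leftUnit (projTensorShift n i)).hom = 𝟙 _ := by
    refine projTensor_hom_ext_shift ?_
    refine (congrArg (fun t => Hom.toFun (leftUnit (projTensorShift n i)).hom (Hom.toFun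
      (tensorMap (dBraid n i) (𝟙 (projTensorShift n i))) t)) (coprodShift_gen i)).trans ?_
    change ((Hom.toFun (dBraid n i) (projGen i) : QuiverAlg n) • projGen i : projTensor n i) =
      projGen i
    rw [dBraid_gen, pathE_smul_projGen]
  rw [← Iso.eq_comp_inv] at h
  rw [h]
  infer_instance

theorem isIso_coprodShift_dBraid' (i : ZMod n) :
    IsIso ((coprodShift i ≫ (tensorShiftSwap _ _ _).inv) ≫
      tensorMap (𝟙 (projTensorShift n i)) (dBraid n i)) := by
  have h : ((coprodShift i ≫ (tensorShiftSwap _ _ _).inv) ≫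
      tensorMap (𝟙 (projTensorShift n i)) (dBraid n i)) ≫
      (rightUnit (projTensorShift n i)).hom = 𝟙 _ := by
    refine projTensor_hom_ext_shift ?_
    refine (congrArg (fun t => Hom.toFun (rightUnit (projTensorShift n i)).hom (Hom.toFun
      (tensorMap (𝟙 (projTensorShift n i)) (dBraid n i)) (Hom.toFun (tensorShiftSwap _ _ _).inv t)))
      (coprodShift_gen i)).trans ?_
    change (op (Hom.toFun (dBraid n i) (projGen i) : QuiverAlg n) • projGen i : projTensor n i) =
      projGen i
    rw [dBraid_gen, op_pathE_smul_projGen]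
  rw [← Iso.eq_comp_inv] at h
  rw [h]
  infer_instance

/-- Tensoring `d'_i` with `P_i ⊗ _iP` gives a split monomorphism whose complement is mapped
isomorphically by `d_i`. -/
theorem cancels_casimir (i : ZMod n) :
    (bimodTriang n).Cancels ((hotS n _).map (dBraid n i)) ((hotS n _).map (dBraidInv n i)) := by
  have hr := loopHomShift_gen (i := i) (zero_mem _) (gen_one_mem i) (corner_zero i)
  have hr' := loopHomShift_loop (i := i) (zero_mem _) (gen_one_mem i) (corner_gen_one i)
  have hp := loopHomShift_gen (Q := projTensorShift n i) (projGen_mem_shift i)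
    (op_smul_gen_mem_shift i) (corner_gen i)
  have hp' := loopHomShift_loop (Q := projTensorShift n i) (projGen_mem_shift i)
    (op_smul_gen_mem_shift i) (corner_neg_op_smul_gen i)
  have hs : Hom.toFun (coprodShift i) (-(op (pathX i) • projGen i) : projTensor n i) =
      -(tmul (N := projTensorShift n i) (projGen i)
        (op (pathX i) • projGen i : projTensor n i)) := by
    refine (map_neg (coprodShift i).toFun _).trans (congrArg Neg.neg ?_)
    exact hom_op_smul_of_eq (coprodShift i) (pathX i) (coprodShift_gen i)
  refine cancels_of_bimod _ _ (coprodShift i)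
    (loopHomShift i (-1, 0, 0) 0 _ (zero_mem _) (gen_one_mem i))
    (loopHomShift i (-1, 0, 0) _ _ (projGen_mem_shift i) (op_smul_gen_mem_shift i))
    ?_ ?_ ?_ ?_ ?_ (isIso_coprodShift_dBraid i)
  · refine tensor_regBimod_hom_ext (comp_apply_of_eq (tensorMap_dBraidInv i) ?_)
    refine (map_add _ _ _).trans ((congrArg₂ (· + ·) (hom_gen_op_smul_gen_zero _ hr) hr').trans
        (zero_add _))
  · exact projTensor_hom_ext_shift (comp_apply_of_eq (coprodShift_gen i) hp)
  · refine tensor_regBimod_hom_ext (comp_apply_of_eq (tensorMap_dBraidInv i) ?_)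
    refine (map_add _ _ _).trans ((congrArg₂ (· + ·) (hom_gen_op_smul_gen _ hp) hp').trans ?_)
    exact add_neg_cancel (op (pathX i) • projGen i : projTensor n i)
  · exact projTensor_hom_ext_shift (comp_apply_of_eq (coprodShift_gen i) hr)
  · refine loop_hom_ext_shift ?_ ?_
    · exact (congrArg₂ (· + ·) (comp_apply_of_eq hr (map_zero _))
        (comp_apply_of_eq hp (coprodShift_gen i))).trans (zero_add _)
    · refine (congrArg₂ (· + ·) (comp_apply_of_eq hr' (tensorMap_dBraidInv i))
        (comp_apply_of_eq hp' hs)).trans ?_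
      exact (congrArg (· + _) (add_comm _ _)).trans (add_neg_cancel_right _ _)

/-- The mirror image of `cancels_casimir`. -/
theorem cancels_op_casimir (i : ZMod n) :
    (bimodTriang n).op.Cancels ((hotS n _).map (dBraid n i)) ((hotS n _).map (dBraidInv n i)) := by
  have hr := loopHomShift_gen (i := i) (zero_mem _) (one_gen_mem i) (corner_zero i)
  have hr' := loopHomShift_loop (i := i) (zero_mem _) (one_gen_mem i) (corner_one_gen i)
  have hp := loopHomShift_gen (Q := projTensorShift n i) (projGen_mem_shift i)
    (smul_gen_mem_shift i) (corner_gen i)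
  have hp' := loopHomShift_loop (Q := projTensorShift n i) (projGen_mem_shift i)
    (smul_gen_mem_shift i) (corner_neg_smul_gen i)
  have hs : Hom.toFun (coprodShift i) (-(pathX i • projGen i) : projTensor n i) =
      -(tmul (N := projTensorShift n i) (pathX i • projGen i) (projGen i)) := by
    refine (map_neg (coprodShift i).toFun _).trans (congrArg Neg.neg ?_)
    exact hom_smul_of_eq (coprodShift i) (pathX i) (coprodShift_gen i)
  set sw := tensorShiftSwap (-1, 0, 0) (projTensor n i) (projTensor n i) with hsw
  set r₀ := loopHomShift i (-1, 0, 0) 0 _ (zero_mem _) (one_gen_mem i) with hr₀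
  set p₀ := loopHomShift (Q := projTensorShift n i) i (-1, 0, 0) _ _ (projGen_mem_shift i)
    (smul_gen_mem_shift i) with hp₀
  have e₅ : r₀ ≫ tensorMap (dBraidInv n i) (𝟙 _) ≫ sw.hom + p₀ ≫ coprodShift i = 𝟙 _ := by
    refine loop_hom_ext_shift ?_ ?_
    · exact (congrArg₂ (· + ·) (comp_apply_of_eq hr (map_zero _))
        (comp_apply_of_eq hp (coprodShift_gen i))).trans (zero_add _)
    · refine (congrArg₂ (· + ·) (comp_apply_of_eq hr' (tensorMap_dBraidInv' i))
        (comp_apply_of_eq hp' hs)).trans ?_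
      exact add_neg_cancel_right _ _
  refine cancels_op_of_bimod _ _ (coprodShift i ≫ sw.inv) (sw.hom ≫ r₀) (sw.hom ≫ p₀)
    ?_ ?_ ?_ ?_ ?_ (isIso_coprodShift_dBraid' i)
  · rw [← Category.assoc]
    refine regBimod_tensor_hom_ext (comp_apply_of_eq (tensorMap_dBraidInv' i) ?_)
    refine (map_add _ _ _).trans ((congrArg₂ (· + ·) hr' (hom_smul_gen_gen_zero _ hr)).trans
        (add_zero _))
  · rw [Category.assoc, sw.inv_hom_id_assoc]
    exact projTensor_hom_ext_shift (comp_apply_of_eq (coprodShift_gen i) hp)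
  · rw [← Category.assoc]
    refine regBimod_tensor_hom_ext (comp_apply_of_eq (tensorMap_dBraidInv' i) ?_)
    refine (map_add _ _ _).trans ((congrArg₂ (· + ·) hp' (hom_smul_gen_gen _ hp)).trans ?_)
    exact neg_add_cancel (pathX i • projGen i : projTensor n i)
  · rw [Category.assoc, sw.inv_hom_id_assoc]
    exact projTensor_hom_ext_shift (comp_apply_of_eq (coprodShift_gen i) hr)
  · have e₆ : (sw.hom ≫ r₀) ≫ tensorMap (dBraidInv n i) (𝟙 _) +
        (sw.hom ≫ p₀) ≫ coprodShift i ≫ sw.inv =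
        sw.hom ≫ (r₀ ≫ tensorMap (dBraidInv n i) (𝟙 _) ≫ sw.hom + p₀ ≫ coprodShift i) ≫
          sw.inv := by
      rw [Preadditive.add_comp, Preadditive.comp_add]
      simp only [Category.assoc, Iso.hom_inv_id, Category.comp_id]
    rw [e₆, e₅, Category.id_comp, Iso.hom_inv_id]

end
end AffineBraid

/-! ### Morphisms to the unit -/

namespace AffineBraid
open TriBimod QuiverAlg MulOpposite

section
variable {A B : TriRing}

theorem decompose_mem {M : Type} [AddCommGroup M] {gr : TriDeg → AddSubgroup M}
    (h : DirectSum.IsInternal gr) (m : M) (γ : TriDeg) : decompose h m γ ∈ gr γ := by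
  refine homogeneous_induction h (p := fun m => decompose h m γ ∈ gr γ) ?_ (fun δ m hm => ?_)
    (fun m m' hm hm' => ?_) m
  · rw [map_zero]; exact zero_mem _
  · rw [decompose_of_mem h hm, Finsupp.single_apply]
    split_ifs with hδ
    · exact hδ ▸ hm
    · exact zero_mem _
  · rw [map_add]; exact add_mem hm hm'

theorem decompose_hom {M N : TriBimod A B} (f : M ⟶ N) (m : M) (γ : TriDeg) :
    decompose N.internal (f.toFun m) γ = f.toFun (decompose M.internal m γ) := by
  refine homogeneous_induction M.internal
    (p := fun m => decompose N.internal (f.toFun m) γ = f.toFun (decompose M.internal m γ))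
    ?_ (fun δ m hm => ?_) (fun m m' hm hm' => ?_) m
  · rw [map_zero, map_zero, map_zero, Finsupp.zero_apply]
    exact (map_zero f.toFun).symm
  · rw [decompose_of_mem _ hm, decompose_of_mem _ (f.map_gr hm), Finsupp.single_apply,
      Finsupp.single_apply]
    split_ifs
    · rfl
    · rw [map_zero]
  · rw [map_add, map_add, map_add, Finsupp.add_apply, Finsupp.add_apply, map_add, hm, hm']

theorem mem_of_decompose_eq {M : Type} [AddCommGroup M] {gr : TriDeg → AddSubgroup M}
    (h : DirectSum.IsInternal gr) {m : M} {γ : TriDeg} (hm : decompose h m γ = m) : m ∈ gr γ :=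
  hm ▸ decompose_mem h m γ

theorem isIso_of_bijective {M N : TriBimod A B} (f : M ⟶ N) (hf : Function.Bijective f.toFun) :
    IsIso f := by
  let e := AddEquiv.ofBijective f.toFun hf
  have he : ∀ y, f.toFun (e.symm y) = y := e.apply_symm_apply
  refine ⟨⟨e.symm.toAddMonoidHom, fun a y => ?_, fun b y => ?_, fun {γ y} hy => ?_⟩, ?_, ?_⟩
  · refine hf.1 ((he _).trans ?_)
    rw [f.map_smul]
    exact congrArg (a • ·) (he y).symm
  · refine hf.1 ((he _).trans ?_)
    rw [f.map_op_smul]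
    exact congrArg (op b • ·) (he y).symm
  · refine mem_of_decompose_eq M.internal (hf.1 ?_)
    rw [← decompose_hom]
    have h := he y
    refine (congrArg (fun t => decompose N.internal t γ) h).trans ?_
    rw [decompose_of_mem _ hy, Finsupp.single_eq_same]
    exact h.symm
  · exact Hom.ext (AddMonoidHom.ext fun x => e.symm_apply_apply x)
  · exact Hom.ext (AddMonoidHom.ext he)

end

section
variable {n : ℕ}

theorem pathE_mul_mem_of_compat {P Q S : PathDeg n} (h : PathDeg.Compat P Q S) {γ : TriDeg}
    {s : QuiverAlg n} (hs : s ∈ pathGr S γ) (i : ZMod n) :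
    pathE i * s ∈ pathGr Q (γ - P.e i) := by
  obtain ⟨h₁, h₂, h₃, h₄⟩ := hs
  refine ⟨fun j hj => ?_, fun j hj => ?_, fun j hj => ?_, fun j hj => ?_⟩ <;>
    obtain rfl : j = i := by_contra fun hji => hj (by simp [pathE, hji])
  · rw [← h₁ j (by simpa [pathE] using hj), ← h.ee, add_sub_cancel_left]
  · rw [← h₂ j (by simpa [pathE] using hj), ← h.eu, add_sub_cancel_left]
  · rw [← h₃ j (by simpa [pathE] using hj), ← h.ed, add_sub_cancel_left]
  · rw [← h₄ j (by simpa [pathE] using hj), ← h.ex, add_sub_cancel_left]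

theorem mul_pathE_mem_of_compat {P Q S : PathDeg n} (h : PathDeg.Compat P Q S) {γ : TriDeg}
    {s : QuiverAlg n} (hs : s ∈ pathGr S γ) (i : ZMod n) :
    s * pathE i ∈ pathGr P (γ - Q.e i) := by
  obtain ⟨h₁, h₂, h₃, h₄⟩ := hs
  refine ⟨fun j hj => ?_, fun j hj => ?_, fun j hj => ?_, fun j hj => ?_⟩
  · obtain rfl : j = i := by_contra fun hji => hj (by simp [pathE, hji])
    rw [← h₁ j (by simpa [pathE] using hj), ← h.ee, add_sub_cancel_right]
  · obtain rfl : j + 1 = i := by_contra fun hji => hj (by simp [pathE, hji])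
    rw [← h₂ j (by simpa [pathE] using hj), ← h.ue, add_sub_cancel_right]
  · obtain rfl : j - 1 = i := by_contra fun hji => hj (by simp [pathE, hji])
    rw [← h₃ j (by simpa [pathE] using hj), ← h.de, add_sub_cancel_right]
  · obtain rfl : j = i := by_contra fun hji => hj (by simp [pathE, hji])
    rw [← h₄ j (by simpa [pathE] using hj), ← h.xe, add_sub_cancel_right]

theorem tRho_symm_mem {r : QuiverAlg n} {γ : TriDeg} (h : r ∈ pathGr (rotDeg n) γ) :
    (tRho n).symm r ∈ pathGr (stdDeg n) γ := by
  obtain ⟨h₁, h₂, h₃, h₄⟩ := h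
  refine ⟨fun i hi => (h₁ (i + 1) hi).symm ▸ ?_, fun i hi => (h₂ (i + 1) hi).symm ▸ ?_,
    fun i hi => (h₃ (i + 1) hi).symm ▸ ?_, fun i hi => (h₄ (i + 1) hi).symm ▸ ?_⟩ <;>
    simp [rotDeg]

theorem tRho_pathE (i : ZMod n) : tRho n (pathE i) = pathE (i + 1) := by
  ext j <;> simp [tRho, pathE, Pi.single_apply, sub_eq_iff_eq_add]

variable [Fact (3 ≤ n)]

/-- Every bimodule map `P_i ⊗ _iP ⟶ R_n` is a multiple of the multiplication. -/
theorem exists_eq_zsmul_dBraid {i : ZMod n} (f : projTensor n i ⟶ regBimod n) :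
    ∃ k : ℤ, f = k • dBraid n i := by
  obtain ⟨z, hz⟩ : ∃ z : QuiverAlg n, z = f.toFun (projGen i) := ⟨_, rfl⟩
  have hg : z ∈ pathGr (stdDeg n) 0 := hz ▸ f.map_gr (projGen_mem i)
  have h₁ : pathE i * z = z := by
    have := f.map_smul (pathE i) (projGen i)
    rw [pathE_smul_projGen, ← hz] at this
    exact this.symm
  have h₂ : z * pathE i = z := by
    have := f.map_op_smul (pathE i) (projGen i)
    rw [op_pathE_smul_projGen, ← hz] at this
    exact this.symm
  refine ⟨z.e i, projTensor_hom_ext ?_⟩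
  have h₃ : z = z.e i • pathE i := by
    have hx : z.x i = 0 := by_contra fun hx => by
      have := hg.2.2.2 i hx
      simp [stdDeg] at this
    have := pathE_mul_mul_pathE i z
    rwa [h₁, h₂, hx, zero_smul, add_zero] at this
  have h₄ : (z.e i • dBraid n i).toFun (projGen i) = z.e i • pathE i := by
    rw [← dBraid_gen i]
    exact map_zsmul (AddMonoidHom.mk' (fun f : projTensor n i ⟶ regBimod n =>
      Hom.toFun f (projGen i)) fun _ _ => rfl) _ _
  exact hz.symm.trans (h₃.trans h₄.symm)

theorem eq_zero_of_zsmul_dBraid {i : ZMod n} {k : ℤ} (h : k • dBraid n i = 0) : k = 0 := by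
  have h₄ : (k • dBraid n i).toFun (projGen i) = k • pathE i := by
    rw [← dBraid_gen i]
    exact map_zsmul (AddMonoidHom.mk' (fun f : projTensor n i ⟶ regBimod n =>
      Hom.toFun f (projGen i)) fun _ _ => rfl) _ _
  have h₅ : (0 : QuiverAlg n) = k • pathE i :=
    (congrArg (fun f : projTensor n i ⟶ regBimod n => Hom.toFun f (projGen i)) h).symm.trans h₄
  have := congrArg (fun r : QuiverAlg n => r.e i) h₅
  rw [zsmul_e] at this
  simpa [pathE] using this.symm

/-- The group `(i) R_n (j)` vanishes if `j` is neither `i` nor adjacent to it. -/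
theorem isZero_projTensor_tensor {i j : ZMod n} (h₀ : j ≠ i) (h₁ : j ≠ i + 1) (h₂ : j ≠ i - 1) :
    IsZero (tensorObj (projTensor n i) (projTensor n j)) := by
  rw [IsZero.iff_id_eq_zero]
  refine projTensor_tensor_hom_ext fun y => ?_
  have key : tmul (projGen i) y = 0 := by
    refine projTensor_induction (P := fun y => tmul (projGen i) y = 0) (tmul_zero _)
      (fun a b => ?_) (fun x y hx hy => ?_) y
    · have h : pathE i • a • op b • projGen j = 0 := by
        rw [smul_smul, smul_comm, smul_gen_mul, pathE_mul_mul_pathE_eq_zero h₀ h₁ h₂, zero_smul,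
          smul_zero]
      rw [gen_tmul, h, tmul_zero]
    · rw [tmul_add, hx, hy, add_zero]
  exact (congrArg _ key).trans ((map_zero _).trans rfl)

end
end AffineBraid

/-! ### Conjugation by `T_n^ρ` -/

namespace AffineBraid
open TriBimod QuiverAlg MulOpposite
section
variable {n : ℕ} [Fact (3 ≤ n)]

theorem op_smul_zero {A B : TriRing} (Q : TriBimod A B) (c : B) : op c • (0 : Q) = 0 := smul_zero _

theorem op_smul_add {A B : TriRing} {Q : TriBimod A B} (c : B) (x y : Q) :
    op c • (x + y) = op c • x + op c • y := smul_add _ _ _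

theorem smul_congr {A B : TriRing} {Q : TriBimod A B} (c : A) {x y : Q} (h : x = y) :
    c • x = c • y := h ▸ rfl

theorem op_smul_congr {A B : TriRing} {Q : TriBimod A B} (c : B) {x y : Q} (h : x = y) :
    op c • x = op c • y := h ▸ rfl

/-- The element `r` of `T_n^ρ`. -/
def toTwist (r : QuiverAlg n) : twistBimod n := r

theorem twist_smul (a r : QuiverAlg n) : a • toTwist r = toTwist (a * r) := rfl

theorem twist_op_smul (b r : QuiverAlg n) : op b • toTwist r = toTwist (r * tRho n b) := rfl

/-- The right module map `y ↦ (i+1) ⊗ (i) ⊗ t_ρ⁻¹(y)`. -/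
noncomputable def twistGen (i : ZMod n) :
    twistBimod n →+ tensorObj (twistBimod n) (projTensor n i) :=
  AddMonoidHom.mk' (fun y : QuiverAlg n => tmul (M := twistBimod n) (toTwist (pathE (i + 1)))
      (op ((tRho n).symm y) • projGen i))
    (fun (y y' : QuiverAlg n) => by
      have h : op ((tRho n).symm (y + y')) • projGen i =
          op ((tRho n).symm y) • projGen i + op ((tRho n).symm y') • projGen i := by
        rw [map_add, MulOpposite.op_add, add_smul]
      exact (congrArg (tmul (M := twistBimod n) (toTwist (pathE (i + 1)))) h).trans
        (tmul_add _ _ _))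

theorem twistGen_apply (i : ZMod n) (y : QuiverAlg n) : twistGen i (toTwist y) =
    tmul (M := twistBimod n) (toTwist (pathE (i + 1))) (op ((tRho n).symm y) • projGen i) := rfl

theorem toTwist_pathE_mem (i : ZMod n) :
    toTwist (pathE i) ∈ (twistBimod n).gr ((twistDeg n).e i) := by
  refine ⟨fun j hj => ?_, fun j hj => absurd rfl hj, fun j hj => absurd rfl hj,
    fun j hj => absurd rfl hj⟩
  obtain rfl : j = i := by_contra fun hji => hj (by simp [toTwist, pathE, hji])
  rfl

theorem op_tRho_symm_smul_gen (i : ZMod n) (y : QuiverAlg n) :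
    op ((tRho n).symm (pathE (i + 1) * y)) • projGen i = op ((tRho n).symm y) • projGen i := by
  rw [map_mul, ← tRho_pathE, RingEquiv.symm_apply_apply, op_mul, mul_smul, op_pathE_smul_projGen]

theorem twistGen_mem (i : ZMod n) {γ : TriDeg} {y : twistBimod n} (hy : y ∈ (twistBimod n).gr γ) :
    twistGen i y ∈ (tensorObj (twistBimod n) (projTensor n i)).gr γ := by
  have h₁ := (projTensor n i).op_smul_mem (projGen_mem i)
    (tRho_symm_mem (pathE_mul_mem_of_compat twistDeg_compat_right hy (i + 1)))
  have h := op_tRho_symm_smul_gen i y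
  have h₂ := tmul_mem (toTwist_pathE_mem (i + 1)) (h ▸ h₁)
  rw [zero_add, add_sub_cancel] at h₂
  exact h₂

/-- The map `P_{i+1} ⊗ _{i+1}P ⊗ T_n^ρ ⟶ T_n^ρ ⊗ P_i ⊗ _iP`. -/
noncomputable def twistSwapInv (i : ZMod n) :
    tensorObj (projTensor n (i + 1)) (twistBimod n) ⟶ tensorObj (twistBimod n) (projTensor n i) :=
  projMul (i + 1) (twistGen i) (fun c y => by
    have h : op ((tRho n).symm ((show QuiverAlg n from y) * tRho n c)) • projGen i =
        op (c : QuiverAlg n) • op ((tRho n).symm (show QuiverAlg n from y)) • projGen i := by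
      rw [map_mul, RingEquiv.symm_apply_apply, op_mul, mul_smul]
    exact congrArg (tmul (M := twistBimod n) (toTwist (pathE (i + 1)))) h) (twistGen_mem i)

/-- The map `p ⊗ q ↦ t t_ρ(p) ⊗ (i+1) ⊗ t_ρ(q)`. -/
noncomputable def twistSwapFix (i : ZMod n) (t : QuiverAlg n) :
    projTensor n i →+ tensorObj (projTensor n (i + 1)) (twistBimod n) :=
  tensorLift (M := projLeft n i) (N := projRight n i)
    (AddMonoidHom.mk' (fun p => AddMonoidHom.mk' (fun q =>
      tmul ((t * tRho n p.1) • projGen (i + 1)) (toTwist (tRho n q.1)))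
      (fun q q' => by
        rw [← tmul_add]
        exact congrArg (fun y => tmul ((t * tRho n p.1) • projGen (i + 1)) (toTwist y))
          (map_add (tRho n) q.1 q'.1)))
      (fun p p' => by
        ext q
        have : (t * tRho n (p.1 + p'.1)) • projGen (i + 1) =
            (t * tRho n p.1) • projGen (i + 1) + (t * tRho n p'.1) • projGen (i + 1) := by
          rw [map_add, mul_add, add_smul]
        exact (congrArg (fun u => tmul u (toTwist (tRho n q.1))) this).trans (add_tmul _ _ _)))
    (fun p k q => by
      have h₁ : (t * tRho n (k • p.1)) • projGen (i + 1) =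
          k • (t * tRho n p.1) • projGen (i + 1) := by
        rw [map_zsmul, mul_smul_comm, smul_assoc]
      have h₂ : toTwist (tRho n (k • q.1)) = k • toTwist (tRho n q.1) := map_zsmul (tRho n) k q.1
      exact (congrArg (fun u => tmul u (toTwist (tRho n q.1))) h₁).trans ((zsmul_tmul _ _ _).trans
        ((congrArg (tmul _) h₂).trans (tmul_zsmul _ _ _)).symm))

theorem twistSwapFix_add (i : ZMod n) (t t' : QuiverAlg n) :
    twistSwapFix i (t + t') = twistSwapFix i t + twistSwapFix i t' := by
  refine AddMonoidHom.ext fun u => ?_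
  refine projTensor_induction' (P := fun u => twistSwapFix i (t + t') u =
    twistSwapFix i t u + twistSwapFix i t' u) ?_ (fun p q => ?_) (fun x y hx hy => ?_) u
  · rw [map_zero, map_zero, map_zero, add_zero]
  · have : ((t + t') * tRho n p.1) • projGen (i + 1) =
        (t * tRho n p.1) • projGen (i + 1) + (t' * tRho n p.1) • projGen (i + 1) := by
      rw [add_mul, add_smul]
    exact (congrArg (fun u => tmul u (toTwist (tRho n q.1))) this).trans (add_tmul _ _ _)
  · rw [map_add, map_add, map_add, hx, hy, add_add_add_comm]

/-- The biadditive map `(t, p ⊗ q) ↦ t t_ρ(p) ⊗ (i+1) ⊗ t_ρ(q)`. -/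
noncomputable def twistSwapAux (i : ZMod n) :
    twistBimod n →+ projTensor n i →+ tensorObj (projTensor n (i + 1)) (twistBimod n) :=
  AddMonoidHom.mk' (fun t : QuiverAlg n => twistSwapFix i t) (twistSwapFix_add i)

/-- The map `t ⊗ p ⊗ q ↦ t t_ρ(p) ⊗ (i+1) ⊗ t_ρ(q)`. -/
noncomputable def twistSwap (i : ZMod n) :
    tensorObj (twistBimod n) (projTensor n i) ⟶ tensorObj (projTensor n (i + 1)) (twistBimod n) :=
  tensorDesc (twistSwapAux i)
    (fun t b u => by
      induction u using projTensor_induction' with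
      | h₀ => rw [smul_zero, map_zero, map_zero]
      | h₁ p q =>
        have : ((show QuiverAlg n from t) * tRho n b * tRho n p.1) • projGen (i + 1) =
            ((show QuiverAlg n from t) * tRho n (b * p.1)) • projGen (i + 1) := by
          rw [map_mul, mul_assoc]
        exact congrArg (fun u => tmul u (toTwist (tRho n q.1))) this
      | h₂ x y hx hy => rw [smul_add, map_add, map_add, hx, hy])
    (fun a t u => by
      induction u using projTensor_induction' with
      | h₀ => rw [map_zero, map_zero]; exact (smul_zero (a : QuiverAlg n)).symm
      | h₁ p q =>
        have : ((a : QuiverAlg n) * (show QuiverAlg n from t) * tRho n p.1) • projGen (i + 1) =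
            (a : QuiverAlg n) • ((show QuiverAlg n from t) * tRho n p.1) • projGen (i + 1) := by
          rw [mul_assoc, mul_smul]
        exact (congrArg (fun u => tmul u (toTwist (tRho n q.1))) this).trans (smul_tensor _ _
            _).symm
      | h₂ x y hx hy => rw [map_add, map_add, hx, hy]; exact (smul_add (a : QuiverAlg n) _ _).symm)
    (fun c t u => by
      induction u using projTensor_induction' with
      | h₀ => rw [smul_zero, map_zero]; exact (op_smul_zero (tensorObj (projTensor n (i + 1))
          (twistBimod n)) c).symm
      | h₁ p q =>
        exact congrArg (fun y => tmul (((show QuiverAlg n from t) * tRho n p.1) •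
          projGen (i + 1)) (toTwist y)) (map_mul (tRho n) q.1 c)
      | h₂ x y hx hy =>
        rw [smul_add, map_add, map_add, hx, hy]; exact (op_smul_add (Q := tensorObj (projTensor n
            (i + 1)) (twistBimod n)) c _ _).symm)
    (fun {α β t u} ht hu => by
      refine projTensor_gr_induction (P := fun u => twistSwapAux i t u ∈
        (tensorObj (projTensor n (i + 1)) (twistBimod n)).gr (α + β)) ?_
        (fun β₁ β₂ p q hp hq h => ?_) (fun u v hu hv => ?_) (fun u hu => ?_) hu
      · rw [map_zero]; exact zero_mem _
      · have h₁ := mul_mem_pathGr twistDeg_compat_right ht (tRho_mem hp)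
        have h₂ := (projTensor n (i + 1)).smul_mem
          (mul_pathE_mem_of_compat twistDeg_compat_left h₁ (i + 1)) (projGen_mem (i + 1))
        rw [← smul_gen_mul] at h₂
        have h₃ := (twistBimod n).op_smul_mem (toTwist_pathE_mem (i + 1)) hq
        have h₄ : op q.1 • toTwist (pathE (i + 1)) = toTwist (tRho n q.1) := by
          rw [twist_op_smul, ← tRho_pathE, ← map_mul, pathE_mul_of_mem q.2]
        rw [h₄] at h₃
        have h₅ := tmul_mem h₂ h₃
        have h₆ : α + β₁ - (twistDeg n).e (i + 1) + 0 + ((twistDeg n).e (i + 1) + β₂) = α + β := by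
          rw [← h]; abel
        rw [h₆] at h₅
        exact h₅
      · rw [map_add]; exact add_mem hu hv
      · rw [map_neg]; exact neg_mem hu)

theorem twistSwap_gen (i : ZMod n) (t : QuiverAlg n) :
    Hom.toFun (twistSwap i) (tmul (toTwist t) (projGen i)) =
      tmul (t • projGen (i + 1)) (toTwist (pathE (i + 1))) := by
  have h : (t * tRho n (pathE i)) • projGen (i + 1) = t • projGen (i + 1) := by
    rw [tRho_pathE, ← smul_gen_mul]
  have h₂ : toTwist (tRho n (pathE i)) = toTwist (pathE (i + 1)) := congrArg toTwist (tRho_pathE i)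
  exact congrArg₂ tmul h h₂

theorem twistSwapInv_gen (i : ZMod n) (y : QuiverAlg n) :
    Hom.toFun (twistSwapInv i) (tmul (projGen (i + 1)) (toTwist y)) =
      tmul (toTwist (pathE (i + 1))) (op ((tRho n).symm y) • projGen i) := by
  have h : pathE (i + 1) • toTwist (pathE (i + 1)) = toTwist (pathE (i + 1)) :=
    congrArg toTwist (pathE_mul_pathE (i + 1))
  refine (projMul_gen (twistGen i) _ (twistGen_mem i) (toTwist y)).trans ?_
  have k := twistGen_apply i (pathE (i + 1) * y)
  rw [op_tRho_symm_smul_gen] at k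
  refine (smul_congr (Q := tensorObj (twistBimod n) (projTensor n i)) (pathE (i + 1)) k).trans ?_
  have k' := smul_tensor (pathE (i + 1)) (toTwist (pathE (i + 1)))
    (op ((tRho n).symm y) • projGen i)
  exact k'.trans (congrArg (fun z => tmul (M := twistBimod n) z
    (op ((tRho n).symm y) • projGen i)) h)

theorem twistSwapInv_smul_gen (i : ZMod n) (t : QuiverAlg n) :
    Hom.toFun (twistSwapInv i) (tmul (t • projGen (i + 1)) (toTwist (pathE (i + 1)))) =
      tmul (toTwist t) (projGen i) := by
  have h₁ : op ((tRho n).symm (pathE (i + 1))) • projGen i = projGen i := by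
    rw [← tRho_pathE, RingEquiv.symm_apply_apply, op_pathE_smul_projGen]
  have h₂ := twistSwapInv_gen i (pathE (i + 1))
  rw [h₁] at h₂
  have h₃ : t • toTwist (pathE (i + 1)) = op (pathE i) • toTwist t := by
    rw [twist_smul, twist_op_smul, tRho_pathE]
  refine (hom_smul_tmul (twistSwapInv i) t (projGen (i + 1)) (toTwist (pathE (i + 1)))).trans ?_
  refine (smul_congr (Q := tensorObj (twistBimod n) (projTensor n i)) t h₂).trans
    ((smul_tensor t (toTwist (pathE (i + 1))) (projGen i)).trans ?_)
  refine (congrArg (fun z => tmul (M := twistBimod n) z (projGen i)) h₃).trans ?_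
  exact (tensor_balanced (pathE i) (toTwist t) (projGen i)).trans
    (congrArg (tmul (toTwist t)) (pathE_smul_projGen i))

theorem twistSwap_op_smul_gen (i : ZMod n) (y : QuiverAlg n) :
    Hom.toFun (twistSwap i) (tmul (toTwist (pathE (i + 1))) (op ((tRho n).symm y) • projGen i)) =
      tmul (projGen (i + 1)) (toTwist y) := by
  have h₁ := twistSwap_gen i (pathE (i + 1))
  rw [pathE_smul_projGen] at h₁
  have h₂ : op ((tRho n).symm y) • toTwist (pathE (i + 1)) = pathE (i + 1) • toTwist y := by
    rw [twist_smul, twist_op_smul, RingEquiv.apply_symm_apply]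
  have h₃ : tmul (projGen (i + 1)) (op ((tRho n).symm y) • toTwist (pathE (i + 1))) =
      tmul (projGen (i + 1)) (toTwist y) := by
    rw [h₂, ← gen_tmul]
  refine (hom_tmul_op_smul (C := quiverRing n) (twistSwap i) (toTwist (pathE (i + 1)))
    ((tRho n).symm y) (projGen i)).trans ?_
  exact (op_smul_congr (Q := tensorObj (projTensor n (i + 1)) (twistBimod n)) _ h₁).trans h₃

/-- Conjugation by `T_n^ρ` rotates the indices. -/
noncomputable def twistSwapIso (i : ZMod n) :
    tensorObj (twistBimod n) (projTensor n i) ≅ tensorObj (projTensor n (i + 1)) (twistBimod n)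
        where
  hom := twistSwap i
  inv := twistSwapInv i
  hom_inv_id := tensor_projTensor_hom_ext fun t =>
    (congrArg (Hom.toFun (twistSwapInv i)) (twistSwap_gen i t)).trans (twistSwapInv_smul_gen i t)
  inv_hom_id := projTensor_tensor_hom_ext fun y =>
    (congrArg (Hom.toFun (twistSwap i)) (twistSwapInv_gen i y)).trans (twistSwap_op_smul_gen i y)

end
end AffineBraid

/-! ### Invertibility of `T_n^ρ` -/

namespace AffineBraid
open TriBimod QuiverAlg MulOpposite
section
variable {n : ℕ} [Fact (3 ≤ n)]

theorem twist_cotwist_compat : PathDeg.Compat (twistDeg n) (cotwistDeg n) (stdDeg n) := by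
  have h21 := two_ne_one_zmod (n := n)
  have h10 := one_ne_zero_zmod (n := n)
  constructor <;> intro i <;>
    simp [stdDeg, cotwistDeg, twistDeg, Prod.ext_iff, sub_eq_iff_eq_add] <;>
    (try constructor) <;> (try decide) <;> (try norm_num) <;>
    (try (split_ifs <;> simp_all))

theorem cotwist_twist_compat : PathDeg.Compat (cotwistDeg n) (twistDeg n) (rotDeg n) := by
  have h21 := two_ne_one_zmod (n := n)
  have h10 := one_ne_zero_zmod (n := n)
  have h2 : ∀ i : ZMod n, i + 1 = 2 ↔ i = 1 := fun i =>
    ⟨fun h => by linear_combination h, fun h => by linear_combination h⟩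
  have h3 : ∀ i : ZMod n, i - 1 = 1 ↔ i = 2 := fun i =>
    ⟨fun h => by linear_combination h, fun h => by linear_combination h⟩
  constructor <;> intro i <;>
    simp [stdDeg, rotDeg, cotwistDeg, twistDeg, Prod.ext_iff, sub_eq_iff_eq_add, h2, h3] <;>
    (try constructor) <;> (try decide) <;>
    (try (split_ifs <;> simp_all))

/-- The element `r` of `^ρT_n`. -/
def toCotwist (r : QuiverAlg n) : cotwistBimod n := r

/-- The map `T_n^ρ ⊗ ^ρT_n ⟶ R_n`, `t ⊗ s ↦ t s`. -/
noncomputable def twistMul : tensorObj (twistBimod n) (cotwistBimod n) ⟶ regBimod n :=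
  tensorDesc (AddMonoidHom.mul (R := QuiverAlg n))
    (fun m b k => mul_assoc (G := QuiverAlg n) m (tRho n b) k)
    (fun a m k => mul_assoc (G := QuiverAlg n) a m k)
    (fun c m k => (mul_assoc (G := QuiverAlg n) m k c).symm)
    (fun hm hk => mul_mem_pathGr twist_cotwist_compat hm hk)

/-- The map `^ρT_n ⊗ T_n^ρ ⟶ R_n`, `s ⊗ t ↦ t_ρ⁻¹(s t)`. -/
noncomputable def cotwistMul : tensorObj (cotwistBimod n) (twistBimod n) ⟶ regBimod n :=
  tensorDesc (AddMonoidHom.compr₂ (AddMonoidHom.mul (R := QuiverAlg n))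
      (tRho n).symm.toRingHom.toAddMonoidHom)
    (fun m b k => congrArg (tRho n).symm (mul_assoc (G := QuiverAlg n) m b k))
    (fun a m k => by
      have h : (tRho n).symm (tRho n a * (show QuiverAlg n from m) * (show QuiverAlg n from k)) =
          (a : QuiverAlg n) * (tRho n).symm
            ((show QuiverAlg n from m) * (show QuiverAlg n from k)) := by
        rw [mul_assoc, map_mul, RingEquiv.symm_apply_apply]
      exact h)
    (fun c m k => by
      have h : (tRho n).symm ((show QuiverAlg n from m) * ((show QuiverAlg n from k) * tRho n c)) =
          (tRho n).symm ((show QuiverAlg n from m) * (show QuiverAlg n from k)) *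
            (c : QuiverAlg n) := by
        rw [← mul_assoc, map_mul, RingEquiv.symm_apply_apply]
      exact h)
    (fun hm hk => tRho_symm_mem (mul_mem_pathGr cotwist_twist_compat hm hk))

/-- An inverse of the multiplication is `r ↦ r ⊗ 1`. -/
theorem isIso_twistMul : IsIso (twistMul (n := n)) := by
  have h : ∀ x, tmul (M := twistBimod n) (toTwist (Hom.toFun twistMul x)) (toCotwist 1) = x :=
      fun x => by
    refine tensor_induction (p := fun x => tmul (M := twistBimod n)
      (toTwist (Hom.toFun twistMul x)) (toCotwist 1) = x) ?_ (fun m k => ?_) (fun x y hx hy => ?_) x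
    · exact (congrArg (fun t => tmul (M := twistBimod n) (toTwist t) (toCotwist (n := n) 1))
        (map_zero (Hom.toFun twistMul))).trans (zero_tmul _)
    · have h₁ : op ((tRho n).symm (show QuiverAlg n from k)) • m =
          toTwist ((show QuiverAlg n from m) * (show QuiverAlg n from k)) :=
        congrArg (fun t => (show QuiverAlg n from m) * t) ((tRho n).apply_symm_apply k)
      have h₂ : (tRho n).symm (show QuiverAlg n from k) • toCotwist (n := n) 1 = k :=
        (congrArg (· * (1 : QuiverAlg n)) ((tRho n).apply_symm_apply k)).trans (mul_one _)
      have h₃ := tensor_balanced ((tRho n).symm (show QuiverAlg n from k)) m (toCotwist (n := n) 1)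
      rw [h₁, h₂] at h₃
      exact h₃
    · refine Eq.trans ?_ (congrArg₂ (· + ·) hx hy)
      refine Eq.trans ?_ (add_tmul _ _ _)
      exact congrArg (fun t => tmul (M := twistBimod n) (toTwist t) (toCotwist (n := n) 1))
        (map_add (Hom.toFun twistMul) x y)
  refine isIso_of_bijective _ ⟨fun x y hxy => ?_, fun r => ⟨tmul (M := twistBimod n) (toTwist r)
    (toCotwist 1), mul_one (show QuiverAlg n from r)⟩⟩
  rw [← h x, ← h y, hxy]

theorem isIso_cotwistMul : IsIso (cotwistMul (n := n)) := by
  have h : ∀ x, tmul (M := cotwistBimod n) (toCotwist 1)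
      (toTwist (tRho n (Hom.toFun cotwistMul x))) = x := fun x => by
    refine tensor_induction (p := fun x => tmul (M := cotwistBimod n) (toCotwist 1)
      (toTwist (tRho n (Hom.toFun cotwistMul x))) = x) ?_ (fun m k => ?_) (fun x y hx hy => ?_) x
    · exact (congrArg (fun t => tmul (M := cotwistBimod n) (toCotwist (n := n) 1)
        (toTwist (tRho n t))) (map_zero (Hom.toFun cotwistMul))).trans
          ((congrArg (tmul _) (map_zero (tRho n))).trans (tmul_zero _))
    · have h₁ : toTwist (tRho n ((tRho n).symm
          ((show QuiverAlg n from m) * (show QuiverAlg n from k)))) = (show QuiverAlg n from m) •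
              k :=
        congrArg toTwist ((tRho n).apply_symm_apply _)
      have h₂ : op (show QuiverAlg n from m) • toCotwist (n := n) 1 = m :=
        one_mul (show QuiverAlg n from m)
      have h₃ := tensor_balanced (show QuiverAlg n from m) (toCotwist (n := n) 1) k
      rw [h₂] at h₃
      exact (congrArg (tmul _) h₁).trans h₃.symm
    · refine Eq.trans ?_ (congrArg₂ (· + ·) hx hy)
      refine Eq.trans ?_ (tmul_add _ _ _)
      exact (congrArg (fun t => tmul (M := cotwistBimod n) (toCotwist (n := n) 1)
        (toTwist (tRho n t))) (map_add (Hom.toFun cotwistMul) x y)).trans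
          (congrArg (tmul _) (map_add (tRho n) _ _))
  refine isIso_of_bijective _ ⟨fun x y hxy => ?_, fun r => ⟨tmul (M := cotwistBimod n) (toCotwist 1)
    (toTwist (tRho n r)), ?_⟩⟩
  · rw [← h x, ← h y, hxy]
  · exact (congrArg (tRho n).symm (one_mul _)).trans ((tRho n).symm_apply_apply r)

end
end AffineBraid

/-! ### The relations of the braid group -/

namespace AffineBraid
open TriBimod QuiverAlg MulOpposite BraidGen
open Pretriangulated
section
variable {𝓗 : Type*} [Category 𝓗] [Preadditive 𝓗] [HasZeroObject 𝓗] [HasShift 𝓗 ℤ]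
  [∀ n : ℤ, (shiftFunctor 𝓗 n).Additive] [Pretriangulated 𝓗]

/-- The mirror image of `TensorTriang.cone_tensor`. -/
theorem TensorTriang.cone_tensor_left (W : TensorTriang 𝓗) {U F X X' Y : 𝓗} {m : U ⟶ W.unit}
    {f : W.unit ⟶ F} {k : F ⟶ U⟦(1 : ℤ)⟧} (hF : Triangle.mk m f k ∈ distTriang 𝓗) {x : X ⟶ X'}
    {g : X' ⟶ Y} {l : Y ⟶ X⟦(1 : ℤ)⟧} (hY : Triangle.mk x g l ∈ distTriang 𝓗)
    (hc : W.op.Cancels m x) : Nonempty ((W.T.obj Y).obj F ≅ X⟦(1 : ℤ)⟧) :=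
  W.op.cone_tensor hF hY hc

end

section
variable {n : ℕ} [Fact (3 ≤ n)]

variable (n) in
/-- The complex attached to a letter, as an object of the homotopy category. -/
noncomputable abbrev letterHot (l : BraidGen n × Bool) : BHot n (quiverRing n) :=
  (hotQ n _).obj (letterComplex n l)

/-- The complex `F_i` is the cone of `d_i`. -/
theorem exists_sigma_triangle (i : ZMod n) :
    ∃ (g : (bimodTriang n).unit ⟶ letterHot n (sigma i, true)) (k : _ ⟶ _),
      Triangle.mk ((hotS n _).map (dBraid n i)) g k ∈ distTriang (BHot n (quiverRing n)) :=
  exists_double_triangle (dBraid n i) (show (-1 : ℤ) + 1 = 0 by norm_num)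

/-- The differential `d_i` generates the group of morphisms from `P_i ⊗ _iP` to the unit, also in
the homotopy category. -/
theorem hot_eq_zsmul {i : ZMod n} (φ : (hotS n _).obj (projTensor n i) ⟶ (bimodTriang n).unit) :
    ∃ k : ℤ, φ = k • (hotS n _).map (dBraid n i) := by
  obtain ⟨f, rfl⟩ := (hotQ n _).map_surjective φ
  obtain ⟨g, rfl⟩ := (HomologicalComplex.single (RBimod n) (ComplexShape.up ℤ) 0).map_surjective f
  obtain ⟨k, rfl⟩ := exists_eq_zsmul_dBraid g
  exact ⟨k, (hotS n _).map_zsmul⟩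

theorem eq_zero_of_hot_zsmul {i : ZMod n} (k : ℤ)
    (h : k • (hotS n _).map (dBraid n i) = 0) : k = 0 := by
  have h' : (hotS n _).map (k • dBraid n i) = (hotS n _).map 0 :=
    (hotS n _).map_zsmul.trans (h.trans ((hotS n _).map_zero _ _).symm)
  exact eq_zero_of_zsmul_dBraid (eq_of_single_homotopic _ h')

theorem cancels_sigma {i j : ZMod n} (E : Edge i j) :
    (bimodTriang n).Cancels ((hotS n _).map (dBraid n i))
      (((bimodTriang n).T.map ((hotS n _).map (dBraid n j))).app
        ((hotS n _).obj (projTensor n i))) := by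
  refine (cancels_edge E).of_arrow_iso (hotMu _ _).symm
    ((hotS n _).mapIso (leftUnit (projTensor n i)).symm ≪≫ (hotMu _ _).symm) ?_
  have h := hotMu_left (dBraid n j) (projTensor n i)
  have h₂ : (hotS n _).map (contractLeft j i) ≫ (hotS n _).map (leftUnit (projTensor n i)).inv =
      (hotS n _).map (tensorMap (dBraid n j) (𝟙 _)) := by
    rw [← Functor.map_comp, contractLeft, Category.assoc, Iso.hom_inv_id, Category.comp_id]
  exact (Category.assoc _ _ _).symm.trans ((congrArg (· ≫ (hotMu _ _).inv) h₂).trans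
    (comp_inv_eq_of_comp_hom_eq h))

theorem cancels_op_sigma {i j : ZMod n} (E : Edge i j) :
    (bimodTriang n).op.Cancels ((hotS n _).map (dBraid n i))
      (((bimodTriang n).T.obj ((hotS n _).obj (projTensor n i))).map
        ((hotS n _).map (dBraid n j))) := by
  refine (cancels_op_edge E).of_arrow_iso (hotMu _ _).symm
    ((hotS n _).mapIso (rightUnit (projTensor n i)).symm ≪≫ (hotMu _ _).symm) ?_
  have h := hotMu_right (projTensor n i) (dBraid n j)
  have h₂ : (hotS n _).map (contractRight i j) ≫ (hotS n _).map (rightUnit (projTensor n i)).inv =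
      (hotS n _).map (tensorMap (𝟙 _) (dBraid n j)) := by
    rw [← Functor.map_comp, contractRight, Category.assoc, Iso.hom_inv_id, Category.comp_id]
  exact (Category.assoc _ _ _).symm.trans ((congrArg (· ≫ (hotMu _ _).inv) h₂).trans
    (comp_inv_eq_of_comp_hom_eq h))

variable (n) in
/-- The complex `F'_i`, shifted so that `R_n` sits in degree `-1`. -/
noncomputable abbrev sigmaInvHot (i : ZMod n) : BHot n (quiverRing n) :=
  (hotQ n _).obj (HomologicalComplex.double (c := ComplexShape.up ℤ) (dBraidInv n i)
    (show (-1 : ℤ) + 1 = 0 by norm_num))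

theorem exists_sigma_inv_triangle (i : ZMod n) :
    ∃ (g : (hotS n _).obj (projTensorShift n i) ⟶ sigmaInvHot n i) (k : _ ⟶ _),
      Triangle.mk (C := BHot n (quiverRing n)) ((hotS n _).map (dBraidInv n i)) g k ∈
        distTriang (BHot n (quiverRing n)) :=
  exists_double_triangle (dBraidInv n i) (show (-1 : ℤ) + 1 = 0 by norm_num)

theorem nonempty_sigma_inv_shift (i : ZMod n) :
    Nonempty ((letterHot n (sigma i, false))⟦(1 : ℤ)⟧ ≅ sigmaInvHot n i) := by
  obtain ⟨e⟩ := nonempty_double_shift_iso (dBraidInv n i) (show (0 : ℤ) + 1 = 1 by norm_num)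
    (show (-1 : ℤ) + 1 = 0 by norm_num)
  exact ⟨((HomotopyCategory.quotient _ _).commShiftIso (1 : ℤ)).symm.app _ ≪≫
    (hotQ n _).mapIso e⟩

/-- The complex `F'_i` is inverse to `F_i`, stated for the cone of `d'_i`, which is its shift. -/
theorem sigma_tensor_inv (i : ZMod n) :
    Nonempty (((bimodTriang n).T.obj (letterHot n (sigma i, true))).obj (sigmaInvHot n i) ≅
      (bimodTriang n).unit⟦(1 : ℤ)⟧) := by
  obtain ⟨g, k, hT⟩ := exists_sigma_triangle i
  obtain ⟨g', k', hT'⟩ := exists_sigma_inv_triangle i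
  exact (bimodTriang n).cone_tensor hT hT' (cancels_casimir i)

theorem sigma_inv_tensor (i : ZMod n) :
    Nonempty (((bimodTriang n).T.obj (sigmaInvHot n i)).obj (letterHot n (sigma i, true)) ≅
      (bimodTriang n).unit⟦(1 : ℤ)⟧) := by
  obtain ⟨g, k, hT⟩ := exists_sigma_triangle i
  obtain ⟨g', k', hT'⟩ := exists_sigma_inv_triangle i
  exact (bimodTriang n).cone_tensor_left hT hT' (cancels_op_casimir i)

theorem inv_sigma (i : ZMod n) :
    (bimodTriang n).Inv (letterHot n (sigma i, true)) (letterHot n (sigma i, false)) := by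
  obtain ⟨e⟩ := nonempty_sigma_inv_shift i
  exact .of_shift (sigma_tensor_inv i) (sigma_inv_tensor i) e

theorem inv_rho : (bimodTriang n).Inv (letterHot n (rho, true)) (letterHot n (rho, false)) := by
  have := isIso_twistMul (n := n)
  have := isIso_cotwistMul (n := n)
  exact ⟨⟨hotMu _ _ ≪≫ (hotS n _).mapIso (asIso (twistMul (n := n)))⟩,
    ⟨hotMu _ _ ≪≫ (hotS n _).mapIso (asIso (cotwistMul (n := n)))⟩⟩

theorem isZero_hot_tensor {i j : ZMod n} (h₀ : j ≠ i) (h₁ : j ≠ i + 1) (h₂ : j ≠ i - 1) :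
    IsZero (((bimodTriang n).T.obj ((hotS n _).obj (projTensor n i))).obj
      ((hotS n _).obj (projTensor n j))) :=
  IsZero.of_iso ((hotS n _).map_isZero (isZero_projTensor_tensor h₀ h₁ h₂)) (hotMu _ _)

theorem braid_sigma (i : ZMod n) : Nonempty
    (((bimodTriang n).T.obj (((bimodTriang n).T.obj (letterHot n (sigma i, true))).obj
      (letterHot n (sigma (i + 1), true)))).obj (letterHot n (sigma i, true)) ≅
    ((bimodTriang n).T.obj (letterHot n (sigma (i + 1), true))).obj
      (((bimodTriang n).T.obj (letterHot n (sigma i, true))).obj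
        (letterHot n (sigma (i + 1), true)))) := by
  obtain ⟨g, k, hT⟩ := exists_sigma_triangle i
  obtain ⟨g', k', hT'⟩ := exists_sigma_triangle (i + 1)
  exact TensorTriang.braid_of_cancels hT hT' hot_eq_zsmul hot_eq_zsmul eq_zero_of_hot_zsmul
    (inv_sigma i) (inv_sigma (i + 1)) (cancels_sigma (edgeSucc i))
    (cancels_op_sigma (edgeSucc i).symm)

theorem comm_sigma {i j : ZMod n} (h₁ : j ≠ i + 1) (h₂ : j ≠ i - 1) : Nonempty
    (((bimodTriang n).T.obj (letterHot n (sigma i, true))).obj (letterHot n (sigma j, true)) ≅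
      ((bimodTriang n).T.obj (letterHot n (sigma j, true))).obj (letterHot n (sigma i, true))) := by
  by_cases h₀ : j = i
  · subst h₀
    exact ⟨Iso.refl _⟩
  obtain ⟨g, k, hT⟩ := exists_sigma_triangle i
  obtain ⟨g', k', hT'⟩ := exists_sigma_triangle j
  exact TensorTriang.comm_of_isZero hT hT' hot_eq_zsmul eq_zero_of_hot_zsmul (inv_sigma i)
    (isZero_hot_tensor h₀ h₁ h₂) (isZero_hot_tensor (Ne.symm h₀)
      (fun h => h₂ (by rw [h, add_sub_cancel_right])) (fun h => h₁ (by rw [h, sub_add_cancel])))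

theorem conj_sigma (i : ZMod n) : Nonempty
    (((bimodTriang n).T.obj (letterHot n (rho, true))).obj (letterHot n (sigma i, true)) ≅
      ((bimodTriang n).T.obj (letterHot n (sigma (i + 1), true))).obj (letterHot n (rho, true)))
          := by
  obtain ⟨g, k, hT⟩ := exists_sigma_triangle i
  obtain ⟨g', k', hT'⟩ := exists_sigma_triangle (i + 1)
  exact inv_rho.conj hT hT' hot_eq_zsmul hot_eq_zsmul eq_zero_of_hot_zsmul
    ⟨hotMu _ _ ≪≫ (hotS n _).mapIso (twistSwapIso i) ≪≫ (hotMu _ _).symm⟩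

theorem inv_letter (x : BraidGen n) :
    (bimodTriang n).Inv (letterHot n (x, true)) (letterHot n (x, false)) := by
  cases x with
  | sigma i => exact inv_sigma i
  | rho => exact inv_rho

variable (n) in
/-- The homomorphism from the braid group to the isomorphism classes of invertible complexes of
bimodules. -/
noncomputable def braidClass : BraidGroup n →* (bimodTriang n).IsoClassˣ :=
  PresentedGroup.toGroup (f := fun x => (inv_letter x).unit) (by
    intro r hr
    obtain ⟨i, j, h₁, h₂⟩ | ⟨i⟩ | ⟨i⟩ := hr
    · simp only [map_mul, map_inv, FreeGroup.lift_apply_of]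
      exact mul_inv_eq_one.2 (Units.ext (TensorTriang.cls_eq_iff.2 (comm_sigma h₁ h₂)))
    · simp only [map_mul, map_inv, FreeGroup.lift_apply_of]
      refine mul_inv_eq_one.2 ?_
      rw [mul_assoc (inv_letter (sigma (i + 1))).unit]
      exact Units.ext (TensorTriang.cls_eq_iff.2 (braid_sigma i))
    · simp only [map_mul, map_inv, FreeGroup.lift_apply_of]
      refine mul_inv_eq_one.2 (mul_inv_eq_iff_eq_mul.2 ?_)
      exact Units.ext (TensorTriang.cls_eq_iff.2 (conj_sigma i)))

theorem braidClass_eval (w : BraidWord n) :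
    (braidClass n w.eval : (bimodTriang n).IsoClass) =
      (bimodTriang n).cls ((hotQ n _).obj (wordComplex w)) := by
  induction w with
  | nil => exact congrArg Units.val (map_one (braidClass n))
  | cons l w ih =>
    have h₁ : BraidWord.eval (l :: w) = (cond l.2 (gen l.1) (gen l.1)⁻¹) * BraidWord.eval w := by
      obtain ⟨x, b⟩ := l
      have : (FreeGroup.mk ((x, b) :: w) : FreeGroup (BraidGen n)) =
          FreeGroup.mk [(x, b)] * FreeGroup.mk w := by rw [FreeGroup.mul_mk]; rfl
      rw [BraidWord.eval, this, map_mul]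
      cases b
      · rfl
      · rfl
    have h₂ : ((braidClass n (cond l.2 (gen l.1) (gen l.1)⁻¹) : (bimodTriang n).IsoClassˣ) :
        (bimodTriang n).IsoClass) = (bimodTriang n).cls (letterHot n l) := by
      have h₃ : braidClass n (gen l.1) = (inv_letter l.1).unit := PresentedGroup.toGroup.of _
      obtain ⟨x, b⟩ := l
      cases b
      · exact congrArg Units.val ((map_inv (braidClass n) (gen x)).trans (congrArg _ h₃))
      · exact congrArg Units.val h₃
    rw [h₁, map_mul, Units.val_mul, h₂, ih]
    rfl

/-- Words representing the same braid have homotopy equivalent complexes of bimodules. -/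
theorem nonempty_wordComplex_iso {w w' : BraidWord n} (h : w.eval = w'.eval) :
    Nonempty ((hotQ n _).obj (wordComplex w) ≅ (hotQ n _).obj (wordComplex w')) := by
  rw [← TensorTriang.cls_eq_iff (W := bimodTriang n), ← braidClass_eval, ← braidClass_eval, h]

end
end AffineBraid

/-! ### Perfect complexes -/

namespace AffineBraid
open TriBimod QuiverAlg MulOpposite BraidGen

section
variable {A B C : TriRing}

/-- A bimodule which is finitely generated and projective as a left module. -/
def LeftPerfect (M : TriBimod A B) : Prop := Module.Finite A M ∧ Module.Projective A M

/-- Evaluation of morphisms at an element. -/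
def evalAt {M N : TriBimod A B} (x : M) : (M ⟶ N) →+ N :=
  AddMonoidHom.mk' (fun f => Hom.toFun f x) fun _ _ => rfl

theorem hom_sum_apply {M N : TriBimod A B} {ι : Type} (s : Finset ι) (f : ι → (M ⟶ N)) (x : M) :
    Hom.toFun (∑ i ∈ s, f i : M ⟶ N) x = ∑ i ∈ s, Hom.toFun (f i) x := map_sum (evalAt x) f s

/-- A morphism of bimodules as a map of left modules. -/
def homLinear {M N : TriBimod A B} (f : M ⟶ N) : M →ₗ[A] N where
  toFun := f.toFun
  map_add' := map_add _
  map_smul' := f.map_smul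

theorem LeftPerfect.exists_retract {M : TriBimod A B} (h : LeftPerfect M) :
    ∃ (k : ℕ) (f : (Fin k → A) →ₗ[A] M) (g : M →ₗ[A] (Fin k → A)), f ∘ₗ g = .id := by
  have := h.1
  have := h.2
  obtain ⟨k, f, g, -, -, h⟩ := Module.Finite.exists_comp_eq_id_of_projective A M
  exact ⟨k, f, g, h⟩

theorem LeftPerfect.of_retract_pi {M : TriBimod A B} {ι : Type} [Finite ι]
    {Z : ι → Type} [∀ i, AddCommGroup (Z i)] [∀ i, Module A (Z i)]
    (hZ : ∀ i, Module.Finite A (Z i) ∧ Module.Projective A (Z i))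
    (f : (∀ i, Z i) →ₗ[A] M) (g : M →ₗ[A] (∀ i, Z i)) (h : f ∘ₗ g = .id) : LeftPerfect M := by
  have := fun i => (hZ i).1
  have := fun i => (hZ i).2
  have : Module.Projective A (∀ i, Z i) := by
    classical
    have := Fintype.ofFinite ι
    exact Module.Projective.of_equiv (DirectSum.linearEquivFunOnFintype A ι Z)
  refine ⟨Module.Finite.of_surjective f fun m => ⟨g m, LinearMap.congr_fun h m⟩,
    Module.Projective.of_split g f h⟩

theorem LeftPerfect.of_iso {M N : TriBimod A B} (h : LeftPerfect M) (e : M ≅ N) :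
    LeftPerfect N := by
  have := h.1
  have := h.2
  have he : homLinear e.hom ∘ₗ homLinear e.inv = .id :=
    LinearMap.ext fun m => congrArg (fun f => Hom.toFun f m) e.inv_hom_id
  exact ⟨Module.Finite.of_surjective (homLinear e.hom) fun m => ⟨homLinear e.inv m,
      LinearMap.congr_fun he m⟩,
    Module.Projective.of_split _ _ he⟩

theorem eq_zero_of_isZero {M : TriBimod A B} (h : IsZero M) (m : M) : m = 0 :=
  congrArg (fun f => Hom.toFun f m) (h.eq_of_src (𝟙 M) 0)

theorem LeftPerfect.of_isZero {M : TriBimod A B} (h : IsZero M) : LeftPerfect M := by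
  have : Subsingleton M := ⟨fun a b => by rw [eq_zero_of_isZero h a, eq_zero_of_isZero h b]⟩
  exact ⟨inferInstance, inferInstance⟩

/-- A tensor product of bimodules which are finitely generated and projective on the left is so:
if `N` is a retract of `B^k`, then `M ⊗ N` is a retract of `M^k`. -/
theorem LeftPerfect.tensor {M : TriBimod A B} {N : TriBimod B C} (hM : LeftPerfect M)
    (hN : LeftPerfect N) : LeftPerfect (tensorObj M N) := by
  obtain ⟨k, f, g, hfg⟩ := hN.exists_retract
  let y : Fin k → N := fun j => f fun l => if j = l then 1 else 0
  have hf : ∀ v, f v = ∑ j, v j • y j := LinearMap.pi_apply_eq_sum_univ f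
  let F : (Fin k → M) →ₗ[A] Tensor M N :=
    { toFun := fun v => ∑ j, tmul (v j) (y j)
      map_add' := fun v w => by
        rw [← Finset.sum_add_distrib]
        exact Finset.sum_congr rfl fun j _ => add_tmul _ _ _
      map_smul' := fun a v => by
        rw [Finset.smul_sum]
        exact Finset.sum_congr rfl fun j _ => (smul_tmul' _ _ _).symm }
  let G₀ : Tensor M N →+ (Fin k → M) := tensorLift
    (AddMonoidHom.mk' (fun m => AddMonoidHom.mk' (fun z j => op (g z j) • m)
      (fun z z' => by
        ext j
        change op (g (z + z') j) • m = op (g z j) • m + op (g z' j) • m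
        rw [map_add, Pi.add_apply, MulOpposite.op_add, add_smul]))
      (fun m m' => by ext z j; exact smul_add _ _ _))
    (fun m b z => by
      ext j
      change op (g z j) • op b • m = op (g (b • z) j) • m
      rw [map_smul, Pi.smul_apply, smul_eq_mul, op_mul, mul_smul])
  have hG₀ : ∀ m z, G₀ (tmul m z) = fun j => op (g z j) • m := fun m z => tensorLift_tmul _ _ _ _
  let G : Tensor M N →ₗ[A] (Fin k → M) :=
    { toFun := G₀
      map_add' := map_add _
      map_smul' := fun a x => by
        induction x using tensor_induction with
        | h₀ => rw [smul_zero, map_zero, smul_zero]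
        | h₁ m z =>
          rw [smul_tmul', hG₀, hG₀]
          ext j
          exact (smul_comm a (op (g z j)) m).symm
        | h₂ x y hx hy => rw [smul_add, map_add, map_add, hx, hy, smul_add] }
  refine LeftPerfect.of_retract_pi (M := tensorObj M N) (Z := fun _ : Fin k => M) (fun _ => hM) F G
    (LinearMap.ext fun x => ?_)
  induction x using tensor_induction with
  | h₀ => exact (map_zero _).trans rfl
  | h₁ m z =>
    change ∑ j, tmul (G₀ (tmul m z) j) (y j) = tmul m z
    rw [hG₀]
    have : ∀ j, tmul (op (g z j) • m) (y j) = tmul m (g z j • y j) := fun j => tmul_balanced _ _ _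
    simp only [this]
    have h₂ : ∑ j, tmul m (g z j • y j) = tmul m (∑ j, g z j • y j) :=
      (map_sum (tmulHom m) _ _).symm
    rw [h₂, ← hf]
    exact congrArg (tmul m) (LinearMap.congr_fun hfg z)
  | h₂ x y hx hy => rw [map_add, hx, hy]; rfl

end

section
variable {A B : TriRing}

/-- A bounded complex of bimodules which are finitely generated and projective on the left. -/
def PerfectComplex (K : CochainComplex (TriBimod A B) ℤ) : Prop :=
  (∀ k : ℤ, LeftPerfect (K.X k)) ∧ ∃ a b : ℤ, ∀ k : ℤ, k < a ∨ b < k → IsZero (K.X k)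

variable {n : ℕ} [Fact (3 ≤ n)] {C : TriRing}

theorem perfectComplex_single {M : TriBimod A B} (h : LeftPerfect M) :
    PerfectComplex ((HomologicalComplex.single _ (ComplexShape.up ℤ) 0).obj M) := by
  have hz := fun (k : ℤ) (hk : k ≠ 0) =>
    HomologicalComplex.isZero_single_obj_X (ComplexShape.up ℤ) 0 M k hk
  refine ⟨fun k => ?_, 0, 0, fun k hk => hz k (by omega)⟩
  by_cases hk : k = 0
  · subst hk
    exact h.of_iso (HomologicalComplex.singleObjXSelf (ComplexShape.up ℤ) (0 : ℤ) M).symm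
  · exact .of_isZero (hz k hk)

theorem perfectComplex_double {M N : TriBimod A B} (hM : LeftPerfect M) (hN : LeftPerfect N)
    (f : M ⟶ N) {i j : ℤ} (h : (ComplexShape.up ℤ).Rel i j) :
    PerfectComplex (HomologicalComplex.double (c := ComplexShape.up ℤ) f h) := by
  have hij : i + 1 = j := h
  have hz := HomologicalComplex.isZero_double_X f h
  refine ⟨fun k => ?_, i, j, fun k hk => hz k (by omega) (by omega)⟩
  by_cases h₀ : k = i
  · subst h₀
    exact hM.of_iso (HomologicalComplex.doubleXIso₀ f h).symm
  by_cases h₁ : k = j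
  · subst h₁
    exact hN.of_iso (HomologicalComplex.doubleXIso₁ f h (by omega)).symm
  exact .of_isZero (hz k h₀ h₁)

open HomologicalComplex in
/-- As the complexes are bounded, the terms of the total complex are finite direct sums. -/
theorem PerfectComplex.tensor {K : CochainComplex (RBimod n) ℤ}
    {L : CochainComplex (TriBimod (quiverRing n) C) ℤ} (hK : PerfectComplex K)
    (hL : PerfectComplex L) : PerfectComplex (tensorComplex K L) := by
  obtain ⟨hK, a, b, hab⟩ := hK
  obtain ⟨hL, c, d, hcd⟩ := hL
  have hz : ∀ p q : ℤ, (p < a ∨ b < p) ∨ (q < c ∨ d < q) →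
      IsZero (tensorObj (K.X p) (L.X q)) := by
    rintro p q (h | h)
    · exact ((tensorFunctor (quiverRing n) (quiverRing n) C).flip.obj (L.X q)).map_isZero (hab p h)
    · exact ((tensorFunctor (quiverRing n) (quiverRing n) C).obj (K.X p)).map_isZero (hcd q h)
  refine ⟨fun k => ?_, a + c, b + d, fun k hk => ?_⟩
  · classical
    let T := (tensorComplex K L).X k
    let Z : Set.Icc a b → TriBimod (quiverRing n) C := fun p => tensorObj (K.X p.1) (L.X (k - p.1))
    let inc : ∀ p, Z p ⟶ T := fun p =>
      ιMapBifunctor K L (tensorFunctor _ _ _) (.up ℤ) p.1 (k - p.1) k (by simp)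
    let pr : ∀ p, T ⟶ Z p := fun p => mapBifunctorDesc fun i j h =>
      if h' : i = p.1 then eqToHom (by
        subst h'
        have : j = k - p.1 := by have : p.1 + j = k := h; omega
        subst this; rfl) else 0
    have hT : 𝟙 T = ∑ p, pr p ≫ inc p := by
      refine mapBifunctor.hom_ext fun i j h => ?_
      have hij : i + j = k := h
      obtain rfl : j = k - i := by omega
      rw [Category.comp_id, Preadditive.comp_sum]
      by_cases hi : i ∈ Set.Icc a b
      · rw [Finset.sum_eq_single ⟨i, hi⟩]
        · rw [← Category.assoc, ι_mapBifunctorDesc, dif_pos rfl]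
          exact (Category.id_comp _).symm
        · intro p _ hp
          rw [← Category.assoc, ι_mapBifunctorDesc, dif_neg (fun h => hp (Subtype.ext h.symm)),
            zero_comp]
        · exact fun h => absurd (Finset.mem_univ _) h
      · exact (hz i (k - i) (.inl (by
          by_contra hc
          exact hi ⟨by omega, by omega⟩))).eq_of_src _ _
    refine LeftPerfect.of_retract_pi (Z := fun p => Z p) (fun p => (hK p.1).tensor (hL _))
      (∑ p, homLinear (inc p) ∘ₗ LinearMap.proj p) (LinearMap.pi fun p => homLinear (pr p))
      (LinearMap.ext fun x => ?_)
    have h := congrArg (fun f => Hom.toFun f x) hT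
    have h' : Hom.toFun (∑ p, pr p ≫ inc p : T ⟶ T) x = ∑ p, Hom.toFun (inc p) (Hom.toFun (pr p)
        x) :=
      hom_sum_apply _ _ _
    rw [LinearMap.comp_apply, LinearMap.sum_apply]
    exact h'.symm.trans h.symm
  · rw [IsZero.iff_id_eq_zero]
    refine mapBifunctor.hom_ext fun i j h => ?_
    have hij : i + j = k := h
    exact (hz i j (by omega)).eq_of_src _ _

end
end AffineBraid

/-! ### The weak action -/

namespace AffineBraid
open TriBimod QuiverAlg MulOpposite BraidGen
section
variable {n : ℕ}

/-- A quadruple of coefficient vectors as an element of `R_n`. -/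
def coeffEquiv (n : ℕ) :
    ((ZMod n → ℤ) × (ZMod n → ℤ) × (ZMod n → ℤ) × (ZMod n → ℤ)) ≃ₗ[ℤ] QuiverAlg n :=
  AddEquiv.toIntLinearEquiv
    { toFun := fun v => ⟨v.1, v.2.1, v.2.2.1, v.2.2.2⟩
      invFun := fun r => (r.e, r.u, r.d, r.x)
      map_add' := fun _ _ => rfl
      left_inv := fun _ => rfl
      right_inv := fun _ => rfl }

theorem exists_word (g : BraidGroup n) : ∃ w : BraidWord n, w.eval = g := by
  classical
  obtain ⟨x, rfl⟩ := PresentedGroup.mk_surjective _ g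
  exact ⟨x.toWord, congrArg _ FreeGroup.mk_toWord⟩

/-- A word representing a braid. -/
noncomputable def chosenWord (g : BraidGroup n) : BraidWord n := (exists_word g).choose

theorem eval_chosenWord (g : BraidGroup n) : (chosenWord g).eval = g := (exists_word g).choose_spec

variable [Fact (3 ≤ n)]

instance : Module.Free ℤ (QuiverAlg n) := .of_equiv (coeffEquiv n)

instance : Module.Finite ℤ (QuiverAlg n) := .equiv (coeffEquiv n)

theorem LeftPerfect.shift {A B : TriRing} {M : TriBimod A B} (h : LeftPerfect M) (γ : TriDeg) :
    LeftPerfect ((TriBimod.shift γ).obj M) := h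

theorem leftPerfect_regBimod : LeftPerfect (regBimod n) :=
  ⟨inferInstanceAs (Module.Finite (QuiverAlg n) (QuiverAlg n)),
    inferInstanceAs (Module.Projective (QuiverAlg n) (QuiverAlg n))⟩

theorem leftPerfect_twistBimod : LeftPerfect (twistBimod n) :=
  ⟨inferInstanceAs (Module.Finite (QuiverAlg n) (QuiverAlg n)),
    inferInstanceAs (Module.Projective (QuiverAlg n) (QuiverAlg n))⟩

theorem leftPerfect_cotwistBimod : LeftPerfect (cotwistBimod n) := by
  let e : QuiverAlg n ≃ₗ[QuiverAlg n] Cotwist n :=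
    { (tRho n).toAddEquiv with
      map_smul' := fun a r => map_mul (tRho n) a r }
  exact ⟨Module.Finite.equiv e, Module.Projective.of_equiv e⟩

theorem leftPerfect_projLeft (i : ZMod n) : LeftPerfect (projLeft n i) :=
  ⟨finite_projLeft i, projective_projLeft i⟩

theorem leftPerfect_projRight (i : ZMod n) : LeftPerfect (projRight n i) := by
  let f : QuiverAlg n →ₗ[ℤ] rightIdeal n i :=
    (AddMonoidHom.mk' (fun r => (⟨pathE i * r, mem_rightIdeal (by
      rw [← mul_assoc, pathE_mul_pathE])⟩ : rightIdeal n i))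
      (fun r s => Subtype.ext (mul_add _ r s))).toIntLinearMap
  let g : rightIdeal n i →ₗ[ℤ] QuiverAlg n := (rightIdeal n i).subtype.toAddMonoidHom.toIntLinearMap
  have h : f ∘ₗ g = .id := LinearMap.ext fun q => Subtype.ext (pathE_mul_of_mem q.2)
  exact ⟨Module.Finite.of_surjective f fun q => ⟨g q, LinearMap.congr_fun h q⟩,
    Module.Projective.of_split g f h⟩

theorem leftPerfect_projTensor (i : ZMod n) : LeftPerfect (projTensor n i) :=
  (leftPerfect_projLeft i).tensor (leftPerfect_projRight i)

theorem perfectComplex_letter (l : BraidGen n × Bool) : PerfectComplex (letterComplex n l) := by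
  obtain ⟨i | _, _ | _⟩ := l
  · exact perfectComplex_double leftPerfect_regBimod ((leftPerfect_projTensor i).shift _) _
      (show (0 : ℤ) + 1 = 1 by norm_num)
  · exact perfectComplex_double (leftPerfect_projTensor i) leftPerfect_regBimod _
      (show (-1 : ℤ) + 1 = 0 by norm_num)
  · exact perfectComplex_single leftPerfect_cotwistBimod
  · exact perfectComplex_single leftPerfect_twistBimod

theorem perfectComplex_word (w : BraidWord n) : PerfectComplex (wordComplex w) := by
  induction w with
  | nil => exact perfectComplex_single leftPerfect_regBimod
  | cons l w ih => exact (perfectComplex_letter l).tensor ih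

theorem isPerfect_tensorHot {B : CochainComplex (RBimod n) ℤ} (hB : PerfectComplex B) {K : RHot n}
    (hK : IsPerfect n K) : IsPerfect n ((tensorHot B).obj K) :=
  PerfectComplex.tensor hB hK

/-- Homotopy equivalent complexes of bimodules give isomorphic functors. -/
theorem nonempty_tensorHot_iso {B B' : CochainComplex (RBimod n) ℤ}
    (h : Nonempty ((hotQ n _).obj B ≅ (hotQ n _).obj B')) :
    Nonempty (tensorHot B ≅ tensorHot B') :=
  ⟨(hotTensor n intRing).mapIso h.some⟩

theorem nonempty_tensorHot_unit : Nonempty (tensorHot (n := n) (wordComplex []) ≅ 𝟭 _) := by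
  refine ⟨NatIso.ofComponents (fun X => (hotQ n _).mapIso (complexLeftUnit X.as)) fun {X X'} f =>
      ?_⟩
  obtain ⟨f, rfl⟩ := (hotQ n _).map_surjective f
  have := congrArg (hotQ n _).map (complexLeftUnit_naturality f)
  rw [Functor.map_comp, Functor.map_comp] at this
  exact this

theorem nonempty_tensorHot_comp (B B' : CochainComplex (RBimod n) ℤ) :
    Nonempty (tensorHot (tensorComplex B B') ≅ tensorHot B' ⋙ tensorHot B) :=
  ⟨NatIso.ofComponents (fun X => hotAssoc ((hotQ n _).obj B) ((hotQ n _).obj B') X)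
    fun f => hotAssoc_naturality₃ _ _ f⟩

theorem nonempty_wordComplex_append (w w' : BraidWord n) :
    Nonempty ((hotQ n _).obj (wordComplex (w ++ w')) ≅
      (hotQ n _).obj (tensorComplex (wordComplex w) (wordComplex w'))) := by
  rw [← TensorTriang.cls_eq_iff (W := bimodTriang n), ← braidClass_eval]
  have h : BraidWord.eval (w ++ w') = w.eval * w'.eval := by
    rw [BraidWord.eval, ← FreeGroup.mul_mk, map_mul]; rfl
  rw [h, map_mul, Units.val_mul, braidClass_eval, braidClass_eval]
  rfl

/-- The functor by which a braid acts. -/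
noncomputable def braidFunctor (g : BraidGroup n) : Cn n ⥤ Cn n :=
  (IsPerfect n).lift ((IsPerfect n).ι ⋙ tensorHot (wordComplex (chosenWord g)))
    fun K => isPerfect_tensorHot (perfectComplex_word _) K.property

theorem nonempty_iso_of_comp_ι {F G : Cn n ⥤ Cn n}
    (h : Nonempty (F ⋙ (IsPerfect n).ι ≅ G ⋙ (IsPerfect n).ι)) : Nonempty (F ≅ G) :=
  ⟨Functor.fullyFaithfulCancelRight (IsPerfect n).ι h.some⟩

theorem nonempty_tensorHot_of_eval {w w' : BraidWord n} (h : w.eval = w'.eval) :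
    Nonempty (tensorHot (wordComplex w) ≅ tensorHot (wordComplex w')) :=
  nonempty_tensorHot_iso (nonempty_wordComplex_iso h)

variable (n) in
/-- The weak action of the braid group. -/
noncomputable def braidAction : WeakAction (BraidGroup n) (Cn n) where
  functor := braidFunctor
  one := by
    obtain ⟨e⟩ := nonempty_tensorHot_of_eval (w := chosenWord (1 : BraidGroup n)) (w' := [])
      (eval_chosenWord _)
    obtain ⟨e'⟩ := nonempty_tensorHot_unit (n := n)
    exact nonempty_iso_of_comp_ι ⟨Functor.isoWhiskerLeft (IsPerfect n).ι (e ≪≫ e')⟩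
  mul g h := by
    obtain ⟨e⟩ := nonempty_tensorHot_of_eval (w := chosenWord (g * h))
      (w' := chosenWord g ++ chosenWord h) (by
        rw [eval_chosenWord, BraidWord.eval, ← FreeGroup.mul_mk, map_mul]
        exact (congrArg₂ (· * ·) (eval_chosenWord g) (eval_chosenWord h)).symm)
    obtain ⟨e₁⟩ := nonempty_tensorHot_iso (nonempty_wordComplex_append (chosenWord g) (chosenWord
        h))
    obtain ⟨e₂⟩ := nonempty_tensorHot_comp (wordComplex (chosenWord g)) (wordComplex (chosenWord h))
    exact nonempty_iso_of_comp_ι ⟨Functor.isoWhiskerLeft (IsPerfect n).ι (e ≪≫ e₁ ≪≫ e₂)⟩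

theorem actsBy_eval (w : BraidWord n) : ActsBy (braidAction n) w.eval (wordComplex w) := by
  obtain ⟨e⟩ := nonempty_tensorHot_of_eval (eval_chosenWord w.eval)
  exact ⟨Functor.isoWhiskerLeft (IsPerfect n).ι e⟩

theorem actsBy_letter (l : BraidGen n × Bool) :
    ActsBy (braidAction n) (cond l.2 (gen l.1) (gen l.1)⁻¹) (letterComplex n l) := by
  have h : BraidWord.eval [l] = cond l.2 (gen l.1) (gen l.1)⁻¹ := by
    obtain ⟨x, b⟩ := l
    cases b <;> rfl
  rw [← h]
  obtain ⟨e⟩ := actsBy_eval [l]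
  obtain ⟨e'⟩ := nonempty_tensorHot_iso (B := wordComplex [l]) (B' := letterComplex n l)
    ⟨(bimodTriang n).rho (letterHot n l)⟩
  exact ⟨e ≪≫ Functor.isoWhiskerLeft (IsPerfect n).ι e'⟩

end
end AffineBraid

/-! ### Euler characteristics of socles -/

namespace AffineBraid
open TriBimod QuiverAlg MulOpposite BraidGen
open Pretriangulated
section
variable {n : ℕ} [Fact (3 ≤ n)]

/-- The degree `γ` part of the multiplicity space of the `i`-th simple module in the socle: the
elements of `(i) M` of degree `γ` which are annihilated by all paths of positive length. -/
def socle (i : ZMod n) (γ : TriDeg) (M : RMod n) : AddSubgroup M where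
  carrier := {m | m ∈ M.gr γ ∧ pathE i • m = m ∧ ∀ a : QuiverAlg n, a.e = 0 → a • m = 0}
  add_mem' := fun ⟨h₁, h₂, h₃⟩ ⟨k₁, k₂, k₃⟩ => ⟨add_mem h₁ k₁, by rw [smul_add, h₂, k₂],
    fun a ha => by rw [smul_add, h₃ a ha, k₃ a ha, add_zero]⟩
  zero_mem' := ⟨zero_mem _, smul_zero _, fun _ _ => smul_zero _⟩
  neg_mem' := fun ⟨h₁, h₂, h₃⟩ => ⟨neg_mem h₁, by rw [smul_neg, h₂],
    fun a ha => by rw [smul_neg, h₃ a ha, neg_zero]⟩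

/-- The map induced on socles. -/
def socleMap (i : ZMod n) (γ : TriDeg) {M N : RMod n} (f : M ⟶ N) :
    socle i γ M →+ socle i γ N :=
  (f.toFun.comp (socle i γ M).subtype).codRestrict _ fun m => ⟨f.map_gr m.2.1,
    (f.map_smul _ _).symm.trans (congrArg f.toFun m.2.2.1), fun a ha =>
    (f.map_smul _ _).symm.trans ((congrArg f.toFun (m.2.2.2 a ha)).trans (map_zero _))⟩

/-- The ring `R_n` is a free abelian group of finite rank. -/
theorem LeftPerfect.free {M : RMod n} (h : LeftPerfect M) :
    Module.Free ℤ M ∧ Module.Finite ℤ M := by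
  obtain ⟨k, f, g, hfg⟩ := h.exists_retract
  have h' : f.toAddMonoidHom.toIntLinearMap ∘ₗ g.toAddMonoidHom.toIntLinearMap = .id :=
    LinearMap.ext fun m => LinearMap.congr_fun hfg m
  have : Module.Finite ℤ (Fin k → QuiverAlg n) := inferInstance
  have : Module.Projective ℤ (Fin k → QuiverAlg n) := inferInstance
  have h₁ : Module.Finite ℤ M := Module.Finite.of_surjective f.toAddMonoidHom.toIntLinearMap
    fun m => ⟨g m, LinearMap.congr_fun h' m⟩
  have h₂ : Module.Projective ℤ M := Module.Projective.of_split _ _ h'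
  exact ⟨inferInstance, h₁⟩

theorem LeftPerfect.free_subgroup {M : RMod n} (h : LeftPerfect M) (S : AddSubgroup M) :
    Module.Free ℤ S ∧ Module.Finite ℤ S := by
  have := h.free.1
  have := h.free.2
  exact ⟨inferInstanceAs (Module.Free ℤ (AddSubgroup.toIntSubmodule S)),
    inferInstanceAs (Module.Finite ℤ (AddSubgroup.toIntSubmodule S))⟩

theorem socleMap_add (i : ZMod n) (γ : TriDeg) {M N : RMod n} (f g : M ⟶ N) :
    (socleMap i γ (f + g)).toIntLinearMap =
      (socleMap i γ f).toIntLinearMap + (socleMap i γ g).toIntLinearMap := rfl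

theorem socleMap_id (i : ZMod n) (γ : TriDeg) (M : RMod n) :
    (socleMap i γ (𝟙 M)).toIntLinearMap = LinearMap.id := rfl

/-- The trace of an endomorphism on the socle. -/
noncomputable def socleTrace (i : ZMod n) (γ : TriDeg) {M : RMod n} : (M ⟶ M) →+ ℤ :=
  AddMonoidHom.mk' (fun f => LinearMap.trace ℤ (socle i γ M) (socleMap i γ f).toIntLinearMap)
    fun f g => by rw [socleMap_add, map_add]

theorem socleTrace_comm (i : ZMod n) (γ : TriDeg) {M N : RMod n} (hM : LeftPerfect M)
    (hN : LeftPerfect N) (f : M ⟶ N) (g : N ⟶ M) :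
    socleTrace i γ (f ≫ g) = socleTrace i γ (g ≫ f) := by
  have := (hM.free_subgroup (socle i γ M)).1
  have := (hM.free_subgroup (socle i γ M)).2
  have := (hN.free_subgroup (socle i γ N)).1
  have := (hN.free_subgroup (socle i γ N)).2
  exact LinearMap.trace_comp_comm' (R := ℤ) (socleMap i γ f).toIntLinearMap
    (socleMap i γ g).toIntLinearMap

/-- The rank of the socle. -/
noncomputable def socleRank (i : ZMod n) (γ : TriDeg) (M : RMod n) : ℤ := socleTrace i γ (𝟙 M)

theorem socleRank_eq (i : ZMod n) (γ : TriDeg) {M : RMod n} (hM : LeftPerfect M) :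
    socleRank i γ M = Module.finrank ℤ (socle i γ M) := by
  have := (hM.free_subgroup (socle i γ M)).1
  have := (hM.free_subgroup (socle i γ M)).2
  exact (congrArg (LinearMap.trace ℤ (socle i γ M)) (socleMap_id i γ M)).trans
    (LinearMap.trace_id (R := ℤ) (M := socle i γ M))

theorem socleTrace_of_isZero (i : ZMod n) (γ : TriDeg) {M : RMod n} (hM : IsZero M) (f : M ⟶ M) :
    socleTrace i γ f = 0 := by
  rw [hM.eq_of_src f 0, map_zero]

/-- The alternating sum of the traces of an endomorphism of a complex on socles. -/
noncomputable def lefschetz (i : ZMod n) (γ : TriDeg) {K : CochainComplex (RMod n) ℤ} (f : K ⟶ K) :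
    ℤ := ∑ᶠ k : ℤ, k.negOnePow * socleTrace i γ (f.f k)

theorem finite_support_of_perfect {K : CochainComplex (RMod n) ℤ} (hK : PerfectComplex K)
    {φ : ℤ → ℤ} (hφ : ∀ k, IsZero (K.X k) → φ k = 0) : φ.support.Finite := by
  obtain ⟨-, a, b, hab⟩ := hK
  refine (Set.finite_Icc a b).subset fun k hk => ?_
  by_contra h
  exact hk (hφ k (hab k (by simp only [Set.mem_Icc] at h; omega)))

theorem finsum_negOnePow_succ (φ : ℤ → ℤ) :
    ∑ᶠ k : ℤ, (k.negOnePow * φ (k + 1) : ℤ) = -∑ᶠ k : ℤ, (k.negOnePow * φ k : ℤ) := by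
  rw [← finsum_neg_distrib,
    ← finsum_comp_equiv (f := fun k : ℤ => (-(k.negOnePow * φ k) : ℤ)) (Equiv.addRight (1 : ℤ))]
  refine finsum_congr fun k => ?_
  simp [Int.negOnePow_succ]

theorem finsum_negOnePow_add {φ : ℤ → ℤ} (hφ : φ.support.Finite) :
    ∑ᶠ k : ℤ, (k.negOnePow * (φ k + φ (k - 1)) : ℤ) = 0 := by
  have h₁ : (fun k : ℤ => (k.negOnePow * φ k : ℤ)).support.Finite :=
    hφ.subset fun k hk h => hk (by simp only [h, mul_zero])
  have h₂ : (fun k : ℤ => (k.negOnePow * φ (k - 1) : ℤ)).support.Finite :=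
    (hφ.image (· + 1)).subset fun k hk =>
      ⟨k - 1, fun h => hk (by simp only [h, mul_zero]), sub_add_cancel k 1⟩
  simp only [mul_add]
  rw [finsum_add_distrib h₁ h₂]
  have h₃ := finsum_negOnePow_succ fun k => φ (k - 1)
  simp only [add_sub_cancel_right] at h₃
  rw [h₃, neg_add_cancel]

/-- The contributions of `d h` and of `h d` cancel in the alternating sum. -/
theorem lefschetz_homotopy (i : ZMod n) (γ : TriDeg) {K : CochainComplex (RMod n) ℤ}
    (hK : PerfectComplex K) {f g : K ⟶ K} (h : Homotopy f g) : lefschetz i γ f = lefschetz i γ g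
        := by
  let φ : ℤ → ℤ := fun k => socleTrace i γ (K.d k (k + 1) ≫ h.hom (k + 1) k)
  have hφ : φ.support.Finite := finite_support_of_perfect hK fun k hk => socleTrace_of_isZero i γ
      hk _
  have hg := finite_support_of_perfect hK (φ := fun k : ℤ => (k.negOnePow * socleTrace i γ (g.f
      k) : ℤ))
    fun k hk => by simp only [socleTrace_of_isZero i γ hk, mul_zero]
  have hφ' : (fun k : ℤ => (k.negOnePow * (φ k + φ (k - 1)) : ℤ)).support.Finite :=
    (hφ.union (hφ.image (· + 1))).subset fun k hk => by
      by_contra hc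
      simp only [Set.mem_union, Function.mem_support, Set.mem_image, not_or, not_not] at hc
      refine hk ?_
      have : φ (k - 1) = 0 := by
        by_contra h'
        exact hc.2 ⟨k - 1, h', sub_add_cancel k 1⟩
      simp only [hc.1, this, add_zero, mul_zero]
  have key : ∀ k, socleTrace i γ (f.f k) = φ k + φ (k - 1) + socleTrace i γ (g.f k) := fun k => by
    have hk := h.comm k
    rw [dNext_eq _ (show (ComplexShape.up ℤ).Rel k (k + 1) from rfl),
      prevD_eq _ (show (ComplexShape.up ℤ).Rel (k - 1) k from sub_add_cancel k 1)] at hk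
    rw [hk, map_add, map_add, socleTrace_comm i γ (hK.1 k) (hK.1 (k - 1))]
    have : ∀ l, l = k → socleTrace i γ (K.d (k - 1) k ≫ h.hom k (k - 1)) =
        socleTrace i γ (K.d (k - 1) l ≫ h.hom l (k - 1)) := by rintro l rfl; rfl
    rw [this _ (sub_add_cancel k 1)]
  have hsum := finsum_add_distrib hφ' hg
  rw [finsum_negOnePow_add hφ, zero_add] at hsum
  refine Eq.trans (finsum_congr fun k => ?_) hsum
  rw [key]
  ring

theorem lefschetz_comm (i : ZMod n) (γ : TriDeg) {K L : CochainComplex (RMod n) ℤ}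
    (hK : PerfectComplex K) (hL : PerfectComplex L) (f : K ⟶ L) (g : L ⟶ K) :
    lefschetz i γ (f ≫ g) = lefschetz i γ (g ≫ f) :=
  finsum_congr fun k => congrArg _ (socleTrace_comm i γ (hK.1 k) (hL.1 k) (f.f k) (g.f k))

/-- The Euler characteristic of the socles of the terms of a complex. -/
noncomputable def socleEuler (i : ZMod n) (γ : TriDeg) (K : CochainComplex (RMod n) ℤ) : ℤ :=
  lefschetz i γ (𝟙 K)

theorem socleEuler_eq_of_iso (i : ZMod n) (γ : TriDeg) {K L : CochainComplex (RMod n) ℤ}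
    (hK : PerfectComplex K) (hL : PerfectComplex L) (e : (hotQ n intRing).obj K ≅ (hotQ n _).obj
        L) :
    socleEuler i γ K = socleEuler i γ L := by
  obtain ⟨f, hf⟩ := (hotQ n _).map_surjective e.hom
  obtain ⟨g, hg⟩ := (hotQ n _).map_surjective e.inv
  have h₁ : (hotQ n _).map (f ≫ g) = (hotQ n _).map (𝟙 K) := by
    rw [Functor.map_comp, hf, hg, e.hom_inv_id, CategoryTheory.Functor.map_id]
  have h₂ : (hotQ n _).map (g ≫ f) = (hotQ n _).map (𝟙 L) := by
    rw [Functor.map_comp, hf, hg, e.inv_hom_id, CategoryTheory.Functor.map_id]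
  rw [socleEuler, ← lefschetz_homotopy i γ hK (HomotopyCategory.homotopyOfEq _ _ h₁),
    lefschetz_comm i γ hK hL, lefschetz_homotopy i γ hL (HomotopyCategory.homotopyOfEq _ _ h₂)]
  rfl

theorem LeftPerfect.of_split {X Y Z : RMod n} (hX : LeftPerfect X) (hY : LeftPerfect Y)
    (a : X ⟶ Z) (b : Z ⟶ X) (c : Y ⟶ Z) (d : Z ⟶ Y) (h : b ≫ a + d ≫ c = 𝟙 Z) :
    LeftPerfect Z := by
  let W : Bool → RMod n := fun t => cond t X Y
  refine LeftPerfect.of_retract_pi (Z := fun t => W t) (fun t => by cases t; exacts [hY, hX])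
    (homLinear a ∘ₗ LinearMap.proj true + homLinear c ∘ₗ LinearMap.proj false)
    (LinearMap.pi fun t => match t with | true => homLinear b | false => homLinear d)
    (LinearMap.ext fun x => congrArg (fun f => Hom.toFun f x) h)

open CochainComplex in
theorem perfectComplex_mappingCone {K L : CochainComplex (RMod n) ℤ} (hK : PerfectComplex K)
    (hL : PerfectComplex L) (f : K ⟶ L) : PerfectComplex (mappingCone f) := by
  have key : ∀ k, (mappingCone.fst f).1.v k (k + 1) rfl ≫ (mappingCone.inl f).v (k + 1) k (by
      omega) +
      (mappingCone.snd f).v k k (add_zero k) ≫ (mappingCone.inr f).f k = 𝟙 _ := fun k =>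
    mappingCone.id_X f k (k + 1) rfl
  refine ⟨fun k => (hK.1 (k + 1)).of_split (hL.1 k) _ _ _ _ (key k), ?_⟩
  obtain ⟨-, a, b, hab⟩ := hK
  obtain ⟨-, c, d, hcd⟩ := hL
  refine ⟨min (a - 1) c, max b d, fun k hk => ?_⟩
  rw [IsZero.iff_id_eq_zero, ← key k, (hab (k + 1) (by omega)).eq_of_src
    ((mappingCone.inl f).v (k + 1) k (by omega)) 0, (hcd k (by omega)).eq_of_src
      ((mappingCone.inr f).f k) 0, comp_zero, comp_zero, add_zero]

open CochainComplex in
theorem socleEuler_mappingCone (i : ZMod n) (γ : TriDeg) {K L : CochainComplex (RMod n) ℤ}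
    (hK : PerfectComplex K) (hL : PerfectComplex L) (f : K ⟶ L) :
    socleEuler i γ L = socleEuler i γ K + socleEuler i γ (mappingCone f) := by
  have hC := perfectComplex_mappingCone hK hL f
  have key : ∀ k, socleRank i γ ((mappingCone f).X k) =
      socleRank i γ (K.X (k + 1)) + socleRank i γ (L.X k) := fun k => by
    rw [socleRank, ← mappingCone.id_X f k (k + 1) rfl, map_add,
      socleTrace_comm i γ (hC.1 k) (hK.1 (k + 1)), socleTrace_comm i γ (hC.1 k) (hL.1 k)]
    simp [socleRank]
  have h₁ : (fun k : ℤ => (k.negOnePow * socleRank i γ (K.X (k + 1)) : ℤ)).support.Finite := by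
    obtain ⟨-, a, b, hab⟩ := hK
    refine (Set.finite_Icc (a - 1) b).subset fun k hk => ?_
    by_contra h
    refine hk ?_
    have : socleRank i γ (K.X (k + 1)) = 0 :=
      socleTrace_of_isZero i γ (hab (k + 1) (by simp only [Set.mem_Icc] at h; omega)) _
    simp only [this, mul_zero]
  have h₂ := finite_support_of_perfect hL (φ := fun k : ℤ => (k.negOnePow * socleRank i γ (L.X k)
      : ℤ))
    fun k hk => by simp only [socleRank, socleTrace_of_isZero i γ hk, mul_zero]
  have h₃ : socleEuler i γ (mappingCone f) = ∑ᶠ k : ℤ, ((k.negOnePow * socleRank i γ (K.X (k +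
      1)) : ℤ) +
      (k.negOnePow * socleRank i γ (L.X k) : ℤ)) :=
    finsum_congr fun k => (congrArg (_ * ·) (key k)).trans (mul_add _ _ _)
  rw [h₃, finsum_add_distrib h₁ h₂, finsum_negOnePow_succ fun k => socleRank i γ (K.X k)]
  exact (add_neg_cancel_left _ _).symm

/-- The Euler characteristics of socles are additive, so that they are defined on the Grothendieck
group. -/
theorem socleEuler_triangle (i : ZMod n) (γ : TriDeg) {X Y Z : Cn n} {f : X.obj ⟶ Y.obj}
    {g : Y.obj ⟶ Z.obj} {h : Z.obj ⟶ (shiftFunctor (RHot n) (1 : ℤ)).obj X.obj}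
    (H : Triangle.mk f g h ∈ distTriang (RHot n)) :
    socleEuler i γ Y.obj.as = socleEuler i γ X.obj.as + socleEuler i γ Z.obj.as := by
  obtain ⟨φ, rfl⟩ := (hotQ n _).map_surjective f
  have hT := HomotopyCategory.mappingCone_triangleh_distinguished φ
  obtain ⟨e⟩ := nonempty_iso_of_triangle H hT (Iso.refl _) (Iso.refl _)
    ((Category.comp_id _).trans (Category.id_comp _).symm)
  rw [socleEuler_mappingCone i γ X.property Y.property φ,
    socleEuler_eq_of_iso i γ Z.property (perfectComplex_mappingCone X.property Y.property φ) e]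

end
end AffineBraid

/-! ### Linear independence of the classes of the `P_i` -/

namespace AffineBraid
open TriBimod QuiverAlg MulOpposite BraidGen
open Pretriangulated
section
variable {n : ℕ} [Fact (3 ≤ n)]

theorem socleEuler_shift (i : ZMod n) (γ δ : TriDeg) (X : Cn n) :
    socleEuler i γ ((shiftCn δ).obj X).obj.as = socleEuler i (γ - δ) X.obj.as := rfl

theorem socleRank_eq_of_iso (i : ZMod n) (γ : TriDeg) {M N : RMod n} (hM : LeftPerfect M)
    (e : M ≅ N) : socleRank i γ M = socleRank i γ N := by
  rw [socleRank, ← e.hom_inv_id, socleTrace_comm i γ hM (hM.of_iso e), e.inv_hom_id, socleRank]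

theorem socleEuler_single (i : ZMod n) (γ : TriDeg) {M : RMod n} (hM : LeftPerfect M) :
    socleEuler i γ (inDegreeZero M).as = socleRank i γ M := by
  have hz := fun (k : ℤ) (hk : k ≠ 0) =>
    HomologicalComplex.isZero_single_obj_X (ComplexShape.up ℤ) 0 M k hk
  have h := socleRank_eq_of_iso i γ ((perfectComplex_single hM).1 0)
    (HomologicalComplex.singleObjXSelf (ComplexShape.up ℤ) (0 : ℤ) M)
  refine (finsum_eq_single _ 0 fun k hk => ?_).trans ?_
  · exact (congrArg (_ * ·) (socleTrace_of_isZero i γ (hz k hk) _)).trans (mul_zero _)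
  · rw [← h]
    simp [socleRank]
    rfl

variable (n) in
/-- The additive function on the Grothendieck group given by the multiplicity of the `i`-th simple
module, in the tridegrees with first degree `a` and third degree `b`, in the socle. -/
noncomputable def socleK (i : ZMod n) (a b : ℤ) : KGroup n →+ ℤ :=
  QuotientAddGroup.lift _ (FreeAbelianGroup.lift fun X : Cn n =>
    socleEuler i (a, 0, b) X.obj.as - socleEuler i (a, 1, b) X.obj.as) (by
    rw [AddSubgroup.closure_le]
    rintro x hx
    change FreeAbelianGroup.lift _ x = 0
    cases hx with
    | triangle X Y Z f g h H =>
      simp [socleEuler_triangle i _ H]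
      ring
    | sign X =>
      have h₁ : ((a, 0, b) : TriDeg) - (0, 1, 0) = (a, 1, b) := by
        refine Prod.ext (sub_zero a) (Prod.ext ?_ (sub_zero b))
        change (0 : ZMod 2) - 1 = 1
        decide
      have h₂ : ((a, 1, b) : TriDeg) - (0, 1, 0) = (a, 0, b) := by
        refine Prod.ext (sub_zero a) (Prod.ext ?_ (sub_zero b))
        exact sub_self (1 : ZMod 2)
      simp [socleEuler_shift, h₁, h₂])

theorem socleK_mk (i : ZMod n) (a b : ℤ) (X : Cn n) : socleK n i a b (KGroup.mk X) =
    socleEuler i (a, 0, b) X.obj.as - socleEuler i (a, 1, b) X.obj.as :=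
  FreeAbelianGroup.lift_apply_of _ _

/-- The socle of `P_j` is spanned by the path `(j|j+1|j)`. -/
theorem eq_of_mem_socle {i j : ZMod n} {γ : TriDeg} {m : projLeft n j}
    (hm : m ∈ socle i γ (projLeft n j)) : m.1 = m.1.x j • pathX j := by
  obtain ⟨-, -, h⟩ := hm
  have h' : ∀ a : QuiverAlg n, a.e = 0 → a * m.1 = 0 := fun a ha => congrArg Subtype.val (h a ha)
  have hj := mul_pathE_of_mem m.2
  have h₁ := congrArg (fun r : QuiverAlg n => r.x j) (h' (pathX j) rfl)
  have h₂ := congrArg (fun r : QuiverAlg n => r.x j) (h' (pathD j) rfl)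
  have h₃ := congrArg (fun r : QuiverAlg n => r.x j) (h' (pathU j) rfl)
  simp [pathX] at h₁
  simp [pathD] at h₂
  simp [pathU] at h₃
  ext k
  · by_cases hk : k = j
    · subst hk; simpa [zsmul_e, pathX] using h₁
    · rw [← hj]; simp [pathX, pathE, hk]
  · by_cases hk : k + 1 = j
    · subst hk
      simpa [zsmul_u, pathX] using h₂
    · rw [← hj]; simp [pathX, pathE, hk]
  · by_cases hk : k - 1 = j
    · subst hk
      simpa [zsmul_d, pathX] using h₃
    · rw [← hj]; simp [pathX, pathE, hk]
  · by_cases hk : k = j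
    · subst hk; rw [zsmul_x]; simp [pathX]
    · rw [← hj]; simp [pathX, pathE, hk]

theorem pathX_mem_socle (j : ZMod n) :
    (⟨pathX j, mem_leftIdeal (pathX_mul j)⟩ : leftIdeal n j) ∈ socle j (1, 0, 0) (projLeft n j) :=
  ⟨pathX_mem j, Subtype.ext (mul_pathX j), fun a ha => Subtype.ext (by
    change a * pathX j = 0
    ext k <;> simp [ha, pathX])⟩

theorem socleRank_projLeft (i j : ZMod n) (γ : TriDeg) :
    socleRank i γ (projLeft n j) = if i = j ∧ γ = (1, 0, 0) then 1 else 0 := by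
  rw [socleRank_eq i γ (leftPerfect_projLeft j)]
  split_ifs with h
  · obtain ⟨rfl, rfl⟩ := h
    let f : socle i (1, 0, 0) (projLeft n i) →+ ℤ :=
      AddMonoidHom.mk' (fun m => QuiverAlg.x m.1.1 i) fun _ _ => rfl
    have hf : Function.Bijective f := by
      refine ⟨fun m m' h => Subtype.ext (Subtype.ext ?_), fun k => ⟨k • ⟨_, pathX_mem_socle i⟩, ?_⟩⟩
      · rw [eq_of_mem_socle m.2, eq_of_mem_socle m'.2]
        exact congrArg (· • pathX i) h
      · rw [map_zsmul]
        simp [f, pathX]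
    rw [((AddEquiv.ofBijective f hf).toIntLinearEquiv).finrank_eq, Module.finrank_self]
    rfl
  · have : Subsingleton (socle i γ (projLeft n j)) := by
      refine subsingleton_of_forall_eq 0 fun m => Subtype.ext (Subtype.ext ?_)
      have hm := eq_of_mem_socle m.2
      by_contra hne
      have hx : m.1.1.x j ≠ 0 := fun hx => hne (by rw [hm, hx, zero_smul]; rfl)
      refine h ⟨?_, (m.2.1.2.2.2 j hx).symm⟩
      by_contra hij
      apply hx
      have h₂ : pathE i * m.1.1 = m.1.1 := congrArg Subtype.val m.2.2.1
      rw [← h₂]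
      simp [pathE, Ne.symm hij]
    rw [Module.finrank_zero_of_subsingleton]
    rfl

theorem socleK_mono_smul (i j : ZMod n) (a b c d : ℤ) :
    socleK n i a b (Laurent.mono c d • KGroup.mk (projObj n j)) =
      if i = j ∧ a = c + 1 ∧ b = d then 1 else 0 := by
  have hj := leftPerfect_projLeft (n := n) j
  have h₀ : ((1 : ZMod 2) = 0) = False := by simp
  rw [mono_smul_mk, socleK_mk, socleEuler_shift, socleEuler_shift]
  change socleEuler i _ (inDegreeZero (projLeft n j)).as -
    socleEuler i _ (inDegreeZero (projLeft n j)).as = _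
  rw [socleEuler_single i _ hj, socleEuler_single i _ hj, socleRank_projLeft, socleRank_projLeft]
  simp [Prod.ext_iff, sub_eq_iff_eq_add, add_comm, h₀]

/-- The functions `socleK` extract the coefficients of a combination of the classes of the `P_j`. -/
theorem socleK_smul (i j : ZMod n) (a b : ℤ) (f : Laurent) :
    socleK n i a b (f • KGroup.mk (projObj n j)) = if i = j then f.coeff (a - 1, b) else 0 := by
  let φ : Laurent →+ ℤ := AddMonoidHom.mk' (fun f => socleK n i a b (f • KGroup.mk (projObj n j)))
    (fun f g => by rw [add_smul, map_add])
  let ψ : Laurent →+ ℤ := AddMonoidHom.mk' (fun f => if i = j then f.coeff (a - 1, b) else 0)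
    (fun f g => by split_ifs <;> simp)
  have : φ = ψ := by
    ext ⟨c, d⟩
    change φ (Laurent.mono c d) = ψ (Laurent.mono c d)
    change socleK n i a b (Laurent.mono c d • _) =
      if i = j then (AddMonoidAlgebra.single (c, d) 1 : Laurent).coeff (a - 1, b) else 0
    have h : (c, d) = (a - 1, b) ↔ a = c + 1 ∧ b = d := by
      rw [Prod.mk.injEq]
      omega
    rw [socleK_mono_smul, AddMonoidAlgebra.coeff_single, Finsupp.single_apply]
    simp [h, ite_and]
  exact DFunLike.congr_fun this f

theorem linearIndependent_projObj :
    LinearIndependent Laurent fun i : ZMod n => KGroup.mk (projObj n i) := by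
  have : NeZero n := inferInstance
  rw [Fintype.linearIndependent_iff]
  intro f hf i
  ext ⟨a, b⟩
  have h := congrArg (socleK n i (a + 1) b) hf
  rw [map_sum, map_zero] at h
  simpa [socleK_smul] using h

end
end AffineBraid

/-! ### Morphisms to `P_i` from functionals -/

namespace AffineBraid
open TriBimod QuiverAlg MulOpposite
section
variable {n : ℕ} [Fact (3 ≤ n)]

instance {A : TriRing} (M : TriBimod A intRing) : Module ℤᵐᵒᵖ M := M.rightModule

theorem op_int_smul {A : TriRing} (M : TriBimod A intRing) (b : ℤ) (m : M) :
    (op b : ℤᵐᵒᵖ) • m = b • m :=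
  Int.cast_smul_eq_zsmul ℤᵐᵒᵖ b m

/-- A map of left modules that preserves the gradings is a morphism of trigraded modules. -/
def homMk {A : TriRing} {M N : TriBimod A intRing} (f : M →+ N)
    (h₁ : ∀ (a : A) (m : M), f (a • m) = a • f m)
    (h₂ : ∀ {γ : TriDeg} {m : M}, m ∈ M.gr γ → f m ∈ N.gr γ) : M ⟶ N where
  toFun := f
  map_smul := h₁
  map_op_smul b m := (congrArg f (op_int_smul M b m)).trans
    ((map_zsmul f b m).trans (op_int_smul N b (f m)).symm)
  map_gr := h₂

theorem projTensor_addHom_ext {i : ZMod n} {P : Type} [AddCommGroup P] {f g : projTensor n i →+ P}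
    (h : ∀ p q, f (pureTensor i p q) = g (pureTensor i p q)) : f = g :=
  AddMonoidHom.ext fun z => tensor_induction (M := projLeft n i) (N := projRight n i)
    (p := fun z : projTensor n i => f z = g z) ((map_zero f).trans (map_zero g).symm) h
    (fun x y hx hy => (map_add f x y).trans ((congrArg₂ (· + ·) hx hy).trans (map_add g x
        y).symm)) z

/-- The map `P_i ⊗ _iP → P_i`, `p ⊗ q ↦ φ (q m) p`, for an additive function `φ` on a left module
and an element `m` of the module. -/
noncomputable def contract (i : ZMod n) {M : RMod n} (φ : M →+ ℤ) (m : M) : projTensor n i →+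
    projLeft n i :=
  tensorLift (M := projLeft n i) (N := projRight n i)
    (AddMonoidHom.mk' (fun p => AddMonoidHom.mk' (fun q => φ ((q.1 : QuiverAlg n) • m) • p)
      (fun q q' => by
        have h : ((q + q' : projRight n i).1 : QuiverAlg n) • m = q.1 • m + q'.1 • m :=
          add_smul q.1 q'.1 m
        rw [h, map_add, add_smul]))
      (fun p p' => AddMonoidHom.ext fun q => smul_add _ p p'))
    (fun p b q => by
      have h : ((b • q : projRight n i).1 : QuiverAlg n) • m = b • ((q.1 : QuiverAlg n) • m) :=
        smul_assoc (b : ℤ) q.1 m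
      have h₁ : φ (((b • q : projRight n i).1 : QuiverAlg n) • m) =
          φ ((q.1 : QuiverAlg n) • m) * b := by
        rw [h, map_zsmul, smul_eq_mul, mul_comm]
      exact ((congrArg (φ ((q.1 : QuiverAlg n) • m) • ·) (op_int_smul (projLeft n i) b p)).trans
        (smul_smul _ _ _)).trans (congrArg (· • p) h₁.symm))

theorem contract_smul (i : ZMod n) {M : RMod n} (φ : M →+ ℤ) (m : M) (r : QuiverAlg n)
    (z : projTensor n i) : contract i φ m (r • z) = r • contract i φ m z :=
  DFunLike.congr_fun (projTensor_addHom_ext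
    (f := (contract i φ m).comp (DistribSMul.toAddMonoidHom (projTensor n i) r))
    (g := (DistribSMul.toAddMonoidHom (projLeft n i) r).comp (contract i φ m))
    fun p q => (smul_comm r (φ ((q.1 : QuiverAlg n) • m)) p).symm) z

theorem contract_op_smul (i : ZMod n) {M : RMod n} (φ : M →+ ℤ) (m : M) (r : QuiverAlg n)
    (z : projTensor n i) : contract i φ m ((op r : (QuiverAlg n)ᵐᵒᵖ) • z) =
      contract i φ (r • m) z :=
  DFunLike.congr_fun (projTensor_addHom_ext
    (f := (contract i φ m).comp
      (DistribSMul.toAddMonoidHom (projTensor n i) (op r : (QuiverAlg n)ᵐᵒᵖ)))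
    (g := contract i φ (r • m)) fun p q => congrArg (fun y => φ y • p) (mul_smul q.1 r m)) z

theorem contract_add (i : ZMod n) {M : RMod n} (φ : M →+ ℤ) (m m' : M) :
    contract i φ (m + m') = contract i φ m + contract i φ m' :=
  projTensor_addHom_ext fun p q =>
    (congrArg (fun k => k • p) ((congrArg φ (smul_add q.1 m m')).trans (map_add φ _ _))).trans
      (add_smul _ _ p)

theorem casimir_mem (i : ZMod n) : casimir n i ∈ (projTensor n i).gr (1, 0, 0) := by
  have h := (dBraidInv n i).map_gr (γ := 0) (quiverRing n).one_mem
  have h' : (dBraidInv n i).toFun (1 : QuiverAlg n) = casimir n i := one_smul _ _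
  rw [h'] at h
  exact h

theorem contract_mem (i : ZMod n) {M : RMod n} {φ : M →+ ℤ} {ε : TriDeg}
    (hφ : ∀ δ, δ ≠ ε → ∀ m ∈ M.gr δ, φ m = 0) {δ ζ : TriDeg} {m : M} (hm : m ∈ M.gr δ)
    {z : projTensor n i} (hz : z ∈ (projTensor n i).gr ζ) :
    contract i φ m z ∈ (projLeft n i).gr (ζ + δ - ε) := by
  induction hz using AddSubgroup.closure_induction with
  | mem z h =>
    obtain ⟨α, β, p, q, hp, hq, rfl, rfl⟩ := h
    change φ ((q.1 : QuiverAlg n) • m) • p ∈ (projLeft n i).gr (α + β + δ - ε)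
    by_cases h : β + δ = ε
    · rw [add_assoc, h, add_sub_cancel_right]
      exact zsmul_mem hp _
    · have h₀ : φ ((q.1 : QuiverAlg n) • m) = 0 := hφ _ h _ (M.smul_mem hq hm)
      rw [h₀, zero_smul]
      exact zero_mem _
  | zero => rw [map_zero]; exact zero_mem _
  | add x y _ _ hx hy => rw [map_add]; exact add_mem hx hy
  | neg x _ hx =>
    have h : contract i φ m (-x) = -contract i φ m x := map_neg (contract i φ m) x
    exact h ▸ neg_mem hx

/-- The morphism `M → P_i {γ}` attached to an additive function `φ` on the part of degree
`γ + (1, 0, 0)` of `M`: it sends `m` to the contraction of the Casimir element with `m` and `φ`.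
This expresses that `R_n` is a Frobenius algebra. -/
noncomputable def frobeniusHom (i : ZMod n) (γ : TriDeg) {M : RMod n} (φ : M →+ ℤ)
    (hφ : ∀ δ, δ ≠ γ + (1, 0, 0) → ∀ m ∈ M.gr δ, φ m = 0) : M ⟶ (shift γ).obj (projLeft n i) :=
  homMk (AddMonoidHom.mk' (fun m => contract i φ m (casimir n i))
      fun m m' => DFunLike.congr_fun (contract_add i φ m m') _)
    (fun r m => (contract_op_smul i φ m r _).symm.trans
      ((congrArg (contract i φ m) (smul_casimir i r).symm).trans (contract_smul i φ m r _)))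
    (fun {δ m} hm => by
      have h := contract_mem i hφ hm (casimir_mem i)
      rwa [add_comm γ, add_sub_add_left_eq_sub] at h)

theorem frobeniusHom_apply (i : ZMod n) (γ : TriDeg) {M : RMod n} (φ : M →+ ℤ)
    (hφ : ∀ δ, δ ≠ γ + (1, 0, 0) → ∀ m ∈ M.gr δ, φ m = 0) (m : M) :
    Subtype.val (p := (· ∈ leftIdeal n i)) ((frobeniusHom i γ φ hφ).toFun m) =
      φ (pathD i • m) • pathU (i - 1) + φ (pathU i • m) • pathD (i + 1) +
        φ (pathX i • m) • pathE i + φ (pathE i • m) • pathX i := rfl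

/-- The third power of the radical of `R_n` vanishes. -/
theorem mul_mul_eq_zero_of_e_eq_zero {n : ℕ} {a b : QuiverAlg n} (ha : a.e = 0) (hb : b.e = 0)
    (c : QuiverAlg n) (hc : c.e = 0) : a * b * c = 0 := by
  ext i <;> simp [ha, hb, hc]

theorem pathX_mul_eq {n : ℕ} (i : ZMod n) (r : QuiverAlg n) : pathX i * r = r.e i • pathX i := by
  ext j <;> simp only [zsmul_e, zsmul_u, zsmul_d, zsmul_x] <;> simp [pathX, Pi.single_apply]
  · by_cases h : j = i <;> simp [h]

/-- A nonzero projective module has a nonzero socle. -/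
theorem LeftPerfect.exists_pathX_smul_ne_zero {M : RMod n} (hM : LeftPerfect M) {m₀ : M}
    (h₀ : m₀ ≠ 0) : ∃ (i : ZMod n) (m : M), pathX i • m ≠ 0 := by
  by_contra! hx
  obtain ⟨k, f, g, hfg⟩ := hM.exists_retract
  let y : Fin k → M := fun j => f fun l => if j = l then 1 else 0
  have hf : ∀ v, f v = ∑ j, v j • y j := LinearMap.pi_apply_eq_sum_univ f
  have hm : ∀ m, ∑ j, g m j • y j = m := fun m => (hf _).symm.trans (LinearMap.congr_fun hfg m)
  -- the coordinates of every element lie in the radical, which is nilpotent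
  have he : ∀ m j, QuiverAlg.e (g m j) = 0 := by
    intro m j
    funext i
    have h : g (pathX i • m) j = 0 := by rw [hx i m, map_zero]; rfl
    have h' : pathX i * (g m j : QuiverAlg n) = 0 := by rw [map_smul] at h; exact h
    rw [pathX_mul_eq] at h'
    have h'' := congrArg (fun r : QuiverAlg n => r.x i) h'
    rw [zsmul_x] at h''
    simpa [pathX] using h''
  -- hence the square of the radical annihilates the module, and then so does the radical itself
  have h₂ : ∀ a b : QuiverAlg n, a.e = 0 → b.e = 0 → ∀ m : M, (a * b) • m = 0 := by
    intro a b ha hb m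
    rw [← hm m, Finset.smul_sum]
    refine Finset.sum_eq_zero fun j _ => ?_
    have h := mul_mul_eq_zero_of_e_eq_zero ha hb _ (he m j)
    exact (smul_smul (a * b) (g m j : QuiverAlg n) (y j)).trans
      ((congrArg (· • y j) h).trans (zero_smul _ _))
  have h₁ : ∀ a : QuiverAlg n, a.e = 0 → ∀ m : M, a • m = 0 := by
    intro a ha m
    rw [← hm m, Finset.smul_sum]
    exact Finset.sum_eq_zero fun j _ => (smul_smul _ (g m j : QuiverAlg n) (y j)).trans
      (h₂ _ _ ha (he m j) _)
  refine h₀ ?_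
  rw [← hm m₀]
  exact Finset.sum_eq_zero fun j _ => h₁ _ (he m₀ j) _

/-- The subgroup `x_i M_γ` of a module `M`. -/
def pathXImage (i : ZMod n) (γ : TriDeg) (M : RMod n) : Submodule ℤ M :=
  AddSubgroup.toIntSubmodule ((M.gr γ).map (DistribSMul.toAddMonoidHom M (pathX i : QuiverAlg n)))

theorem mem_pathXImage {i : ZMod n} {γ : TriDeg} {M : RMod n} {m : M} :
    m ∈ pathXImage i γ M ↔ ∃ a ∈ M.gr γ, (pathX i : QuiverAlg n) • a = m := Iff.rfl

theorem decompose_smul {M : RMod n} {r : QuiverAlg n} {α : TriDeg} (hr : r ∈ pathGr (stdDeg n) α)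
    (m : M) (γ : TriDeg) :
    decompose M.internal (r • m) (α + γ) = r • decompose M.internal m γ := by
  refine homogeneous_induction M.internal
    (p := fun m => decompose M.internal (r • m) (α + γ) = r • decompose M.internal m γ)
    ?_ (fun δ m hm => ?_) (fun m m' hm hm' => ?_) m
  · simp
  · rw [decompose_of_mem _ hm, decompose_of_mem _ (M.smul_mem hr hm)]
    by_cases h : γ = δ
    · simp [h]
    · rw [Finsupp.single_eq_of_ne h, Finsupp.single_eq_of_ne (fun h' => h (add_left_cancel h')),
        smul_zero]
  · simp [hm, hm']

/-- In a projective module `x_i M_γ` is a pure subgroup. -/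
theorem LeftPerfect.mem_pathXImage_of_zsmul {M : RMod n} (hM : LeftPerfect M) {i : ZMod n}
    {γ : TriDeg} {y : M} {k : ℤ} (hk : k ≠ 0) (h : k • y ∈ pathXImage i γ M) :
    y ∈ pathXImage i γ M := by
  have := hM.free.1
  obtain ⟨a, ha, hay⟩ := mem_pathXImage.mp h
  have hdeg : k • y ∈ M.gr ((1, 0, 0) + γ) := hay ▸ M.smul_mem (pathX_mem i) ha
  have hy : decompose M.internal y ((1, 0, 0) + γ) = y := by
    have h₁ := decompose_of_mem M.internal hdeg
    rw [map_zsmul] at h₁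
    have h₂ := DFunLike.congr_fun h₁ ((1, 0, 0) + γ)
    rw [Finsupp.single_eq_same, Finsupp.smul_apply] at h₂
    exact smul_right_injective M hk h₂
  obtain ⟨l, f, g, hfg⟩ := hM.exists_retract
  -- the coordinates of `y` in a free module are multiples of `x_i`
  let w : Fin l → QuiverAlg n := fun j => QuiverAlg.x (g y j) i • pathE i
  have hw : (pathX i : QuiverAlg n) • (w : Fin l → quiverRing n) = g y := by
    funext j
    have h₁ : k • (g y j : QuiverAlg n) = pathX i * (g a j : QuiverAlg n) := by
      have h₃ : g (k • y) = (pathX i : QuiverAlg n) • g a := by rw [← hay, map_smul]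
      rw [map_zsmul] at h₃
      exact congrFun h₃ j
    have h₂ : (g y j : QuiverAlg n) = QuiverAlg.x (g y j) i • pathX i := by
      rw [pathX_mul_eq] at h₁
      ext j' <;> apply mul_left_cancel₀ hk
      · have := congrArg (fun r : QuiverAlg n => r.e j') h₁
        simp only [zsmul_e] at this ⊢
        simpa [pathX] using this
      · have := congrArg (fun r : QuiverAlg n => r.u j') h₁
        simp only [zsmul_u] at this ⊢
        simpa [pathX] using this
      · have := congrArg (fun r : QuiverAlg n => r.d j') h₁
        simp only [zsmul_d] at this ⊢
        simpa [pathX] using this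
      · have := congrArg (fun r : QuiverAlg n => r.x j') h₁
        simp only [zsmul_x] at this ⊢
        by_cases h : j' = i
        · subst h; simp [pathX]
        · simpa [pathX, h] using this
    refine Eq.trans ?_ h₂.symm
    change pathX i * (QuiverAlg.x (g y j) i • pathE i) = _
    rw [mul_smul_comm, pathX_mul]
  refine mem_pathXImage.mpr ⟨decompose M.internal (f w) γ, decompose_mem M.internal _ γ, ?_⟩
  rw [← decompose_smul (pathX_mem i), ← map_smul, hw]
  exact (congrArg (fun z => decompose M.internal z _) (LinearMap.congr_fun hfg y)).trans hy

/-- A nonzero projective module has a homogeneous element `a` and an additive function that is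
`1` on `x_i a`. -/
theorem LeftPerfect.exists_functional {M : RMod n} (hM : LeftPerfect M) {m₀ : M} (h₀ : m₀ ≠ 0) :
    ∃ (i : ZMod n) (γ : TriDeg) (a : M) (φ : M →+ ℤ), a ∈ M.gr γ ∧
      φ ((pathX i : QuiverAlg n) • a) = 1 := by
  have := hM.free.1
  have := hM.free.2
  obtain ⟨i, m, hm⟩ := hM.exists_pathX_smul_ne_zero h₀
  obtain ⟨γ, a, ha, hne⟩ : ∃ γ, ∃ a ∈ M.gr γ, (pathX i : QuiverAlg n) • a ≠ 0 := by
    by_contra! hx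
    refine hm (homogeneous_induction M.internal (p := fun m => (pathX i : QuiverAlg n) • m = 0)
      (smul_zero _) hx (fun m m' h h' => by rw [smul_add, h, h', add_zero]) m)
  let X := pathXImage i γ M
  -- as `x_i M_γ` is pure, it is a direct summand, and its coordinates extend to `M`
  have htf : Module.IsTorsionFree ℤ (M ⧸ X) := by
    refine .of_smul_eq_zero fun k z hz => ?_
    obtain ⟨y, rfl⟩ := X.mkQ_surjective z
    by_contra! hk
    refine hk.2 ((Submodule.Quotient.mk_eq_zero X).mpr (hM.mem_pathXImage_of_zsmul hk.1 ?_))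
    rw [← map_smul] at hz
    exact (Submodule.Quotient.mk_eq_zero X).mp hz
  obtain ⟨s, hs⟩ := Module.projective_lifting_property X.mkQ LinearMap.id X.mkQ_surjective
  have hr : ∀ y, y - s (X.mkQ y) ∈ X := fun y => by
    rw [← Submodule.Quotient.mk_eq_zero, Submodule.Quotient.mk_sub, sub_eq_zero]
    exact (LinearMap.congr_fun hs (X.mkQ y)).symm
  let ρ : M →ₗ[ℤ] X := (LinearMap.id - s ∘ₗ X.mkQ).codRestrict X hr
  let b := Module.Free.chooseBasis ℤ X
  have hX : Nonempty (Module.Free.ChooseBasisIndex ℤ X) := by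
    by_contra hemp
    rw [not_nonempty_iff] at hemp
    have : (⟨_, mem_pathXImage.mpr ⟨a, ha, rfl⟩⟩ : X) = 0 := b.ext_elem fun j => hemp.elim j
    exact hne (congrArg Subtype.val this)
  obtain ⟨j⟩ := hX
  obtain ⟨a', ha', hb⟩ := mem_pathXImage.mp (b j).2
  refine ⟨i, γ, a', (b.coord j ∘ₗ ρ).toAddMonoidHom, ha', ?_⟩
  have : ρ ((pathX i : QuiverAlg n) • a') = b j := by
    refine Subtype.ext ?_
    change _ - s (X.mkQ _) = _
    have h : X.mkQ (b j : M) = 0 := (Submodule.Quotient.mk_eq_zero X).mpr (b j).2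
    rw [hb, h, map_zero, sub_zero]
    rfl
  change b.coord j (ρ _) = 1
  rw [this]
  simp

end
end AffineBraid

/-! ### Projective modules in the Grothendieck group -/

namespace AffineBraid
open TriBimod QuiverAlg MulOpposite Pretriangulated

section
universe v u
variable {C : Type u} [Category.{v} C] [Preadditive C] [HasZeroObject C] [HasShift C ℤ]
  [∀ n : ℤ, (shiftFunctor C n).Additive] [Pretriangulated C]

/-- A split short exact sequence is a distinguished triangle. -/
theorem distinguished_of_split {X Y Z : C} (a : X ⟶ Y) (b : Y ⟶ X) (c : Z ⟶ Y) (d : Y ⟶ Z)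
    (hab : a ≫ b = 𝟙 X) (hcd : c ≫ d = 𝟙 Z) (had : a ≫ d = 0) (hcb : c ≫ b = 0)
    (h : b ≫ a + d ≫ c = 𝟙 Y) : Triangle.mk a d 0 ∈ distTriang C := by
  let e : Y ≅ X ⊞ Z :=
    { hom := biprod.lift b d
      inv := biprod.desc a c
      hom_inv_id := by rw [biprod.lift_desc, h]
      inv_hom_id := by ext <;> simp [hab, hcd, had, hcb] }
  refine isomorphic_distinguished _ (binaryBiproductTriangle_distinguished X Z) _
    (Triangle.isoMk _ _ (Iso.refl _) e (Iso.refl _) ?_ ?_ ?_)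
  · change a ≫ biprod.lift b d = 𝟙 X ≫ biprod.inl
    ext <;> simp [hab, had]
  · change d ≫ 𝟙 Z = biprod.lift b d ≫ biprod.snd
    simp
  · exact zero_comp.trans comp_zero.symm
end

section Kernel
variable {A B : TriRing} {M P : TriBimod A B}

/-- The kernel of a split epimorphism of trigraded bimodules. -/
def splitKernel (f : P ⟶ M) (g : M ⟶ P) (h : f ≫ g = 𝟙 P) : TriBimod A B where
  carrier := LinearMap.ker (homLinear g)
  rightModule :=
    letI : SMul (B : Type)ᵐᵒᵖ (LinearMap.ker (homLinear g)) :=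
      ⟨fun b m => ⟨b • m.1, (g.map_op_smul b.unop m.1).trans
        ((congrArg (b • ·) m.2).trans (smul_zero b))⟩⟩
    Function.Injective.module (B : Type)ᵐᵒᵖ (LinearMap.ker (homLinear g)).subtype.toAddMonoidHom
      Subtype.val_injective fun _ _ => rfl
  smulComm := by
    let : SMul (B : Type)ᵐᵒᵖ (LinearMap.ker (homLinear g)) :=
      ⟨fun b m => ⟨b • m.1, (g.map_op_smul b.unop m.1).trans
        ((congrArg (b • ·) m.2).trans (smul_zero b))⟩⟩
    exact ⟨fun a b m => Subtype.ext (smul_comm a b m.1)⟩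
  gr γ := (M.gr γ).comap (LinearMap.ker (homLinear g)).subtype.toAddMonoidHom
  internal := isInternal_of_retract M.internal _
    (AddMonoidHom.mk' (fun m => (⟨m - f.toFun (g.toFun m), by
        change g.toFun _ = 0
        rw [map_sub, sub_eq_zero]
        exact (congrArg (fun φ => Hom.toFun φ (g.toFun m)) h).symm⟩ : LinearMap.ker (homLinear g)))
      (fun m m' => Subtype.ext (by
        change m + m' - f.toFun (g.toFun (m + m')) =
          (m - f.toFun (g.toFun m)) + (m' - f.toFun (g.toFun m'))
        rw [map_add, map_add, add_sub_add_comm])))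
    (fun m => Subtype.ext (by
      have hm : g.toFun m.1 = 0 := m.2
      change m.1 - f.toFun (g.toFun m.1) = m.1
      rw [hm, map_zero, sub_zero]))
    (fun γ m hm => sub_mem hm (f.map_gr (g.map_gr hm)))
  smul_mem := M.smul_mem
  op_smul_mem := M.op_smul_mem

/-- The inclusion of the kernel of a split epimorphism. -/
def splitKernelι (f : P ⟶ M) (g : M ⟶ P) (h : f ≫ g = 𝟙 P) : splitKernel f g h ⟶ M where
  toFun := (LinearMap.ker (homLinear g)).subtype.toAddMonoidHom
  map_smul _ _ := rfl
  map_op_smul _ _ := rfl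
  map_gr h := h

/-- The projection onto the kernel of a split epimorphism. -/
def splitKernelπ (f : P ⟶ M) (g : M ⟶ P) (h : f ≫ g = 𝟙 P) : M ⟶ splitKernel f g h where
  toFun := AddMonoidHom.mk' (fun m => (⟨m - f.toFun (g.toFun m), by
        change g.toFun _ = 0
        rw [map_sub, sub_eq_zero]
        exact (congrArg (fun φ => Hom.toFun φ (g.toFun m)) h).symm⟩ : LinearMap.ker (homLinear g)))
      (fun m m' => Subtype.ext (by
        change m + m' - f.toFun (g.toFun (m + m')) =
          (m - f.toFun (g.toFun m)) + (m' - f.toFun (g.toFun m'))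
        rw [map_add, map_add, add_sub_add_comm]))
  map_smul a m := Subtype.ext (by
    change a • m - f.toFun (g.toFun (a • m)) = a • (m - f.toFun (g.toFun m))
    rw [g.map_smul, f.map_smul, smul_sub])
  map_op_smul b m := Subtype.ext (by
    change op b • m - f.toFun (g.toFun (op b • m)) = op b • (m - f.toFun (g.toFun m))
    rw [g.map_op_smul, f.map_op_smul, smul_sub])
  map_gr hm := sub_mem hm (f.map_gr (g.map_gr hm))

theorem splitKernel_ι_π (f : P ⟶ M) (g : M ⟶ P) (h : f ≫ g = 𝟙 P) :
    splitKernelι f g h ≫ splitKernelπ f g h = 𝟙 _ :=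
  hom_ext fun m => Subtype.ext (by
    have hm : g.toFun m.1 = 0 := m.2
    change m.1 - f.toFun (g.toFun m.1) = m.1
    rw [hm, map_zero, sub_zero])

theorem splitKernel_π_ι (f : P ⟶ M) (g : M ⟶ P) (h : f ≫ g = 𝟙 P) :
    g ≫ f + splitKernelπ f g h ≫ splitKernelι f g h = 𝟙 M :=
  hom_ext fun m => add_sub_cancel _ m

theorem splitKernel_ι_comp (f : P ⟶ M) (g : M ⟶ P) (h : f ≫ g = 𝟙 P) :
    splitKernelι f g h ≫ g = 0 :=
  hom_ext fun m => m.2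

theorem comp_splitKernelπ (f : P ⟶ M) (g : M ⟶ P) (h : f ≫ g = 𝟙 P) :
    f ≫ splitKernelπ f g h = 0 :=
  hom_ext fun p => Subtype.ext (by
    change f.toFun p - f.toFun (g.toFun (f.toFun p)) = 0
    have : g.toFun (f.toFun p) = p := congrArg (fun φ => Hom.toFun φ p) h
    rw [this, sub_self])

end Kernel

section
variable {n : ℕ} [Fact (3 ≤ n)]

theorem LeftPerfect.of_retract {A B : TriRing} {M N : TriBimod A B} (h : LeftPerfect M)
    (f : M ⟶ N) (g : N ⟶ M) (hgf : g ≫ f = 𝟙 N) : LeftPerfect N :=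
  .of_retract_pi (ι := Unit) (Z := fun _ => M) (fun _ => h) (homLinear f ∘ₗ LinearMap.proj ())
    (LinearMap.pi fun _ => homLinear g) (LinearMap.ext fun x => congrArg (fun φ => Hom.toFun φ x)
        hgf)

/-- A finitely generated projective module as an object of `C_n`. -/
noncomputable def moduleObj (M : RMod n) (h : LeftPerfect M) : Cn n :=
  ⟨inDegreeZero M, perfectComplex_single h⟩

theorem mk_moduleObj_split {X Y Z : RMod n} (hX : LeftPerfect X) (hY : LeftPerfect Y)
    (hZ : LeftPerfect Z) (a : X ⟶ Y) (b : Y ⟶ X) (c : Z ⟶ Y) (d : Y ⟶ Z)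
    (hab : a ≫ b = 𝟙 X) (hcd : c ≫ d = 𝟙 Z) (had : a ≫ d = 0) (hcb : c ≫ b = 0)
    (h : b ≫ a + d ≫ c = 𝟙 Y) :
    KGroup.mk (moduleObj Y hY) = KGroup.mk (moduleObj X hX) + KGroup.mk (moduleObj Z hZ) := by
  let S := HomologicalComplex.single (RMod n) (ComplexShape.up ℤ) 0 ⋙ HomotopyCategory.quotient _ _
  have H := distinguished_of_split (S.map a) (S.map b) (S.map c) (S.map d)
    (by rw [← S.map_comp, hab, S.map_id]) (by rw [← S.map_comp, hcd, S.map_id])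
    (by rw [← S.map_comp, had, S.map_zero]) (by rw [← S.map_comp, hcb, S.map_zero])
    (by rw [← S.map_comp, ← S.map_comp, ← S.map_add, h, S.map_id])
  exact KGroup.mk_triangle (X := moduleObj X hX) (Y := moduleObj Y hY) (Z := moduleObj Z hZ) H

theorem mk_moduleObj_of_iso {M N : RMod n} (hM : LeftPerfect M) (hN : LeftPerfect N) (e : M ≅ N) :
    KGroup.mk (moduleObj M hM) = KGroup.mk (moduleObj N hN) :=
  KGroup.mk_eq_of_iso (X := moduleObj M hM) (Y := moduleObj N hN)
    ((HomologicalComplex.single (RMod n) (ComplexShape.up ℤ) 0 ⋙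
      HomotopyCategory.quotient _ _).mapIso e)

theorem mk_moduleObj_of_subsingleton {M : RMod n} (hM : LeftPerfect M) [Subsingleton M] :
    KGroup.mk (moduleObj M hM) = 0 := by
  have h : ∀ {N : RMod n} (f g : N ⟶ M), f = g := fun f g => hom_ext fun m => Subsingleton.elim _ _
  have := mk_moduleObj_split hM hM hM (𝟙 M) (𝟙 M) (𝟙 M) (𝟙 M) (h _ _) (h _ _) (h _ _) (h _ _) (h
      _ _)
  exact left_eq_add.mp this

theorem mk_moduleObj_shift {M : RMod n} (hM : LeftPerfect M) (γ : TriDeg) :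
    KGroup.mk (moduleObj ((shift γ).obj M) (hM.shift γ)) =
      KGroup.mk ((shiftCn γ).obj (moduleObj M hM)) :=
  KGroup.mk_eq_of_iso (X := moduleObj ((shift γ).obj M) (hM.shift γ))
    (Y := (shiftCn γ).obj (moduleObj M hM))
    ((HomotopyCategory.quotient _ _).mapIso
      ((HomologicalComplex.singleMapHomologicalComplex (shift γ : RMod n ⥤ RMod n)
        (ComplexShape.up ℤ) 0).app M).symm)

/-- The morphism `P_i {γ} → M` with `e_i ↦ e_i a`, for a homogeneous element `a`. -/
def homOfElement (i : ZMod n) {γ : TriDeg} {M : RMod n} {a : M} (ha : a ∈ M.gr γ) :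
    (shift γ).obj (projLeft n i) ⟶ M :=
  homMk (M := (shift γ).obj (projLeft n i))
    (AddMonoidHom.mk' (fun p : leftIdeal n i => (p.1 : QuiverAlg n) • a)
      (fun p q => add_smul p.1 q.1 a))
    (fun r p => mul_smul r (Subtype.val (p := (· ∈ leftIdeal n i)) p) a)
    (fun {δ p} hp => by
      have := M.smul_mem hp ha
      rwa [sub_add_cancel] at this)

theorem pathD_mem {n : ℕ} (i : ZMod n) : (pathD i : QuiverAlg n) ∈ pathGr (stdDeg n) ((stdDeg
    n).d i) :=
  ⟨fun _ h => absurd rfl h, fun _ h => absurd rfl h, fun k h => by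
    by_cases hk : k = i
    · rw [hk]
    · exact absurd (Pi.single_eq_of_ne hk _) h, fun _ h => absurd rfl h⟩

theorem pathU_mem {n : ℕ} (i : ZMod n) : (pathU i : QuiverAlg n) ∈ pathGr (stdDeg n) ((stdDeg
    n).u i) :=
  ⟨fun _ h => absurd rfl h, fun k h => by
    by_cases hk : k = i
    · rw [hk]
    · exact absurd (Pi.single_eq_of_ne hk _) h, fun _ h => absurd rfl h, fun _ h => absurd rfl h⟩

/-- A nonzero finitely generated projective module has a summand `P_i {γ}`. -/
theorem LeftPerfect.exists_split {M : RMod n} (hM : LeftPerfect M) {m₀ : M} (h₀ : m₀ ≠ 0) :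
    ∃ (i : ZMod n) (γ : TriDeg) (f : (TriBimod.shift γ).obj (projLeft n i) ⟶ M)
      (g : M ⟶ (TriBimod.shift γ).obj (projLeft n i)), f ≫ g = 𝟙 _ := by
  obtain ⟨i, γ, a, φ₀, ha, hφ⟩ := hM.exists_functional h₀
  -- only the part of the functional in the degree of `x_i a` matters
  let φ : M →+ ℤ := φ₀.comp ((Finsupp.applyAddHom (γ + (1, 0, 0))).comp (decompose M.internal))
  have hφ' : ∀ δ, δ ≠ γ + (1, 0, 0) → ∀ m ∈ M.gr δ, φ m = 0 := by
    intro δ hδ m hm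
    change φ₀ (decompose M.internal m (γ + (1, 0, 0))) = 0
    rw [decompose_of_mem _ hm, Finsupp.single_eq_of_ne hδ.symm, map_zero]
  have hφa : φ ((pathX i : QuiverAlg n) • a) = 1 := by
    change φ₀ (decompose M.internal _ (γ + (1, 0, 0))) = 1
    rw [add_comm γ, decompose_of_mem _ (M.smul_mem (pathX_mem i) ha), Finsupp.single_eq_same, hφ]
  -- for reasons of degree, the other three terms of the Casimir element do not contribute
  have h₁ : φ ((pathD i : QuiverAlg n) • a) = 0 :=
    hφ' _ (fun h => by simpa [stdDeg] using congrArg (fun δ : TriDeg => δ.2.1) h) _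
      (M.smul_mem (pathD_mem i) ha)
  have h₂ : φ ((pathU i : QuiverAlg n) • a) = 0 :=
    hφ' _ (fun h => by simpa [stdDeg] using congrArg (fun δ : TriDeg => δ.2.1) h) _
      (M.smul_mem (pathU_mem i) ha)
  have h₃ : φ ((pathE i : QuiverAlg n) • a) = 0 :=
    hφ' _ (fun h => by simpa using congrArg (fun δ : TriDeg => δ.1) h) _
      (M.smul_mem (pathE_mem i) ha)
  have hψ : Subtype.val (p := (· ∈ leftIdeal n i)) ((frobeniusHom i γ φ hφ').toFun a) =
      pathE i := by
    rw [frobeniusHom_apply, hφa, h₁, h₂, h₃]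
    simp
  refine ⟨i, γ, homOfElement i ha, frobeniusHom i γ φ hφ', hom_ext fun p => Subtype.ext ?_⟩
  have h : (frobeniusHom i γ φ hφ').toFun
      ((Subtype.val (p := (· ∈ leftIdeal n i)) p : QuiverAlg n) • a) =
        (Subtype.val (p := (· ∈ leftIdeal n i)) p : QuiverAlg n) •
          (frobeniusHom i γ φ hφ').toFun a := (frobeniusHom i γ φ hφ').map_smul _ _
  refine (congrArg (Subtype.val (p := (· ∈ leftIdeal n i))) h).trans ?_
  change (Subtype.val (p := (· ∈ leftIdeal n i)) p : QuiverAlg n) *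
    Subtype.val (p := (· ∈ leftIdeal n i)) ((frobeniusHom i γ φ hφ').toFun a) = _
  rw [hψ]
  exact mul_pathE_of_mem p.2

variable (n) in
/-- The submodule of the Grothendieck group spanned by the classes of the `P_i`. -/
noncomputable def projSpan : Submodule Laurent (KGroup n) :=
  Submodule.span Laurent (Set.range fun i => KGroup.mk (projObj n i))

/-- A shift of the tridegree acts on the Grothendieck group by a monomial, up to a sign. -/
theorem mk_shift_sign (X : Cn n) (γ : TriDeg) : ∃ z : ℤ,
    KGroup.mk ((shiftCn γ).obj X) = z • Laurent.mono γ.1 γ.2.2 • KGroup.mk X := by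
  obtain ⟨a, c, b⟩ := γ
  have h : ((a, c, b) : TriDeg) = (a, 0, b) + (0, c, 0) := by simp
  have hc : ∀ c : ZMod 2, c = 0 ∨ c = 1 := by decide
  rcases hc c with rfl | rfl
  · exact ⟨1, by rw [one_smul, mono_smul_mk]⟩
  · refine ⟨-1, ?_⟩
    rw [mono_smul_mk, neg_smul, one_smul, ← KGroup.mk_sign, KGroup.mk_shift_shift _ _ _ h.symm]

/-- The class of a projective module lies in the span of the `[P_i]`: summands `P_i {γ}` are split
off until the rank over `ℤ` is zero. -/
theorem mk_moduleObj_mem : ∀ (k : ℕ) {M : RMod n} (hM : LeftPerfect M),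
    Module.finrank ℤ M ≤ k → KGroup.mk (moduleObj M hM) ∈ projSpan n := by
  intro k
  induction k with
  | zero =>
    intro M hM hk
    have := hM.free.1
    have := hM.free.2
    have : Subsingleton M := Module.finrank_zero_iff.mp (Nat.le_zero.mp hk)
    rw [mk_moduleObj_of_subsingleton]
    exact zero_mem _
  | succ k ih =>
    intro M hM hk
    by_cases hs : Subsingleton M
    · rw [mk_moduleObj_of_subsingleton]
      exact zero_mem _
    obtain ⟨m₀, h₀⟩ : ∃ m₀ : M, m₀ ≠ 0 := by
      by_contra! h
      exact hs (subsingleton_of_forall_eq 0 h)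
    obtain ⟨i, γ, f, g, h⟩ := hM.exists_split h₀
    have hP := (leftPerfect_projLeft (n := n) i).shift γ
    have hK := hM.of_retract _ _ (splitKernel_ι_π f g h)
    rw [mk_moduleObj_split hP hM hK f g _ _ h (splitKernel_ι_π f g h) (comp_splitKernelπ f g h)
      (splitKernel_ι_comp f g h) (splitKernel_π_ι f g h),
      mk_moduleObj_shift (leftPerfect_projLeft i)]
    refine add_mem ?_ (ih hK ?_)
    · obtain ⟨z, hz⟩ := mk_shift_sign (moduleObj _ (leftPerfect_projLeft (n := n) i)) γ
      rw [hz]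
      exact zsmul_mem ((projSpan n).smul_mem _ (Submodule.subset_span ⟨i, rfl⟩)) z
    · -- the kernel is a proper direct summand
      have := hM.free.1
      have := hM.free.2
      have := hK.free.1
      have := hK.free.2
      let e : leftIdeal n i := ⟨pathE i, mem_leftIdeal (pathE_mul_pathE i)⟩
      let v : M := f.toFun e
      have hv : g.toFun v = e := congrArg (fun φ => Hom.toFun φ e) h
      let j : splitKernel f g h × ℤ →ₗ[ℤ] M :=
        ((splitKernelι f g h).toFun.toIntLinearMap).coprod (LinearMap.toSpanSingleton ℤ M v)
      have hj : Function.Injective j := by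
        rw [injective_iff_map_eq_zero]
        rintro ⟨x, z⟩ hx
        have hx' : (splitKernelι f g h).toFun x + z • v = 0 := hx
        have h₁ := congrArg g.toFun hx'
        have h₂ : g.toFun ((splitKernelι f g h).toFun x) = 0 := x.2
        rw [map_add, map_zsmul, h₂, zero_add, hv, map_zero] at h₁
        have h₃ := congrArg (fun r : QuiverAlg n => r.e i)
          (congrArg (Subtype.val (p := (· ∈ leftIdeal n i))) h₁)
        have h₄ : z = 0 := by
          change (z • (pathE i : QuiverAlg n)).e i = 0 at h₃
          rw [zsmul_e] at h₃
          simpa [pathE] using h₃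
        subst h₄
        rw [zero_smul, add_zero] at hx'
        exact Prod.ext (Subtype.ext hx') rfl
      have := LinearMap.finrank_le_finrank_of_injective hj
      rw [Module.finrank_prod, Module.finrank_self] at this
      exact Nat.le_of_succ_le_succ (this.trans hk)

end
end AffineBraid

/-! ### Complexes in the Grothendieck group -/

namespace AffineBraid
open TriBimod QuiverAlg MulOpposite Pretriangulated HomologicalComplex

section Brutal
open ZeroObject
universe v u
variable {C : Type u} [Category.{v} C] [Preadditive C] [HasZeroObject C]

open Classical in
/-- The terms of the brutal truncation of a complex to the degrees satisfying `p`. -/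
noncomputable def brutalX (K : CochainComplex C ℤ) (p : ℤ → Prop) (k : ℤ) : C :=
  if p k then K.X k else 0

open Classical in
/-- The inclusion of a term of the brutal truncation. -/
noncomputable def brutalι (K : CochainComplex C ℤ) (p : ℤ → Prop) (k : ℤ) : brutalX K p k ⟶ K.X k :=
  if h : p k then eqToHom (if_pos h) else 0

open Classical in
/-- The projection onto a term of the brutal truncation. -/
noncomputable def brutalπ (K : CochainComplex C ℤ) (p : ℤ → Prop) (k : ℤ) : K.X k ⟶ brutalX K p k :=
  if h : p k then eqToHom (if_pos h).symm else 0

variable {K : CochainComplex C ℤ} {p q : ℤ → Prop} {k : ℤ}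

theorem brutalX_isZero (h : ¬p k) : IsZero (brutalX K p k) := by
  rw [brutalX, if_neg h]
  exact isZero_zero C

theorem brutalι_eq_zero (h : ¬p k) : brutalι K p k = 0 := dif_neg h

theorem brutalπ_eq_zero (h : ¬p k) : brutalπ K p k = 0 := dif_neg h

@[simp]
theorem brutalι_π : brutalι K p k ≫ brutalπ K p k = 𝟙 _ := by
  by_cases h : p k
  · rw [brutalι, brutalπ, dif_pos h, dif_pos h]
    exact eqToHom_trans _ _
  · exact (brutalX_isZero h).eq_of_src _ _

theorem brutalπ_ι (h : p k) : brutalπ K p k ≫ brutalι K p k = 𝟙 _ := by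
  rw [brutalι, brutalπ, dif_pos h, dif_pos h]
  exact eqToHom_trans _ _

/-- The brutal truncation of a complex to a convex set of degrees. -/
noncomputable def brutal (K : CochainComplex C ℤ) (p : ℤ → Prop)
    (hp : ∀ k, p k → p (k + 1 + 1) → p (k + 1)) : CochainComplex C ℤ where
  X := brutalX K p
  d i j := brutalι K p i ≫ K.d i j ≫ brutalπ K p j
  shape i j h := by rw [K.shape i j h, zero_comp, comp_zero]
  d_comp_d' := by
    rintro i _ _ rfl rfl
    simp only [Category.assoc]
    by_cases h₁ : p (i + 1)
    · rw [← Category.assoc (brutalπ K p (i + 1)), brutalπ_ι h₁, Category.id_comp,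
        ← Category.assoc (K.d _ _), K.d_comp_d, zero_comp, comp_zero]
    · by_cases h₂ : p i
      · rw [brutalπ_eq_zero (fun h => h₁ (hp i h₂ h))]
        simp
      · rw [brutalι_eq_zero h₂, zero_comp]

variable (K) in
/-- The degreewise split short exact sequence given by an up-closed set of degrees. -/
noncomputable def brutalSequence (p : ℤ → Prop) (hp : ∀ k, p k → p (k + 1)) :
    ShortComplex (CochainComplex C ℤ) where
  X₁ := brutal K p fun k h _ => hp k h
  X₂ := K
  X₃ := brutal K (fun k => ¬p k) fun k _ h h' => h (hp _ h')
  f := { f := brutalι K p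
         comm' := by
          rintro k _ rfl
          change brutalι K p k ≫ K.d _ _ = (brutalι K p k ≫ K.d _ _ ≫ brutalπ K p _) ≫ brutalι K p _
          by_cases h : p (k + 1)
          · rw [Category.assoc, Category.assoc, brutalπ_ι h, Category.comp_id]
          · rw [brutalι_eq_zero fun h' => h (hp k h'), zero_comp, zero_comp, zero_comp] }
  g := { f := brutalπ K fun k => ¬p k
         comm' := by
          rintro k _ rfl
          change brutalπ K _ k ≫ brutalι K _ k ≫ K.d _ _ ≫ brutalπ K _ _ = K.d _ _ ≫ brutalπ K _ _
          by_cases h : p k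
          · rw [brutalπ_eq_zero (p := fun k => ¬p k) (not_not.mpr (hp k h)), comp_zero, comp_zero,
              comp_zero]
          · rw [← Category.assoc, brutalπ_ι (p := fun k => ¬p k) h, Category.id_comp] }
  zero := by
    ext k
    change brutalι K p k ≫ brutalπ K (fun k => ¬p k) k = 0
    by_cases h : p k
    · rw [brutalπ_eq_zero (not_not.mpr h), comp_zero]
    · rw [brutalι_eq_zero h, zero_comp]

variable (K) in
theorem brutalSequence_splitting (p : ℤ → Prop) (hp : ∀ k, p k → p (k + 1)) (k : ℤ) :
    Nonempty (((brutalSequence K p hp).map (eval C _ k)).Splitting) := by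
  refine (degreewise_split_iff _ k).mpr ⟨brutalπ K p k, brutalι K (fun k => ¬p k) k,
    brutalι_π, brutalι_π, ?_⟩
  change brutalπ K p k ≫ brutalι K p k + brutalπ K (fun k => ¬p k) k ≫
    brutalι K (fun k => ¬p k) k = 𝟙 (K.X k)
  by_cases h : p k
  · rw [brutalπ_ι h, brutalπ_eq_zero (not_not.mpr h), zero_comp, add_zero]
  · rw [brutalπ_eq_zero h, brutalπ_ι (p := fun k => ¬p k) h, zero_comp, zero_add]

end Brutal

section
variable {n : ℕ} [Fact (3 ≤ n)]

/-- A perfect complex as an object of `C_n`. -/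
noncomputable def complexObj (K : CochainComplex (RMod n) ℤ) (h : PerfectComplex K) : Cn n :=
  ⟨(HomotopyCategory.quotient _ _).obj K, h⟩

theorem mk_complexObj_of_iso {K L : CochainComplex (RMod n) ℤ} (hK : PerfectComplex K)
    (hL : PerfectComplex L) (e : K ≅ L) :
    KGroup.mk (complexObj K hK) = KGroup.mk (complexObj L hL) :=
  KGroup.mk_eq_of_iso (X := complexObj K hK) (Y := complexObj L hL)
    ((HomotopyCategory.quotient _ _).mapIso e)

theorem mk_complexObj_of_split (S : ShortComplex (CochainComplex (RMod n) ℤ))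
    (hS : ∀ k, Nonempty ((S.map (eval (RMod n) _ k)).Splitting)) (h₁ : PerfectComplex S.X₁)
    (h₂ : PerfectComplex S.X₂) (h₃ : PerfectComplex S.X₃) :
    KGroup.mk (complexObj _ h₂) = KGroup.mk (complexObj _ h₁) + KGroup.mk (complexObj _ h₃) := by
  let T := CochainComplex.trianglehOfDegreewiseSplit S fun k => (hS k).some
  have hT : T ∈ distTriang _ :=
    (HomotopyCategory.distinguished_iff_iso_trianglehOfDegreewiseSplit _).2 ⟨_, _, ⟨Iso.refl _⟩⟩
  exact KGroup.mk_triangle (X := complexObj _ h₁) (Y := complexObj _ h₂) (Z := complexObj _ h₃)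
    (f := T.mor₁) (g := T.mor₂) (h := T.mor₃) hT

theorem perfectComplex_brutal {K : CochainComplex (RMod n) ℤ} (hK : PerfectComplex K) (p : ℤ → Prop)
    (hp : ∀ k, p k → p (k + 1 + 1) → p (k + 1)) : PerfectComplex (brutal K p hp) := by
  obtain ⟨h, a, b, hab⟩ := hK
  refine ⟨fun k => ?_, a, b, fun k hk => ?_⟩
  · change LeftPerfect (brutalX K p k)
    rw [brutalX]
    split_ifs
    exacts [h k, .of_isZero (isZero_zero _)]
  · change IsZero (brutalX K p k)
    rw [brutalX]
    split_ifs
    exacts [hab k hk, isZero_zero _]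

theorem mk_complexObj_of_isZero {K : CochainComplex (RMod n) ℤ} (hK : PerfectComplex K)
    (h : IsZero K) : KGroup.mk (complexObj K hK) = 0 := by
  have := mk_complexObj_of_split ⟨𝟙 K, 𝟙 K, h.eq_of_src _ _⟩ (fun k => (degreewise_split_iff _
      k).mpr
    ⟨𝟙 _, 𝟙 _, by simp, by simp, ((eval (RMod n) _ k).map_isZero h).eq_of_src _ _⟩) hK hK hK
  exact left_eq_add.mp this

theorem PerfectComplex.shift {K : CochainComplex (RMod n) ℤ} (hK : PerfectComplex K) (a : ℤ) :
    PerfectComplex ((CategoryTheory.shiftFunctor (CochainComplex (RMod n) ℤ) a).obj K) := by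
  obtain ⟨h, b, c, hbc⟩ := hK
  exact ⟨fun k => h (k + a), b - a, c - a, fun k hk => hbc (k + a) (by omega)⟩

theorem mk_complexObj_shift {K : CochainComplex (RMod n) ℤ} (hK : PerfectComplex K) :
    KGroup.mk (complexObj _ (hK.shift 1)) = -KGroup.mk (complexObj K hK) := by
  let Z := Classical.choose (HasZeroObject.zero (C := CochainComplex (RMod n) ℤ))
  have hZ : IsZero Z := Classical.choose_spec (HasZeroObject.zero (C := CochainComplex (RMod n) ℤ))
  have hz : PerfectComplex Z :=
    ⟨fun k => .of_isZero ((eval (RMod n) _ k).map_isZero hZ), 0, 0,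
      fun k _ => (eval (RMod n) _ k).map_isZero hZ⟩
  have H := rot_of_distTriang _ (contractible_distinguished ((complexObj K hK).obj))
  have hZ' : IsZero (complexObj Z hz).obj := Functor.map_isZero (HomotopyCategory.quotient _ _) hZ
  let e : (complexObj _ (hK.shift 1)).obj ≅
      (CategoryTheory.shiftFunctor (RHot n) (1 : ℤ)).obj (complexObj K hK).obj :=
    ((HomotopyCategory.quotient (RMod n) (ComplexShape.up ℤ)).commShiftIso (1 : ℤ)).app K
  have H' : Triangle.mk (0 : (complexObj K hK).obj ⟶ (complexObj Z hz).obj)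
      (0 : (complexObj Z hz).obj ⟶ (complexObj _ (hK.shift 1)).obj)
      (-e.hom) ∈ distTriang (RHot n) := by
    refine isomorphic_distinguished _ H _ (Triangle.isoMk _ _ (Iso.refl _)
      (hZ'.iso (isZero_zero _)) e ((isZero_zero _).eq_of_tgt _ _)
      (hZ'.eq_of_src _ _) ?_)
    change (-e.hom) ≫ (CategoryTheory.shiftFunctor (RHot n) (1 : ℤ)).map (𝟙 _) =
      e.hom ≫ (-(CategoryTheory.shiftFunctor (RHot n) (1 : ℤ)).map (𝟙 _))
    rw [CategoryTheory.Functor.map_id, Preadditive.comp_neg,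
      Category.comp_id, Category.comp_id]
  have := KGroup.mk_triangle (X := complexObj K hK) (Y := complexObj Z hz)
    (Z := complexObj _ (hK.shift 1)) H'
  rw [mk_complexObj_of_isZero hz hZ] at this
  exact (neg_eq_of_add_eq_zero_right this.symm).symm

theorem mk_complexObj_mem_of_concentrated {K : CochainComplex (RMod n) ℤ} (hK : PerfectComplex K)
    (b : ℤ) (hb : ∀ k, k ≠ b → IsZero (K.X k)) : KGroup.mk (complexObj K hK) ∈ projSpan n := by
  induction b using Int.induction_on generalizing K with
  | zero =>
    have e : K ≅ (single (RMod n) (ComplexShape.up ℤ) 0).obj (K.X 0) := by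
      let f := mkHomToSingle (j := (0 : ℤ)) (𝟙 (K.X 0))
        (fun i hi => (hb i (by change i + 1 = 0 at hi; omega)).eq_of_src _ _)
      have : ∀ k, IsIso (f.f k) := fun k => by
        by_cases hk : k = 0
        · subst hk
          rw [mkHomToSingle_f]
          infer_instance
        · exact ⟨0, (hb k hk).eq_of_src _ _, (isZero_single_obj_X _ 0 _ k hk).eq_of_src _ _⟩
      have : IsIso f := Hom.isIso_of_components f
      exact asIso f
    rw [mk_complexObj_of_iso hK (perfectComplex_single (hK.1 0)) e]
    exact mk_moduleObj_mem _ (hK.1 0) le_rfl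
  | succ b ih =>
    have := ih (hK.shift 1) fun k hk => hb (k + 1) (by omega)
    rwa [mk_complexObj_shift, neg_mem_iff] at this
  | pred b ih =>
    have := ih (hK.shift (-1)) fun k hk => hb (k + -1) (by omega)
    rwa [← neg_mem_iff, ← mk_complexObj_shift (hK.shift (-1)), mk_complexObj_of_iso _ hK
      (shiftNegShift K 1)] at this

/-- Induction on the length of a complex, whose first term is split off by brutal truncation. -/
theorem mk_complexObj_mem (m : ℕ) {K : CochainComplex (RMod n) ℤ} (hK : PerfectComplex K) (b : ℤ)
    (hb : ∀ k, k < b ∨ b + m ≤ k → IsZero (K.X k)) :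
    KGroup.mk (complexObj K hK) ∈ projSpan n := by
  induction m generalizing K b with
  | zero =>
    rw [mk_complexObj_of_isZero]
    · exact zero_mem _
    · rw [IsZero.iff_id_eq_zero]
      ext1 k
      exact (hb k (by omega)).eq_of_src _ _
  | succ m ih =>
    have hp : ∀ k, b + 1 ≤ k → b + 1 ≤ k + 1 := fun k h => h.trans (by omega)
    have h := mk_complexObj_of_split (brutalSequence K (b + 1 ≤ ·) hp)
      (brutalSequence_splitting K _ hp) (perfectComplex_brutal hK _ fun k h _ => hp k h) hK
      (perfectComplex_brutal hK _ fun k _ h h' => h (hp _ h'))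
    refine h ▸ ?_
    refine add_mem (ih _ (b + 1) fun k hk => ?_) (mk_complexObj_mem_of_concentrated _ b fun k
        hk => ?_)
    · change IsZero (brutalX K _ k)
      by_cases h : b + 1 ≤ k
      · rw [brutalX, if_pos h]
        exact hb k (by push_cast at *; omega)
      · exact brutalX_isZero h
    · change IsZero (brutalX K (fun k => ¬b + 1 ≤ k) k)
      by_cases h : b + 1 ≤ k
      · exact brutalX_isZero (not_not.mpr h)
      · rw [brutalX, if_pos h]
        exact hb k (by omega)

/-- The classes of the `P_i` span the Grothendieck group. -/
theorem mk_mem_projSpan (X : Cn n) : KGroup.mk X ∈ projSpan n := by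
  obtain ⟨h, a, b, hab⟩ := X.property
  exact mk_complexObj_mem (b + 1 - a).toNat (K := X.obj.as) ⟨h, a, b, hab⟩ a
    fun k hk => hab k (by omega)

end
end AffineBraid

/-! ### The representation on the Grothendieck group -/

namespace AffineBraid
open TriBimod QuiverAlg MulOpposite Pretriangulated HomologicalComplex

/-- The regular bimodule of the ring of integers. -/
abbrev intBimod : TriBimod intRing intRing where
  carrier := ℤ
  gr := intRing.gr
  internal := intRing.internal
  smul_mem := intRing.mul_mem
  op_smul_mem := fun hm hb => intRing.mul_mem hm hb

section
variable {n : ℕ} [Fact (3 ≤ n)]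

/-- The shift of the tridegree is the tensor product with a shift of the integers. -/
noncomputable def tensorShiftIso (γ : TriDeg) (M : RMod n) :
    tensorObj M ((shift γ).obj intBimod) ≅ (shift γ).obj M where
  hom := tensorDesc (P := (shift γ).obj M) (N := (shift γ).obj intBimod)
    (AddMonoidHom.mk' (fun m => AddMonoidHom.mk' (fun k : ℤ => k • m) fun (k l : ℤ) => add_smul k
        l m)
      fun m m' => AddMonoidHom.ext fun k : ℤ => smul_add k m m')
    (fun m (b : ℤ) (k : ℤ) => (congrArg (fun m => k • m) (op_int_smul M b m)).trans
      ((smul_smul k b m).trans (congrArg (· • m) (mul_comm k b))))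
    (fun a m (k : ℤ) => (smul_comm a k m).symm)
    (fun (b : ℤ) m (k : ℤ) => ((congrArg (· • m) (mul_comm k b)).trans (mul_smul b k m)).trans
      (op_int_smul M b (k • m)).symm)
    (fun {α β m} => fun {k : ℤ} hm hk => by
      change k • m ∈ M.gr (α + β - γ)
      by_cases h : k = 0
      · rw [h, zero_smul]
        exact zero_mem _
      · have hβ : β - γ = 0 := hk h
        rw [add_sub_assoc, hβ, add_zero]
        exact zsmul_mem hm k)
  inv := homMk (M := (shift γ).obj M) (N := tensorObj M ((shift γ).obj intBimod))
    (AddMonoidHom.mk' (fun m : M => tmul (M := M) (N := (shift γ).obj intBimod) m (1 : ℤ))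
      fun m m' => add_tmul (M := M) (N := (shift γ).obj intBimod) m m' (1 : ℤ))
    (fun a m => (smul_tmul' (M := M) (N := (shift γ).obj intBimod) a m (1 : ℤ)).symm)
    (fun {δ m} hm => by
      have h : (1 : ℤ) ∈ ((shift γ).obj intBimod).gr γ := fun _ => sub_self γ
      have := tmul_mem (M := M) (N := (shift γ).obj intBimod) hm h
      rwa [sub_add_cancel] at this)
  hom_inv_id := tensorObj_hom_ext fun m (k : ℤ) =>
    (congrArg (fun m => tmul (M := M) (N := (shift γ).obj intBimod) m (1 : ℤ))
      (op_int_smul M k m).symm).trans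
    ((tmul_balanced (M := M) (N := (shift γ).obj intBimod) m k (1 : ℤ)).trans
      (congrArg (tmul (M := M) (N := (shift γ).obj intBimod) m) (mul_one k)))
  inv_hom_id := hom_ext fun m => one_smul ℤ m

theorem tensorShiftIso_naturality (γ : TriDeg) {M N : RMod n} (f : M ⟶ N) :
    tensorMap f (𝟙 ((shift γ).obj intBimod)) ≫ (tensorShiftIso γ N).hom =
      (tensorShiftIso γ M).hom ≫ (shift γ).map f :=
  tensorObj_hom_ext fun m (k : ℤ) => (map_zsmul f.toFun k m).symm

/-- The shift of the tridegree as a tensor product functor. -/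
noncomputable def tensorShiftNatIso (γ : TriDeg) :
    (tensorFunctor (quiverRing n) intRing intRing).flip.obj ((shift γ).obj intBimod) ≅ shift γ :=
  NatIso.ofComponents (tensorShiftIso γ) fun f => tensorShiftIso_naturality γ f

/-- The shift of a complex as a tensor product of complexes. -/
noncomputable def complexShiftIso (γ : TriDeg) (L : CochainComplex (RMod n) ℤ) :
    mapBifunctor L ((single _ (.up ℤ) 0).obj ((shift γ).obj intBimod))
      (tensorFunctor (quiverRing n) intRing intRing) (.up ℤ) ≅
        ((shift γ : RMod n ⥤ RMod n).mapHomologicalComplex (.up ℤ)).obj L :=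
  (mapBifunctorSingleRight _ L _).symm ≪≫
    (NatIso.mapHomologicalComplex (tensorShiftNatIso γ) (.up ℤ)).app L

/-- The tensor product commutes with the shift of the tridegree. -/
theorem nonempty_tensorHot_shift (B : CochainComplex (RBimod n) ℤ) (γ : TriDeg) (X : RHot n) :
    Nonempty ((tensorHot B).obj ((shiftHot γ).obj X) ≅ (shiftHot γ).obj ((tensorHot B).obj X)) :=
  ⟨(hotQ n _).mapIso ((tensorLeft B).mapIso (complexShiftIso γ X.as).symm ≪≫
    (mapBifunctorAssociator (tensorFunctorAssoc (quiverRing n) (quiverRing n) intRing intRing)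
      B X.as ((single _ (.up ℤ) 0).obj ((shift γ).obj intBimod)) (.up ℤ) (.up ℤ) (.up ℤ)).symm ≪≫
    complexShiftIso γ _)⟩

/-- The functor `B ⊗ -` on `C_n`, for a perfect complex of bimodules `B`. -/
noncomputable def tensorCn (B : CochainComplex (RBimod n) ℤ) (hB : PerfectComplex B) :
    Cn n ⥤ Cn n :=
  (IsPerfect n).lift ((IsPerfect n).ι ⋙ tensorHot B) fun K => isPerfect_tensorHot hB K.property

theorem mk_tensorCn_shift {B : CochainComplex (RBimod n) ℤ} (hB : PerfectComplex B) (γ : TriDeg)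
    (X : Cn n) : KGroup.mk ((tensorCn B hB).obj ((shiftCn γ).obj X)) =
      KGroup.mk ((shiftCn γ).obj ((tensorCn B hB).obj X)) :=
  KGroup.mk_eq_of_iso (nonempty_tensorHot_shift B γ X.obj).some

/-- The endomorphism of the Grothendieck group given by the functor `B ⊗ -`. -/
noncomputable def tensorK (B : CochainComplex (RBimod n) ℤ) (hB : PerfectComplex B) :
    KGroup n →+ KGroup n :=
  QuotientAddGroup.lift _
    (FreeAbelianGroup.lift fun X => KGroup.mk ((tensorCn B hB).obj X)) (by
    rw [AddSubgroup.closure_le]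
    rintro x hx
    change FreeAbelianGroup.lift _ x = 0
    cases hx with
    | triangle X Y Z f g h H =>
      obtain ⟨h', H'⟩ := map₂Hot_obj_exact (tensorFunctor (quiverRing n) (quiverRing n) intRing)
        ((hotQ n _).obj B) f g h H
      have := KGroup.mk_triangle (X := (tensorCn B hB).obj X) (Y := (tensorCn B hB).obj Y)
        (Z := (tensorCn B hB).obj Z) H'
      simp [this]
    | sign X => simp [mk_tensorCn_shift, KGroup.mk_sign])

theorem tensorK_mk {B : CochainComplex (RBimod n) ℤ} (hB : PerfectComplex B) (X : Cn n) :
    tensorK B hB (KGroup.mk X) = KGroup.mk ((tensorCn B hB).obj X) :=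
  FreeAbelianGroup.lift_apply_of _ _

theorem tensorK_smul {B : CochainComplex (RBimod n) ℤ} (hB : PerfectComplex B) (f : Laurent)
    (x : KGroup n) : tensorK B hB (f • x) = f • tensorK B hB x := by
  let φ : Laurent →+ KGroup n →+ KGroup n := AddMonoidHom.mk' (fun f => AddMonoidHom.mk'
    (fun x => tensorK B hB (f • x)) fun x y => by rw [smul_add, map_add])
    fun f g => AddMonoidHom.ext fun x => by simp [add_smul]
  let ψ : Laurent →+ KGroup n →+ KGroup n := AddMonoidHom.mk' (fun f => AddMonoidHom.mk'
    (fun x => f • tensorK B hB x) fun x y => by rw [map_add, smul_add])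
    fun f g => AddMonoidHom.ext fun x => by simp [add_smul]
  have : φ = ψ := by
    ext ⟨c, d⟩ : 2
    refine KGroup.hom_ext fun X => ?_
    change tensorK B hB (Laurent.mono c d • KGroup.mk X) =
      Laurent.mono c d • tensorK B hB (KGroup.mk X)
    rw [mono_smul_mk, tensorK_mk, tensorK_mk, mono_smul_mk, mk_tensorCn_shift]
  exact DFunLike.congr_fun (DFunLike.congr_fun this f) x

variable (n) in
/-- The representation of the braid group on the Grothendieck group. -/
noncomputable def repK : Representation Laurent (BraidGroup n) (KGroup n) where
  toFun g :=
    { toFun := tensorK (wordComplex (chosenWord g)) (perfectComplex_word _)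
      map_add' := map_add _
      map_smul' := tensorK_smul _ }
  map_one' := LinearMap.ext fun x => DFunLike.congr_fun (f := tensorK _ _)
    (g := AddMonoidHom.id _) (KGroup.hom_ext fun X => (tensorK_mk _ X).trans
      (KGroup.mk_eq_of_iso (((IsPerfect n).ι.mapIso ((braidAction n).one.some.app X))))) x
  map_mul' g h := LinearMap.ext fun x => DFunLike.congr_fun (f := tensorK _ _)
    (g := (tensorK _ _).comp (tensorK _ _)) (KGroup.hom_ext fun X => by
      rw [AddMonoidHom.comp_apply, tensorK_mk, tensorK_mk, tensorK_mk]
      exact KGroup.mk_eq_of_iso (((IsPerfect n).ι.mapIso (((braidAction n).mul g h).some.app X)))) x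

theorem repK_mk (g : BraidGroup n) (X : Cn n) :
    repK n g (KGroup.mk X) = KGroup.mk (((braidAction n).functor g).obj X) :=
  tensorK_mk _ X

variable (n) in
/-- The basis of the Grothendieck group consisting of the classes of the `P_i`. -/
noncomputable def basisK : Module.Basis (ZMod n) Laurent (KGroup n) :=
  Module.Basis.mk linearIndependent_projObj (by
    rintro x -
    obtain ⟨x, rfl⟩ := QuotientAddGroup.mk_surjective x
    induction x using FreeAbelianGroup.induction_on with
    | zero => exact zero_mem _
    | of X => exact mk_mem_projSpan X
    | neg X h => exact neg_mem h
    | add x y hx hy => exact add_mem hx hy)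

theorem basisK_apply (i : ZMod n) : basisK n i = KGroup.mk (projObj n i) :=
  Module.Basis.mk_apply _ _ _

end
end AffineBraid

/-! ### Tensor products with `P_i ⊗ _iP` in the Grothendieck group -/

namespace AffineBraid
open TriBimod QuiverAlg MulOpposite Pretriangulated HomologicalComplex BraidGen
section
variable {n : ℕ} [Fact (3 ≤ n)]

/-- The morphism `(P_i ⊗ _iP) ⊗ M → P_i {δ}` given by an additive function on the part of degree
`δ` of `M`. -/
noncomputable def contractHom (i : ZMod n) {M : RMod n} {δ : TriDeg} (φ : M →+ ℤ)
    (hφ : ∀ ε, ε ≠ δ → ∀ m ∈ M.gr ε, φ m = 0) :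
    tensorObj (projTensor n i) M ⟶ (shift δ).obj (projLeft n i) :=
  tensorDesc (M := projTensor n i) (P := (shift δ).obj (projLeft n i))
    (AddMonoidHom.mk' (fun z => AddMonoidHom.mk' (fun m => contract i φ m z)
      fun m m' => DFunLike.congr_fun (contract_add i φ m m') z)
      fun z z' => AddMonoidHom.ext fun m => map_add (contract i φ m) z z')
    (fun z r m => contract_op_smul i φ m r z)
    (fun r z m => contract_smul i φ m r z)
    (fun b z m => by
      refine (congrArg (fun m => contract i φ m z) (op_int_smul M b m)).trans ?_
      have h : contract i φ (b • m) z = b • contract i φ m z :=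
        map_zsmul (AddMonoidHom.mk' (fun m => contract i φ m z)
          fun m m' => DFunLike.congr_fun (contract_add i φ m m') z) b m
      exact h.trans (op_int_smul (projLeft n i) b _).symm)
    (fun hz hm => contract_mem i hφ hm hz)

/-- The morphism `P_i {δ} → (P_i ⊗ _iP) ⊗ M` given by a homogeneous element of `M`. -/
noncomputable def insertHom (i : ZMod n) {M : RMod n} {δ : TriDeg} {a : M} (ha : a ∈ M.gr δ) :
    (shift δ).obj (projLeft n i) ⟶ tensorObj (projTensor n i) M :=
  homMk (M := (shift δ).obj (projLeft n i)) (N := tensorObj (projTensor n i) M)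
    (AddMonoidHom.mk' (fun p : leftIdeal n i =>
      tmul (M := projTensor n i) (pureTensor i p (inRight (pathE i) (pathE_mul_pathE i))) a)
      fun p p' => (congrArg (fun z => tmul (M := projTensor n i) z a)
        (DFunLike.congr_fun (map_add (pureTensor i) p p') _)).trans (add_tmul _ _ _))
    (fun r p => (smul_tmul' (M := projTensor n i) r
      (pureTensor i p (inRight (pathE i) (pathE_mul_pathE i))) a).symm)
    (fun {ε p} hp => by
      have h₁ : pureTensor i p (inRight (pathE i) (pathE_mul_pathE i)) ∈
          (projTensor n i).gr (ε - δ + 0) :=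
        tmul_mem (M := projLeft n i) (N := projRight n i) hp (pathE_mem i)
      have h₂ := tmul_mem h₁ ha
      rwa [add_zero, sub_add_cancel] at h₂)

theorem tensorObj_projTensor_hom_ext {i : ZMod n} {M N : RMod n}
    {f g : tensorObj (projTensor n i) M ⟶ N}
    (h : ∀ p q m, f.toFun (tmul (M := projTensor n i) (pureTensor i p q) m) =
      g.toFun (tmul (M := projTensor n i) (pureTensor i p q) m)) : f = g :=
  tensorObj_hom_ext fun z m => DFunLike.congr_fun (projTensor_addHom_ext (i := i)
    (f := f.toFun.comp ((tmulHom (M := projTensor n i) (N := M)).flip m))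
    (g := g.toFun.comp ((tmulHom (M := projTensor n i) (N := M)).flip m)) fun p q => h p q m) z

theorem tmul_pureTensor (i : ZMod n) {M : RMod n} (p : leftIdeal n i) (q : rightIdeal n i) (m : M) :
    tmul (M := projTensor n i) (pureTensor i p q) m =
      tmul (M := projTensor n i) (pureTensor i p (inRight (pathE i) (pathE_mul_pathE i)))
        ((q.1 : QuiverAlg n) • m) := by
  refine Eq.trans ?_ (tmul_balanced (M := projTensor n i)
    (pureTensor i p (inRight (pathE i) (pathE_mul_pathE i))) q.1 m)
  refine congrArg (fun z => tmul (M := projTensor n i) z m) ?_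
  exact congrArg (pureTensor i p) (Subtype.ext (pathE_mul_of_mem q.2).symm)

theorem contractHom_insertHom_apply (i : ZMod n) {M : RMod n} {δ : TriDeg} {a : M} (ha : a ∈ M.gr δ)
    (φ : M →+ ℤ) (hφ : ∀ ζ, ζ ≠ δ → ∀ m ∈ M.gr ζ, φ m = 0) (p : leftIdeal n i) (q : rightIdeal n i)
    (m : M) : (insertHom i ha).toFun ((contractHom i φ hφ).toFun
      (tmul (M := projTensor n i) (pureTensor i p q) m)) =
        tmul (M := projTensor n i) (pureTensor i p (inRight (pathE i) (pathE_mul_pathE i)))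
          (φ ((q.1 : QuiverAlg n) • m) • a) :=
  (map_zsmul (insertHom i ha).toFun (φ ((q.1 : QuiverAlg n) • m)) p).trans
    (tmul_zsmul (M := projTensor n i) _ _ a).symm

theorem leftPerfect_projTensor_tensor (i : ZMod n) {M : RMod n} (hM : LeftPerfect M) :
    LeftPerfect (tensorObj (projTensor n i) M) :=
  (leftPerfect_projTensor i).tensor hM

/-- The tensor product `P_i ⊗ _iP ⊗ M` depends only on `(i) M`; it vanishes if `(i) M` does. -/
theorem mk_projTensor_tensor_zero (i : ZMod n) {M : RMod n} (hM : LeftPerfect M)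
    (h : ∀ m : M, (pathE i : QuiverAlg n) • m = m → m = 0) :
    KGroup.mk (moduleObj _ (leftPerfect_projTensor_tensor i hM)) = 0 := by
  have h₀ : 𝟙 (tensorObj (projTensor n i) M) = 0 :=
    tensorObj_projTensor_hom_ext fun p q m => (tmul_pureTensor i p q m).trans <| by
      rw [h ((q.1 : QuiverAlg n) • m) ((smul_smul _ _ _).trans
        (congrArg (· • m) (pathE_mul_of_mem q.2)))]
      exact tmul_zero _
  have : Subsingleton (tensorObj (projTensor n i) M) :=
    subsingleton_of_forall_eq 0 fun z => congrArg (fun f => Hom.toFun f z) h₀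
  exact mk_moduleObj_of_subsingleton _

/-- If `(i) M` has the basis `a`, with the coordinate `φ`, then `P_i ⊗ _iP ⊗ M` is a shift of
`P_i`. -/
theorem mk_projTensor_tensor_one (i : ZMod n) {M : RMod n} (hM : LeftPerfect M) {δ : TriDeg} {a : M}
    (ha : a ∈ M.gr δ) (φ : M →+ ℤ) (hφ : ∀ ε, ε ≠ δ → ∀ m ∈ M.gr ε, φ m = 0)
    (h₁ : φ ((pathE i : QuiverAlg n) • a) = 1)
    (h : ∀ m : M, (pathE i : QuiverAlg n) • m = m → φ m • a = m) :
    KGroup.mk (moduleObj _ (leftPerfect_projTensor_tensor i hM)) =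
      KGroup.mk ((shiftCn δ).obj (projObj n i)) := by
  let e : tensorObj (projTensor n i) M ≅ (shift δ).obj (projLeft n i) :=
    { hom := contractHom i φ hφ
      inv := insertHom i ha
      hom_inv_id := tensorObj_projTensor_hom_ext fun p q m => by
        refine (contractHom_insertHom_apply i ha φ hφ p q m).trans
          (Eq.trans ?_ (tmul_pureTensor i p q m).symm)
        rw [h _ ((smul_smul _ _ _).trans (congrArg (· • m) (pathE_mul_of_mem q.2)))]
      inv_hom_id := hom_ext fun p => (congrArg (· • p) h₁).trans (one_smul ℤ p) }
  exact (mk_moduleObj_of_iso _ ((leftPerfect_projLeft i).shift δ) e).trans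
    (mk_moduleObj_shift (leftPerfect_projLeft i) δ)

/-- If `(i) M` has the basis `a`, `a'`, with the coordinates `φ` and `φ'`, then `P_i ⊗ _iP ⊗ M` is
a sum of two shifts of `P_i`. -/
theorem mk_projTensor_tensor_two (i : ZMod n) {M : RMod n} (hM : LeftPerfect M) {δ δ' : TriDeg}
    {a a' : M} (ha : a ∈ M.gr δ) (ha' : a' ∈ M.gr δ') (φ φ' : M →+ ℤ)
    (hφ : ∀ ε, ε ≠ δ → ∀ m ∈ M.gr ε, φ m = 0) (hφ' : ∀ ε, ε ≠ δ' → ∀ m ∈ M.gr ε, φ' m = 0)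
    (h₁ : φ ((pathE i : QuiverAlg n) • a) = 1) (h₁' : φ' ((pathE i : QuiverAlg n) • a') = 1)
    (h₂ : φ' ((pathE i : QuiverAlg n) • a) = 0) (h₂' : φ ((pathE i : QuiverAlg n) • a') = 0)
    (h : ∀ m : M, (pathE i : QuiverAlg n) • m = m → φ m • a + φ' m • a' = m) :
    KGroup.mk (moduleObj _ (leftPerfect_projTensor_tensor i hM)) =
      KGroup.mk ((shiftCn δ).obj (projObj n i)) + KGroup.mk ((shiftCn δ').obj (projObj n i)) := by
  refine (mk_moduleObj_split ((leftPerfect_projLeft i).shift δ) _ ((leftPerfect_projLeft i).shift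
      δ')
    (insertHom i ha) (contractHom i φ hφ) (insertHom i ha') (contractHom i φ' hφ')
    (hom_ext fun p => (congrArg (· • p) h₁).trans (one_smul ℤ p))
    (hom_ext fun p => (congrArg (· • p) h₁').trans (one_smul ℤ p))
    (hom_ext fun p => (congrArg (· • p) h₂).trans (zero_smul ℤ p))
    (hom_ext fun p => (congrArg (· • p) h₂').trans (zero_smul ℤ p))
    (tensorObj_projTensor_hom_ext fun p q m => ?_)).trans
    (congrArg₂ (· + ·) (mk_moduleObj_shift (leftPerfect_projLeft i) δ)
      (mk_moduleObj_shift (leftPerfect_projLeft i) δ'))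
  refine (congrArg₂ (· + ·) (contractHom_insertHom_apply i ha φ hφ p q m)
    (contractHom_insertHom_apply i ha' φ' hφ' p q m)).trans
      (((tmul_add _ _ _).symm).trans (Eq.trans ?_ (tmul_pureTensor i p q m).symm))
  rw [h _ ((smul_smul _ _ _).trans (congrArg (· • m) (pathE_mul_of_mem q.2)))]

end
end AffineBraid

/-! ### The matrices on the Grothendieck group -/

namespace AffineBraid
open TriBimod QuiverAlg MulOpposite Pretriangulated HomologicalComplex BraidGen
section
variable {n : ℕ}

theorem corner_e {i j k : ZMod n} {r : QuiverAlg n} (hl : pathE i * r = r) (hr : r * pathE j = r)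
    (h : r.e k ≠ 0) : k = i ∧ k = j := by
  constructor <;> by_contra hk <;> apply h
  · rw [← hl]; simp [pathE, hk]
  · rw [← hr]; simp [pathE, hk]

theorem corner_x {i j k : ZMod n} {r : QuiverAlg n} (hl : pathE i * r = r) (hr : r * pathE j = r)
    (h : r.x k ≠ 0) : k = i ∧ k = j := by
  constructor <;> by_contra hk <;> apply h
  · rw [← hl]; simp [pathE, hk]
  · rw [← hr]; simp [pathE, hk]

theorem corner_u {i j k : ZMod n} {r : QuiverAlg n} (hl : pathE i * r = r) (hr : r * pathE j = r)
    (h : r.u k ≠ 0) : k = i ∧ k + 1 = j := by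
  constructor <;> by_contra hk <;> apply h
  · rw [← hl]; simp [pathE, hk]
  · rw [← hr]; simp [pathE, hk]

theorem corner_d {i j k : ZMod n} {r : QuiverAlg n} (hl : pathE i * r = r) (hr : r * pathE j = r)
    (h : r.d k ≠ 0) : k = i ∧ k - 1 = j := by
  constructor <;> by_contra hk <;> apply h
  · rw [← hl]; simp [pathE, hk]
  · rw [← hr]; simp [pathE, hk]

variable [Fact (3 ≤ n)]

theorem one_add_one_ne_zero_zmod : (1 + 1 : ZMod n) ≠ 0 := by
  rw [one_add_one_eq_two]
  exact two_ne_zero_zmod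

/-- The group `(i) R_n (i)` has the basis `(i)`, `(i|i+1|i)`. -/
theorem mk_projTensor_projLeft_self (i : ZMod n) :
    KGroup.mk (moduleObj _ (leftPerfect_projTensor_tensor i (leftPerfect_projLeft i))) =
      KGroup.mk (projObj n i) + Laurent.mono 1 0 • KGroup.mk (projObj n i) := by
  refine (mk_projTensor_tensor_two i (leftPerfect_projLeft i) (δ := 0) (δ' := (1, 0, 0))
    (a := (⟨pathE i, mem_leftIdeal (pathE_mul_pathE i)⟩ : leftIdeal n i))
    (a' := (⟨pathX i, mem_leftIdeal (pathX_mul i)⟩ : leftIdeal n i)) (pathE_mem i) (pathX_mem i)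
    (AddMonoidHom.mk' (fun m : leftIdeal n i => QuiverAlg.e m.1 i) fun _ _ => rfl)
    (AddMonoidHom.mk' (fun m : leftIdeal n i => QuiverAlg.x m.1 i) fun _ _ => rfl)
    (fun ε hε m hm => by_contra fun h => hε (hm.1 i h).symm)
    (fun ε hε m hm => by_contra fun h => hε (hm.2.2.2 i h).symm) ?_ ?_ ?_ ?_ ?_).trans ?_
  · change (pathE i * pathE i : QuiverAlg n).e i = 1
    simp [pathE]
  · change (pathE i * pathX i : QuiverAlg n).x i = 1
    simp [pathE, pathX]
  · change (pathE i * pathE i : QuiverAlg n).x i = 0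
    simp [pathE]
  · change (pathE i * pathX i : QuiverAlg n).e i = 0
    simp [pathE, pathX]
  · rintro ⟨m, hm⟩ h
    have hl : pathE i * m = m := congrArg Subtype.val h
    have hr := mul_pathE_of_mem hm
    refine Subtype.ext ?_
    change m.e i • pathE i + m.x i • pathX i = m
    ext k <;> simp only [add_e, add_u, add_d, add_x, zsmul_e, zsmul_u, zsmul_d, zsmul_x]
    · by_cases h : m.e k = 0
      · by_cases hk : k = i
        · subst hk; simp [pathE, pathX]
        · simp [pathE, pathX, h, hk]
      · obtain ⟨rfl, -⟩ := corner_e hl hr h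
        simp [pathE, pathX]
    · by_cases h : m.u k = 0
      · simp [pathE, pathX, h]
      · obtain ⟨rfl, h'⟩ := corner_u hl hr h
        exact absurd (add_eq_left.mp h') one_ne_zero_zmod
    · by_cases h : m.d k = 0
      · simp [pathE, pathX, h]
      · obtain ⟨rfl, h'⟩ := corner_d hl hr h
        exact absurd (sub_eq_self.mp h') one_ne_zero_zmod
    · by_cases h : m.x k = 0
      · by_cases hk : k = i
        · subst hk; simp [pathE, pathX]
        · simp [pathE, pathX, h, hk]
      · obtain ⟨rfl, -⟩ := corner_x hl hr h
        simp [pathE, pathX]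
  · rw [mono_smul_mk, KGroup.mk_shift_zero]

/-- The group `(i) R_n (i+1)` has the basis `(i|i+1)`. -/
theorem mk_projTensor_projLeft_succ (i : ZMod n) :
    KGroup.mk (moduleObj _ (leftPerfect_projTensor_tensor i (leftPerfect_projLeft (i + 1)))) =
      -((if i = 0 then Laurent.mono 1 1 else Laurent.mono 1 0) • KGroup.mk (projObj n i)) := by
  refine (mk_projTensor_tensor_one i (leftPerfect_projLeft (i + 1)) (δ := (stdDeg n).u i)
    (a := (⟨pathU i, mem_leftIdeal (by
      have h := pathU_mul (i + 1)
      rwa [add_sub_cancel_right] at h)⟩ : leftIdeal n (i + 1)))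
    (pathU_mem i)
    (AddMonoidHom.mk' (fun m : leftIdeal n (i + 1) => QuiverAlg.u m.1 i) fun _ _ => rfl)
    (fun ε hε m hm => by_contra fun h => hε (hm.2.1 i h).symm) ?_ ?_).trans ?_
  · change (pathE i * pathU i : QuiverAlg n).u i = 1
    simp [pathE, pathU]
  · rintro ⟨m, hm⟩ h
    have hl : pathE i * m = m := congrArg Subtype.val h
    have hr := mul_pathE_of_mem hm
    refine Subtype.ext ?_
    change m.u i • pathU i = m
    ext k <;> simp only [zsmul_e, zsmul_u, zsmul_d, zsmul_x]
    · by_cases h : m.e k = 0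
      · simp [pathU, h]
      · obtain ⟨rfl, h'⟩ := corner_e hl hr h
        exact absurd (left_eq_add.mp h') one_ne_zero_zmod
    · by_cases h : m.u k = 0
      · by_cases hk : k = i
        · subst hk; simp [pathU]
        · simp [pathU, h, hk]
      · obtain ⟨rfl, -⟩ := corner_u hl hr h
        simp [pathU]
    · by_cases h : m.d k = 0
      · simp [pathU, h]
      · obtain ⟨rfl, h'⟩ := corner_d hl hr h
        rw [sub_eq_iff_eq_add, add_assoc] at h'
        exact absurd (left_eq_add.mp h') one_add_one_ne_zero_zmod
    · by_cases h : m.x k = 0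
      · simp [pathU, h]
      · obtain ⟨rfl, h'⟩ := corner_x hl hr h
        exact absurd (left_eq_add.mp h') one_ne_zero_zmod
  · obtain ⟨z, hz⟩ : ∃ z : ℤ, (stdDeg n).u i = (1, 0, z) + (0, 1, 0) ∧
        z = if i = 0 then 1 else 0 := ⟨_, by simp [stdDeg], rfl⟩
    rw [hz.1, ← KGroup.mk_shift_shift _ _ _ rfl, KGroup.mk_sign, ← mono_smul_mk, hz.2]
    split_ifs <;> rfl

/-- The group `(i) R_n (i-1)` has the basis `(i|i-1)`. -/
theorem mk_projTensor_projLeft_pred (i : ZMod n) :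
    KGroup.mk (moduleObj _ (leftPerfect_projTensor_tensor i (leftPerfect_projLeft (i - 1)))) =
      -((if i = 1 then Laurent.mono 0 (-1) else 1) • KGroup.mk (projObj n i)) := by
  refine (mk_projTensor_tensor_one i (leftPerfect_projLeft (i - 1)) (δ := (stdDeg n).d i)
    (a := (⟨pathD i, mem_leftIdeal (by
      have h := pathD_mul (i - 1)
      rwa [sub_add_cancel] at h)⟩ : leftIdeal n (i - 1)))
    (pathD_mem i)
    (AddMonoidHom.mk' (fun m : leftIdeal n (i - 1) => QuiverAlg.d m.1 i) fun _ _ => rfl)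
    (fun ε hε m hm => by_contra fun h => hε (hm.2.2.1 i h).symm) ?_ ?_).trans ?_
  · change (pathE i * pathD i : QuiverAlg n).d i = 1
    simp [pathE, pathD]
  · rintro ⟨m, hm⟩ h
    have hl : pathE i * m = m := congrArg Subtype.val h
    have hr := mul_pathE_of_mem hm
    refine Subtype.ext ?_
    change m.d i • pathD i = m
    ext k <;> simp only [zsmul_e, zsmul_u, zsmul_d, zsmul_x]
    · by_cases h : m.e k = 0
      · simp [pathD, h]
      · obtain ⟨rfl, h'⟩ := corner_e hl hr h
        exact absurd (sub_eq_self.mp h'.symm) one_ne_zero_zmod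
    · by_cases h : m.u k = 0
      · simp [pathD, h]
      · obtain ⟨rfl, h'⟩ := corner_u hl hr h
        rw [eq_sub_iff_add_eq, add_assoc] at h'
        exact absurd (add_eq_left.mp h') one_add_one_ne_zero_zmod
    · by_cases h : m.d k = 0
      · by_cases hk : k = i
        · subst hk; simp [pathD]
        · simp [pathD, h, hk]
      · obtain ⟨rfl, -⟩ := corner_d hl hr h
        simp [pathD]
    · by_cases h : m.x k = 0
      · simp [pathD, h]
      · obtain ⟨rfl, h'⟩ := corner_x hl hr h
        exact absurd (sub_eq_self.mp h'.symm) one_ne_zero_zmod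
  · obtain ⟨z, hz⟩ : ∃ z : ℤ, (stdDeg n).d i = (0, 0, z) + (0, 1, 0) ∧
        z = if i = 1 then -1 else 0 := ⟨_, by simp [stdDeg], rfl⟩
    rw [hz.1, ← KGroup.mk_shift_shift _ _ _ rfl, KGroup.mk_sign, ← mono_smul_mk, hz.2]
    split_ifs <;> rfl

theorem mk_projTensor_projLeft_of_ne {i j : ZMod n} (h₀ : j ≠ i) (h₁ : j ≠ i + 1) (h₂ : j ≠ i - 1) :
    KGroup.mk (moduleObj _ (leftPerfect_projTensor_tensor i (leftPerfect_projLeft j))) = 0 := by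
  refine mk_projTensor_tensor_zero i (leftPerfect_projLeft j) ?_
  rintro ⟨m, hm⟩ h
  have hl : pathE i * m = m := congrArg Subtype.val h
  have hr := mul_pathE_of_mem hm
  refine Subtype.ext ?_
  change m = 0
  ext k <;> by_contra h
  · obtain ⟨rfl, h'⟩ := corner_e hl hr h
    exact h₀ h'.symm
  · obtain ⟨rfl, h'⟩ := corner_u hl hr h
    exact h₁ h'.symm
  · obtain ⟨rfl, h'⟩ := corner_d hl hr h
    exact h₂ h'.symm
  · obtain ⟨rfl, h'⟩ := corner_x hl hr h
    exact h₀ h'.symm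

theorem repK_letter (l : BraidGen n × Bool) (X : Cn n) :
    repK n (cond l.2 (gen l.1) (gen l.1)⁻¹) (KGroup.mk X) =
      KGroup.mk ((tensorCn _ (perfectComplex_letter l)).obj X) := by
  rw [repK_mk]
  exact KGroup.mk_eq_of_iso ((actsBy_letter l).some.app X)

theorem mk_tensorCn_single {M : RBimod n} (hM : LeftPerfect M) {N : RMod n} (hN : LeftPerfect N) :
    KGroup.mk ((tensorCn _ (perfectComplex_single hM)).obj (moduleObj N hN)) =
      KGroup.mk (moduleObj _ (hM.tensor hN)) :=
  KGroup.mk_eq_of_iso (X := (tensorCn _ (perfectComplex_single hM)).obj (moduleObj N hN))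
    (Y := moduleObj _ (hM.tensor hN)) (hotMu M N)

/-- The class of `F_i ⊗ M` is the difference of the classes of `M` and `P_i ⊗ _iP ⊗ M`. -/
theorem repK_sigma (i : ZMod n) {M : RMod n} (hM : LeftPerfect M) :
    repK n (gen (sigma i)) (KGroup.mk (moduleObj M hM)) = KGroup.mk (moduleObj M hM) -
      KGroup.mk (moduleObj _ (leftPerfect_projTensor_tensor i hM)) := by
  refine (repK_letter (sigma i, true) _).trans (eq_sub_of_add_eq' ?_)
  obtain ⟨g, k, H⟩ := exists_sigma_triangle i
  obtain ⟨k', H'⟩ := map₂Hot_flip_obj_exact (tensorFunctor (quiverRing n) (quiverRing n) intRing)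
    (inDegreeZero M) _ g k H
  have h := KGroup.mk_triangle
    (X := (tensorCn _ (perfectComplex_single (leftPerfect_projTensor i))).obj (moduleObj M hM))
    (Y := (tensorCn _ (perfectComplex_single leftPerfect_regBimod)).obj (moduleObj M hM))
    (Z := (tensorCn _ (perfectComplex_letter (sigma i, true))).obj (moduleObj M hM)) H'
  rw [mk_tensorCn_single (leftPerfect_projTensor i) hM] at h
  refine h.symm.trans (KGroup.mk_eq_of_iso ?_)
  exact nonempty_tensorHot_unit.some.app (inDegreeZero M)

theorem toMatrix_eq_iff {f : KGroup n →ₗ[Laurent] KGroup n} {A : Matrix (ZMod n) (ZMod n) Laurent} :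
    LinearMap.toMatrix (basisK n) (basisK n) f = A ↔
      ∀ j, f (KGroup.mk (projObj n j)) = ∑ i, A i j • KGroup.mk (projObj n i) := by
  rw [← (Matrix.toLin (basisK n) (basisK n)).injective.eq_iff, Matrix.toLin_toMatrix]
  constructor
  · rintro rfl j
    rw [← basisK_apply, Matrix.toLin_self]
    simp only [basisK_apply]
  · intro h
    refine (basisK n).ext fun j => ?_
    rw [Matrix.toLin_self, basisK_apply, h]
    simp only [basisK_apply]

theorem toMatrix_repK_sigma (i : ZMod n) :
    LinearMap.toMatrix (basisK n) (basisK n) (repK n (gen (sigma i))) = matSigma i := by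
  refine toMatrix_eq_iff.mpr fun j => ?_
  have hij : i + 1 ≠ i := fun h => one_ne_zero_zmod (add_eq_left.mp h)
  have hij' : i - 1 ≠ i := fun h => one_ne_zero_zmod (sub_eq_self.mp h)
  have hij'' : i - 1 ≠ i + 1 := fun h => one_add_one_ne_zero_zmod (by
    rw [sub_eq_iff_eq_add, add_assoc] at h
    exact left_eq_add.mp h)
  -- off the diagonal, a column is that of the identity plus a multiple of the `i`-th basis vector
  have key : ∀ c : Laurent, (j ≠ i → (∀ a, matSigma i a j =
        (if a = i then c else 0) + if a = j then 1 else 0) →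
      ∑ a, matSigma i a j • KGroup.mk (projObj n a) =
        KGroup.mk (projObj n j) + c • KGroup.mk (projObj n i)) := by
    intro c _ h
    simp only [h, add_smul, ite_smul, zero_smul, one_smul, Finset.sum_add_distrib,
      Finset.sum_ite_eq', Finset.mem_univ, if_true]
    exact add_comm _ _
  refine (repK_sigma i (leftPerfect_projLeft j)).trans ?_
  change KGroup.mk (projObj n j) - _ = _
  by_cases h₀ : j = i
  · subst h₀
    rw [mk_projTensor_projLeft_self]
    have : ∀ a, matSigma j a j = if a = j then -Laurent.mono 1 0 else 0 := fun a => by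
      by_cases h : a = j <;> simp [matSigma, h]
    simp [this]
  by_cases h₁ : j = i + 1
  · subst h₁
    rw [mk_projTensor_projLeft_succ, key _ h₀, sub_neg_eq_add]
    intro a
    by_cases h : a = i
    · subst h; simp [matSigma, one_ne_zero_zmod]
    · simp [matSigma, h]
  by_cases h₂ : j = i - 1
  · subst h₂
    rw [mk_projTensor_projLeft_pred, key _ h₀, sub_neg_eq_add]
    intro a
    by_cases h : a = i
    · subst h; simp [matSigma, hij', hij'', hij'.symm]
    · simp [matSigma, h]
  · rw [mk_projTensor_projLeft_of_ne h₀ h₁ h₂, key 0 h₀]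
    · simp
    intro a
    by_cases h : a = i
    · subst h; simp [matSigma, h₀, h₁, h₂, Ne.symm h₀]
    · simp [matSigma, h]

/-- The morphism `P_{j+1} → T ⊗ P_j`, `p ↦ p ⊗ e_j`, of the twisted bimodule `T`. -/
noncomputable def twistProjHom (j : ZMod n) :
    (shift ((twistDeg n).e (j + 1) + 0)).obj (projLeft n (j + 1)) ⟶
      tensorObj (twistBimod n) (projLeft n j) :=
  homOfElement (j + 1) (M := tensorObj (twistBimod n) (projLeft n j))
    (a := tmul (M := twistBimod n) (toTwist (pathE (j + 1)))
      (⟨pathE j, mem_leftIdeal (pathE_mul_pathE j)⟩ : leftIdeal n j))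
    (tmul_mem (M := twistBimod n) (toTwist_pathE_mem (j + 1)) (pathE_mem j))

/-- The inverse of the morphism `P_{j+1} → T ⊗ P_j`. -/
noncomputable def twistProjInv (j : ZMod n) :
    tensorObj (twistBimod n) (projLeft n j) →+ leftIdeal n (j + 1) :=
  tensorLift (M := twistBimod n) (N := projLeft n j)
    (AddMonoidHom.mk' (fun t : QuiverAlg n => AddMonoidHom.mk'
      (fun p : leftIdeal n j => (⟨t * tRho n p.1, mem_leftIdeal (by
        rw [mul_assoc, ← tRho_pathE, ← map_mul, mul_pathE_of_mem p.2])⟩ : leftIdeal n (j + 1)))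
      fun p q => Subtype.ext ((congrArg (t * ·) (map_add (tRho n) p.1 q.1)).trans (mul_add _ _ _)))
      fun (t t' : QuiverAlg n) => AddMonoidHom.ext fun p : leftIdeal n j => Subtype.ext (add_mul
          t t' _))
    (fun (t : QuiverAlg n) (b : QuiverAlg n) p => Subtype.ext ((mul_assoc t _ _).trans
      (congrArg (t * ·) (map_mul (tRho n) b p.1).symm)))

theorem isIso_twistProjHom (j : ZMod n) : IsIso (twistProjHom (n := n) j) := by
  refine isIso_of_bijective _ (Function.bijective_iff_has_inverse.mpr ⟨twistProjInv j, ?_, ?_⟩)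
  · intro p
    refine Subtype.ext ?_
    change (Subtype.val (p := (· ∈ leftIdeal n (j + 1))) p * pathE (j + 1)) * tRho n (pathE j) = _
    rw [tRho_pathE, mul_assoc, pathE_mul_pathE]
    exact mul_pathE_of_mem p.2
  · have h : ((twistProjHom j).toFun : _ →+ tensorObj (twistBimod n) (projLeft n j)).comp
        (twistProjInv j) = AddMonoidHom.id _ := by
      refine AddMonoidHom.ext fun z => ?_
      refine tensor_induction (M := twistBimod n) (N := projLeft n j)
        (p := fun z => (twistProjHom j).toFun (twistProjInv j z) = z) ?_ (fun (t : QuiverAlg n)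
            p => ?_)
        (fun x y hx hy => ?_) z
      · exact (congrArg _ (map_zero (twistProjInv j))).trans (map_zero _)
      · change tmul (M := twistBimod n) (toTwist ((t * tRho n p.1) * pathE (j + 1)))
          (⟨pathE j, mem_leftIdeal (pathE_mul_pathE j)⟩ : leftIdeal n j) = tmul (M := twistBimod
              n) t p
        have h₁ : (t * tRho n p.1) * pathE (j + 1) = t * tRho n p.1 := by
          rw [mul_assoc, ← tRho_pathE, ← map_mul, mul_pathE_of_mem p.2]
        rw [h₁]
        refine (tmul_balanced (M := twistBimod n) (N := projLeft n j) t p.1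
          (⟨pathE j, mem_leftIdeal (pathE_mul_pathE j)⟩ : leftIdeal n j)).trans ?_
        exact congrArg (tmul (M := twistBimod n) (N := projLeft n j) t) (Subtype.ext
            (mul_pathE_of_mem p.2))
      · refine (congrArg _ (map_add (twistProjInv j) x y)).trans ((map_add _ _ _).trans ?_)
        exact congrArg₂ (· + ·) hx hy
    exact DFunLike.congr_fun h

theorem repK_rho (j : ZMod n) : repK n (gen rho) (KGroup.mk (projObj n j)) =
    (if j = 0 then Laurent.mono 0 (-1) else 1) • KGroup.mk (projObj n (j + 1)) := by
  have := isIso_twistProjHom (n := n) j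
  refine (repK_letter (rho, true) _).trans ((mk_tensorCn_single leftPerfect_twistBimod
    (leftPerfect_projLeft j)).trans ?_)
  refine ((mk_moduleObj_of_iso ((leftPerfect_projLeft (j + 1)).shift _) _
    (asIso (twistProjHom j))).symm.trans (mk_moduleObj_shift (leftPerfect_projLeft (j + 1))
        _)).trans ?_
  have h : (twistDeg n).e (j + 1) + 0 = (0, 0, if j = 0 then -1 else 0) := by
    simp [twistDeg]
  rw [h, ← mono_smul_mk]
  split_ifs <;> rfl

theorem toMatrix_repK_rho :
    LinearMap.toMatrix (basisK n) (basisK n) (repK n (gen rho)) = matRho := by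
  refine toMatrix_eq_iff.mpr fun j => (repK_rho j).trans ?_
  simp [matRho, ite_smul]

theorem toMatrix_repK_rho_inv :
    LinearMap.toMatrix (basisK n) (basisK n) (repK n (gen rho)⁻¹) = matRhoInv := by
  refine toMatrix_eq_iff.mpr fun j => ?_
  have h : repK n (gen rho) (∑ i, (matRhoInv i j : Laurent) • KGroup.mk (projObj n i)) =
      KGroup.mk (projObj n j) := by
    have hs : ∑ i, (matRhoInv i j : Laurent) • KGroup.mk (projObj n i) =
        (if j = 1 then Laurent.mono 0 1 else 1) • KGroup.mk (projObj n (j - 1)) := by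
      have : ∀ i : ZMod n, (matRhoInv i j : Laurent) =
          if i = j - 1 then (if j = 1 then Laurent.mono 0 1 else 1) else 0 := fun i => by
        by_cases h : i = j - 1
        · subst h; simp [matRhoInv, sub_eq_zero]
        · have : j ≠ i + 1 := fun h' => h (eq_sub_of_add_eq h'.symm)
          simp [matRhoInv, h, this]
      simp [this]
    rw [hs, map_smul, repK_rho, smul_smul, sub_add_cancel]
    by_cases hj : j = 1
    · simp [hj, Laurent.mono_mul, Laurent.mono_zero]
    · simp [hj, sub_eq_zero]
  rw [← h, ← Module.End.mul_apply, ← map_mul, inv_mul_cancel, map_one]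
  rfl

end
end AffineBraid

/-! ### The action on chains of the cover -/

namespace AffineBraid
open BraidGen QuiverAlg
section
variable {n : ℕ}

theorem deckHom_loop (j : ZMod n) : deckHom n (loop j) = Multiplicative.ofAdd (1, 0) :=
  FreeGroup.lift_apply_of

theorem deckHom_loopZero : deckHom n loopZero = Multiplicative.ofAdd (0, 1) :=
  FreeGroup.lift_apply_of

theorem liftChain_loop (j : ZMod n) : liftChain (loop j) = coverEdge (some j) := liftChain_of _

theorem liftChain_mul_loop (w : LoopGroup n) (j : ZMod n) :
    liftChain (w * loop j) = coverEdge (some j) + Laurent.mono 1 0 • liftChain w := by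
  rw [liftChain_mul, deckHom_loop, liftChain_loop]
  rfl

theorem liftChain_conj (w : LoopGroup n) (j : ZMod n) : liftChain (w⁻¹ * loop j * w) =
    (1 - Laurent.mono 1 0) • liftChain w +
      Laurent.mono (deckHom n w).toAdd.1 (deckHom n w).toAdd.2 • coverEdge (some j) := by
  have h := liftChain_mul w⁻¹ w
  rw [inv_mul_cancel, liftChain_one, eq_comm, add_eq_zero_iff_neg_eq] at h
  rw [liftChain_mul, liftChain_mul_loop, smul_add, smul_comm _ (Laurent.mono 1 0), ← h, smul_neg,
    sub_smul, one_smul]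
  abel

/-- The lift of the word `x_1 ⋯ x_m`, which is read from right to left: the letter `x_{m-k}` is
lifted from the vertex `t^k p̃`. -/
theorem liftChain_prefix (m : ℕ) :
    liftChain ((List.range m).map fun k : ℕ => (loop ((k : ZMod n) + 1) : LoopGroup n)).prod =
      ∑ k ∈ Finset.range m, Laurent.mono k 0 • coverEdge (some ((m : ZMod n) - (k : ZMod n))) ∧
    deckHom n ((List.range m).map fun k : ℕ => (loop ((k : ZMod n) + 1) : LoopGroup n)).prod =
      Multiplicative.ofAdd ((m : ℤ), (0 : ℤ)) := by
  induction m with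
  | zero => exact ⟨by simp [liftChain_one], by simp; rfl⟩
  | succ m ih =>
    rw [List.range_succ, List.map_append, List.prod_append, List.map_singleton, List.prod_singleton]
    constructor
    · rw [liftChain_mul_loop, ih.1, Finset.sum_range_succ', Finset.smul_sum, add_comm]
      congr 1
      · refine Finset.sum_congr rfl fun k _ => ?_
        rw [smul_smul, Laurent.mono_mul]
        push_cast
        rw [add_sub_add_right_eq_sub, add_comm (1 : ℤ)]
      · push_cast
        rw [sub_zero, Laurent.mono_zero, one_smul]
    · rw [map_mul, ih.2, deckHom_loop, ← ofAdd_add]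
      simp

/-- The chain of the lift of the boundary loop. -/
theorem liftChain_boundary : liftChain (boundaryLoop n) =
    ∑ k ∈ Finset.range n, Laurent.mono k 0 • coverEdge (some (-(k : ZMod n))) +
      Laurent.mono n 0 • coverEdge none := by
  rw [boundaryLoop, liftChain_mul, (liftChain_prefix n).1, (liftChain_prefix n).2, loopZero,
    liftChain_of]
  simp

theorem deckHom_boundary : deckHom n (boundaryLoop n) = Multiplicative.ofAdd ((n : ℤ), (1 : ℤ))
    := by
  rw [boundaryLoop, map_mul, (liftChain_prefix n).2, deckHom_loopZero, ← ofAdd_add]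
  simp

/-- The cycle `γ̃_n`, in terms of the lift of the boundary loop. -/
theorem gammaCycle_zero : gammaCycle (0 : ZMod n) =
    (1 - Laurent.mono 1 0) • liftChain (boundaryLoop n) + Laurent.mono n 1 • coverEdge (some 1) -
      coverEdge (some 0) := by
  rw [gammaCycle, if_pos rfl, liftChain_boundary, smul_add, Finset.smul_sum, smul_smul,
    mul_comm (1 - _) (Laurent.mono n 0)]
  simp only [smul_smul, mul_comm (1 - Laurent.mono 1 0)]

theorem gammaCycle_of_ne {i : ZMod n} (h : i ≠ 0) :
    gammaCycle i = coverEdge (some (i + 1)) - coverEdge (some i) := if_neg h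

variable [Fact (3 ≤ n)]

theorem artin_gen (x : BraidGen n) : artin n (gen x) = artinGen x := PresentedGroup.toGroup.of _

theorem chainMap_sigma_edge {i : ZMod n} (hi : i ≠ 0) (j : ZMod n) :
    chainMap (artin n (gen (sigma i))) (coverEdge (some j)) =
      if j = i then coverEdge (some (i + 1)) else
        if j = i + 1 then (1 - Laurent.mono 1 0) • coverEdge (some (i + 1)) +
          Laurent.mono 1 0 • coverEdge (some i) else coverEdge (some j) := by
  have h : artin n (gen (sigma i)) (loop j) = sigmaHom i (loop j) := by
    rw [artin_gen, artinGen, if_neg hi]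
    rfl
  rw [chainMap_edge]
  refine (congrArg liftChain h).trans ?_
  rw [sigmaHom_loop]
  split_ifs
  · exact liftChain_loop _
  · rw [liftChain_conj, liftChain_loop, deckHom_loop]
    rfl
  · exact liftChain_loop _

theorem chainMap_sigma_boundary {i : ZMod n} (hi : i ≠ 0) :
    chainMap (artin n (gen (sigma i))) (liftChain (boundaryLoop n)) =
      liftChain (boundaryLoop n) := by
  rw [chainMap_liftChain, artin_gen, artinGen, if_neg hi]
  exact congrArg liftChain (sigmaHom_boundary hi)

theorem chainMap_rho_edge {j : ZMod n} (hj : j ≠ 0) :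
    chainMap (artin n (gen rho)) (coverEdge (some j)) = coverEdge (some (j + 1)) := by
  have h : artin n (gen rho) (loop j) = rhoHom (loop j) := by
    rw [artin_gen]
    rfl
  rw [chainMap_edge]
  refine (congrArg liftChain h).trans ?_
  rw [rhoHom_loop, if_neg hj, liftChain_loop]

/-- The lift of `D⁻¹ x_1 D`, the image of `x_n` under `ρ`, is `γ̃_n + x̃_n`. -/
theorem chainMap_rho_edge_zero : chainMap (artin n (gen rho)) (coverEdge (some 0)) =
    gammaCycle 0 + coverEdge (some 0) := by
  have h : artin n (gen rho) (loop 0) = rhoHom (loop 0) := by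
    rw [artin_gen]
    rfl
  rw [chainMap_edge]
  refine (congrArg liftChain h).trans ?_
  rw [rhoHom_loop, if_pos rfl, liftChain_conj, deckHom_boundary, gammaCycle_zero, sub_add_cancel]
  rfl

theorem chainMap_rho_boundary :
    chainMap (artin n (gen rho)) (liftChain (boundaryLoop n)) = liftChain (boundaryLoop n) := by
  rw [chainMap_liftChain, artin_gen]
  exact congrArg liftChain rhoHom_boundary

/-- The generator `ρ` rotates the cycles, with the factor `q t^n` at `γ̃_n`. -/
theorem chainMap_rho_gammaCycle (i : ZMod n) :
    chainMap (artin n (gen rho)) (gammaCycle i) =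
      (if i = 0 then Laurent.mono n 1 else 1 : Laurent) • gammaCycle (i + 1) := by
  by_cases h : i = 0
  · subst h
    rw [if_pos rfl, zero_add, gammaCycle_of_ne one_ne_zero_zmod]
    conv_lhs => rw [gammaCycle_zero]
    rw [map_sub, map_add, map_smul, map_smul, chainMap_rho_boundary,
      chainMap_rho_edge one_ne_zero_zmod, chainMap_rho_edge_zero, gammaCycle_zero, smul_sub]
    abel
  · rw [if_neg h, one_smul, gammaCycle_of_ne h, map_sub, chainMap_rho_edge h]
    by_cases h' : i + 1 = 0
    · rw [h', chainMap_rho_edge_zero, add_sub_cancel_right]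
    · rw [chainMap_rho_edge h', gammaCycle_of_ne h']

/-- The coefficient of `γ̃_i` in `σ_i γ̃_j - γ̃_j`. -/
noncomputable def sigmaCoeff (i j : ZMod n) : Laurent :=
  if j = i then -Laurent.mono 1 0 - 1
  else if j = i + 1 then Laurent.mono 1 0
  else if j = i - 1 then (if i = 1 then Laurent.mono n 1 else 1)
  else 0

/-- The generator `σ_i`, for `i ≠ n`, changes the cycles by multiples of `γ̃_i`. -/
theorem chainMap_sigma_gammaCycle {i : ZMod n} (hi : i ≠ 0) (j : ZMod n) :
    chainMap (artin n (gen (sigma i))) (gammaCycle j) =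
      gammaCycle j + sigmaCoeff i j • gammaCycle i := by
  have h₁ : i + 1 ≠ i := fun h => one_ne_zero_zmod (add_eq_left.mp h)
  have h₂ : i + 1 + 1 ≠ i := fun h => one_add_one_ne_zero_zmod (by rwa [add_assoc,
      add_eq_left] at h)
  have h₃ : i + 1 + 1 ≠ i + 1 := fun h => one_ne_zero_zmod (add_eq_left.mp h)
  rw [gammaCycle_of_ne hi]
  by_cases hj : j = 0
  · subst hj
    rw [gammaCycle_zero, map_sub, map_add, map_smul, map_smul, chainMap_sigma_boundary hi,
      chainMap_sigma_edge hi, chainMap_sigma_edge hi, if_neg (Ne.symm hi)]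
    by_cases c₁ : i = 1
    · subst c₁
      have h₄ : (0 : ZMod n) ≠ 1 := Ne.symm hi
      have h₅ : (0 : ZMod n) ≠ 1 + 1 := Ne.symm one_add_one_ne_zero_zmod
      simp only [h₄, h₅, sub_self, sigmaCoeff, if_true, if_false]
      module
    have c₂ : (1 : ZMod n) ≠ i + 1 := fun h => hi (right_eq_add.mp h)
    by_cases c₃ : 0 = i + 1
    · simp only [Ne.symm c₁, Ne.symm hi, one_ne_zero_zmod, ← c₃, sigmaCoeff, if_true, if_false]
      module
    · have c₄ : 0 ≠ i - 1 := fun h => c₁ (sub_eq_zero.mp h.symm)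
      simp only [Ne.symm c₁, Ne.symm hi, c₂, c₃, c₄, sigmaCoeff, if_false]
      module
  · rw [gammaCycle_of_ne hj, map_sub, chainMap_sigma_edge hi, chainMap_sigma_edge hi]
    by_cases c₁ : j = i
    · subst c₁
      simp only [h₁, sigmaCoeff, if_true, if_false]
      module
    by_cases c₂ : j = i + 1
    · subst c₂
      simp only [h₁, h₂, h₃, sigmaCoeff, if_true, if_false]
      module
    by_cases c₃ : j = i - 1
    · subst c₃
      have : i ≠ 1 := fun h => hj (by rw [h, sub_self])
      simp only [c₁, c₂, this, sub_add_cancel, sigmaCoeff, if_true, if_false]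
      module
    · have c₄ : j + 1 ≠ i := fun h => c₃ (eq_sub_of_add_eq h)
      have c₅ : j + 1 ≠ i + 1 := fun h => c₁ (add_right_cancel h)
      simp only [c₁, c₂, c₃, c₄, c₅, sigmaCoeff, if_false]
      module

end
end AffineBraid

/-! ### The homology of the cover -/

namespace AffineBraid
open BraidGen QuiverAlg
section
variable {n : ℕ}

theorem Laurent.mono_ne_one {a b : ℤ} (h : (a, b) ≠ 0) : Laurent.mono a b - 1 ≠ 0 := by
  intro h'
  have := congrArg (fun f : Laurent => f.coeff (a, b)) (sub_eq_zero.mp h')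
  simp [Laurent.mono, AddMonoidAlgebra.one_def, h.symm] at this

theorem Laurent.mono_sub_one_dvd (a : ℤ) : Laurent.mono 1 0 - 1 ∣ Laurent.mono a 0 - 1 := by
  have hpow : ∀ m : ℕ, Laurent.mono 1 0 - 1 ∣ Laurent.mono m 0 - 1 := fun m => by
    have : Laurent.mono m 0 = Laurent.mono 1 0 ^ m := by
      simp [Laurent.mono, AddMonoidAlgebra.single_pow]
    rw [this]
    exact sub_one_dvd_pow_sub_one _ m
  obtain ⟨m, rfl | rfl⟩ := a.eq_nat_or_neg
  · exact hpow m
  · have : Laurent.mono (-m) 0 - 1 = -Laurent.mono (-m) 0 * (Laurent.mono m 0 - 1) := by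
      rw [mul_sub, neg_mul, Laurent.mono_mul, neg_add_cancel, add_zero, Laurent.mono_zero]
      ring
    rw [this]
    exact (hpow m).mul_left _

/-- The specialization `t ↦ 1`. -/
noncomputable def evalOne : Laurent →+* Laurent :=
  AddMonoidAlgebra.mapDomainRingHom ℤ ((AddMonoidHom.inr ℤ ℤ).comp (AddMonoidHom.snd ℤ ℤ))

theorem evalOne_mono (a b : ℤ) : evalOne (Laurent.mono a b) = Laurent.mono 0 b :=
  AddMonoidAlgebra.mapDomain_single

theorem dvd_sub_evalOne (f : Laurent) : Laurent.mono 1 0 - 1 ∣ f - evalOne f := by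
  rw [← Ideal.mem_span_singleton, ← Ideal.Quotient.eq]
  refine DFunLike.congr_fun (f := (Ideal.Quotient.mk
    (Ideal.span {Laurent.mono 1 0 - 1})).toAddMonoidHom) (g := ((Ideal.Quotient.mk
    (Ideal.span {Laurent.mono 1 0 - 1})).comp evalOne).toAddMonoidHom) ?_ f
  ext ⟨a, b⟩
  change Ideal.Quotient.mk _ (Laurent.mono a b) = Ideal.Quotient.mk _ (evalOne (Laurent.mono a b))
  rw [evalOne_mono, Ideal.Quotient.eq, Ideal.mem_span_singleton]
  have : Laurent.mono a b - Laurent.mono 0 b = (Laurent.mono a 0 - 1) * Laurent.mono 0 b := by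
    rw [sub_mul, Laurent.mono_mul, one_mul, add_zero, zero_add]
  rw [this]
  exact (Laurent.mono_sub_one_dvd a).mul_right _

theorem gammaCycle_zero_none :
    gammaCycle (0 : ZMod n) none = -Laurent.mono n 0 * (Laurent.mono 1 0 - 1) := by
  simp [gammaCycle, coverEdge]
  ring

variable [Fact (3 ≤ n)]

theorem coverBoundary_eq (c : CoverChains n) : coverBoundary n c =
    c none * (Laurent.mono 0 1 - 1) + (∑ j, c (some j)) * (Laurent.mono 1 0 - 1) := by
  rw [coverBoundary, Fintype.linearCombination_apply, Fintype.sum_option, Finset.sum_mul]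
  rfl

theorem coverBoundary_edge (j : ZMod n) :
    coverBoundary n (coverEdge (some j)) = Laurent.mono 1 0 - 1 := by
  simp [coverBoundary_eq, coverEdge, Pi.single_apply]

theorem gammaCycle_mem (i : ZMod n) : gammaCycle i ∈ CoverH1 n := by
  rw [LinearMap.mem_ker]
  by_cases h : i = 0
  · subst h
    rw [gammaCycle_zero, map_sub, map_add, map_smul, map_smul, coverBoundary_liftChain,
      deckHom_boundary, coverBoundary_edge, coverBoundary_edge, smul_eq_mul, smul_eq_mul]
    change _ * (Laurent.mono n 1 - 1) + _ - _ = _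
    ring
  · rw [gammaCycle_of_ne h, map_sub, coverBoundary_edge, coverBoundary_edge, sub_self]

theorem linearIndependent_gammaCycle :
    LinearIndependent Laurent (gammaCycle : ZMod n → CoverChains n) := by
  rw [Fintype.linearIndependent_iff]
  intro g hg
  -- only `γ̃_n` has a component at `x̃_0`
  have h₀ : g 0 = 0 := by
    have h := congrFun hg none
    rw [Finset.sum_apply, Finset.sum_eq_single 0 (fun i _ hi => by
      simp [gammaCycle_of_ne hi, coverEdge]) (by simp), Pi.smul_apply, gammaCycle_zero_none,
      Pi.zero_apply, smul_eq_mul] at h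
    have hn : -Laurent.mono n 0 ≠ 0 := neg_ne_zero.mpr (by simp [Laurent.mono])
    exact (mul_eq_zero.mp h).resolve_right
      (mul_ne_zero hn (Laurent.mono_ne_one (by simp)))
  -- the component at `x̃_{k+1}` of the remaining combination
  have hstep : ∀ k, g (k + 1) = g k := fun k => by
    have h : ∑ i, g i • (coverEdge (some (i + 1)) - coverEdge (some i) : CoverChains n) = 0 := by
      rw [← hg]
      refine Finset.sum_congr rfl fun i _ => ?_
      by_cases hi : i = 0
      · rw [hi, h₀, zero_smul, zero_smul]
      · rw [gammaCycle_of_ne hi]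
    have h := congrFun h (some (k + 1))
    simp only [Finset.sum_apply, Pi.smul_apply, Pi.sub_apply, coverEdge, Pi.single_apply,
      Option.some.injEq, add_left_inj, smul_eq_mul, mul_sub, mul_ite, mul_one, mul_zero,
      Finset.sum_sub_distrib, Finset.sum_ite_eq, Finset.mem_univ, if_true, Pi.zero_apply] at h
    exact (sub_eq_zero.mp h).symm
  have hnat : ∀ m : ℕ, g m = 0 := fun m => by
    induction m with
    | zero => rw [Nat.cast_zero, h₀]
    | succ m ih => rw [Nat.cast_succ, hstep, ih]
  intro i
  rw [← ZMod.natCast_zmod_val i, hnat]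

/-- Differences of edges `x̃_k` with `k ≠ 0` are sums of the cycles `γ̃_i` with `i ≠ n`. -/
theorem coverEdge_sub_mem (k : ZMod n) : (coverEdge (some k) - coverEdge (some 1) : CoverChains n) ∈
    Submodule.span Laurent (Set.range (gammaCycle : ZMod n → CoverChains n)) := by
  have h : ∀ m : ℕ, m < n → (coverEdge (some ((m : ZMod n) + 1)) - coverEdge (some 1) :
      CoverChains n) ∈ Submodule.span Laurent (Set.range (gammaCycle : ZMod n → CoverChains n))
          := by
    intro m
    induction m with
    | zero => simp
    | succ m ih =>
      intro hm
      have hne : ((m : ZMod n) + 1) ≠ 0 := fun h => by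
        rw [← Nat.cast_succ, ZMod.natCast_eq_zero_iff] at h
        exact absurd (Nat.le_of_dvd m.succ_pos h) (by omega)
      have := add_mem (Submodule.subset_span (R := Laurent) (Set.mem_range_self (f := gammaCycle)
          ((m : ZMod n) + 1)))
        (ih (by omega))
      rwa [gammaCycle_of_ne hne, sub_add_sub_cancel, ← Nat.cast_succ] at this
  have := h (k - 1).val (ZMod.val_lt _)
  rwa [ZMod.natCast_zmod_val, sub_add_cancel] at this

/-- The coefficient of a cycle at `x̃_0` is divisible by `t - 1`: the specialization `t ↦ 1` of the
boundary is `q - 1` times that of the coefficient. -/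
theorem dvd_of_mem_coverH1 {c : CoverChains n} (hc : c ∈ CoverH1 n) :
    Laurent.mono 1 0 - 1 ∣ c none := by
  rw [LinearMap.mem_ker, coverBoundary_eq] at hc
  have h := congrArg evalOne hc
  rw [map_add, map_mul, map_mul, map_sub, map_sub, evalOne_mono, evalOne_mono, Laurent.mono_zero,
    map_one, sub_self, mul_zero, add_zero, map_zero] at h
  have h' := (mul_eq_zero.mp h).resolve_right (Laurent.mono_ne_one (by simp))
  simpa [h'] using dvd_sub_evalOne (c none)

theorem span_gammaCycle :
    Submodule.span Laurent (Set.range (gammaCycle : ZMod n → CoverChains n)) = CoverH1 n := by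
  refine le_antisymm (Submodule.span_le.mpr (Set.range_subset_iff.mpr gammaCycle_mem)) ?_
  -- a cycle without a component at `x̃_0` is a combination of differences of the other edges
  have key : ∀ c ∈ CoverH1 n, c none = 0 →
      c ∈ Submodule.span Laurent (Set.range (gammaCycle : ZMod n → CoverChains n)) := by
    intro c hc h
    rw [LinearMap.mem_ker, coverBoundary_eq, h, zero_mul, zero_add] at hc
    have hs := (mul_eq_zero.mp hc).resolve_right (Laurent.mono_ne_one (by simp))
    have : c = ∑ j, c (some j) • (coverEdge (some j) - coverEdge (some 1)) := by
      simp only [smul_sub]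
      rw [Finset.sum_sub_distrib, ← Finset.sum_smul, hs, zero_smul, sub_zero]
      funext j
      cases j <;> simp [h, coverEdge, Pi.single_apply]
    rw [this]
    exact Submodule.sum_mem _ fun j _ => Submodule.smul_mem _ _ (coverEdge_sub_mem j)
  intro c hc
  -- in general, the component at `x̃_0` is removed by a multiple of `γ̃_n`
  obtain ⟨f, hf⟩ := dvd_of_mem_coverH1 hc
  have h : (c + (Laurent.mono (-n) 0 * f) • gammaCycle 0 : CoverChains n) none = 0 := by
    have hm : Laurent.mono (-n) 0 * Laurent.mono n 0 = 1 := by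
      rw [Laurent.mono_mul, neg_add_cancel, add_zero, Laurent.mono_zero]
    rw [Pi.add_apply, Pi.smul_apply, gammaCycle_zero_none, hf, smul_eq_mul]
    linear_combination (-(f * (Laurent.mono 1 0 - 1))) * hm
  have h' := key _ (add_mem hc (Submodule.smul_mem _ _ (gammaCycle_mem 0))) h
  have := sub_mem h' (Submodule.smul_mem _ (Laurent.mono (-n) 0 * f)
    (Submodule.subset_span ⟨0, rfl⟩))
  rwa [add_sub_cancel_right] at this

variable (n) in
/-- The basis of the first homology of the cover that consists of the cycles `γ̃_i`. -/
noncomputable def basisH1 : Module.Basis (ZMod n) Laurent (CoverH1 n) :=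
  (Module.Basis.span linearIndependent_gammaCycle).map (LinearEquiv.ofEq _ _ span_gammaCycle)

theorem basisH1_apply (i : ZMod n) : (basisH1 n i : CoverChains n) = gammaCycle i := by
  rw [basisH1, Module.Basis.map_apply, LinearEquiv.coe_ofEq_apply, Module.Basis.span_apply]

theorem toMatrix_basisH1 {f : CoverH1 n →ₗ[Laurent] CoverH1 n}
    {A : Matrix (ZMod n) (ZMod n) Laurent}
    (h : ∀ j, (f (basisH1 n j) : CoverChains n) = ∑ i, A i j • gammaCycle i) :
    LinearMap.toMatrix (basisH1 n) (basisH1 n) f = A := by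
  rw [← (Matrix.toLin (basisH1 n) (basisH1 n)).injective.eq_iff, Matrix.toLin_toMatrix]
  refine (basisH1 n).ext fun j => Subtype.ext ?_
  rw [Matrix.toLin_self, h, AddSubmonoidClass.coe_finsetSum]
  simp only [SetLike.val_smul, basisH1_apply]

theorem toMatrix_rhoRH_rho :
    LinearMap.toMatrix (basisH1 n) (basisH1 n) (rhoRH n (gen rho)) =
      (matRho : Matrix (ZMod n) (ZMod n) Laurent).map (specialize n) := by
  refine toMatrix_basisH1 fun j => ?_
  change chainMap _ (basisH1 n j : CoverChains n) = _
  rw [basisH1_apply, chainMap_rho_gammaCycle]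
  by_cases hj : j = 0 <;> simp [matRho, hj, apply_ite (specialize n), specialize_mono, ite_smul]

theorem toMatrix_rhoRH_sigma {i : ZMod n} (hi : i ≠ 0) :
    LinearMap.toMatrix (basisH1 n) (basisH1 n) (rhoRH n (gen (sigma i))) =
      (matSigma i).map (specialize n) := by
  refine toMatrix_basisH1 fun j => ?_
  change chainMap _ (basisH1 n j : CoverChains n) = _
  have hentry : ∀ a, ((matSigma i).map (specialize n)) a j =
      (if a = j then 1 else 0) + if a = i then sigmaCoeff i j else 0 := by
    intro a
    rw [Matrix.map_apply, matSigma, Matrix.of_apply, sigmaCoeff]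
    by_cases ha : a = i
    · subst ha
      by_cases h₁ : j = a
      · simp [h₁, specialize_mono]
      · simp only [h₁, Ne.symm h₁, hi, if_true, if_false, zero_add, apply_ite (specialize n),
          specialize_mono, map_one, map_zero]
        simp
    · simp only [ha, if_false, add_zero, apply_ite (specialize n), map_one, map_zero]
  rw [basisH1_apply, chainMap_sigma_gammaCycle hi]
  simp only [hentry, add_smul, ite_smul, one_smul, zero_smul, Finset.sum_add_distrib,
    Finset.sum_ite_eq', Finset.mem_univ, if_true]

/-- The braid group is generated by `ρ` and the `σ_i` with `i ≠ 0`. -/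
theorem braid_hom_ext {M : Type*} [Monoid M] {f g : BraidGroup n →* M}
    (hσ : ∀ i, i ≠ 0 → f (gen (sigma i)) = g (gen (sigma i))) (hρ : f (gen rho) = g (gen rho)) :
    f = g := by
  have hρ' : f.toHomUnits (gen rho) = g.toHomUnits (gen rho) := Units.ext hρ
  have hσ' : ∀ i, i ≠ 0 → f.toHomUnits (gen (sigma i)) = g.toHomUnits (gen (sigma i)) :=
    fun i hi => Units.ext (hσ i hi)
  have h : f.toHomUnits = g.toHomUnits := by
    refine PresentedGroup.ext fun x => ?_
    change f.toHomUnits (gen x) = g.toHomUnits (gen x)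
    cases x with
    | rho => exact hρ'
    | sigma i =>
      by_cases hi : i = 0
      · subst hi
        have hconj : (gen (sigma 0) : BraidGroup n) =
            gen rho * gen (sigma (-1)) * (gen rho)⁻¹ := by
          have h : (gen rho * gen (sigma (-1)) * (gen rho)⁻¹ * (gen (sigma (-1 + 1)))⁻¹ :
              BraidGroup n) = 1 := PresentedGroup.one_of_mem (BraidRel.conj (-1))
          rw [mul_inv_eq_one, neg_add_cancel] at h
          exact h.symm
        rw [hconj, map_mul, map_mul, map_inv, map_mul, map_mul, map_inv, hρ',
          hσ' _ (neg_ne_zero.mpr one_ne_zero_zmod)]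
      · exact hσ' i hi
  exact MonoidHom.ext fun x => congrArg Units.val (DFunLike.congr_fun h x)

/-- The representations on the Grothendieck group and on the homology of the cover have the same
matrices. -/
theorem toMatrix_repK_specialize (g : BraidGroup n) :
    (LinearMap.toMatrix (basisK n) (basisK n) (repK n g)).map (specialize n) =
      LinearMap.toMatrix (basisH1 n) (basisH1 n) (rhoRH n g) := by
  refine DFunLike.congr_fun (f := ((specialize n).mapMatrix.toMonoidHom.comp
    ((LinearMap.toMatrixAlgEquiv (basisK n)).toRingEquiv.toMonoidHom)).comp (repK n))
    (g := ((LinearMap.toMatrixAlgEquiv (basisH1 n)).toRingEquiv.toMonoidHom).comp (rhoRH n))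
    (braid_hom_ext (fun i hi => ?_) ?_) g
  · exact (congrArg (fun A : Matrix (ZMod n) (ZMod n) Laurent => A.map (specialize n))
        (toMatrix_repK_sigma i)).trans
      (toMatrix_rhoRH_sigma hi).symm
  · exact (congrArg (fun A : Matrix (ZMod n) (ZMod n) Laurent => A.map (specialize n))
        toMatrix_repK_rho).trans
      toMatrix_rhoRH_rho.symm

end
end AffineBraid

theorem mainTheorem4 (n : ℕ) [Fact (3 ≤ n)] :
    ∃ A : WeakAction (BraidGroup n) (Cn n),
      (∀ i, ActsBy A (gen (.sigma i)) (letterComplex n (.sigma i, true))) ∧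
      (∀ i, ActsBy A (gen (.sigma i))⁻¹ (letterComplex n (.sigma i, false))) ∧
      ActsBy A (gen .rho) (letterComplex n (.rho, true)) ∧
      ActsBy A (gen .rho)⁻¹ (letterComplex n (.rho, false)) ∧
      (∀ w : BraidWord n, ActsBy A w.eval (wordComplex w)) ∧
      ∃ b : Module.Basis (ZMod n) Laurent (KGroup n),
        (∀ i, b i = KGroup.mk (projObj n i)) ∧
        ∃ rhoAKS : Representation Laurent (BraidGroup n) (KGroup n),
          (∀ g X, rhoAKS g (KGroup.mk X) = KGroup.mk ((A.functor g).obj X)) ∧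
          (∀ i, LinearMap.toMatrix b b (rhoAKS (gen (.sigma i))) = matSigma i) ∧
          LinearMap.toMatrix b b (rhoAKS (gen .rho)) = matRho ∧
          LinearMap.toMatrix b b (rhoAKS (gen .rho)⁻¹) = matRhoInv ∧
          ∃ c : Module.Basis (ZMod n) Laurent (CoverH1 n),
            (∀ i, (c i : CoverChains n) = gammaCycle i) ∧
            ∀ g, (LinearMap.toMatrix b b (rhoAKS g)).map (specialize n) =
              LinearMap.toMatrix c c (rhoRH n g) :=
  ⟨braidAction n, fun i => actsBy_letter (.sigma i, true), fun i => actsBy_letter (.sigma i, false),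
    actsBy_letter (.rho, true), actsBy_letter (.rho, false), actsBy_eval, basisK n, basisK_apply,
    repK n, repK_mk, toMatrix_repK_sigma, toMatrix_repK_rho, toMatrix_repK_rho_inv, basisH1 n,
    basisH1_apply, toMatrix_repK_specialize⟩
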